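/- **Notation.** Let $r^2=x^2+y^2$, $\Omega=\{r\le 1\}\subset\mathbb R^2$, let $P_n^{(a,b)}$ be the Jacobi polynomials, $P_n=P_n^{(0,0)}$ the Legendre polynomials, $C_k^{(3/2)}=\frac{k+2}{2}P_k^{(1,1)}$ and $W_k(z)=(1-z^2)C_k^{(3/2)}(z)$. For $m\in\mathbb Z$, $j\ge 0$ put $y_m=r^{|m|}e^{im\theta}$, $$z_{mj}=P_j^{(0,|m|)}(2r^2-1)\,y_m,\qquad w_{mj}=(1-r^2)P_j^{(1,|m|)}(2r^2-1)\,y_m .$$ With $\mathfrak r_n^{(b)}=10n^2+n(13b+19)+4(b+1)(b+2)$ and $$\mathbf v_n^{(b)}(t)=\begin{pmatrix}(b+1)(1-t)P_n^{(1,b+1)}(2t-1)-2t(n+1)P_n^{(0,b+2)}(2t-1)\\(b+1)P_n^{(1,b+1)}(2t-1)\end{pmatrix},$$ let $$\mathbf q_n^{(b),1}=\tfrac{2n+b+1}{(n+1)\mathfrak r_n^{(b)}}\Big[(2n+b+2)(2n+b+3)P_n^{(1,b)}(2t-1)\begin{pmatrix}1-t\\1\end{pmatrix}-(n+b+2)\mathbf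 v_n^{(b)}\Big],$$ $\mathbf q_n^{(b),2}=-\frac1n\mathbf v_{n-1}^{(b)}-\mathbf q_n^{(b),1}$ for $n\ge1$, and $\mathbf q_0^{(b),2}=0$. Let $\rho(\varphi)$ be the rotation matrix and $N=\begin{pmatrix}1-y^2&xy\\xy&1-x^2\end{pmatrix}$. Put $\mathbf n^\nu_{mj}=N\,r^{|m|-1}e^{im\theta}\rho(\theta)\,\mathrm{diag}(1,i\,\mathrm{sign}\,m)\,\mathbf q_j^{(|m|-1),\nu}(r^2)$ for $m\ne0$ (a polynomial field), and $\mathbf n^1_{0j}=N P_{j-1}^{(0,1)}(2r^2-1)(x,y)^\top$, $\mathbf n^2_{0j}=N P_{j-1}^{(1,1)}(2r^2-1)(-y,x)^\top$ for $j\ge1$. Let $\mathbf n^+_{0j}=2\mathbf n^1_{0j}$, $\mathbf n^-_{0j}=2\mathbf n^2_{0j}$ ($j\ge 1$) and, for $m\ne0$, $\mathbf n^-_{m0}=2\mathbf n^1_{m0}$, $\mathbf n^\pm_{mj}=\mathbf n^1_{mj}\pm\mathbf n^2_{mj}$ ($j\ge1$). Let $\mathbf t^\pm_{mj}=\rho(\pi/2)\mathbf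 n^\pm_{mj}$, $\kappa_{0j}=4j$ and $\kappa_{mj}=\frac{4(2j+|m|)(2j+|m|+1)(2j+|m|+2)}{\mathfrak r_j^{(|m|-1)}}\,i\,\mathrm{sign}\,m$ for $m\neq0$. Let $\Gamma$ be the periodic cylinder $\Omega\times\mathbb R/2\pi\mathbb Z$ or the finite cylinder $\Omega\times[-1,1]$. $\mathring H^1$, $\mathring H_{\rm curl}$, $\mathring H_{\rm div}$ are the $L^2$ fields on $\Gamma$ with weak gradient, curl, divergence in $L^2$ and zero weak trace, zero tangential trace, zero normal trace on the whole boundary of $\Gamma$. Put $a_k=b_k=e^{ikz}$, $k\in\mathbb Z$, in the periodic case, and $a_k=W_k$, $b_k=P_k$, $k\ge0$, in the finite case. "For $\mathbf n^+,\mathbf t^+$" the indices run over $m\in\mathbb Z$, $j\ge1$; "for $\mathbf n^-,\mathbf t^-$" over $m\in\mathbb Z$, $j\ge\max(0,1-|m|)$; for $w,z$ over $m\in\mathbb Z$, $j\ge0$. **(A) Bases.** The families - $a_kw_{mj}$ in $\mathring H^1$; - $a_k\binom{\mathbf n^\pm_{mj}}{0}$, $b_k\binom{\mathbf 0}{w_{mj}}$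 in $\mathring H_{\rm curl}$; - $b_k\binom{\mathbf t^\pm_{mj}}{0}$, $a_k\binom{\mathbf 0}{z_{mj}}$ in $\mathring H_{\rm div}$; - $b_kz_{mj}$ in $L^2$ lie in these spaces (the first three vanish, are normal, are tangential pointwise on the boundary, respectively), are linearly independent on $\Gamma$, and have dense span in the respective graph norm. In the periodic case the $L^2$ family is orthogonal. **(B) Relations, periodic cylinder.** For all $k\in\mathbb Z$ and all admissible $m,j$: $$\nabla(e^{ikz}w_{mj})=-(j+1)e^{ikz}\binom{\mathbf n^+_{m,j+1}}{0}+ik\,e^{ikz}\binom{\mathbf 0}{w_{mj}},$$ $$\operatorname{curl}e^{ikz}\binom{\mathbf n^+_{mj}}0=ik\,e^{ikz}\binom{\mathbf t^+_{mj}}0,\quad \operatorname{curl}e^{ikz}\binom{\mathbf n^-_{mj}}0=ik\,e^{ikz}\binom{\mathbf t^-_{mj}}0-\kappa_{mj}e^{ikz}\binom{\mathbf 0}{z_{mj}},$$ $$\operatorname{curl}e^{ikz}\binom{\mathbf 0}{w_{m,j-1}}=j\,e^{ikz}\binom{\mathbf t^+_{mj}}0\ (j\ge1),$$ $$\operatorname{div}e^{ikz}\binom{\mathbf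 t^+_{mj}}0=0,\quad \operatorname{div}e^{ikz}\binom{\mathbf t^-_{mj}}0=\kappa_{mj}e^{ikz}z_{mj},\quad \operatorname{div}e^{ikz}\binom{\mathbf 0}{z_{mj}}=ik\,e^{ikz}z_{mj}.$$ **(C) Decomposition, periodic cylinder.** The spans of the four families are the internal direct sums of the terms of the following sub-complexes $0\to V_0\xrightarrow{\nabla}V_1\xrightarrow{\rm curl}V_2\xrightarrow{\rm div}V_3\to0$: - for $m,k\in\mathbb Z$, $j\ge0$: $V_0=\langle e^{ikz}w_{mj}\rangle$, $V_1=\langle e^{ikz}\binom{\mathbf n^+_{m,j+1}}0,e^{ikz}\binom{\mathbf n^-_{m,j+1}}0,e^{ikz}\binom{\mathbf 0}{w_{mj}}\rangle$, $V_2=\langle e^{ikz}\binom{\mathbf t^+_{m,j+1}}0,e^{ikz}\binom{\mathbf t^-_{m,j+1}}0,e^{ikz}\binom{\mathbf 0}{z_{m,j+1}}\rangle$, $V_3=\langle e^{ikz}z_{m,j+1}\rangle$; - for $m\neq0$, $k\in\mathbb Z$: $V_0=0$, $V_1=\langle e^{ikz}\binom{\mathbf n^-_{m0}}0\rangle$,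 $V_2=\langle e^{ikz}\binom{\mathbf t^-_{m0}}0,e^{ikz}\binom{\mathbf 0}{z_{m0}}\rangle$, $V_3=\langle e^{ikz}z_{m0}\rangle$; - for $k\in\mathbb Z$: $V_0=V_1=0$, $V_2=\langle e^{ikz}\binom{\mathbf 0}{z_{00}}\rangle$, $V_3=\langle e^{ikz}z_{00}\rangle$. All are exact, with the single exception of the last one for $k=0$. Its terms are spanned by $(0,0,1)^\top$ and $1$, as predicted by $b_1=b_0=1$: $(0,0,1)^\top\in\mathring H_{\rm div}$ is divergence free, no nonzero multiple of it is the curl of an element of $\mathring H_{\rm curl}$, and no nonzero constant is the divergence of an element of $\mathring H_{\rm div}$. **(D) Relations, finite cylinder.** For all $k\ge0$ and all admissible $m,j$, with $c_k=(k+1)(k+2)$: $$\nabla(W_kw_{mj})=-(j+1)W_k\binom{\mathbf n^+_{m,j+1}}0-c_kP_{k+1}\binom{\mathbf 0}{w_{mj}},$$ $$\operatorname{curl}W_k\binom{\mathbf n^+_{mj}}0=-c_kP_{k+1}\binom{\mathbf t^+_{mj}}0,\quad \operatorname{curl}W_k\binom{\mathbf n^-_{mj}}0=-c_kP_{k+1}\binom{\mathbf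 t^-_{mj}}0-\kappa_{mj}W_k\binom{\mathbf 0}{z_{mj}},$$ $$\operatorname{curl}P_k\binom{\mathbf 0}{w_{m,j-1}}=jP_k\binom{\mathbf t^+_{mj}}0\ (j\ge1),$$ $$\operatorname{div}P_k\binom{\mathbf t^+_{mj}}0=0,\quad\operatorname{div}P_k\binom{\mathbf t^-_{mj}}0=\kappa_{mj}P_kz_{mj},\quad\operatorname{div}W_k\binom{\mathbf 0}{z_{mj}}=-c_kP_{k+1}z_{mj}.$$ **(E) Decomposition, finite cylinder.** The spans of the four families are the internal direct sums of the terms of the following sub-complexes: - for $m\in\mathbb Z$, $k,j\ge0$: $V_0=\langle W_kw_{mj}\rangle$, $V_1=\langle W_k\binom{\mathbf n^+_{m,j+1}}0,W_k\binom{\mathbf n^-_{m,j+1}}0,P_{k+1}\binom{\mathbf 0}{w_{mj}}\rangle$, $V_2=\langle P_{k+1}\binom{\mathbf t^+_{m,j+1}}0,P_{k+1}\binom{\mathbf t^-_{m,j+1}}0,W_k\binom{\mathbf 0}{z_{m,j+1}}\rangle$, $V_3=\langle P_{k+1}z_{m,j+1}\rangle$; - for $m\ne0$, $k\ge0$: $V_0=0$,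 $V_1=\langle W_k\binom{\mathbf n^-_{m0}}0\rangle$, $V_2=\langle P_{k+1}\binom{\mathbf t^-_{m0}}0,W_k\binom{\mathbf 0}{z_{m0}}\rangle$, $V_3=\langle P_{k+1}z_{m0}\rangle$; - for $m\in\mathbb Z$, $j\ge0$: $V_0=0$, $V_1=\langle P_0\binom{\mathbf 0}{w_{mj}}\rangle$, $V_2=\langle P_0\binom{\mathbf t^+_{m,j+1}}0,P_0\binom{\mathbf t^-_{m,j+1}}0\rangle$, $V_3=\langle P_0z_{m,j+1}\rangle$; - for $m\neq0$: $V_0=V_1=0$, $V_2=\langle\binom{\mathbf t^-_{m0}}0\rangle$, $V_3=\langle z_{m0}\rangle$; - for $k\ge0$: $V_0=V_1=0$, $V_2=\langle W_k\binom{\mathbf 0}{z_{00}}\rangle$, $V_3=\langle P_{k+1}z_{00}\rangle$; - $V_0=V_1=V_2=0$, $V_3=\langle P_0z_{00}\rangle$. All but the last one are exact. Also, for all $k,j\ge0$, the complex $0\to0\to0\to\langle W_k\binom{\mathbf 0}{z_{0j}}\rangle\to\langle P_{k+1}z_{0j}\rangle\to0$ is exact. The exceptional space consists of the constants, as predicted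 by $b_0=1$, $b_1=b_2=b_3=0$: no nonzero constant is the divergence of an element of $\mathring H_{\rm div}$. -/

import Mathlib

open MeasureTheory Complex

namespace CylDeRham

noncomputable section

/-! ### Polynomials on the disk -/

/-- The Jacobi polynomial `P_n^{(a,b)}(x)` for natural parameters `a`, `b`, by the classical sum
`∑ₛ C(n+a, n-s) C(n+b, s) ((x-1)/2)^s ((x+1)/2)^(n-s)`. -/
def jacobi (n a b : ℕ) (x : ℝ) : ℝ :=
  ∑ s ∈ Finset.range (n + 1), ((n + a).choose (n - s) : ℝ) * ((n + b).choose s : ℝ) *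
    ((x - 1) / 2) ^ s * ((x + 1) / 2) ^ (n - s)

/-- `i sign m`. -/
def signI (m : ℤ) : ℂ := (m.sign : ℂ) * I

/-- The harmonic polynomial `(x + sign(m) i y)^{|m|} = r^{|m|} e^{imθ}`. -/
def harmonic (m : ℤ) (x y : ℝ) : ℂ := ((x : ℂ) + signI m * (y : ℂ)) ^ m.natAbs

/-- The generalised Zernike polynomial `z_{mj}^{(l)} = P_j^{(l,|m|)}(2r²-1) r^{|m|} e^{imθ}`. -/
def zernikeGen (l : ℕ) (m : ℤ) (j : ℕ) (x y : ℝ) : ℂ :=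
  (jacobi j l m.natAbs (2 * (x ^ 2 + y ^ 2) - 1) : ℂ) * harmonic m x y

/-- The Zernike polynomial `z_{mj}`. -/
def zernike (m : ℤ) (j : ℕ) (x y : ℝ) : ℂ := zernikeGen 0 m j x y

/-- The weighted Zernike polynomial `w_{mj} = (1-r²) z_{mj}^{(1)}`. -/
def wZernike (m : ℤ) (j : ℕ) (x y : ℝ) : ℂ :=
  ((1 - (x ^ 2 + y ^ 2) : ℝ) : ℂ) * zernikeGen 1 m j x y

/-- The constant `𝔯_n^{(b)}`. -/
def rConst (n b : ℕ) : ℝ := 10 * n ^ 2 + n * (13 * b + 19) + 4 * (b + 1) * (b + 2)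

/-- The univariate vector polynomial `v_n^{(b)}`. -/
def vPoly (n b : ℕ) (t : ℝ) : Fin 2 → ℝ :=
  ![(b + 1) * (1 - t) * jacobi n 1 (b + 1) (2 * t - 1)
      - 2 * t * (n + 1) * jacobi n 0 (b + 2) (2 * t - 1),
    (b + 1) * jacobi n 1 (b + 1) (2 * t - 1)]

/-- The univariate vector orthogonal polynomial `q_n^{(b),1}`. -/
def q1 (n b : ℕ) (t : ℝ) : Fin 2 → ℝ :=
  ((2 * n + b + 1 : ℝ) / ((n + 1) * rConst n b)) •
    (((2 * n + b + 2 : ℝ) * (2 * n + b + 3) * jacobi n 1 b (2 * t - 1)) • ![1 - t, 1]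
      - (n + b + 2 : ℝ) • vPoly n b t)

/-- The univariate vector orthogonal polynomial `q_n^{(b),2}`, with `q_0^{(b),2} = 0`. -/
def q2 (n b : ℕ) (t : ℝ) : Fin 2 → ℝ :=
  if n = 0 then 0 else -((1 / (n : ℝ)) • vPoly (n - 1) b t) - q1 n b t

/-- The vector analogue of the harmonic polynomials for `m ≠ 0`,
`r^{|m|-1} e^{imθ} (e_r + i sign(m) e_θ) = (x + sign(m) i y)^{|m|-1} (1, i sign m)`. -/
def harmonicVec (m : ℤ) (x y : ℝ) : Fin 2 → ℂ :=
  ((x : ℂ) + signI m * (y : ℂ)) ^ (m.natAbs - 1) • ![1, signI m]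

def sigmaMat (x y : ℝ) : Matrix (Fin 2) (Fin 2) ℂ :=
  !![(x : ℂ) ^ 2 - (y : ℂ) ^ 2, 2 * x * y; 2 * x * y, (y : ℂ) ^ 2 - (x : ℂ) ^ 2]

def normalMat (x y : ℝ) : Matrix (Fin 2) (Fin 2) ℂ :=
  !![1 - (y : ℂ) ^ 2, x * y; x * y, 1 - (x : ℂ) ^ 2]

/-- The rotation matrix `ρ(φ)`. -/
def rotMat (φ : ℝ) : Matrix (Fin 2) (Fin 2) ℂ :=
  !![(Real.cos φ : ℂ), -(Real.sin φ : ℂ); (Real.sin φ : ℂ), (Real.cos φ : ℂ)]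

/-- The map `𝒫_m`, `m ≠ 0`, that sends `f = (f₁, f₂)` with `f₁(0) = f₂(0)` to the vector field
`r^{|m|-1} e^{imθ} ρ(θ) (f₁(r²), i sign(m) f₂(r²))ᵀ`. It is written through
`(f₁+f₂)/2 * (1,1) + (f₁-f₂)/2 * (1,-1)`, which go to multiples of `harmonicVec` and of
`Σ harmonicVec`; `f₁ - f₂` is divisible by `t = r²`, and at `r = 0` the second term vanishes.
The polar form is `liftMode_polar`. -/
def liftMode (m : ℤ) (f : ℝ → Fin 2 → ℝ) (x y : ℝ) : Fin 2 → ℂ :=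
  (((f (x ^ 2 + y ^ 2) 0 + f (x ^ 2 + y ^ 2) 1) / 2 : ℝ) : ℂ) • harmonicVec m x y
    + (((f (x ^ 2 + y ^ 2) 0 - f (x ^ 2 + y ^ 2) 1) / (2 * (x ^ 2 + y ^ 2)) : ℝ) : ℂ) •
      (sigmaMat x y).mulVec (harmonicVec m x y)

/-- `v_{mj}^{N,1}`; for `m = 0` only `j ≥ 1` is meaningful. -/
def vN1 (m : ℤ) (j : ℕ) (x y : ℝ) : Fin 2 → ℂ :=
  if m = 0 then (jacobi (j - 1) 0 1 (2 * (x ^ 2 + y ^ 2) - 1) : ℂ) • ![(x : ℂ), (y : ℂ)]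
  else liftMode m (q1 j (m.natAbs - 1)) x y

/-- `v_{mj}^{N,2}`; for `m = 0` only `j ≥ 1` is meaningful. -/
def vN2 (m : ℤ) (j : ℕ) (x y : ℝ) : Fin 2 → ℂ :=
  if m = 0 then (jacobi (j - 1) 1 1 (2 * (x ^ 2 + y ^ 2) - 1) : ℂ) • ![-(y : ℂ), (x : ℂ)]
  else liftMode m (q2 j (m.natAbs - 1)) x y

def n1 (m : ℤ) (j : ℕ) (x y : ℝ) : Fin 2 → ℂ := (normalMat x y).mulVec (vN1 m j x y)

def n2 (m : ℤ) (j : ℕ) (x y : ℝ) : Fin 2 → ℂ := (normalMat x y).mulVec (vN2 m j x y)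

/-- `n_{mj}^+`, used for `j ≥ 1`. -/
def nPlus (m : ℤ) (j : ℕ) (x y : ℝ) : Fin 2 → ℂ :=
  if m = 0 then (2 : ℂ) • n1 0 j x y else n1 m j x y + n2 m j x y

/-- `n_{mj}^-`, used for `j ≥ max(0, 1 - |m|)`. -/
def nMinus (m : ℤ) (j : ℕ) (x y : ℝ) : Fin 2 → ℂ :=
  if m = 0 then (2 : ℂ) • n2 0 j x y
  else if j = 0 then (2 : ℂ) • n1 m 0 x y
  else n1 m j x y - n2 m j x y

/-- `t_{mj}^+ = ρ(π/2) n_{mj}^+`. -/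
def tPlus (m : ℤ) (j : ℕ) (x y : ℝ) : Fin 2 → ℂ :=
  (rotMat (Real.pi / 2)).mulVec (nPlus m j x y)

/-- `t_{mj}^- = ρ(π/2) n_{mj}^-`. -/
def tMinus (m : ℤ) (j : ℕ) (x y : ℝ) : Fin 2 → ℂ :=
  (rotMat (Real.pi / 2)).mulVec (nMinus m j x y)

/-- The constant `κ_{mj}`. -/
def kappa (m : ℤ) (j : ℕ) : ℂ :=
  if m = 0 then 4 * (j : ℂ)
  else ((4 * (2 * j + m.natAbs) * (2 * j + m.natAbs + 1) * (2 * j + m.natAbs + 2)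
    / rConst j (m.natAbs - 1) : ℝ) : ℂ) * signI m

/-! ### Axial functions -/

/-- `e^{ikz}`. -/
def expWave (k : ℤ) (z : ℝ) : ℂ := Complex.exp (I * (k : ℂ) * (z : ℂ))

/-- The Legendre polynomial `P_k = P_k^{(0,0)}`. -/
def legendre (k : ℕ) (z : ℝ) : ℂ := (jacobi k 0 0 z : ℂ)

/-- The ultraspherical polynomial `C_k^{(3/2)} = (k+2)/2 * P_k^{(1,1)}`. -/
def ultra (k : ℕ) (z : ℝ) : ℂ := (((k + 2 : ℝ) / 2 * jacobi k 1 1 z : ℝ) : ℂ)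

/-- `(1 - z²) C_k^{(3/2)}(z)`. -/
def wUltra (k : ℕ) (z : ℝ) : ℂ := (1 - (z : ℂ) ^ 2) * ultra k z

/-! ### Fields in three variables and the classical operators -/

abbrev Scalar := (Fin 3 → ℝ) → ℂ
abbrev Vector := (Fin 3 → ℝ) → (Fin 3 → ℂ)

def pd (i : Fin 3) (u : Scalar) (p : Fin 3 → ℝ) : ℂ := fderiv ℝ u p (Pi.single i 1)

def grad (u : Scalar) : Vector := fun p => ![pd 0 u p, pd 1 u p, pd 2 u p]

def curl (f : Vector) : Vector := fun p =>
  ![pd 1 (fun q => f q 2) p - pd 2 (fun q => f q 1) p,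
    pd 2 (fun q => f q 0) p - pd 0 (fun q => f q 2) p,
    pd 0 (fun q => f q 1) p - pd 1 (fun q => f q 0) p]

def div (f : Vector) : Scalar := fun p =>
  pd 0 (fun q => f q 0) p + pd 1 (fun q => f q 1) p + pd 2 (fun q => f q 2) p

/-- `a(z) u(x,y)`. -/
def scal (a : ℝ → ℂ) (u : ℝ → ℝ → ℂ) : Scalar := fun p => a (p 2) * u (p 0) (p 1)

/-- `a(z) (v(x,y), 0)`. -/
def horiz (a : ℝ → ℂ) (v : ℝ → ℝ → Fin 2 → ℂ) : Vector := fun p =>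
  a (p 2) • ![v (p 0) (p 1) 0, v (p 0) (p 1) 1, 0]

/-- `a(z) (0, 0, u(x,y))`. -/
def vert (a : ℝ → ℂ) (u : ℝ → ℝ → ℂ) : Vector := fun p => a (p 2) • ![0, 0, u (p 0) (p 1)]

/-! ### The two cylinders and the Sobolev spaces with boundary conditions -/

inductive Cylinder
  | periodic
  | finite

/-- The (fundamental domain of the) cylinder. -/
def Cylinder.region : Cylinder → Set (Fin 3 → ℝ)
  | .periodic => {p | p 0 ^ 2 + p 1 ^ 2 ≤ 1 ∧ 0 ≤ p 2 ∧ p 2 < 2 * Real.pi}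
  | .finite => {p | p 0 ^ 2 + p 1 ^ 2 ≤ 1 ∧ -1 ≤ p 2 ∧ p 2 ≤ 1}

/-- Lebesgue measure on the cylinder. -/
def Cylinder.vol (c : Cylinder) : Measure (Fin 3 → ℝ) := volume.restrict c.region

/-- Functions that are smooth up to the boundary of the cylinder. -/
def Cylinder.Smooth : Cylinder → Scalar → Prop
  | .periodic, φ => ContDiff ℝ (⊤ : ℕ∞) φ ∧ ∀ p, φ (p + Pi.single 2 (2 * Real.pi)) = φ p
  | .finite, φ => ContDiff ℝ (⊤ : ℕ∞) φ

/-- `ν` is an outward unit normal at the boundary point `p` of the cylinder (at the rim of a finite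
cylinder both the lateral and the top or bottom normal count). -/
def Cylinder.IsNormal : Cylinder → (Fin 3 → ℝ) → (Fin 3 → ℝ) → Prop
  | .periodic, p, ν => p 0 ^ 2 + p 1 ^ 2 = 1 ∧ ν = ![p 0, p 1, 0]
  | .finite, p, ν =>
      (p 0 ^ 2 + p 1 ^ 2 = 1 ∧ -1 ≤ p 2 ∧ p 2 ≤ 1 ∧ ν = ![p 0, p 1, 0]) ∨
      (p 0 ^ 2 + p 1 ^ 2 ≤ 1 ∧ ((p 2 = 1 ∧ ν = ![0, 0, 1]) ∨ (p 2 = -1 ∧ ν = ![0, 0, -1])))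

/-- `u ∈ H̊¹` with weak gradient `g`. As the test fields are smooth up to the boundary and need not
vanish there, the identity says both that `g` is the weak gradient of `u` and that the weak boundary
trace of `u`, the functional `φ ↦ ∫ g·φ + ∫ u div φ`, is zero. -/
def HasGrad₀ (c : Cylinder) (u : Scalar) (g : Vector) : Prop :=
  MemLp u 2 c.vol ∧ MemLp g 2 c.vol ∧
    ∀ φ : Vector, (∀ i, c.Smooth (fun p => φ p i)) →
      ∫ p, g p ⬝ᵥ φ p ∂c.vol = - ∫ p, u p * div φ p ∂c.vol

/-- `f ∈ H̊_curl` (zero weak tangential trace) with weak curl `g`. -/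
def HasCurl₀ (c : Cylinder) (f g : Vector) : Prop :=
  MemLp f 2 c.vol ∧ MemLp g 2 c.vol ∧
    ∀ φ : Vector, (∀ i, c.Smooth (fun p => φ p i)) →
      ∫ p, g p ⬝ᵥ φ p ∂c.vol = ∫ p, f p ⬝ᵥ curl φ p ∂c.vol

/-- `f ∈ H̊_div` (zero weak normal trace) with weak divergence `h`. -/
def HasDiv₀ (c : Cylinder) (f : Vector) (h : Scalar) : Prop :=
  MemLp f 2 c.vol ∧ MemLp h 2 c.vol ∧
    ∀ φ : Scalar, c.Smooth φ →
      ∫ p, h p * φ p ∂c.vol = - ∫ p, f p ⬝ᵥ grad φ p ∂c.vol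

/-! ### The tensor bases -/

/-- Indices of the vector families; `K` is the set of axial indices. -/
inductive VecIdx (K : Type)
  | plus (m : ℤ) (k : K) (j : ℕ) (hj : 1 ≤ j)
  | minus (m : ℤ) (k : K) (j : ℕ) (hj : 1 - |m| ≤ (j : ℤ))
  | axial (m : ℤ) (k : K) (j : ℕ)

def h1Fam {K : Type} (a : K → ℝ → ℂ) : ℤ × K × ℕ → Scalar :=
  fun i => scal (a i.2.1) (wZernike i.1 i.2.2)

def curlFam {K : Type} (a b : K → ℝ → ℂ) : VecIdx K → Vector
  | .plus m k j _ => horiz (a k) (nPlus m j)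
  | .minus m k j _ => horiz (a k) (nMinus m j)
  | .axial m k j => vert (b k) (wZernike m j)

def divFam {K : Type} (a b : K → ℝ → ℂ) : VecIdx K → Vector
  | .plus m k j _ => horiz (b k) (tPlus m j)
  | .minus m k j _ => horiz (b k) (tMinus m j)
  | .axial m k j => vert (a k) (zernike m j)

def l2Fam {K : Type} (b : K → ℝ → ℂ) : ℤ × K × ℕ → Scalar :=
  fun i => scal (b i.2.1) (zernike i.1 i.2.2)

/-- Linear independence of a family of functions on the cylinder. -/
def IndepOn {ι V : Type} [AddCommGroup V] [Module ℂ V] (c : Cylinder)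
    (F : ι → (Fin 3 → ℝ) → V) : Prop :=
  LinearIndependent ℂ (fun i => fun p : c.region => F i p)

/-- The four families are bases of `H̊¹`, `H̊_curl`, `H̊_div` and `L²`: they lie in these spaces
(with the classical derivatives as weak ones) and satisfy the boundary conditions pointwise, they are
linearly independent, and their spans are dense in the graph norms. -/
structure IsDeRhamBasis (c : Cylinder) {ι₀ ι₁ ι₂ ι₃ : Type}
    (F₀ : ι₀ → Scalar) (F₁ : ι₁ → Vector) (F₂ : ι₂ → Vector) (F₃ : ι₃ → Scalar) : Prop where
  mem₀ : ∀ i, HasGrad₀ c (F₀ i) (grad (F₀ i))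
  mem₁ : ∀ i, HasCurl₀ c (F₁ i) (curl (F₁ i))
  mem₂ : ∀ i, HasDiv₀ c (F₂ i) (div (F₂ i))
  mem₃ : ∀ i, MemLp (F₃ i) 2 c.vol
  vanish : ∀ i p ν, c.IsNormal p ν → F₀ i p = 0
  normal : ∀ i p ν, c.IsNormal p ν → crossProduct (F₁ i p) (fun l => (ν l : ℂ)) = 0
  tangential : ∀ i p ν, c.IsNormal p ν → F₂ i p ⬝ᵥ (fun l => (ν l : ℂ)) = 0
  indep₀ : IndepOn c F₀
  indep₁ : IndepOn c F₁
  indep₂ : IndepOn c F₂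
  indep₃ : IndepOn c F₃
  dense₀ : ∀ u g, HasGrad₀ c u g → ∀ ε : ENNReal, 0 < ε →
    ∃ s ∈ Submodule.span ℂ (Set.range F₀),
      eLpNorm (u - s) 2 c.vol < ε ∧ eLpNorm (g - grad s) 2 c.vol < ε
  dense₁ : ∀ f g, HasCurl₀ c f g → ∀ ε : ENNReal, 0 < ε →
    ∃ s ∈ Submodule.span ℂ (Set.range F₁),
      eLpNorm (f - s) 2 c.vol < ε ∧ eLpNorm (g - curl s) 2 c.vol < ε
  dense₂ : ∀ f h, HasDiv₀ c f h → ∀ ε : ENNReal, 0 < ε →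
    ∃ s ∈ Submodule.span ℂ (Set.range F₂),
      eLpNorm (f - s) 2 c.vol < ε ∧ eLpNorm (h - div s) 2 c.vol < ε
  dense₃ : ∀ u, MemLp u 2 c.vol → ∀ ε : ENNReal, 0 < ε →
    ∃ s ∈ Submodule.span ℂ (Set.range F₃), eLpNorm (u - s) 2 c.vol < ε

/-! ### Sub-complexes -/

/-- The four terms of a candidate sub-complex `0 → V₀ → V₁ → V₂ → V₃ → 0`. -/
structure FourTerm where
  V₀ : Submodule ℂ Scalar
  V₁ : Submodule ℂ Vector
  V₂ : Submodule ℂ Vector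
  V₃ : Submodule ℂ Scalar

/-- `grad`, `curl` and `div` map each term into the next. -/
def FourTerm.IsSubcomplex (S : FourTerm) : Prop :=
  (∀ u ∈ S.V₀, grad u ∈ S.V₁) ∧ (∀ f ∈ S.V₁, curl f ∈ S.V₂) ∧ (∀ f ∈ S.V₂, div f ∈ S.V₃)

/-- `0 → V₀ → V₁ → V₂ → V₃ → 0` is an exact complex. -/
def FourTerm.IsExact (S : FourTerm) : Prop :=
  S.IsSubcomplex ∧
  (∀ u ∈ S.V₀, grad u = 0 → u = 0) ∧
  (∀ f ∈ S.V₁, curl f = 0 ↔ ∃ u ∈ S.V₀, grad u = f) ∧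
  (∀ f ∈ S.V₂, div f = 0 ↔ ∃ g ∈ S.V₁, curl g = f) ∧
  (∀ h ∈ S.V₃, ∃ f ∈ S.V₂, div f = h)

/-- The spans of the four families are the internal direct sums of the terms of the
complexes `B i`. -/
def DecomposesInto {κ ι₀ ι₁ ι₂ ι₃ : Type} (B : κ → FourTerm)
    (F₀ : ι₀ → Scalar) (F₁ : ι₁ → Vector) (F₂ : ι₂ → Vector) (F₃ : ι₃ → Scalar) : Prop :=
  (iSupIndep (fun i => (B i).V₀) ∧ ⨆ i, (B i).V₀ = Submodule.span ℂ (Set.range F₀)) ∧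
  (iSupIndep (fun i => (B i).V₁) ∧ ⨆ i, (B i).V₁ = Submodule.span ℂ (Set.range F₁)) ∧
  (iSupIndep (fun i => (B i).V₂) ∧ ⨆ i, (B i).V₂ = Submodule.span ℂ (Set.range F₂)) ∧
  (iSupIndep (fun i => (B i).V₃) ∧ ⨆ i, (B i).V₃ = Submodule.span ℂ (Set.range F₃))

/-- Labels of the sub-complexes on the periodic cylinder. -/
inductive PerBlock
  | main (m k : ℤ) (j : ℕ)
  | edge (m k : ℤ) (hm : m ≠ 0)
  | const (k : ℤ)

def PerBlock.terms : PerBlock → FourTerm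
  | .main m k j =>
    { V₀ := Submodule.span ℂ {scal (expWave k) (wZernike m j)}
      V₁ := Submodule.span ℂ {horiz (expWave k) (nPlus m (j + 1)),
        horiz (expWave k) (nMinus m (j + 1)), vert (expWave k) (wZernike m j)}
      V₂ := Submodule.span ℂ {horiz (expWave k) (tPlus m (j + 1)),
        horiz (expWave k) (tMinus m (j + 1)), vert (expWave k) (zernike m (j + 1))}
      V₃ := Submodule.span ℂ {scal (expWave k) (zernike m (j + 1))} }
  | .edge m k _ =>
    { V₀ := ⊥
      V₁ := Submodule.span ℂ {horiz (expWave k) (nMinus m 0)}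
      V₂ := Submodule.span ℂ {horiz (expWave k) (tMinus m 0), vert (expWave k) (zernike m 0)}
      V₃ := Submodule.span ℂ {scal (expWave k) (zernike m 0)} }
  | .const k =>
    { V₀ := ⊥
      V₁ := ⊥
      V₂ := Submodule.span ℂ {vert (expWave k) (zernike 0 0)}
      V₃ := Submodule.span ℂ {scal (expWave k) (zernike 0 0)} }

/-- Labels of the sub-complexes on the finite cylinder. -/
inductive FinBlock
  | main (m : ℤ) (k j : ℕ)
  | edge (m : ℤ) (k : ℕ) (hm : m ≠ 0)
  | low (m : ℤ) (j : ℕ)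
  | lowEdge (m : ℤ) (hm : m ≠ 0)
  | axial (k : ℕ)
  | const

/-- The complex `0 → 0 → 0 → span{(1-z²)C_k^{(3/2)} (0, z_{0j})} → span{P_{k+1} z_{0j}} → 0`. -/
def axialTerms (k j : ℕ) : FourTerm :=
  { V₀ := ⊥
    V₁ := ⊥
    V₂ := Submodule.span ℂ {vert (wUltra k) (zernike 0 j)}
    V₃ := Submodule.span ℂ {scal (legendre (k + 1)) (zernike 0 j)} }

def FinBlock.terms : FinBlock → FourTerm
  | .main m k j =>
    { V₀ := Submodule.span ℂ {scal (wUltra k) (wZernike m j)}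
      V₁ := Submodule.span ℂ {horiz (wUltra k) (nPlus m (j + 1)),
        horiz (wUltra k) (nMinus m (j + 1)), vert (legendre (k + 1)) (wZernike m j)}
      V₂ := Submodule.span ℂ {horiz (legendre (k + 1)) (tPlus m (j + 1)),
        horiz (legendre (k + 1)) (tMinus m (j + 1)), vert (wUltra k) (zernike m (j + 1))}
      V₃ := Submodule.span ℂ {scal (legendre (k + 1)) (zernike m (j + 1))} }
  | .edge m k _ =>
    { V₀ := ⊥
      V₁ := Submodule.span ℂ {horiz (wUltra k) (nMinus m 0)}
      V₂ := Submodule.span ℂ {horiz (legendre (k + 1)) (tMinus m 0), vert (wUltra k) (zernike m 0)}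
      V₃ := Submodule.span ℂ {scal (legendre (k + 1)) (zernike m 0)} }
  | .low m j =>
    { V₀ := ⊥
      V₁ := Submodule.span ℂ {vert (legendre 0) (wZernike m j)}
      V₂ := Submodule.span ℂ {horiz (legendre 0) (tPlus m (j + 1)),
        horiz (legendre 0) (tMinus m (j + 1))}
      V₃ := Submodule.span ℂ {scal (legendre 0) (zernike m (j + 1))} }
  | .lowEdge m _ =>
    { V₀ := ⊥
      V₁ := ⊥
      V₂ := Submodule.span ℂ {horiz (legendre 0) (tMinus m 0)}
      V₃ := Submodule.span ℂ {scal (legendre 0) (zernike m 0)} }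
  | .axial k => axialTerms k 0
  | .const =>
    { V₀ := ⊥
      V₁ := ⊥
      V₂ := ⊥
      V₃ := Submodule.span ℂ {scal (legendre 0) (zernike 0 0)} }

/-- The polar form of `liftMode`: at `(r cos θ, r sin θ)`, `r ≠ 0`, the value is
`r^{|m|-1} e^{imθ} ρ(θ) (f₁(r²), i sign(m) f₂(r²))ᵀ`. -/
theorem liftMode_polar (m : ℤ) (hm : m ≠ 0) (f : ℝ → Fin 2 → ℝ) (r θ : ℝ) (hr : r ≠ 0) :
    liftMode m f (r * Real.cos θ) (r * Real.sin θ) =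
      ((r : ℂ) ^ (m.natAbs - 1) * Complex.exp (I * m * θ)) •
        (rotMat θ).mulVec ![(f (r ^ 2) 0 : ℂ), signI m * (f (r ^ 2) 1 : ℂ)] := by
  have h2 : (r * Real.cos θ) ^ 2 + (r * Real.sin θ) ^ 2 = r ^ 2 := by
    nlinarith [Real.sin_sq_add_cos_sq θ]
  have hr' : (r : ℂ) ≠ 0 := by exact_mod_cast hr
  have hcs : (Complex.sin θ) ^ 2 + (Complex.cos θ) ^ 2 = 1 := Complex.sin_sq_add_cos_sq _
  obtain ⟨n, hn⟩ : ∃ n, m.natAbs = n + 1 :=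
    ⟨m.natAbs - 1, by have := Int.natAbs_pos.mpr hm; omega⟩
  have hs : signI m ^ 2 = -1 := by
    rcases lt_or_gt_of_ne hm with h | h
    · simp [signI, Int.sign_eq_neg_one_of_neg h]
    · simp [signI, Int.sign_eq_one_of_pos h]
  have hE : Complex.exp (I * m * θ) =
      (Complex.cos θ + signI m * Complex.sin θ) ^ (n + 1) := by
    rcases lt_or_gt_of_ne hm with h | h
    · have e1 : (m : ℂ) = -((n + 1 : ℕ) : ℂ) := by
        have : m = -((n + 1 : ℕ) : ℤ) := by omega
        rw [this]; push_cast; ring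
      have e2 : Complex.cos θ + signI m * Complex.sin θ = Complex.exp (-θ * I) := by
        rw [Complex.exp_mul_I]
        simp [signI, Int.sign_eq_neg_one_of_neg h]; ring
      rw [e2, ← Complex.exp_nat_mul, e1]; congr 1; ring
    · have e1 : (m : ℂ) = ((n + 1 : ℕ) : ℂ) := by
        have : m = ((n + 1 : ℕ) : ℤ) := by omega
        rw [this]; push_cast; ring
      have e2 : Complex.cos θ + signI m * Complex.sin θ = Complex.exp (θ * I) := by
        rw [Complex.exp_mul_I]
        simp [signI, Int.sign_eq_one_of_pos h]; ring
      rw [e2, ← Complex.exp_nat_mul, e1]; congr 1; ring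
  have hp : ((r * Real.cos θ : ℝ) : ℂ) + signI m * ((r * Real.sin θ : ℝ) : ℂ) =
      r * (Complex.cos θ + signI m * Complex.sin θ) := by push_cast; ring
  unfold liftMode harmonicVec sigmaMat rotMat
  rw [h2, hp, hE, hn]
  generalize f (r ^ 2) 0 = a
  generalize f (r ^ 2) 1 = c
  generalize signI m = s at *
  simp only [Nat.add_sub_cancel, mul_pow, pow_succ (Complex.cos θ + s * Complex.sin θ) n]
  generalize (Complex.cos θ + s * Complex.sin θ) ^ n = P
  ext i
  fin_cases i
  · simp
    field_simp
    generalize Complex.cos θ = C at *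
    generalize Complex.sin θ = S at *
    linear_combination (-(P * a) - P * c) * hcs + 2 * P * c * S ^ 2 * hs
  · simp
    field_simp
    generalize Complex.cos θ = C at *
    generalize Complex.sin θ = S at *
    linear_combination (-(P * a * s) - P * c * s) * hcs - 2 * P * c * C * S * hs

end

end CylDeRham

open CylDeRham

namespace CylDeRham

/-! The cylinder is a product, so almost everything reduces to the axial variable and the disk. For
m ≠ 0 put σ = i sign m and e = x + σy; the plane fields are then combinations of P(r²)e^c times a
constant direction (1, ±σ), and differentiating them is polynomial algebra in t = r². The modes m =
0 are radial and angular fields. Two identities for shifted Jacobi polynomials,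
`derivative_one_sub_mul_jac` and `mul_derivative_one_sub_mul_jac`, carry the relations: n⁺_{m,j+1}
is a nonzero multiple of the gradient of w_{mj} (`nPlus_succ`), n⁻_{mj} has scalar curl −κ_{mj}
z_{mj} (`isPlaneCurl_nMinus`), and W_k has derivative −(k+1)(k+2)P_{k+1} (`isAxialDeriv_wUltra`).
The product rule lifts this to space.

Pointwise boundary conditions become weak ones through a divergence theorem for tangential fields,
`Cylinder.integral_div_eq_zero`. It needs no surface measure: the field is replaced by one with the
same divergence whose relevant components vanish on the boundary or are periodic, and Fubini with
the fundamental theorem of calculus does the rest. The same theorem proves orthogonality, since a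
nonzero multiple of the integrand is a divergence, by means of ∂_z, of ∂_θ, or of the Wronskian of
the Jacobi equation.

Independence follows from tensor products (`LinearIndependent.tensor`) in axial and plane variables,
and in polar coordinates. For the fields n^± the curl isolates the coefficients of n⁻; what remains
is the gradient of a combination of w_{mj}, which vanishes on the circle and hence vanishes.

Density has two stages. A mollifier composed with a dilation moves the support off the boundary
(`Cylinder.isCore_mollify`). Since test fields are smooth up to the boundary, the kernel itself is
admissible, so weak derivatives of the input become classical derivatives of the output, up to
dilation factors tending to 1. A function vanishing near the boundary is then divided by a
polynomial boundary weight, convolved with a Landau or trigonometric kernel, and multiplied by the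
weight again (`Cylinder.IsCore.approx`). These kernels are separable, so the result lies in the span
of the a_k w_{mj}. A vector field with such components lies in the curl and div spans
(`vec_mem_span_curlFam`, `vec_mem_span_divFam`).

Each sub-complex is a small complex with explicit matrices whose exactness depends on κ ≠ 0 and j +
1 ≠ 0 (`isExact_main`, `isExact_edge`, `isExact_low`) or, for a single arrow, on its factor being
nonzero (`isExact_tail`). The direct sums come from sorting the independent families into blocks
(`LinearIndependent.iSupIndep_of_fibres`). The exceptional classes are detected by constant test
fields. -/

/-! ### Shifted Jacobi polynomials -/

open Polynomial in
/-- The shifted Jacobi polynomial `P_n^{(a,b)}(2t-1)` as a polynomial in `t`. -/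
noncomputable def jac (n a b : ℕ) : Polynomial ℂ :=
  ∑ s ∈ Finset.range (n + 1), C (((n + a).choose (n - s) : ℂ) * ((n + b).choose s : ℂ)) *
    ((X - 1) ^ s * X ^ (n - s))

theorem jac_eval (n a b : ℕ) (t : ℝ) :
    (jac n a b).eval (t : ℂ) = ((jacobi n a b (2 * t - 1) : ℝ) : ℂ) := by
  simp only [jac, jacobi, Polynomial.eval_finsetSum, Complex.ofReal_sum]
  refine Finset.sum_congr rfl fun s _ => ?_
  have h1 : (2 * t - 1 - 1) / 2 = t - 1 := by ring
  have h2 : (2 * t - 1 + 1) / 2 = t := by ring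
  rw [h1, h2]
  simp [mul_assoc]

/-- Differentiating (X-1)^s X^d produces two neighbouring basis elements. Shifting one half of the
sum by one index lets identities between such sums be checked coefficient by coefficient. -/
theorem sum_range_succ_eq {M : Type*} [AddCommGroup M] {n : ℕ} (f g T : ℕ → M) (h0 : f 0 = T 0)
    (hn : g n = 0) (h : ∀ s < n, f (s + 1) + g s = T (s + 1)) :
    ∑ s ∈ Finset.range (n + 1), (f s + g s) = ∑ s ∈ Finset.range (n + 1), T s := by
  rw [Finset.sum_add_distrib, Finset.sum_range_succ' f, Finset.sum_range_succ g, hn, add_zero,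
    Finset.sum_range_succ' T, ← h0, add_right_comm, ← Finset.sum_add_distrib]
  congr 1
  exact Finset.sum_congr rfl fun s hs => h s (Finset.mem_range.1 hs)

theorem choose_cast_succ (n k : ℕ) :
    ((n + 1).choose (k + 1) : ℂ) * ((k : ℂ) + 1) = ((n : ℂ) + 1) * (n.choose k : ℂ) := by
  have := Nat.add_one_mul_choose_eq n k
  exact_mod_cast this.symm

theorem choose_cast_right (s d : ℕ) :
    ((s + 1 + d).choose (s + 1) : ℂ) * ((s : ℂ) + 1)
      = ((s + 1 + d).choose s : ℂ) * ((d : ℂ) + 1) := by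
  have h := Nat.choose_succ_right_eq (s + 1 + d) s
  have h2 : s + 1 + d - s = d + 1 := by omega
  rw [h2] at h
  exact_mod_cast h

theorem choose_cast_pascal (n k : ℕ) :
    ((n + 1).choose (k + 1) : ℂ) = (n.choose k : ℂ) + (n.choose (k + 1) : ℂ) := by
  exact_mod_cast Nat.choose_succ_succ n k

open Polynomial in
theorem derivative_pow_mul_pow (s d : ℕ) :
    derivative ((X - 1 : ℂ[X]) ^ s * X ^ d) =
      C (s : ℂ) * ((X - 1) ^ (s - 1) * X ^ d) + C (d : ℂ) * ((X - 1) ^ s * X ^ (d - 1)) := by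
  simp only [derivative_mul, derivative_pow, derivative_X, derivative_sub, derivative_one, sub_zero,
    mul_one]
  ring

-- In the basis (X-1)^s X^(n-s) this is a coefficient identity: Pascal's rule splits the second
-- binomial, and absorption rewrites the first. The identity supplies both the gradient of w_{mj}
-- and the curl of `rotPart`.
open Polynomial in
theorem derivative_one_sub_mul_jac (n c : ℕ) :
    derivative ((1 - X) * jac n 1 c) = C (-((n : ℂ) + 1)) * jac n 0 (c + 1) := by
  have h : (1 - X) * jac n 1 c = ∑ s ∈ Finset.range (n + 1),
      C (-(((n + 1).choose (n - s) : ℂ) * ((n + c).choose s : ℂ))) *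
        ((X - 1) ^ (s + 1) * X ^ (n - s)) := by
    rw [jac, Finset.mul_sum]
    refine Finset.sum_congr rfl fun s _ => ?_
    rw [C_neg]; ring
  rw [h, jac, Finset.mul_sum, derivative_sum]
  simp only [derivative_C_mul, derivative_pow_mul_pow, mul_add]
  refine sum_range_succ_eq _ _ _ ?_ ?_ fun s hs => ?_
  · simp
  · simp
  · obtain ⟨d, rfl⟩ : ∃ d, n = s + 1 + d := ⟨n - (s + 1), by omega⟩
    have e1 : s + 1 + d - (s + 1) = d := by omega
    have e2 : s + 1 + d - s = d + 1 := by omega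
    have e3 : s + 1 + d + (c + 1) = (s + 1 + d + c) + 1 := by omega
    rw [e1, e2, e3, choose_cast_pascal (s + 1 + d + c) s]
    simp only [Nat.add_sub_cancel, add_zero, ← mul_assoc, ← C_mul]
    have e4 : (s + 1 + d + 1).choose d = (s + 1 + d + 1).choose (s + 1 + 1) :=
      Nat.choose_symm_of_eq_add (by omega)
    have e5 : (s + 1 + d + 1).choose (d + 1) = (s + 1 + d + 1).choose (s + 1) :=
      Nat.choose_symm_of_eq_add (by omega)
    have e6 : (s + 1 + d).choose d = (s + 1 + d).choose (s + 1) :=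
      Nat.choose_symm_of_eq_add (by omega)
    rw [e4, e5, e6, ← add_mul, ← add_mul, ← C_add]
    congr 3
    have h1 := choose_cast_succ (s + 1 + d) (s + 1)
    have h2 := choose_cast_right (s + 1) d
    rw [show s + 1 + 1 + d = s + 1 + d + 1 by omega] at h2
    push_cast at *
    linear_combination (-((s + 1 + d + c).choose (s + 1) : ℂ)) * h1
      + ((s + 1 + d + c).choose s : ℂ) * (h2 - h1)

open Polynomial in
theorem jac_one_eq (n b : ℕ) : jac n 1 b = ∑ s ∈ Finset.range (n + 1),
    C (((n + 1).choose (s + 1) : ℂ) * ((n + b).choose s : ℂ)) * ((X - 1) ^ s * X ^ (n - s)) := by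
  refine Finset.sum_congr rfl fun s hs => ?_
  have := Finset.mem_range.1 hs
  rw [Nat.choose_symm_of_eq_add (show n + 1 = n - s + (s + 1) by omega)]

open Polynomial in
theorem jac_zero_eq (n b : ℕ) : jac n 0 b = ∑ s ∈ Finset.range (n + 1),
    C ((n.choose s : ℂ) * ((n + b).choose s : ℂ)) * ((X - 1) ^ s * X ^ (n - s)) := by
  refine Finset.sum_congr rfl fun s hs => ?_
  have := Finset.mem_range.1 hs
  rw [add_zero, Nat.choose_symm_of_eq_add (show n = n - s + s by omega)]

-- This is the derivative of t^(c+1) (1-t) P_n^{(1,c+1)}(2t-1) divided by t^c, a Rodrigues-type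
-- relation. With c = 0 it gives the derivative of `wUltra` and the curl of n⁻ for m = 0; for
-- general c it is half of the Jacobi equation `jac_ode`.
open Polynomial in
theorem mul_derivative_one_sub_mul_jac (n c : ℕ) :
    C ((c : ℂ) + 1) * ((1 - X) * jac n 1 (c + 1)) + X * derivative ((1 - X) * jac n 1 (c + 1))
      = C (-((n : ℂ) + 1)) * jac (n + 1) 0 c := by
  have h : (1 - X) * jac n 1 (c + 1) = ∑ s ∈ Finset.range (n + 1),
      C (-(((n + 1).choose (s + 1) : ℂ) * ((n + (c + 1)).choose s : ℂ))) *
        ((X - 1) ^ (s + 1) * X ^ (n - s)) := by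
    rw [jac_one_eq, Finset.mul_sum]
    refine Finset.sum_congr rfl fun s _ => ?_
    rw [C_neg]; ring
  have h' : C ((c : ℂ) + 1) * ((1 - X) * jac n 1 (c + 1))
      + X * derivative ((1 - X) * jac n 1 (c + 1)) = ∑ s ∈ Finset.range (n + 1 + 1),
      (C (-(((n + 1).choose (s + 1) : ℂ) * ((n + (c + 1)).choose s : ℂ) * ((s : ℂ) + 1))) *
        ((X - 1) ^ s * X ^ (n + 1 - s)) +
      C (-(((n + 1).choose (s + 1) : ℂ) * ((n + (c + 1)).choose s : ℂ) * ((c : ℂ) + 1 + n - s))) *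
        ((X - 1) ^ (s + 1) * X ^ (n - s))) := by
    -- The range has one index more than the sum in `h`; the added coefficient contains C(n+1, n+2)
    -- = 0. This matches the n + 2 terms of the right-hand side.
    rw [Finset.sum_range_succ]
    simp only [Nat.choose_succ_self, Nat.cast_zero, zero_mul, neg_zero, map_zero, add_zero]
    rw [h, Finset.mul_sum, derivative_sum, Finset.mul_sum, ← Finset.sum_add_distrib]
    refine Finset.sum_congr rfl fun s hs => ?_
    have hs' := Finset.mem_range.1 hs
    obtain ⟨d, rfl⟩ : ∃ d, n = s + d := ⟨n - s, by omega⟩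
    rw [derivative_C_mul, derivative_pow_mul_pow, show s + d - s = d by omega,
      show s + d + 1 - s = d + 1 by omega, Nat.add_sub_cancel]
    -- For d = 0 the exponent d - 1 is truncated, but its coefficient is zero.
    rcases d with _ | d
    · simp only [C_neg, C_mul, C_add, C_sub, C_1, Nat.cast_add, Nat.cast_one, Nat.cast_zero, C_0]
      ring
    · simp only [C_neg, C_mul, C_add, C_sub, C_1, Nat.cast_add, Nat.cast_one, Nat.add_sub_cancel]
      ring
  rw [h', jac_zero_eq, Finset.mul_sum]
  refine sum_range_succ_eq _ _ _ ?_ ?_ fun s hs => ?_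
  · simp
  · simp
  · have e1 : n + 1 - (s + 1) = n - s := by omega
    rw [e1, ← add_mul, ← C_add, ← mul_assoc (C _) (C _), ← C_mul]
    congr 2
    obtain ⟨d, rfl⟩ : ∃ d, n = s + d := ⟨n - s, by omega⟩
    rw [show s + d + (c + 1) = s + d + 1 + c by omega]
    have h1 := choose_cast_right s (d + c)
    have h3 : ((s + d + 1).choose (s + 1 + 1) : ℂ) * ((s : ℂ) + 1 + 1)
      = ((s + d + 1).choose (s + 1) : ℂ) * d := by
      have h := Nat.choose_succ_right_eq (s + d + 1) (s + 1)
      rw [show s + d + 1 - (s + 1) = d by omega] at h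
      exact_mod_cast h
    rw [show s + 1 + (d + c) = s + d + 1 + c by omega] at h1
    push_cast at *
    linear_combination ((s + d + 1).choose (s + 1) : ℂ) * h1
      - ((s + d + 1 + c).choose (s + 1) : ℂ) * h3

-- The other half of the Jacobi equation: it lowers the degree while raising both parameters, and
-- `mul_derivative_one_sub_mul_jac` goes back.
open Polynomial in
theorem derivative_jac (n c : ℕ) :
    derivative (jac (n + 1) 0 c) = C ((n : ℂ) + c + 2) * jac n 1 (c + 1) := by
  rw [jac_zero_eq, jac_one_eq, Finset.mul_sum, derivative_sum]
  simp only [derivative_C_mul, derivative_pow_mul_pow, mul_add]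
  rw [Finset.sum_add_distrib, Finset.sum_range_succ', Finset.sum_range_succ _ (n + 1)]
  simp only [Nat.sub_self, Nat.cast_zero, C_0, zero_mul, mul_zero, add_zero]
  rw [← Finset.sum_add_distrib]
  refine Finset.sum_congr rfl fun s hs => ?_
  have hs' := Finset.mem_range.1 hs
  obtain ⟨d, rfl⟩ : ∃ d, n = s + d := ⟨n - s, by omega⟩
  rw [show s + d + 1 - (s + 1) = d by omega, show s + d + 1 - s = d + 1 by omega,
    show s + d - s = d by omega, Nat.add_sub_cancel, Nat.add_sub_cancel, ← mul_assoc (C _) (C _),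
    ← mul_assoc (C _) (C _), ← mul_assoc (C _) (C _), ← C_mul, ← C_mul, ← C_mul, ← add_mul, ← C_add]
  congr 2
  have h1 := choose_cast_right s d
  have h2 := choose_cast_pascal (s + d + 1 + c) s
  have h3 := choose_cast_succ (s + d + 1 + c) s
  rw [show s + 1 + d = s + d + 1 by omega] at h1
  rw [show s + d + (c + 1) = s + d + 1 + c by omega]
  push_cast at *
  linear_combination (-((s + d + 1 + c).choose s : ℂ)) * h1
    - ((s + d + 1).choose (s + 1) : ℂ) * ((s : ℂ) + 1) * h2 + ((s + d + 1).choose (s + 1) : ℂ) * h3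

-- Every (X-1)^s X^(n-s) is monic of degree n and every binomial coefficient in front is positive,
-- so the leading coefficients cannot cancel.
open Polynomial in
theorem degree_jac (n a b : ℕ) : (jac n a b).degree = n := by
  have hm : ∀ s ∈ Finset.range (n + 1), ((X - 1 : ℂ[X]) ^ s * X ^ (n - s)).Monic ∧
      ((X - 1 : ℂ[X]) ^ s * X ^ (n - s)).natDegree = n := by
    intro s hs
    have h1 : ((X - 1 : ℂ[X]) ^ s).Monic := by
      simpa using (monic_X_sub_C (1 : ℂ)).pow s
    refine ⟨h1.mul (monic_X_pow _), ?_⟩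
    rw [h1.natDegree_mul (monic_X_pow _), natDegree_X_pow,
      show (X - 1 : ℂ[X]) = X - C 1 by simp, natDegree_pow, natDegree_X_sub_C]
    have := Finset.mem_range.1 hs
    omega
  refine le_antisymm ?_ ?_
  · refine (degree_sum_le _ _).trans (Finset.sup_le fun s hs => ?_)
    refine degree_le_natDegree.trans (Nat.cast_le.2 ((natDegree_C_mul_le _ _).trans ?_))
    rw [(hm s hs).2]
  · refine le_degree_of_ne_zero ?_
    rw [jac, finsetSum_coeff]
    have : ∀ s ∈ Finset.range (n + 1), (C (((n + a).choose (n - s) : ℂ) * ((n + b).choose s : ℂ)) *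
        ((X - 1) ^ s * X ^ (n - s))).coeff n =
        (((n + a).choose (n - s) * (n + b).choose s : ℕ) : ℂ) := by
      intro s hs
      rw [coeff_C_mul]
      have := (hm s hs).1.coeff_natDegree
      rw [(hm s hs).2] at this
      rw [this]; push_cast; ring
    rw [Finset.sum_congr rfl this, ← Nat.cast_sum, Nat.cast_ne_zero]
    refine (Finset.sum_pos (fun s hs => ?_) ⟨0, by simp⟩).ne'
    have := Finset.mem_range.1 hs
    exact Nat.mul_pos (Nat.choose_pos (by omega)) (Nat.choose_pos (by omega))

/-- The Jacobi polynomials of fixed parameters as a degree sequence. -/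
noncomputable def jacSeq (a b : ℕ) : Polynomial.Sequence ℂ := ⟨fun n => jac n a b, fun n => degree_jac n a b⟩

theorem span_jac (a b : ℕ) : Submodule.span ℂ (Set.range fun n => jac n a b) = ⊤ :=
  (jacSeq a b).span fun i =>
    (isUnit_iff_ne_zero.2 (Polynomial.leadingCoeff_ne_zero.2 ((jacSeq a b).ne_zero i)))

theorem linearIndependent_jac (a b : ℕ) : LinearIndependent ℂ (fun n => jac n a b) :=
  (jacSeq a b).linearIndependent

theorem jac_zero (a b : ℕ) : jac 0 a b = 1 := by simp [jac]

/-! ### Polynomial modes in the plane -/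

/-- The polynomial `P(r²) (x + σ y)^c`. -/
noncomputable def mode (σ : ℂ) (c : ℕ) (P : Polynomial ℂ) (x y : ℝ) : ℂ :=
  P.eval ((x : ℂ) ^ 2 + (y : ℂ) ^ 2) * ((x : ℂ) + σ * y) ^ c

/-- The field `A(r²) e^b (1, σ) + D(r²) e^{b+2} (1, -σ)` with `e = x + σ y`. -/
noncomputable def modeField (σ : ℂ) (b : ℕ) (A D : Polynomial ℂ) (x y : ℝ) : Fin 2 → ℂ :=
  ![mode σ b A x y + mode σ (b + 2) D x y, σ * (mode σ b A x y - mode σ (b + 2) D x y)]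

/-- The radial field `A(r²) (x, y)`. -/
noncomputable def radialField (A : Polynomial ℂ) (x y : ℝ) : Fin 2 → ℂ :=
  A.eval ((x : ℂ) ^ 2 + (y : ℂ) ^ 2) • ![(x : ℂ), (y : ℂ)]

/-- The angular field `B(r²) (-y, x)`. -/
noncomputable def angularField (B : Polynomial ℂ) (x y : ℝ) : Fin 2 → ℂ :=
  B.eval ((x : ℂ) ^ 2 + (y : ℂ) ^ 2) • ![-(y : ℂ), (x : ℂ)]

theorem signI_sq {m : ℤ} (hm : m ≠ 0) : signI m ^ 2 = -1 := by
  rcases lt_or_gt_of_ne hm with h | h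
  · simp [signI, Int.sign_eq_neg_one_of_neg h]
  · simp [signI, Int.sign_eq_one_of_pos h]

theorem natAbs_eq_succ {m : ℤ} (hm : m ≠ 0) : m.natAbs = m.natAbs - 1 + 1 := by
  have := Int.natAbs_pos.2 hm; omega

theorem jacobi_cast (n a b : ℕ) (x y : ℝ) :
    ((jacobi n a b (2 * (x ^ 2 + y ^ 2) - 1) : ℝ) : ℂ)
      = (jac n a b).eval ((x : ℂ) ^ 2 + (y : ℂ) ^ 2) := by
  rw [← jac_eval]; push_cast; rfl

theorem zernikeGen_eq_mode (l : ℕ) (m : ℤ) (j : ℕ) :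
    zernikeGen l m j = mode (signI m) m.natAbs (jac j l m.natAbs) := by
  ext x y
  simp [zernikeGen, mode, harmonic, jacobi_cast]

theorem zernike_eq_mode (m : ℤ) (j : ℕ) :
    zernike m j = mode (signI m) m.natAbs (jac j 0 m.natAbs) := by
  ext x y
  rw [zernike, zernikeGen_eq_mode]

theorem wZernike_eq_mode (m : ℤ) (j : ℕ) :
    wZernike m j = mode (signI m) m.natAbs ((1 - Polynomial.X) * jac j 1 m.natAbs) := by
  ext x y
  rw [wZernike, zernikeGen_eq_mode]
  simp [mode, mul_assoc]

theorem mode_add (σ : ℂ) (c : ℕ) (P Q : Polynomial ℂ) :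
    mode σ c (P + Q) = mode σ c P + mode σ c Q := by
  ext x y; simp [mode, add_mul]

theorem mode_C_mul (σ : ℂ) (c : ℕ) (a : ℂ) (P : Polynomial ℂ) :
    mode σ c (Polynomial.C a * P) = a • mode σ c P := by
  ext x y; simp [mode, mul_assoc]

theorem modeField_add (σ : ℂ) (b : ℕ) (A D A' D' : Polynomial ℂ) :
    modeField σ b (A + A') (D + D') = modeField σ b A D + modeField σ b A' D' := by
  ext x y i
  fin_cases i <;> simp [modeField, mode_add] <;> ring

theorem modeField_C_mul (σ : ℂ) (b : ℕ) (a : ℂ) (A D : Polynomial ℂ) :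
    modeField σ b (Polynomial.C a * A) (Polynomial.C a * D) = a • modeField σ b A D := by
  ext x y i
  fin_cases i <;> simp [modeField, mode_C_mul] <;> ring

/-! ### Smoothness and derivatives -/

/-- Smoothness of a function of two real variables. -/
def PlaneSmooth (u : ℝ → ℝ → ℂ) : Prop := ContDiff ℝ (⊤ : ℕ∞) (fun q : ℝ × ℝ => u q.1 q.2)

theorem planeSmooth_mode (σ : ℂ) (c : ℕ) (P : Polynomial ℂ) : PlaneSmooth (mode σ c P) := by
  have h1 : ContDiff ℝ (⊤ : ℕ∞) (fun q : ℝ × ℝ => (q.1 : ℂ)) := ofRealCLM.contDiff.comp contDiff_fst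
  have h2 : ContDiff ℝ (⊤ : ℕ∞) (fun q : ℝ × ℝ => (q.2 : ℂ)) := ofRealCLM.contDiff.comp contDiff_snd
  have hP : ContDiff ℂ (⊤ : ℕ∞) (fun z : ℂ => P.eval z) := by
    simpa only [Polynomial.coe_aeval_eq_eval] using P.contDiff_aeval (𝕜 := ℂ) (⊤ : ℕ∞)
  exact ((hP.restrict_scalars ℝ).comp ((h1.pow 2).add (h2.pow 2))).mul ((h1.add (contDiff_const.mul h2)).pow c)

theorem hasDerivAt_mode_left (σ : ℂ) (c : ℕ) (P : Polynomial ℂ) (x y : ℝ) :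
    HasDerivAt (fun s => mode σ c P s y)
      (2 * x * mode σ c P.derivative x y + c * mode σ (c - 1) P x y) x := by
  have h : HasDerivAt (fun s : ℂ => P.eval (s ^ 2 + (y : ℂ) ^ 2) * (s + σ * y) ^ c) _ (x : ℂ) :=
    ((P.hasDerivAt _).comp (x : ℂ) (((hasDerivAt_id (x : ℂ)).pow 2).add_const ((y : ℂ) ^ 2))).mul
      (((hasDerivAt_id (x : ℂ)).add_const (σ * y)).pow c)
  refine h.comp_ofReal.congr_deriv ?_
  simp [mode]; ring

theorem hasDerivAt_mode_right (σ : ℂ) (c : ℕ) (P : Polynomial ℂ) (x y : ℝ) :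
    HasDerivAt (fun s => mode σ c P x s)
      (2 * y * mode σ c P.derivative x y + c * σ * mode σ (c - 1) P x y) y := by
  have h : HasDerivAt (fun s : ℂ => P.eval ((x : ℂ) ^ 2 + s ^ 2) * (x + σ * s) ^ c) _ (y : ℂ) :=
    ((P.hasDerivAt _).comp (y : ℂ) (((hasDerivAt_id (y : ℂ)).pow 2).const_add ((x : ℂ) ^ 2))).mul
      ((((hasDerivAt_id (y : ℂ)).const_mul σ).const_add (x : ℂ)).pow c)
  refine h.comp_ofReal.congr_deriv ?_
  simp [mode]; ring

/-- `v` is the gradient of the smooth function `u`. -/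
structure IsPlaneGrad (u : ℝ → ℝ → ℂ) (v : ℝ → ℝ → Fin 2 → ℂ) : Prop where
  smooth : PlaneSmooth u
  left : ∀ x y, HasDerivAt (fun s => u s y) (v x y 0) x
  right : ∀ x y, HasDerivAt (fun s => u x s) (v x y 1) y

/-- The smooth field `v` has the scalar curl `h`. -/
structure IsPlaneCurl (v : ℝ → ℝ → Fin 2 → ℂ) (h : ℝ → ℝ → ℂ) : Prop where
  smooth : ∀ i, PlaneSmooth (fun x y => v x y i)
  curl : ∀ x y, deriv (fun s => v s y 1) x - deriv (fun s => v x s 0) y = h x y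

theorem PlaneSmooth.differentiable_left {u : ℝ → ℝ → ℂ} (hu : PlaneSmooth u) (x y : ℝ) :
    DifferentiableAt ℝ (fun s => u s y) x := by
  have h := hu.differentiable (by simp)
  exact (h (x, y)).comp (f := fun s : ℝ => (s, y)) x (by fun_prop)

theorem PlaneSmooth.differentiable_right {u : ℝ → ℝ → ℂ} (hu : PlaneSmooth u) (x y : ℝ) :
    DifferentiableAt ℝ (fun s => u x s) y := by
  have h := hu.differentiable (by simp)
  exact (h (x, y)).comp (f := fun s : ℝ => (x, s)) y (by fun_prop)

theorem IsPlaneCurl.add {v v' : ℝ → ℝ → Fin 2 → ℂ} {h h' : ℝ → ℝ → ℂ} (hv : IsPlaneCurl v h)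
    (hv' : IsPlaneCurl v' h') : IsPlaneCurl (v + v') (h + h') := by
  refine ⟨fun i => (hv.smooth i).add (hv'.smooth i), fun x y => ?_⟩
  simp only [Pi.add_apply]
  rw [deriv_fun_add ((hv.smooth 1).differentiable_left x y) ((hv'.smooth 1).differentiable_left x y),
    deriv_fun_add ((hv.smooth 0).differentiable_right x y) ((hv'.smooth 0).differentiable_right x y),
    ← hv.curl, ← hv'.curl]
  ring

theorem IsPlaneCurl.smul {v : ℝ → ℝ → Fin 2 → ℂ} {h : ℝ → ℝ → ℂ} (hv : IsPlaneCurl v h) (a : ℂ) :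
    IsPlaneCurl (a • v) (a • h) := by
  refine ⟨fun i => contDiff_const.mul (hv.smooth i), fun x y => ?_⟩
  simp only [Pi.smul_apply, smul_eq_mul]
  rw [deriv_const_mul _ ((hv.smooth 1).differentiable_left x y),
    deriv_const_mul _ ((hv.smooth 0).differentiable_right x y), ← hv.curl]
  ring

/-- The curl of f(1, σ) is σ(∂x + σ∂y)f, and that of f(1, -σ) is -σ(∂x - σ∂y)f. With e = x + σy and
its conjugate factor ē = x - σy, eē = r², the first operator kills e and sends r² to 2e, while the
second sends e to 2 and r² to 2ē. -/
theorem isPlaneCurl_modeField {σ : ℂ} (hσ : σ ^ 2 = -1) (b : ℕ) (A D : Polynomial ℂ) :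
    IsPlaneCurl (modeField σ b A D) (mode σ (b + 1) (Polynomial.C (2 * σ) *
      (A.derivative - Polynomial.C ((b : ℂ) + 2) * D - Polynomial.X * D.derivative))) := by
  refine ⟨fun i => ?_, fun x y => ?_⟩
  · fin_cases i
    · exact (planeSmooth_mode σ b A).add (planeSmooth_mode σ (b + 2) D)
    · exact contDiff_const.mul ((planeSmooth_mode σ b A).sub (planeSmooth_mode σ (b + 2) D))
  · simp only [modeField, Matrix.cons_val_one, Matrix.cons_val_zero, Matrix.cons_val_fin_one]
    rw [(((hasDerivAt_mode_left σ b A x y).fun_sub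
      (hasDerivAt_mode_left σ (b + 2) D x y)).const_mul σ).deriv,
      ((hasDerivAt_mode_right σ b A x y).fun_add (hasDerivAt_mode_right σ (b + 2) D x y)).deriv]
    simp only [mode, Polynomial.eval_mul, Polynomial.eval_sub,
      Polynomial.eval_C, Polynomial.eval_X]
    have h2 : b + 2 - 1 = b + 1 := by omega
    rw [h2]
    generalize (Polynomial.eval ((x : ℂ) ^ 2 + (y : ℂ) ^ 2)) D = d
    generalize (Polynomial.eval ((x : ℂ) ^ 2 + (y : ℂ) ^ 2)) A = a
    generalize (Polynomial.eval ((x : ℂ) ^ 2 + (y : ℂ) ^ 2)) D.derivative = d'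
    generalize (Polynomial.eval ((x : ℂ) ^ 2 + (y : ℂ) ^ 2)) A.derivative = a'
    push_cast
    have e2 : ((x : ℂ) + σ * y) ^ (b + 2) = ((x : ℂ) + σ * y) ^ b * ((x : ℂ) + σ * y) ^ 2 := by ring
    have e1 : ((x : ℂ) + σ * y) ^ (b + 1) = ((x : ℂ) + σ * y) ^ b * ((x : ℂ) + σ * y) := by ring
    rw [e1, e2]
    generalize ((x : ℂ) + σ * y) ^ b = p
    linear_combination (-(2 * a' * p * y + 2 * x ^ 2 * y * p * d' + 2 * σ * x * y ^ 2 * p * d')) * hσ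

/-- The gradient is half of (1, σ)(∂x - σ∂y) + (1, -σ)(∂x + σ∂y); the two operators act on e and r²
as in `isPlaneCurl_modeField`. -/
theorem isPlaneGrad_mode {σ : ℂ} (hσ : σ ^ 2 = -1) (b : ℕ) (G : Polynomial ℂ) :
    IsPlaneGrad (mode σ (b + 1) G) (modeField σ b
      (Polynomial.C ((b : ℂ) + 1) * G + Polynomial.X * G.derivative) G.derivative) := by
  refine ⟨planeSmooth_mode _ _ _, fun x y => ?_, fun x y => ?_⟩
  · refine (hasDerivAt_mode_left σ (b + 1) G x y).congr_deriv ?_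
    simp [modeField, mode]
    linear_combination (-(((x : ℂ) + σ * y) ^ b * G.derivative.eval ((x : ℂ) ^ 2 + (y : ℂ) ^ 2) *
      y ^ 2)) * hσ
  · refine (hasDerivAt_mode_right σ (b + 1) G x y).congr_deriv ?_
    simp [modeField, mode]
    linear_combination ((2 * x * y + σ * y ^ 2) * ((x : ℂ) + σ * y) ^ b *
      G.derivative.eval ((x : ℂ) ^ 2 + (y : ℂ) ^ 2)) * hσ

theorem isPlaneGrad_mode_zero (σ : ℂ) (G : Polynomial ℂ) :
    IsPlaneGrad (mode σ 0 G) (radialField (Polynomial.C 2 * G.derivative)) := by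
  refine ⟨planeSmooth_mode _ _ _, fun x y => ?_, fun x y => ?_⟩
  · refine (hasDerivAt_mode_left σ 0 G x y).congr_deriv ?_
    simp [radialField, mode]; ring
  · refine (hasDerivAt_mode_right σ 0 G x y).congr_deriv ?_
    simp [radialField, mode]; ring

theorem planeSmooth_ofReal_snd : PlaneSmooth (fun _ y => (y : ℂ)) :=
  ofRealCLM.contDiff.comp contDiff_snd

theorem planeSmooth_ofReal_fst : PlaneSmooth (fun x _ => (x : ℂ)) :=
  ofRealCLM.contDiff.comp contDiff_fst

theorem radialField_apply (A : Polynomial ℂ) (x y : ℝ) :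
    radialField A x y = ![mode 0 0 A x y * x, mode 0 0 A x y * y] := by
  simp [radialField, mode]

theorem angularField_apply (B : Polynomial ℂ) (x y : ℝ) :
    angularField B x y = ![mode 0 0 B x y * -y, mode 0 0 B x y * x] := by
  simp [angularField, mode]

theorem isPlaneCurl_radialField (A : Polynomial ℂ) : IsPlaneCurl (radialField A) 0 := by
  refine ⟨fun i => ?_, fun x y => ?_⟩
  · simp only [radialField_apply]
    fin_cases i
    · exact (planeSmooth_mode 0 0 A).mul planeSmooth_ofReal_fst
    · exact (planeSmooth_mode 0 0 A).mul planeSmooth_ofReal_snd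
  · have h1 := ((hasDerivAt_mode_left 0 0 A x y).mul_const (y : ℂ)).deriv
    have h2 := ((hasDerivAt_mode_right 0 0 A x y).mul_const (x : ℂ)).deriv
    simp only [radialField_apply, Matrix.cons_val_one, Matrix.cons_val_zero,
      Matrix.cons_val_fin_one]
    rw [h1, h2]
    simp [mode]
    ring

theorem isPlaneCurl_angularField (B : Polynomial ℂ) : IsPlaneCurl (angularField B)
    (mode 0 0 (Polynomial.C 2 * (B + Polynomial.X * B.derivative))) := by
  refine ⟨fun i => ?_, fun x y => ?_⟩
  · simp only [angularField_apply]
    fin_cases i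
    · exact (planeSmooth_mode 0 0 B).mul planeSmooth_ofReal_snd.neg
    · exact (planeSmooth_mode 0 0 B).mul planeSmooth_ofReal_fst
  · have h1 := ((hasDerivAt_mode_left 0 0 B x y).fun_mul
      (hasDerivAt_id (x : ℂ)).comp_ofReal).deriv
    have h2 := ((hasDerivAt_mode_right 0 0 B x y).fun_mul
      (hasDerivAt_id (y : ℂ)).fun_neg.comp_ofReal).deriv
    simp only [id_eq] at h1 h2
    simp only [angularField_apply, Matrix.cons_val_one, Matrix.cons_val_zero,
      Matrix.cons_val_fin_one]
    rw [h1, h2]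
    simp [mode]
    ring

/-! ### The fields `n` -/

theorem normalMat_mulVec (x y : ℝ) (v : Fin 2 → ℂ) : (normalMat x y).mulVec v =
    ![(1 - (y : ℂ) ^ 2) * v 0 + x * y * v 1, x * y * v 0 + (1 - (x : ℂ) ^ 2) * v 1] := by
  ext i
  fin_cases i <;> simp [normalMat, Matrix.mulVec, dotProduct, Fin.sum_univ_two]

/-- Since N = 1 - (-y, x)(-y, x)ᵀ, multiplication by N alters only the angular component, which is
F. The hypotheses write f as (F + 2tD, F), so that the quotient by 2r² in `liftMode` is the
polynomial D. In the directions (1, ±σ) the correction is (r²F/2) e^b (1, σ) - (F/2) e^(b+2) (1,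
-σ), b = |m| - 1. -/
theorem normalMat_liftMode {m : ℤ} (hm : m ≠ 0) (D F : Polynomial ℂ) (f : ℝ → Fin 2 → ℝ)
    (h0 : ∀ t : ℝ, ((f t 0 : ℝ) : ℂ) = F.eval (t : ℂ) + 2 * t * D.eval (t : ℂ))
    (h1 : ∀ t : ℝ, ((f t 1 : ℝ) : ℂ) = F.eval (t : ℂ)) (x y : ℝ) :
    (normalMat x y).mulVec (liftMode m f x y) = modeField (signI m) (m.natAbs - 1)
      (F + Polynomial.X * D - Polynomial.C (1 / 2) * (Polynomial.X * F))
      (D + Polynomial.C (1 / 2) * F) x y := by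
  have hs := signI_sq hm
  rw [normalMat_mulVec]
  -- At the origin `liftMode` divides by zero, but its second term contains Σ = 0; on the right the
  -- D-term carries e^(b+2), which also vanishes there.
  by_cases hr : x ^ 2 + y ^ 2 = 0
  · obtain ⟨rfl, rfl⟩ : x = 0 ∧ y = 0 := by constructor <;> nlinarith [sq_nonneg x, sq_nonneg y]
    have e0 := h0 0
    have e1 := h1 0
    simp at e0 e1
    ext i
    fin_cases i
    · simp [liftMode, harmonicVec, modeField, mode, e0, e1]
    · simp [liftMode, harmonicVec, modeField, mode, e0, e1]
      ring
  · have hr' : ((x : ℂ) ^ 2 + (y : ℂ) ^ 2) ≠ 0 := by exact_mod_cast hr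
    have e0 := h0 (x ^ 2 + y ^ 2)
    have e1 := h1 (x ^ 2 + y ^ 2)
    push_cast at e0 e1
    generalize hP : ((x : ℂ) + signI m * y) ^ (m.natAbs - 1) = P
    have hP2 : ((x : ℂ) + signI m * y) ^ (m.natAbs - 1 + 2) = P * ((x : ℂ) + signI m * y) ^ 2 := by
      rw [← hP, pow_add]
    have hD : ((f (x ^ 2 + y ^ 2) 0 : ℂ) - f (x ^ 2 + y ^ 2) 1) / (2 * ((x : ℂ) ^ 2 + (y : ℂ) ^ 2))
        = D.eval ((x : ℂ) ^ 2 + (y : ℂ) ^ 2) := by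
      rw [e0, e1]; field_simp; ring
    simp only [liftMode, harmonicVec, modeField, mode, hP, hP2]
    push_cast
    rw [hD, e0, e1]
    simp only [Polynomial.eval_add, Polynomial.eval_sub, Polynomial.eval_mul, Polynomial.eval_C,
      Polynomial.eval_X]
    generalize D.eval ((x : ℂ) ^ 2 + (y : ℂ) ^ 2) = d
    generalize F.eval ((x : ℂ) ^ 2 + (y : ℂ) ^ 2) = g
    generalize signI m = σ at *
    ext i
    fin_cases i
    · simp [sigmaMat]
      linear_combination (-((d + g / 2) * y ^ 2 * P)) * hs
    · simp [sigmaMat]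
      linear_combination ((d + g / 2) * (2 * x * y + y ^ 2 * σ) * P) * hs

/-- The gradient of `w_{mj}`. -/
noncomputable def gradW (m : ℤ) (j : ℕ) : ℝ → ℝ → Fin 2 → ℂ :=
  if m = 0 then radialField (Polynomial.C (-2 * ((j : ℂ) + 1)) * jac j 0 1)
  else modeField (signI m) (m.natAbs - 1)
    (Polynomial.C (((m.natAbs - 1 : ℕ) : ℂ) + 1) * ((1 - Polynomial.X) * jac j 1 m.natAbs)
      + Polynomial.X * ((1 - Polynomial.X) * jac j 1 m.natAbs).derivative)
    ((1 - Polynomial.X) * jac j 1 m.natAbs).derivative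

theorem isPlaneGrad_gradW (m : ℤ) (j : ℕ) : IsPlaneGrad (wZernike m j) (gradW m j) := by
  rw [wZernike_eq_mode]
  by_cases hm : m = 0
  · subst hm
    have h := isPlaneGrad_mode_zero (signI 0) ((1 - Polynomial.X) * jac j 1 0)
    rw [derivative_one_sub_mul_jac, ← mul_assoc, ← Polynomial.C_mul] at h
    rw [gradW, if_pos rfl, show (-2 * ((j : ℂ) + 1)) = 2 * -((j : ℂ) + 1) by ring]
    exact h
  · have h := isPlaneGrad_mode (signI_sq hm) (m.natAbs - 1)
      ((1 - Polynomial.X) * jac j 1 m.natAbs)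
    rw [← natAbs_eq_succ hm] at h
    rwa [gradW, if_neg hm]

theorem isPlaneCurl_gradW (m : ℤ) (j : ℕ) : IsPlaneCurl (gradW m j) 0 := by
  by_cases hm : m = 0
  · rw [gradW, if_pos hm]
    exact isPlaneCurl_radialField _
  · rw [gradW, if_neg hm]
    convert isPlaneCurl_modeField (signI_sq hm) (m.natAbs - 1) _ _ using 1
    ext x y
    simp [mode]
    ring_nf
    simp

/-- The part of `n_{mj}^±`, `m ≠ 0`, that is not a gradient. -/
noncomputable def rotPart (m : ℤ) (j : ℕ) : ℝ → ℝ → Fin 2 → ℂ :=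
  modeField (signI m) (m.natAbs - 1) ((1 - Polynomial.X) * jac j 1 (m.natAbs - 1)) 0

/-- With no (1, -σ) part the curl is 2σA'e^|m|, and A = (1-X) P_j^{(1,|m|-1)} has a multiple of the
radial polynomial of z_{mj} as its derivative. -/
theorem isPlaneCurl_rotPart {m : ℤ} (hm : m ≠ 0) (j : ℕ) :
    IsPlaneCurl (rotPart m j) ((-2 * ((j : ℂ) + 1) * signI m) • zernike m j) := by
  have h := isPlaneCurl_modeField (signI_sq hm) (m.natAbs - 1)
    ((1 - Polynomial.X) * jac j 1 (m.natAbs - 1)) 0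
  rw [derivative_one_sub_mul_jac, ← natAbs_eq_succ hm] at h
  rw [rotPart, zernike_eq_mode, ← mode_C_mul]
  convert h using 2
  simp only [mul_zero, sub_zero, Polynomial.derivative_zero, ← mul_assoc, ← Polynomial.C_mul]
  congr 2
  ring

-- The two terms of `q1` have separate meanings under N. The vector P_j^{(1,b)}(1-t, 1) goes to
-- (1-t)P_j^{(1,b)} e^b (1, σ), which is `rotPart`, and v_j^{(b)} goes to the gradient of w_{mj},
-- where |m| = b + 1.
open Polynomial in
theorem n1_eq {m : ℤ} (hm : m ≠ 0) (j : ℕ) : n1 m j =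
    (((2 * j + m.natAbs : ℝ) / ((j + 1) * rConst j (m.natAbs - 1)) : ℝ) : ℂ) •
      ((((2 * j + m.natAbs + 1) * (2 * j + m.natAbs + 2) : ℝ) : ℂ) • rotPart m j
        + (-((j + m.natAbs + 1 : ℝ) : ℂ)) • gradW m j) := by
  obtain ⟨b, hb⟩ : ∃ b, m.natAbs = b + 1 := ⟨_, natAbs_eq_succ hm⟩
  rw [gradW, if_neg hm, rotPart, ← modeField_C_mul, ← modeField_C_mul, ← modeField_add,
    ← modeField_C_mul, hb, Nat.add_sub_cancel, derivative_one_sub_mul_jac]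
  ext1 x; ext1 y
  rw [n1, vN1, if_neg hm, hb, Nat.add_sub_cancel]
  -- The arguments are D, then F, obtained by solving f₁ = F, f₀ = F + 2tD for `q1`; the halves come
  -- from the division by 2t.
  rw [normalMat_liftMode hm
    (C (((2 * (j : ℝ) + ((b + 1 : ℕ) : ℝ)) / ((j + 1) * rConst j b) : ℝ) : ℂ) *
      (C (-(1 / 2) * ((2 * j + b + 2) * (2 * j + b + 3) : ℂ)) * jac j 1 b
        + C ((j : ℂ) + b + 2) * (C (((b : ℂ) + 1) / 2) * jac j 1 (b + 1)
        + C ((j : ℂ) + 1) * jac j 0 (b + 2))))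
    (C (((2 * (j : ℝ) + ((b + 1 : ℕ) : ℝ)) / ((j + 1) * rConst j b) : ℝ) : ℂ) *
      (C ((2 * j + b + 2) * (2 * j + b + 3) : ℂ) * jac j 1 b
        - C (((j : ℂ) + b + 2) * ((b : ℂ) + 1)) * jac j 1 (b + 1)))]
  · rw [hb, Nat.add_sub_cancel]
    generalize (((2 * (j : ℝ) + ((b + 1 : ℕ) : ℝ)) / ((j + 1) * rConst j b) : ℝ) : ℂ) = α
    have h2 : (C (1 / 2) : ℂ[X]) * 2 = 1 := by
      rw [show (2 : ℂ[X]) = C 2 from rfl, ← C_mul]; norm_num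
    congr 1
    · simp only [C_mul, C_add, C_neg, C_1, Nat.cast_add, Nat.cast_one, ofReal_add, ofReal_mul,
        ofReal_natCast, ofReal_one, ofReal_ofNat, div_eq_mul_inv, one_mul] at h2 ⊢
      rw [show (C (2 : ℂ) : ℂ[X]) = 2 from rfl, show (C (3 : ℂ) : ℂ[X]) = 3 from rfl]
      linear_combination (-(X * C α * ((2 * C (j : ℂ) + C (b : ℂ) + 2) *
        (2 * C (j : ℂ) + C (b : ℂ) + 3) * jac j 1 b - (C (j : ℂ) + C (b : ℂ) + 2) *
        (C (b : ℂ) + 1) * jac j 1 (b + 1)))) * h2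
    · simp only [C_mul, C_add, C_neg, C_1, Nat.cast_add, Nat.cast_one, ofReal_add, ofReal_mul,
        ofReal_natCast, ofReal_one, ofReal_ofNat, div_eq_mul_inv, one_mul] at h2 ⊢
      rw [show (C (2 : ℂ) : ℂ[X]) = 2 from rfl, show (C (3 : ℂ) : ℂ[X]) = 3 from rfl]
      ring
  · intro t
    simp [q1, vPoly, jac_eval]
    ring
  · intro t
    simp [q1, vPoly, jac_eval]
    ring

-- By definition `q2` is -v_{n-1}/n minus `q1`, so the sum retains only -v_j/(j+1), and N lifts v_j
-- to the gradient of w_{mj}.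
open Polynomial in
theorem n1_add_n2 {m : ℤ} (hm : m ≠ 0) (j : ℕ) :
    n1 m (j + 1) + n2 m (j + 1) = (-(1 / ((j : ℂ) + 1))) • gradW m j := by
  obtain ⟨b, hb⟩ : ∃ b, m.natAbs = b + 1 := ⟨_, natAbs_eq_succ hm⟩
  rw [gradW, if_neg hm, ← modeField_C_mul, hb, Nat.add_sub_cancel, derivative_one_sub_mul_jac]
  ext1 x; ext1 y
  have hadd : n1 m (j + 1) x y + n2 m (j + 1) x y = (normalMat x y).mulVec
      (liftMode m (fun t => q1 (j + 1) b t + q2 (j + 1) b t) x y) := by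
    rw [n1, n2, vN1, vN2, if_neg hm, if_neg hm, ← Matrix.mulVec_add, hb, Nat.add_sub_cancel]
    congr 1
    simp only [liftMode, Pi.add_apply]
    rw [add_add_add_comm, ← add_smul, ← add_smul]
    congr 2
    · push_cast; ring
    · push_cast; ring
  have hq : ∀ t, q1 (j + 1) b t + q2 (j + 1) b t = -((1 / ((j : ℝ) + 1)) • vPoly j b t) := by
    intro t
    simp [q2]
  simp only [Pi.add_apply]
  -- Again D precedes F, now solved for -v_j/(j+1).
  rw [hadd, normalMat_liftMode hm
    (C (-(1 / ((j : ℂ) + 1))) *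
      (C (-((b : ℂ) + 1) / 2) * jac j 1 (b + 1) - C ((j : ℂ) + 1) * jac j 0 (b + 2)))
    (C (-(1 / ((j : ℂ) + 1))) * (C ((b : ℂ) + 1) * jac j 1 (b + 1)))]
  · rw [hb, Nat.add_sub_cancel]
    generalize (1 / ((j : ℂ) + 1)) = α
    have h2 : (C (1 / 2) : ℂ[X]) * 2 = 1 := by
      rw [show (2 : ℂ[X]) = C 2 from rfl, ← C_mul]; norm_num
    congr 1
    · simp only [C_mul, C_add, C_neg, C_1, div_eq_mul_inv, one_mul] at h2 ⊢
      linear_combination (X * C α * (C (b : ℂ) + 1) * jac j 1 (b + 1)) * h2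
    · simp only [C_mul, C_add, C_neg, C_1, div_eq_mul_inv, one_mul] at h2 ⊢
      ring
  · intro t
    rw [hq]
    simp [vPoly, jac_eval]
    ring
  · intro t
    rw [hq]
    simp [vPoly, jac_eval]

/-- The source of the gradient relation and of the vanishing curl of n⁺. For m ≠ 0 it is
`n1_add_n2`; for m = 0 the matrix N fixes radial fields, so n¹ is already the gradient up to a
factor. -/
theorem nPlus_succ (m : ℤ) (j : ℕ) : nPlus m (j + 1) = (-(1 / ((j : ℂ) + 1))) • gradW m j := by
  by_cases hm : m = 0
  · subst hm
    ext x y i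
    have hj : (j : ℂ) + 1 ≠ 0 := by exact_mod_cast Nat.succ_ne_zero j
    simp only [nPlus, if_true, n1, vN1, gradW, normalMat_mulVec, jacobi_cast,
      Nat.add_sub_cancel]
    fin_cases i
    · simp [radialField]; field_simp; ring
    · simp [radialField]; field_simp; ring
  · rw [← n1_add_n2 hm]
    ext1 x; ext1 y
    simp [nPlus, hm]

/-- N multiplies the angular vector (-y, x) by 1 - r². -/
theorem nMinus_zero_left (j : ℕ) : nMinus 0 (j + 1) =
    (2 : ℂ) • angularField ((1 - Polynomial.X) * jac j 1 1) := by
  ext x y i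
  simp only [nMinus, if_true, n2, vN2, normalMat_mulVec, jacobi_cast,
    Nat.add_sub_cancel]
  fin_cases i
  · simp [angularField]; ring
  · simp [angularField]; ring

theorem nMinus_zero_right {m : ℤ} (hm : m ≠ 0) : nMinus m 0 = (2 : ℂ) • n1 m 0 := by
  ext x y i
  simp [nMinus, hm]

/-- n¹ - n² = 2n¹ - (n¹ + n²), and the last bracket is a gradient. Hence n⁻ has the curl of 2n¹. -/
theorem nMinus_succ {m : ℤ} (hm : m ≠ 0) (j : ℕ) : nMinus m (j + 1) =
    (2 : ℂ) • n1 m (j + 1) + (1 / ((j : ℂ) + 1)) • gradW m j := by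
  have h := n1_add_n2 hm j
  have h2 : nMinus m (j + 1) = n1 m (j + 1) - n2 m (j + 1) := by
    ext1 x; ext1 y
    simp [nMinus, hm]
  rw [neg_smul, eq_neg_iff_add_eq_zero] at h
  rw [h2, ← sub_eq_zero, ← neg_eq_zero, ← h, two_smul]
  abel

theorem isPlaneCurl_nPlus (m : ℤ) (j : ℕ) (hj : 1 ≤ j) : IsPlaneCurl (nPlus m j) 0 := by
  obtain ⟨j, rfl⟩ : ∃ i, j = i + 1 := ⟨j - 1, by omega⟩
  rw [nPlus_succ]
  simpa using (isPlaneCurl_gradW m j).smul (-(1 / ((j : ℂ) + 1)))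

theorem rConst_pos (n b : ℕ) : 0 < rConst n b := by
  unfold rConst; positivity

/-- Only `rotPart` contributes to the curl. Its factor -2(j+1)σ times the coefficients in `n1_eq`
and the outer 2 is -κ; the j + 1 cancels. -/
theorem isPlaneCurl_two_n1 {m : ℤ} (hm : m ≠ 0) (j : ℕ) :
    IsPlaneCurl ((2 : ℂ) • n1 m j) (-kappa m j • zernike m j) := by
  rw [n1_eq hm]
  have h := ((((isPlaneCurl_rotPart hm j).smul
    ((((2 * j + m.natAbs + 1) * (2 * j + m.natAbs + 2) : ℝ) : ℂ))).add
    ((isPlaneCurl_gradW m j).smul (-((j + m.natAbs + 1 : ℝ) : ℂ)))).smul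
    (((2 * j + m.natAbs : ℝ) / ((j + 1) * rConst j (m.natAbs - 1)) : ℝ) : ℂ)).smul 2
  convert h using 1
  rw [smul_zero, add_zero, smul_smul, smul_smul, smul_smul, kappa, if_neg hm]
  congr 1
  have h1 : ((rConst j (m.natAbs - 1) : ℝ) : ℂ) ≠ 0 := by exact_mod_cast (rConst_pos _ _).ne'
  have h2 : (j : ℂ) + 1 ≠ 0 := by exact_mod_cast Nat.succ_ne_zero j
  push_cast
  field_simp
  ring

theorem isPlaneCurl_nMinus (m : ℤ) (j : ℕ) (hj : 1 - |m| ≤ (j : ℤ)) :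
    IsPlaneCurl (nMinus m j) (-kappa m j • zernike m j) := by
  by_cases hm : m = 0
  · subst hm
    obtain ⟨j, rfl⟩ : ∃ i, j = i + 1 := ⟨j - 1, by simp at hj; omega⟩
    rw [nMinus_zero_left]
    convert (isPlaneCurl_angularField ((1 - Polynomial.X) * jac j 1 1)).smul 2 using 1
    -- For m = 0 the curl of an angular field is 2(tB)', which is the case c = 0 of the
    -- Rodrigues-type identity.
    have h := mul_derivative_one_sub_mul_jac j 0
    simp only [Nat.cast_zero, zero_add, Polynomial.C_1, one_mul] at h
    rw [h, zernike_eq_mode, ← mode_C_mul, ← mode_C_mul, ← mul_assoc, ← mul_assoc,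
      ← Polynomial.C_mul, ← Polynomial.C_mul, kappa, if_pos rfl]
    ext x y
    simp [mode]
    ring
  · rcases j with _ | j
    · rw [nMinus_zero_right hm]
      exact isPlaneCurl_two_n1 hm 0
    · rw [nMinus_succ hm]
      simpa using (isPlaneCurl_two_n1 hm (j + 1)).add
        ((isPlaneCurl_gradW m j).smul (1 / ((j : ℂ) + 1)))

/-! ### Separated fields in three variables -/

theorem pd_eq_of_hasDerivAt {i : Fin 3} {f : Scalar} {p : Fin 3 → ℝ} {f' : ℂ}
    (hf : DifferentiableAt ℝ f p) (h : HasDerivAt (fun s => f (Function.update p i s)) f' (p i)) :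
    pd i f p = f' := by
  have h1 : HasFDerivAt f (fderiv ℝ f p) (Function.update p i (p i)) := by
    rw [Function.update_eq_self]; exact hf.hasFDerivAt
  have h2 := h1.comp_hasDerivAt (p i) (hasDerivAt_update p i (p i))
  exact h2.unique h

theorem contDiff_planar {u : ℝ → ℝ → ℂ} (hu : PlaneSmooth u) :
    ContDiff ℝ (⊤ : ℕ∞) (fun p : Fin 3 → ℝ => u (p 0) (p 1)) :=
  ContDiff.comp (g := fun q : ℝ × ℝ => u q.1 q.2) (f := fun p : Fin 3 → ℝ => (p 0, p 1)) hu
    ((contDiff_apply ℝ ℝ 0).prodMk (contDiff_apply ℝ ℝ 1))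

theorem contDiff_axial {a : ℝ → ℂ} (ha : ContDiff ℝ (⊤ : ℕ∞) a) :
    ContDiff ℝ (⊤ : ℕ∞) (fun p : Fin 3 → ℝ => a (p 2)) :=
  ha.comp (contDiff_apply ℝ ℝ 2)

theorem contDiff_scal {a : ℝ → ℂ} {u : ℝ → ℝ → ℂ} (ha : ContDiff ℝ (⊤ : ℕ∞) a)
    (hu : PlaneSmooth u) : ContDiff ℝ (⊤ : ℕ∞) (scal a u) :=
  (contDiff_axial ha).mul (contDiff_planar hu)

/-- The smooth function `a` has derivative `a'`. -/
structure IsAxialDeriv (a a' : ℝ → ℂ) : Prop where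
  smooth : ContDiff ℝ (⊤ : ℕ∞) a
  deriv : ∀ z, HasDerivAt a (a' z) z

theorem pd_zero_scal {a : ℝ → ℂ} {u : ℝ → ℝ → ℂ} (ha : ContDiff ℝ (⊤ : ℕ∞) a)
    (hu : PlaneSmooth u) (p : Fin 3 → ℝ) :
    pd 0 (scal a u) p = a (p 2) * deriv (fun s => u s (p 1)) (p 0) := by
  refine pd_eq_of_hasDerivAt ((contDiff_scal ha hu).differentiable (by simp) p) ?_
  simpa [scal] using (hu.differentiable_left (p 0) (p 1)).hasDerivAt.const_mul (a (p 2))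

theorem pd_one_scal {a : ℝ → ℂ} {u : ℝ → ℝ → ℂ} (ha : ContDiff ℝ (⊤ : ℕ∞) a)
    (hu : PlaneSmooth u) (p : Fin 3 → ℝ) :
    pd 1 (scal a u) p = a (p 2) * deriv (fun s => u (p 0) s) (p 1) := by
  refine pd_eq_of_hasDerivAt ((contDiff_scal ha hu).differentiable (by simp) p) ?_
  simpa [scal] using (hu.differentiable_right (p 0) (p 1)).hasDerivAt.const_mul (a (p 2))

theorem pd_two_scal {a a' : ℝ → ℂ} {u : ℝ → ℝ → ℂ} (ha : IsAxialDeriv a a')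
    (hu : PlaneSmooth u) (p : Fin 3 → ℝ) :
    pd 2 (scal a u) p = a' (p 2) * u (p 0) (p 1) := by
  refine pd_eq_of_hasDerivAt ((contDiff_scal ha.smooth hu).differentiable (by simp) p) ?_
  simpa [scal] using (ha.deriv (p 2)).mul_const (u (p 0) (p 1))

theorem pd_zero_fun (i : Fin 3) (p : Fin 3 → ℝ) : pd i (fun _ => (0 : ℂ)) p = 0 := by
  simp [pd]

/-- Rotation of a plane field by `π/2`. -/
def rotField (v : ℝ → ℝ → Fin 2 → ℂ) (x y : ℝ) : Fin 2 → ℂ := ![-v x y 1, v x y 0]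

theorem grad_scal {a a' : ℝ → ℂ} {u : ℝ → ℝ → ℂ} {v : ℝ → ℝ → Fin 2 → ℂ}
    (ha : IsAxialDeriv a a') (hu : IsPlaneGrad u v) :
    grad (scal a u) = horiz a v + vert a' u := by
  ext p i
  fin_cases i
  · simp [grad, horiz, vert, pd_zero_scal ha.smooth hu.smooth, (hu.left _ _).deriv]
  · simp [grad, horiz, vert, pd_one_scal ha.smooth hu.smooth, (hu.right _ _).deriv]
  · simp [grad, horiz, vert, pd_two_scal ha hu.smooth]

theorem horiz_apply_zero (a : ℝ → ℂ) (v : ℝ → ℝ → Fin 2 → ℂ) :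
    (fun q => horiz a v q 0) = scal a (fun x y => v x y 0) := by
  ext p; simp [horiz, scal]

theorem horiz_apply_one (a : ℝ → ℂ) (v : ℝ → ℝ → Fin 2 → ℂ) :
    (fun q => horiz a v q 1) = scal a (fun x y => v x y 1) := by
  ext p; simp [horiz, scal]

theorem horiz_apply_two (a : ℝ → ℂ) (v : ℝ → ℝ → Fin 2 → ℂ) :
    (fun q => horiz a v q 2) = fun _ => 0 := by
  ext p; simp [horiz]

theorem vert_apply_zero (a : ℝ → ℂ) (u : ℝ → ℝ → ℂ) : (fun q => vert a u q 0) = fun _ => 0 := by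
  ext p; simp [vert]

theorem vert_apply_one (a : ℝ → ℂ) (u : ℝ → ℝ → ℂ) : (fun q => vert a u q 1) = fun _ => 0 := by
  ext p; simp [vert]

theorem vert_apply_two (a : ℝ → ℂ) (u : ℝ → ℝ → ℂ) : (fun q => vert a u q 2) = scal a u := by
  ext p; simp [vert, scal]

theorem curl_horiz {a a' : ℝ → ℂ} {v : ℝ → ℝ → Fin 2 → ℂ} {h : ℝ → ℝ → ℂ}
    (ha : IsAxialDeriv a a') (hv : IsPlaneCurl v h) :
    curl (horiz a v) = horiz a' (rotField v) + vert a h := by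
  ext p i
  simp only [curl, horiz_apply_zero, horiz_apply_one, horiz_apply_two, pd_zero_fun,
    pd_two_scal ha (hv.smooth _), pd_zero_scal ha.smooth (hv.smooth _),
    pd_one_scal ha.smooth (hv.smooth _)]
  fin_cases i
  · simp [horiz, vert, rotField]
  · simp [horiz, vert, rotField]
  · simp [horiz, vert, ← mul_sub, hv.curl]

theorem curl_vert {a : ℝ → ℂ} {u : ℝ → ℝ → ℂ} {v : ℝ → ℝ → Fin 2 → ℂ}
    (ha : ContDiff ℝ (⊤ : ℕ∞) a) (hu : IsPlaneGrad u v) :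
    curl (vert a u) = -horiz a (rotField v) := by
  ext p i
  simp only [curl, vert_apply_zero, vert_apply_one, vert_apply_two, pd_zero_fun,
    pd_zero_scal ha hu.smooth, pd_one_scal ha hu.smooth, (hu.left _ _).deriv, (hu.right _ _).deriv]
  fin_cases i
  · simp [horiz, rotField]
  · simp [horiz, rotField]
  · simp [horiz]

theorem div_horiz_rotField {a : ℝ → ℂ} {v : ℝ → ℝ → Fin 2 → ℂ} {h : ℝ → ℝ → ℂ}
    (ha : ContDiff ℝ (⊤ : ℕ∞) a) (hv : IsPlaneCurl v h) :
    div (horiz a (rotField v)) = scal a (-h) := by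
  ext p
  have h0 : PlaneSmooth (fun x y => rotField v x y 0) := (hv.smooth 1).neg
  have h1 : PlaneSmooth (fun x y => rotField v x y 1) := hv.smooth 0
  simp only [div, horiz_apply_zero, horiz_apply_one, horiz_apply_two, pd_zero_fun,
    pd_zero_scal ha h0, pd_one_scal ha h1]
  simp [rotField, scal, ← hv.curl]
  ring

theorem div_vert {a a' : ℝ → ℂ} {u : ℝ → ℝ → ℂ} (ha : IsAxialDeriv a a') (hu : PlaneSmooth u) :
    div (vert a u) = scal a' u := by
  ext p
  simp [div, vert_apply_zero, vert_apply_one, vert_apply_two, pd_zero_fun, pd_two_scal ha hu, scal]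

theorem rotMat_mulVec (v : Fin 2 → ℂ) :
    (rotMat (Real.pi / 2)).mulVec v = ![-v 1, v 0] := by
  ext i
  fin_cases i <;> simp [rotMat, Matrix.mulVec, dotProduct, Fin.sum_univ_two]

theorem tPlus_eq (m : ℤ) (j : ℕ) : tPlus m j = rotField (nPlus m j) := by
  ext1 x; ext1 y
  rw [tPlus, rotMat_mulVec, rotField]

theorem tMinus_eq (m : ℤ) (j : ℕ) : tMinus m j = rotField (nMinus m j) := by
  ext1 x; ext1 y
  rw [tMinus, rotMat_mulVec, rotField]

theorem rotField_smul (c : ℂ) (v : ℝ → ℝ → Fin 2 → ℂ) : rotField (c • v) = c • rotField v := by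
  ext x y i
  fin_cases i <;> simp [rotField]

theorem horiz_smul_left (c : ℂ) (a : ℝ → ℂ) (v : ℝ → ℝ → Fin 2 → ℂ) :
    horiz (c • a) v = c • horiz a v := by
  ext p i
  fin_cases i <;> simp [horiz, mul_assoc]

theorem horiz_smul_right (c : ℂ) (a : ℝ → ℂ) (v : ℝ → ℝ → Fin 2 → ℂ) :
    horiz a (c • v) = c • horiz a v := by
  ext p i
  fin_cases i <;> simp [horiz, mul_left_comm]

theorem vert_smul_left (c : ℂ) (a : ℝ → ℂ) (u : ℝ → ℝ → ℂ) : vert (c • a) u = c • vert a u := by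
  ext p i
  fin_cases i <;> simp [vert, mul_assoc]

theorem vert_smul_right (c : ℂ) (a : ℝ → ℂ) (u : ℝ → ℝ → ℂ) : vert a (c • u) = c • vert a u := by
  ext p i
  fin_cases i <;> simp [vert, mul_left_comm]

theorem vert_zero_right (a : ℝ → ℂ) : vert a 0 = 0 := by
  ext p i
  fin_cases i <;> simp [vert]

theorem scal_smul_left (c : ℂ) (a : ℝ → ℂ) (u : ℝ → ℝ → ℂ) : scal (c • a) u = c • scal a u := by
  ext p; simp [scal, mul_assoc]

theorem scal_smul_right (c : ℂ) (a : ℝ → ℂ) (u : ℝ → ℝ → ℂ) : scal a (c • u) = c • scal a u := by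
  ext p; simp [scal, mul_left_comm]

theorem scal_zero_right (a : ℝ → ℂ) : scal a 0 = 0 := by
  ext p; simp [scal]

/-! ### Derivatives of the basis elements -/

theorem isPlaneGrad_wZernike (m : ℤ) (j : ℕ) :
    IsPlaneGrad (wZernike m j) ((-((j : ℂ) + 1)) • nPlus m (j + 1)) := by
  have h : (j : ℂ) + 1 ≠ 0 := by exact_mod_cast Nat.succ_ne_zero j
  convert isPlaneGrad_gradW m j using 1
  rw [nPlus_succ, smul_smul, show (-((j : ℂ) + 1)) * (-(1 / ((j : ℂ) + 1))) = 1 by field_simp,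
    one_smul]

theorem planeSmooth_zernike (m : ℤ) (j : ℕ) : PlaneSmooth (zernike m j) := by
  rw [zernike_eq_mode]; exact planeSmooth_mode _ _ _

section Relations

variable {a b : ℝ → ℂ} {l : ℂ} (m : ℤ) (j : ℕ)

theorem grad_scal_wZernike (ha : IsAxialDeriv a (l • b)) : grad (scal a (wZernike m j)) =
    (-((j : ℂ) + 1)) • horiz a (nPlus m (j + 1)) + l • vert b (wZernike m j) := by
  rw [grad_scal ha (isPlaneGrad_wZernike m j), horiz_smul_right, vert_smul_left]

theorem curl_horiz_nPlus (ha : IsAxialDeriv a (l • b)) (hj : 1 ≤ j) :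
    curl (horiz a (nPlus m j)) = l • horiz b (tPlus m j) := by
  rw [curl_horiz ha (isPlaneCurl_nPlus m j hj), vert_zero_right, add_zero, horiz_smul_left, tPlus_eq]

theorem curl_horiz_nMinus (ha : IsAxialDeriv a (l • b)) (hj : 1 - |m| ≤ (j : ℤ)) :
    curl (horiz a (nMinus m j)) =
      l • horiz b (tMinus m j) - kappa m j • vert a (zernike m j) := by
  rw [curl_horiz ha (isPlaneCurl_nMinus m j hj), horiz_smul_left, tMinus_eq, vert_smul_right,
    neg_smul, sub_eq_add_neg]

theorem curl_vert_wZernike (ha : ContDiff ℝ (⊤ : ℕ∞) a) :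
    curl (vert a (wZernike m j)) = ((j : ℂ) + 1) • horiz a (tPlus m (j + 1)) := by
  rw [curl_vert ha (isPlaneGrad_wZernike m j), rotField_smul, horiz_smul_right, ← neg_smul, neg_neg,
    tPlus_eq]

theorem div_horiz_tPlus (ha : ContDiff ℝ (⊤ : ℕ∞) a) (hj : 1 ≤ j) :
    div (horiz a (tPlus m j)) = 0 := by
  rw [tPlus_eq, div_horiz_rotField ha (isPlaneCurl_nPlus m j hj), neg_zero, scal_zero_right]

theorem div_horiz_tMinus (ha : ContDiff ℝ (⊤ : ℕ∞) a) (hj : 1 - |m| ≤ (j : ℤ)) :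
    div (horiz a (tMinus m j)) = kappa m j • scal a (zernike m j) := by
  rw [tMinus_eq, div_horiz_rotField ha (isPlaneCurl_nMinus m j hj), neg_smul, neg_neg,
    scal_smul_right]

theorem div_vert_zernike (ha : IsAxialDeriv a (l • b)) :
    div (vert a (zernike m j)) = l • scal b (zernike m j) := by
  rw [div_vert ha (planeSmooth_zernike m j), scal_smul_left]

end Relations

/-! ### Derivatives of the axial functions -/

theorem isAxialDeriv_expWave (k : ℤ) : IsAxialDeriv (expWave k) ((I * (k : ℂ)) • expWave k) := by
  refine ⟨?_, fun z => ?_⟩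
  · exact (contDiff_const.mul ofRealCLM.contDiff).cexp
  · have h := (((hasDerivAt_id (z : ℂ)).const_mul (I * (k : ℂ))).cexp).comp_ofReal
    refine h.congr_deriv ?_
    simp [expWave, mul_comm]

theorem jacobi_eq_eval (n a b : ℕ) (z : ℝ) :
    ((jacobi n a b z : ℝ) : ℂ) = (jac n a b).eval (((z : ℂ) + 1) / 2) := by
  have h := jac_eval n a b ((z + 1) / 2)
  rw [show 2 * ((z + 1) / 2) - 1 = z by ring] at h
  rw [← h]; push_cast; rfl

theorem contDiff_eval_half (P : Polynomial ℂ) :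
    ContDiff ℝ (⊤ : ℕ∞) (fun z : ℝ => P.eval (((z : ℂ) + 1) / 2)) := by
  have hP : ContDiff ℂ (⊤ : ℕ∞) (fun z : ℂ => P.eval z) := by
    simpa only [Polynomial.coe_aeval_eq_eval] using P.contDiff_aeval (𝕜 := ℂ) (⊤ : ℕ∞)
  exact (hP.restrict_scalars ℝ).comp ((ofRealCLM.contDiff.add contDiff_const).div_const 2)

theorem contDiff_legendre (k : ℕ) : ContDiff ℝ (⊤ : ℕ∞) (legendre k) := by
  have : legendre k = fun z : ℝ => (jac k 0 0).eval (((z : ℂ) + 1) / 2) := by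
    ext z; rw [legendre, jacobi_eq_eval]
  rw [this]; exact contDiff_eval_half _

theorem wUltra_eq_eval (k : ℕ) : wUltra k = fun z : ℝ => (Polynomial.C (2 * ((k : ℂ) + 2)) *
    (Polynomial.X * ((1 - Polynomial.X) * jac k 1 1))).eval (((z : ℂ) + 1) / 2) := by
  ext z
  simp [wUltra, ultra, jacobi_eq_eval]
  ring

/-- With t = (z+1)/2, W_k is 2(k+2) t(1-t) P_k^{(1,1)}(2t-1), so the Rodrigues-type identity with c
= 0 applies; the chain rule contributes 1/2. -/
theorem isAxialDeriv_wUltra (k : ℕ) : IsAxialDeriv (wUltra k)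
    ((-(((k : ℂ) + 1) * ((k : ℂ) + 2))) • legendre (k + 1)) := by
  rw [wUltra_eq_eval]
  refine ⟨contDiff_eval_half _, fun z => ?_⟩
  have h := ((Polynomial.hasDerivAt (Polynomial.C (2 * ((k : ℂ) + 2)) *
    (Polynomial.X * ((1 - Polynomial.X) * jac k 1 1))) (((z : ℂ) + 1) / 2)).comp (z : ℂ)
    (((hasDerivAt_id (z : ℂ)).add_const (1 : ℂ)).div_const 2)).comp_ofReal
  refine h.congr_deriv ?_
  have h2 := mul_derivative_one_sub_mul_jac k 0
  simp only [Nat.cast_zero, zero_add, Polynomial.C_1, one_mul] at h2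
  rw [Polynomial.derivative_C_mul, Polynomial.derivative_mul, Polynomial.derivative_X, one_mul, h2]
  simp [legendre, jacobi_eq_eval]
  ring

/-! ### The divergence theorem on the cylinders -/

/-- A compact set that contains the cylinder. -/
def Cylinder.hull : Cylinder → Set (Fin 3 → ℝ)
  | .periodic => {p | p 0 ^ 2 + p 1 ^ 2 ≤ 1 ∧ 0 ≤ p 2 ∧ p 2 ≤ 2 * Real.pi}
  | .finite => {p | p 0 ^ 2 + p 1 ^ 2 ≤ 1 ∧ -1 ≤ p 2 ∧ p 2 ≤ 1}

theorem Cylinder.region_subset_hull (c : Cylinder) : c.region ⊆ c.hull := by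
  cases c
  · exact fun p hp => ⟨hp.1, hp.2.1, hp.2.2.le⟩
  · exact fun p hp => hp

theorem Cylinder.measurableSet_region (c : Cylinder) : MeasurableSet c.region := by
  have h0 : MeasurableSet {p : Fin 3 → ℝ | p 0 ^ 2 + p 1 ^ 2 ≤ 1} :=
    measurableSet_le (by fun_prop) measurable_const
  cases c
  · exact h0.inter ((measurableSet_le measurable_const (measurable_pi_apply 2)).inter
      (measurableSet_lt (measurable_pi_apply 2) measurable_const))
  · exact h0.inter ((measurableSet_le measurable_const (measurable_pi_apply 2)).inter
      (measurableSet_le (measurable_pi_apply 2) measurable_const))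

theorem Cylinder.isCompact_hull (c : Cylinder) : IsCompact c.hull := by
  have h0 : IsClosed {p : Fin 3 → ℝ | p 0 ^ 2 + p 1 ^ 2 ≤ 1} :=
    isClosed_le (by fun_prop) continuous_const
  have key : ∀ a b : ℝ, IsCompact {p : Fin 3 → ℝ | p 0 ^ 2 + p 1 ^ 2 ≤ 1 ∧ a ≤ p 2 ∧ p 2 ≤ b} := by
    intro a b
    refine IsCompact.of_isClosed_subset (isCompact_Icc (a := ![-1, -1, a]) (b := ![1, 1, b]))
      (h0.inter ((isClosed_le continuous_const (continuous_apply 2)).inter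
        (isClosed_le (continuous_apply 2) continuous_const))) ?_
    rintro p ⟨h1, h2, h3⟩
    constructor <;> intro i <;> fin_cases i <;> simp <;> first | assumption | nlinarith [sq_nonneg (p 0), sq_nonneg (p 1)]
  cases c
  · exact key 0 (2 * Real.pi)
  · exact key (-1) 1

instance (c : Cylinder) : IsFiniteMeasure c.vol := by
  refine ⟨?_⟩
  rw [Cylinder.vol, Measure.restrict_apply_univ]
  exact (measure_mono c.region_subset_hull).trans_lt c.isCompact_hull.measure_lt_top

theorem Cylinder.ae_mem_region (c : Cylinder) : ∀ᵐ p ∂c.vol, p ∈ c.region :=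
  ae_restrict_mem c.measurableSet_region

theorem memLp_of_continuous {E : Type*} [NormedAddCommGroup E] [SecondCountableTopology E]
    (c : Cylinder) {f : (Fin 3 → ℝ) → E} (hf : Continuous f) (q : ENNReal) : MemLp f q c.vol := by
  borelize E
  obtain ⟨C, hC⟩ := c.isCompact_hull.exists_bound_of_continuousOn hf.continuousOn
  refine MemLp.of_bound hf.aestronglyMeasurable C ?_
  filter_upwards [c.ae_mem_region] with p hp using hC p (c.region_subset_hull hp)

theorem integrable_of_continuous (c : Cylinder) {f : Scalar} (hf : Continuous f) :
    Integrable f c.vol := memLp_one_iff_integrable.1 (memLp_of_continuous c hf 1)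

theorem hasDerivAt_update_pd {F : Scalar} (hF : Differentiable ℝ F) (i : Fin 3) (p : Fin 3 → ℝ)
    (s : ℝ) : HasDerivAt (fun s => F (Function.update p i s)) (pd i F (Function.update p i s)) s :=
  (hF _).hasFDerivAt.comp_hasDerivAt s (hasDerivAt_update p i s)

theorem continuous_pd {F : Scalar} (hF : ContDiff ℝ 1 F) (i : Fin 3) : Continuous (pd i F) :=
  (hF.continuous_fderiv (by simp)).clm_apply continuous_const

/-- Fubini reduces the integral to coordinate lines. On each line the fundamental theorem of
calculus gives the difference of the endpoint values, which is zero. -/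
theorem integral_pd_eq_zero_of_slices {S : Set (Fin 3 → ℝ)} (hS : MeasurableSet S) {F : Scalar}
    (hF : ContDiff ℝ 1 F) (i : Fin 3) (hint : IntegrableOn (pd i F) S)
    (h : ∀ p, ∃ a b, a ≤ b ∧ {s | Function.update p i s ∈ S} =ᵐ[volume] Set.Ioc a b ∧
      F (Function.update p i a) = F (Function.update p i b)) :
    ∫ p in S, pd i F p = 0 := by
  rw [← integral_indicator hS]
  have hmp := volume_preserving_piFinSuccAbove (fun _ : Fin 3 => ℝ) i
  rw [← integrable_indicator_iff hS] at hint
  rw [← hmp.symm.integral_comp (MeasurableEquiv.measurableEmbedding _),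
    Measure.volume_eq_prod, integral_prod_symm]
  · have : ∀ q : Fin 2 → ℝ, ∫ s : ℝ, S.indicator (pd i F)
        ((MeasurableEquiv.piFinSuccAbove (fun _ : Fin 3 => ℝ) i).symm (s, q)) = 0 := by
      intro q
      -- The zero inserted as i-th coordinate is arbitrary: every later use overwrites it by
      -- `Function.update`.
      obtain ⟨a, b, hab, hs, hF'⟩ := h (Fin.insertNth i 0 q)
      have e : ∀ s : ℝ, (MeasurableEquiv.piFinSuccAbove (fun _ : Fin 3 => ℝ) i).symm (s, q)
          = Function.update (Fin.insertNth i 0 q : Fin 3 → ℝ) i s := by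
        intro s
        ext k
        simp [MeasurableEquiv.piFinSuccAbove, Fin.insertNthEquiv]
      simp only [e]
      have e2 : ∀ s : ℝ, S.indicator (pd i F) (Function.update (Fin.insertNth i 0 q : Fin 3 → ℝ) i s)
          = {s | Function.update (Fin.insertNth i 0 q : Fin 3 → ℝ) i s ∈ S}.indicator
            (fun s => pd i F (Function.update (Fin.insertNth i 0 q : Fin 3 → ℝ) i s)) s := by
        intro s; rfl
      simp only [e2]
      have hm : MeasurableSet {s | Function.update (Fin.insertNth i 0 q : Fin 3 → ℝ) i s ∈ S} :=
        hS.preimage (measurable_update _)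
      rw [integral_indicator hm, setIntegral_congr_set hs,
        ← intervalIntegral.integral_of_le hab, intervalIntegral.integral_eq_sub_of_hasDerivAt
          (fun s _ => hasDerivAt_update_pd (hF.differentiable (by simp)) i _ s), hF', sub_self]
      exact ((continuous_pd hF i).comp (continuous_const.update i continuous_id)).intervalIntegrable _ _
    simp only [this, integral_zero]
  · exact (hmp.symm.integrable_comp_emb (MeasurableEquiv.measurableEmbedding _)).2 hint

/-- The axial coordinates that occur on the cylinder; all of them if it is periodic. -/
def Cylinder.InRange : Cylinder → ℝ → Prop
  | .periodic, _ => True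
  | .finite, z => -1 ≤ z ∧ z ≤ 1

/-- The boundary values of `F` on the faces crossed in direction `i` cancel. -/
def Cylinder.Balanced (c : Cylinder) (i : Fin 3) (F : Scalar) : Prop :=
  if i = 2 then
    match c with
    | .periodic => ∀ p, F (p + Pi.single 2 (2 * Real.pi)) = F p
    | .finite => ∀ p, p 0 ^ 2 + p 1 ^ 2 ≤ 1 → (p 2 = 1 ∨ p 2 = -1) → F p = 0
  else ∀ p, p 0 ^ 2 + p 1 ^ 2 = 1 → c.InRange (p 2) → F p = 0

theorem slice_disk (y : ℝ) (hy : y ^ 2 ≤ 1) (s : ℝ) :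
    s ^ 2 + y ^ 2 ≤ 1 ↔ s ∈ Set.Icc (-√(1 - y ^ 2)) (√(1 - y ^ 2)) := by
  rw [Set.mem_Icc, ← abs_le, ← Real.sqrt_sq_eq_abs, Real.sqrt_le_sqrt_iff (by linarith)]
  constructor <;> intro h <;> linarith

/-- A coordinate line meets the cylinder in nothing, in a chord of the disk, or in the whole axial
interval. In the last two cases the balance condition makes the endpoint values agree. -/
theorem Cylinder.integral_pd_eq_zero (c : Cylinder) {F : Scalar} (hF : ContDiff ℝ 1 F) (i : Fin 3)
    (h : c.Balanced i F) : ∫ p, pd i F p ∂c.vol = 0 := by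
  refine integral_pd_eq_zero_of_slices c.measurableSet_region hF i
    (integrable_of_continuous c (continuous_pd hF i)) fun p => ?_
  have hempty : ∀ {s : Set ℝ}, s = ∅ → ∃ a b, a ≤ b ∧ s =ᵐ[volume] Set.Ioc a b ∧
      F (Function.update p i a) = F (Function.update p i b) := by
    rintro s rfl
    exact ⟨0, 0, le_rfl, by simp, rfl⟩
  have key : ∀ k : Fin 3, k ≠ 2 → i ≠ 2 → (∀ s, Function.update p i s 0 ^ 2 +
      Function.update p i s 1 ^ 2 = s ^ 2 + p k ^ 2) → ∃ a b, a ≤ b ∧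
      {s | Function.update p i s ∈ c.region} =ᵐ[volume] Set.Ioc a b ∧
      F (Function.update p i a) = F (Function.update p i b) := by
    intro k hk hi hs
    have h2 : ∀ s, Function.update p i s 2 = p 2 := fun s => Function.update_of_ne (Ne.symm hi) _ _
    unfold Cylinder.Balanced at h
    rw [if_neg hi] at h
    -- Q is the condition on the axial coordinate, which a horizontal line leaves fixed.
    have hreg : ∃ Q : Prop, (Q → c.InRange (p 2)) ∧
        ∀ s, Function.update p i s ∈ c.region ↔ s ^ 2 + p k ^ 2 ≤ 1 ∧ Q := by
      cases c
      · refine ⟨0 ≤ p 2 ∧ p 2 < 2 * Real.pi, fun _ => trivial, fun s => ?_⟩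
        simp only [Cylinder.region, Set.mem_ofPred_eq, hs, h2]
      · refine ⟨-1 ≤ p 2 ∧ p 2 ≤ 1, fun h => h, fun s => ?_⟩
        simp only [Cylinder.region, Set.mem_ofPred_eq, hs, h2]
    obtain ⟨Q, hQ, hreg⟩ := hreg
    by_cases hq : Q ∧ p k ^ 2 ≤ 1
    · have hn : 0 ≤ 1 - p k ^ 2 := by linarith [hq.2]
      refine ⟨-√(1 - p k ^ 2), √(1 - p k ^ 2), by linarith [Real.sqrt_nonneg (1 - p k ^ 2)], ?_, ?_⟩
      · refine Filter.EventuallyEq.trans ?_ Ioc_ae_eq_Icc.symm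
        refine Filter.EventuallyEq.of_eq (Set.ext fun s => ?_)
        rw [Set.mem_ofPred_eq, hreg, slice_disk _ hq.2]
        exact and_iff_left hq.1
      · rw [h _ (by rw [hs, neg_sq, Real.sq_sqrt hn]; ring) (by rw [h2]; exact hQ hq.1),
          h _ (by rw [hs, Real.sq_sqrt hn]; ring) (by rw [h2]; exact hQ hq.1)]
    · refine hempty (Set.eq_empty_of_forall_notMem fun s hs' => hq ?_)
      have := (hreg s).1 hs'
      exact ⟨this.2, by nlinarith [sq_nonneg s]⟩
  fin_cases i
  · exact key 1 (by decide) (by decide) fun s => by simp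
  · exact key 0 (by decide) (by decide) fun s => by simp [add_comm]
  · unfold Cylinder.Balanced at h
    simp only [Fin.reduceFinMk, if_true] at h ⊢
    by_cases hr : p 0 ^ 2 + p 1 ^ 2 ≤ 1
    · cases c
      · refine ⟨0, 2 * Real.pi, by positivity, ?_, ?_⟩
        · refine Filter.EventuallyEq.trans ?_ (Ico_ae_eq_Ioc (a := (0 : ℝ)))
          refine Filter.EventuallyEq.of_eq (Set.ext fun s => ?_)
          simp [Cylinder.region, hr]
        · rw [← h]
          congr 1
          ext k
          fin_cases k <;> simp
      · refine ⟨-1, 1, by norm_num, ?_, ?_⟩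
        · refine Filter.EventuallyEq.trans ?_ (Ioc_ae_eq_Icc (a := (-1 : ℝ))).symm
          refine Filter.EventuallyEq.of_eq (Set.ext fun s => ?_)
          simp [Cylinder.region, hr]
        · rw [h _ (by simpa using hr) (by simp), h _ (by simpa using hr) (by simp)]
    · refine hempty (Set.eq_empty_of_forall_notMem fun s hs' => hr ?_)
      cases c <;> simpa using hs'.1

/-! ### Calculus of partial derivatives and periodicity -/

theorem pd_add {u v : Scalar} (hu : Differentiable ℝ u) (hv : Differentiable ℝ v) (i : Fin 3) :
    pd i (fun p => u p + v p) = fun p => pd i u p + pd i v p := by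
  ext p; simp [pd, fderiv_fun_add (hu p) (hv p)]

theorem pd_sub {u v : Scalar} (hu : Differentiable ℝ u) (hv : Differentiable ℝ v) (i : Fin 3) :
    pd i (fun p => u p - v p) = fun p => pd i u p - pd i v p := by
  ext p; simp [pd, fderiv_fun_sub (hu p) (hv p)]

theorem pd_mul {u v : Scalar} (hu : Differentiable ℝ u) (hv : Differentiable ℝ v) (i : Fin 3) :
    pd i (fun p => u p * v p) = fun p => u p * pd i v p + pd i u p * v p := by
  ext p; simp [pd, fderiv_fun_mul (hu p) (hv p), mul_comm]

theorem contDiff_coord (k : Fin 3) {n : WithTop ℕ∞} :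
    ContDiff ℝ n (fun p : Fin 3 → ℝ => (p k : ℂ)) :=
  ofRealCLM.contDiff.comp (contDiff_apply ℝ ℝ k)

theorem pd_coord (i k : Fin 3) : pd i (fun p : Fin 3 → ℝ => (p k : ℂ)) =
    fun _ => if k = i then 1 else 0 := by
  ext p
  have h : HasFDerivAt (fun p : Fin 3 → ℝ => (p k : ℂ))
      (ofRealCLM.comp (ContinuousLinearMap.proj k)) p :=
    ofRealCLM.hasFDerivAt.comp p (ContinuousLinearMap.proj (R := ℝ) (φ := fun _ : Fin 3 => ℝ) k).hasFDerivAt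
  rw [pd, h.fderiv]
  by_cases hk : k = i
  · subst hk; simp
  · simp [hk]

theorem contDiff_pd {n : WithTop ℕ∞} {F : Scalar} (hF : ContDiff ℝ (n + 1) F) (i : Fin 3) :
    ContDiff ℝ n (pd i F) :=
  (hF.fderiv_right le_rfl).clm_apply contDiff_const

theorem pd_comm {g : Scalar} (hg : ContDiff ℝ 2 g) (i j : Fin 3) : pd i (pd j g) = pd j (pd i g) := by
  ext p
  have hd : DifferentiableAt ℝ (fderiv ℝ g) p :=
    (hg.fderiv_right (m := 1) (by norm_num)).differentiable (by simp) p
  have h : ∀ i j : Fin 3, pd i (pd j g) p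
      = fderiv ℝ (fderiv ℝ g) p (Pi.single i 1) (Pi.single j 1) := by
    intro i j
    unfold pd
    rw [fderiv_clm_apply hd (differentiableAt_const _)]
    simp
  rw [h, h]
  exact (hg.contDiffAt.isSymmSndFDerivAt (by simp)) _ _

theorem Cylinder.IsNormal.lateral {c : Cylinder} {p : Fin 3 → ℝ} (h : p 0 ^ 2 + p 1 ^ 2 = 1)
    (hz : c.InRange (p 2)) : c.IsNormal p ![p 0, p 1, 0] := by
  cases c
  · exact ⟨h, rfl⟩
  · exact Or.inl ⟨h, hz.1, hz.2, rfl⟩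

/-- Periodicity in the axial direction on the periodic cylinder. -/
def Cylinder.Per : Cylinder → Scalar → Prop
  | .periodic, φ => ∀ p, φ (p + Pi.single 2 (2 * Real.pi)) = φ p
  | .finite, _ => True

theorem Cylinder.Smooth.contDiff {c : Cylinder} {φ : Scalar} (h : c.Smooth φ) :
    ContDiff ℝ (⊤ : ℕ∞) φ := by
  cases c
  · exact h.1
  · exact h

theorem Cylinder.Smooth.per {c : Cylinder} {φ : Scalar} (h : c.Smooth φ) : c.Per φ := by
  cases c
  · exact h.2
  · trivial

theorem Cylinder.smooth_iff {c : Cylinder} {φ : Scalar} :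
    c.Smooth φ ↔ ContDiff ℝ (⊤ : ℕ∞) φ ∧ c.Per φ := by
  cases c
  · rfl
  · exact (and_iff_left trivial).symm

theorem Cylinder.Per.op₂ {c : Cylinder} {u v : Scalar} (hu : c.Per u) (hv : c.Per v)
    (o : ℂ → ℂ → ℂ) : c.Per (fun p => o (u p) (v p)) := by
  cases c
  · intro p
    change o (u (p + Pi.single 2 (2 * Real.pi))) (v (p + Pi.single 2 (2 * Real.pi))) = _
    rw [hu p, hv p]
  · trivial

theorem Cylinder.per_planar (c : Cylinder) (u : ℝ → ℝ → ℂ) : c.Per (fun p => u (p 0) (p 1)) := by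
  cases c
  · intro p; simp
  · trivial

theorem Cylinder.balanced_two {c : Cylinder} {F : Scalar} (hp : c.Per F)
    (h : c = .finite → ∀ p, p 0 ^ 2 + p 1 ^ 2 ≤ 1 → (p 2 = 1 ∨ p 2 = -1) → F p = 0) :
    c.Balanced 2 F := by
  unfold Balanced
  rw [if_pos rfl]
  cases c
  · exact hp
  · exact h rfl

theorem Cylinder.balanced_of_ne {c : Cylinder} {F : Scalar} {i : Fin 3} (hi : i ≠ 2)
    (h : ∀ p, p 0 ^ 2 + p 1 ^ 2 = 1 → c.InRange (p 2) → F p = 0) : c.Balanced i F := by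
  unfold Balanced
  rwa [if_neg hi]

/-- The divergence theorem for fields that are tangential on the boundary. -/
theorem Cylinder.integral_div_eq_zero (c : Cylinder) {X : Vector}
    (hX : ∀ i, c.Smooth (fun p => X p i))
    (ht : ∀ p ν, c.IsNormal p ν → X p ⬝ᵥ (fun l => (ν l : ℂ)) = 0) :
    ∫ p, div X p ∂c.vol = 0 := by
  have hs : ∀ i, ContDiff ℝ (⊤ : ℕ∞) (fun p => X p i) := fun i => (hX i).contDiff
  have hc : ∀ k, ContDiff ℝ (⊤ : ℕ∞) (fun p : Fin 3 → ℝ => (p k : ℂ)) := fun k => contDiff_coord k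
  have hlat : ∀ p : Fin 3 → ℝ, p 0 ^ 2 + p 1 ^ 2 = 1 → c.InRange (p 2) →
      X p 0 * p 0 + X p 1 * p 1 = 0 := by
    intro p h hz
    simpa [dotProduct, Fin.sum_univ_three] using ht p _ (IsNormal.lateral h hz)
  have h2 : ∫ p, pd 2 (fun q => X q 2) p ∂c.vol = 0 := by
    refine c.integral_pd_eq_zero ((hs 2).of_le (by exact_mod_cast le_top)) 2
      (balanced_two (hX 2).per ?_)
    rintro rfl p hr (h | h)
    · simpa [dotProduct, Fin.sum_univ_three] using ht p _ (Or.inr ⟨hr, Or.inl ⟨h, rfl⟩⟩)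
    · simpa [dotProduct, Fin.sum_univ_three] using ht p _ (Or.inr ⟨hr, Or.inr ⟨h, rfl⟩⟩)
  -- Let e and g be the radial and angular moments of the horizontal part H of X, and ρ = 1 - r².
  -- Then H = ρH + e(x, y) + g(-y, x). With ∇⊥ = (-∂y, ∂x), the field g(-y, x) - ½ρ∇⊥g equals
  -- -½∇⊥(ρg) and is divergence free. Replacing g(-y, x) by ½ρ∇⊥g therefore keeps the divergence.
  -- The new components Y, Z vanish separately on the lateral boundary, because ρ and e do.
  set g : Scalar := fun p => X p 1 * p 0 - X p 0 * p 1 with hg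
  have hgs : ContDiff ℝ (⊤ : ℕ∞) g := ((hs 1).mul (hc 0)).sub ((hs 0).mul (hc 1))
  have hgd : ∀ i, ContDiff ℝ (⊤ : ℕ∞) (pd i g) := fun i => contDiff_pd (n := (⊤ : ℕ∞)) (by exact_mod_cast hgs) i
  set ρ : Scalar := fun p => 1 - (p 0 * p 0 + p 1 * p 1) with hρ
  have hρs : ContDiff ℝ (⊤ : ℕ∞) ρ :=
    contDiff_const.sub (((hc 0).mul (hc 0)).add ((hc 1).mul (hc 1)))
  set e : Scalar := fun p => X p 0 * p 0 + X p 1 * p 1 with he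
  have hes : ContDiff ℝ (⊤ : ℕ∞) e := ((hs 0).mul (hc 0)).add ((hs 1).mul (hc 1))
  set Y : Scalar := fun p => ρ p * (X p 0 - 1 / 2 * pd 1 g p) + e p * p 0 with hY
  set Z : Scalar := fun p => ρ p * (X p 1 + 1 / 2 * pd 0 g p) + e p * p 1 with hZ
  have hYs : ContDiff ℝ (⊤ : ℕ∞) Y :=
    (hρs.mul ((hs 0).sub (contDiff_const.mul (hgd 1)))).add (hes.mul (hc 0))
  have hZs : ContDiff ℝ (⊤ : ℕ∞) Z :=
    (hρs.mul ((hs 1).add (contDiff_const.mul (hgd 0)))).add (hes.mul (hc 1))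
  have hρ0 : ∀ p : Fin 3 → ℝ, p 0 ^ 2 + p 1 ^ 2 = 1 → ρ p = 0 := by
    intro p h
    have : ((p 0 : ℂ)) ^ 2 + (p 1 : ℂ) ^ 2 = 1 := by exact_mod_cast h
    simp only [hρ]
    linear_combination -this
  have hY0 : ∫ p, pd 0 Y p ∂c.vol = 0 :=
    c.integral_pd_eq_zero (hYs.of_le (by exact_mod_cast le_top)) 0 (balanced_of_ne (by decide)
      fun p h hz => by simp [hY, hρ0 p h, he, hlat p h hz])
  have hZ0 : ∫ p, pd 1 Z p ∂c.vol = 0 :=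
    c.integral_pd_eq_zero (hZs.of_le (by exact_mod_cast le_top)) 1 (balanced_of_ne (by decide)
      fun p h hz => by simp [hZ, hρ0 p h, he, hlat p h hz])
  have hdiff : ∀ {u : Scalar}, ContDiff ℝ (⊤ : ℕ∞) u → Differentiable ℝ u :=
    fun h => h.differentiable (by simp)
  have key : ∀ p, div X p = pd 0 Y p + pd 1 Z p + pd 2 (fun q => X q 2) p := by
    intro p
    have d : ∀ i, Differentiable ℝ (fun p => X p i) := fun i => hdiff (hs i)
    have dc : ∀ k, Differentiable ℝ (fun p : Fin 3 → ℝ => (p k : ℂ)) := fun k => hdiff (hc k)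
    have dg : ∀ i, Differentiable ℝ (pd i g) := fun i => hdiff (hgd i)
    have eg : ∀ i, pd i g p = X p 1 * pd i (fun q : Fin 3 → ℝ => (q 0 : ℂ)) p
        + pd i (fun q => X q 1) p * p 0 - (X p 0 * pd i (fun q : Fin 3 → ℝ => (q 1 : ℂ)) p
        + pd i (fun q => X q 0) p * p 1) := by
      intro i
      rw [hg, pd_sub ((d 1).fun_mul (dc 0)) ((d 0).fun_mul (dc 1)), pd_mul (d 1) (dc 0),
        pd_mul (d 0) (dc 1)]
    have ee : ∀ i, pd i e p = X p 0 * pd i (fun q : Fin 3 → ℝ => (q 0 : ℂ)) p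
        + pd i (fun q => X q 0) p * p 0 + (X p 1 * pd i (fun q : Fin 3 → ℝ => (q 1 : ℂ)) p
        + pd i (fun q => X q 1) p * p 1) := by
      intro i
      rw [he, pd_add ((d 0).fun_mul (dc 0)) ((d 1).fun_mul (dc 1)), pd_mul (d 0) (dc 0),
        pd_mul (d 1) (dc 1)]
    have eρ : ∀ i, pd i ρ p = -(2 * p 0 * pd i (fun q : Fin 3 → ℝ => (q 0 : ℂ)) p
        + 2 * p 1 * pd i (fun q : Fin 3 → ℝ => (q 1 : ℂ)) p) := by
      intro i
      rw [hρ, pd_sub (differentiable_const _) (((dc 0).fun_mul (dc 0)).fun_add ((dc 1).fun_mul (dc 1))),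
        pd_add ((dc 0).fun_mul (dc 0)) ((dc 1).fun_mul (dc 1)), pd_mul (dc 0) (dc 0), pd_mul (dc 1) (dc 1)]
      simp [pd]
      ring
    have eY : pd 0 Y p = ρ p * (pd 0 (fun q => X q 0) p - 1 / 2 * pd 0 (pd 1 g) p)
        + pd 0 ρ p * (X p 0 - 1 / 2 * pd 1 g p) + (e p * 1 + pd 0 e p * p 0) := by
      rw [hY, pd_add ((hdiff hρs).fun_mul ((d 0).fun_sub ((dg 1).const_mul _))) ((hdiff hes).fun_mul (dc 0)),
        pd_mul (hdiff hρs) ((d 0).fun_sub ((dg 1).const_mul _)), pd_mul (hdiff hes) (dc 0),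
        pd_sub (d 0) ((dg 1).const_mul _), pd_mul (differentiable_const _) (dg 1), pd_coord]
      simp [pd]
    have eZ : pd 1 Z p = ρ p * (pd 1 (fun q => X q 1) p + 1 / 2 * pd 1 (pd 0 g) p)
        + pd 1 ρ p * (X p 1 + 1 / 2 * pd 0 g p) + (e p * 1 + pd 1 e p * p 1) := by
      rw [hZ, pd_add ((hdiff hρs).fun_mul ((d 1).fun_add ((dg 0).const_mul _))) ((hdiff hes).fun_mul (dc 1)),
        pd_mul (hdiff hρs) ((d 1).fun_add ((dg 0).const_mul _)), pd_mul (hdiff hes) (dc 1),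
        pd_add (d 1) ((dg 0).const_mul _), pd_mul (differentiable_const _) (dg 0), pd_coord]
      simp [pd]
    -- The second derivatives of g cancel by symmetry; the remaining terms form an algebraic
    -- identity.
    rw [eY, eZ, pd_comm (contDiff_infty.1 hgs 2) 0 1, eρ, eρ, ee, ee, eg, eg]
    simp only [div, pd_coord, hρ, he]
    simp
    ring
  have hi : ∀ {u : Scalar}, ContDiff ℝ (⊤ : ℕ∞) u → ∀ i, Integrable (pd i u) c.vol := fun h i =>
    integrable_of_continuous c (continuous_pd (h.of_le (by exact_mod_cast le_top)) i)
  simp only [key]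
  rw [integral_add (f := fun p => pd 0 Y p + pd 1 Z p) ((hi hYs 0).add (hi hZs 1)) (hi (hs 2) 2), integral_add (hi hYs 0) (hi hZs 1),
    hY0, hZ0, h2]
  simp

/-! ### Smooth fields with vanishing boundary values -/

theorem contDiff_one_of_smooth {u : Scalar} (hu : ContDiff ℝ (⊤ : ℕ∞) u) : ContDiff ℝ 1 u :=
  hu.of_le (by exact_mod_cast le_top)

theorem contDiff_top_pd {u : Scalar} (hu : ContDiff ℝ (⊤ : ℕ∞) u) (i : Fin 3) :
    ContDiff ℝ (⊤ : ℕ∞) (pd i u) := contDiff_pd (n := (⊤ : ℕ∞)) (by exact_mod_cast hu) i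

theorem continuous_grad {u : Scalar} (hu : ContDiff ℝ (⊤ : ℕ∞) u) : Continuous (grad u) := by
  refine continuous_pi fun i => ?_
  have := fun i => (contDiff_top_pd hu i).continuous
  fin_cases i <;> simpa [grad] using this _

theorem continuous_curl {f : Vector} (hf : ∀ i, ContDiff ℝ (⊤ : ℕ∞) (fun p => f p i)) :
    Continuous (curl f) := by
  refine continuous_pi fun i => ?_
  have := fun i j => (contDiff_top_pd (hf j) i).continuous
  fin_cases i <;> simpa [curl] using (this _ _).fun_sub (this _ _)

theorem continuous_div {f : Vector} (hf : ∀ i, ContDiff ℝ (⊤ : ℕ∞) (fun p => f p i)) :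
    Continuous (div f) :=
  (((contDiff_top_pd (hf 0) 0).continuous.add (contDiff_top_pd (hf 1) 1).continuous).add
    (contDiff_top_pd (hf 2) 2).continuous)

theorem continuous_dotProduct {f g : Vector} (hf : Continuous f) (hg : Continuous g) :
    Continuous (fun p => f p ⬝ᵥ g p) :=
  continuous_finsetSum _ fun i _ => ((continuous_apply i).comp hf).mul ((continuous_apply i).comp hg)

theorem continuous_of_smooth {f : Vector} (hf : ∀ i, ContDiff ℝ (⊤ : ℕ∞) (fun p => f p i)) :
    Continuous f := continuous_pi fun i => (hf i).continuous

/-- Integration by parts: the divergence theorem for uφ, which vanishes on the boundary together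
with u. -/
theorem hasGrad₀_of_smooth {c : Cylinder} {u : Scalar} (hu : c.Smooth u)
    (h0 : ∀ p ν, c.IsNormal p ν → u p = 0) : HasGrad₀ c u (grad u) := by
  have hg := continuous_grad hu.contDiff
  refine ⟨memLp_of_continuous c hu.contDiff.continuous 2, memLp_of_continuous c hg 2,
    fun φ hφ => ?_⟩
  have hφs := fun i => (hφ i).contDiff
  have h := c.integral_div_eq_zero (X := fun p => u p • φ p)
    (fun i => Cylinder.smooth_iff.2 ⟨hu.contDiff.mul (hφs i), hu.per.op₂ (hφ i).per (· * ·)⟩)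
    (fun p ν hν => by simp [h0 p ν hν])
  have e : ∀ p, div (fun p => u p • φ p) p = grad u p ⬝ᵥ φ p + u p * div φ p := by
    intro p
    have d := hu.contDiff.differentiable (by simp)
    have dφ := fun i => (hφs i).differentiable (by simp)
    simp only [div, Pi.smul_apply, smul_eq_mul, pd_mul d (dφ _), dotProduct, Fin.sum_univ_three,
      grad, Matrix.cons_val_zero, Matrix.cons_val_one, Matrix.cons_val]
    ring
  simp only [e] at h
  rw [integral_add (integrable_of_continuous c (continuous_dotProduct hg (continuous_of_smooth hφs)))
    (integrable_of_continuous c (hu.contDiff.continuous.fun_mul (continuous_div hφs)))] at h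
  exact eq_neg_of_add_eq_zero_left h

/-- The divergence theorem for f × φ. It is tangential because its normal component is -φ · (f × ν),
and its divergence is curl f · φ - f · curl φ. -/
theorem hasCurl₀_of_smooth {c : Cylinder} {f : Vector} (hf : ∀ i, c.Smooth (fun p => f p i))
    (h0 : ∀ p ν, c.IsNormal p ν → crossProduct (f p) (fun l => (ν l : ℂ)) = 0) :
    HasCurl₀ c f (curl f) := by
  have hfs := fun i => (hf i).contDiff
  have hg := continuous_curl hfs
  have hfc := continuous_of_smooth hfs
  refine ⟨memLp_of_continuous c hfc 2, memLp_of_continuous c hg 2, fun φ hφ => ?_⟩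
  have hφs := fun i => (hφ i).contDiff
  have hX : ∀ i j, c.Smooth (fun p => f p i * φ p j - f p j * φ p i) := fun i j =>
    Cylinder.smooth_iff.2 ⟨((hfs i).mul (hφs j)).sub ((hfs j).mul (hφs i)),
      ((hf i).per.op₂ (hφ j).per (· * ·)).op₂ ((hf j).per.op₂ (hφ i).per (· * ·)) (· - ·)⟩
  have h := c.integral_div_eq_zero (X := fun p => ![f p 1 * φ p 2 - f p 2 * φ p 1,
    f p 2 * φ p 0 - f p 0 * φ p 2, f p 0 * φ p 1 - f p 1 * φ p 0])
    (fun i => by fin_cases i; exacts [hX 1 2, hX 2 0, hX 0 1])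
    (fun p ν hν => by
      have h := h0 p ν hν
      rw [cross_apply] at h
      have e0 := congrFun h 0
      have e1 := congrFun h 1
      have e2 := congrFun h 2
      simp at e0 e1 e2
      simp only [dotProduct, Fin.sum_univ_three, Matrix.cons_val_zero, Matrix.cons_val_one,
        Matrix.cons_val]
      linear_combination (-φ p 0) * e0 - φ p 1 * e1 - φ p 2 * e2)
  have e : ∀ p, div (fun p => ![f p 1 * φ p 2 - f p 2 * φ p 1,
    f p 2 * φ p 0 - f p 0 * φ p 2, f p 0 * φ p 1 - f p 1 * φ p 0]) p =
      curl f p ⬝ᵥ φ p - f p ⬝ᵥ curl φ p := by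
    intro p
    have d := fun i => (hfs i).differentiable (by simp)
    have dφ := fun i => (hφs i).differentiable (by simp)
    simp only [div, dotProduct, Fin.sum_univ_three, curl, Matrix.cons_val_zero,
      Matrix.cons_val_one, Matrix.cons_val, pd_sub ((d _).fun_mul (dφ _)) ((d _).fun_mul (dφ _)),
      pd_mul (d _) (dφ _)]
    ring
  simp only [e] at h
  rw [integral_sub (integrable_of_continuous c (continuous_dotProduct hg (continuous_of_smooth hφs)))
    (integrable_of_continuous c (continuous_dotProduct hfc (continuous_curl hφs)))] at h
  exact sub_eq_zero.1 h

/-- The divergence theorem for φf, which inherits the tangency of f. -/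
theorem hasDiv₀_of_smooth {c : Cylinder} {f : Vector} (hf : ∀ i, c.Smooth (fun p => f p i))
    (h0 : ∀ p ν, c.IsNormal p ν → f p ⬝ᵥ (fun l => (ν l : ℂ)) = 0) : HasDiv₀ c f (div f) := by
  have hfs := fun i => (hf i).contDiff
  have hg := continuous_div hfs
  have hfc := continuous_of_smooth hfs
  refine ⟨memLp_of_continuous c hfc 2, memLp_of_continuous c hg 2, fun φ hφ => ?_⟩
  have h := c.integral_div_eq_zero (X := fun p => φ p • f p)
    (fun i => Cylinder.smooth_iff.2 ⟨hφ.contDiff.mul (hfs i), hφ.per.op₂ (hf i).per (· * ·)⟩)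
    (fun p ν hν => by simp [h0 p ν hν])
  have e : ∀ p, div (fun p => φ p • f p) p = div f p * φ p + f p ⬝ᵥ grad φ p := by
    intro p
    have d := hφ.contDiff.differentiable (by simp)
    have df := fun i => (hfs i).differentiable (by simp)
    simp only [div, Pi.smul_apply, smul_eq_mul, pd_mul d (df _), dotProduct, Fin.sum_univ_three,
      grad, Matrix.cons_val_zero, Matrix.cons_val_one, Matrix.cons_val]
    ring
  simp only [e] at h
  rw [integral_add (integrable_of_continuous c (hg.fun_mul hφ.contDiff.continuous))
    (integrable_of_continuous c (continuous_dotProduct hfc (continuous_grad hφ.contDiff)))] at h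
  exact eq_neg_of_add_eq_zero_left h

/-! ### Smoothness and boundary values of the basis elements -/

/-- Axial functions `a` (smooth, with zero boundary values if the cylinder is finite) and `b`
(smooth), periodic on the periodic cylinder. -/
structure IsAxialPair (c : Cylinder) {K : Type} (a b : K → ℝ → ℂ) : Prop where
  smooth_left : ∀ k, ContDiff ℝ (⊤ : ℕ∞) (a k)
  smooth_right : ∀ k, ContDiff ℝ (⊤ : ℕ∞) (b k)
  per_left : ∀ k, c.Per (fun p => a k (p 2))
  per_right : ∀ k, c.Per (fun p => b k (p 2))
  vanish : c = .finite → ∀ k, a k 1 = 0 ∧ a k (-1) = 0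

theorem Cylinder.smooth_scal {c : Cylinder} {a : ℝ → ℂ} {u : ℝ → ℝ → ℂ}
    (ha : ContDiff ℝ (⊤ : ℕ∞) a) (hp : c.Per (fun p => a (p 2))) (hu : PlaneSmooth u) :
    c.Smooth (scal a u) :=
  smooth_iff.2 ⟨contDiff_scal ha hu, hp.op₂ (c.per_planar u) (· * ·)⟩

theorem Cylinder.smooth_zero (c : Cylinder) : c.Smooth (fun _ => 0) := by
  refine smooth_iff.2 ⟨contDiff_const, ?_⟩
  cases c
  · intro p; rfl
  · trivial

theorem Cylinder.smooth_horiz {c : Cylinder} {a : ℝ → ℂ} {v : ℝ → ℝ → Fin 2 → ℂ}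
    (ha : ContDiff ℝ (⊤ : ℕ∞) a) (hp : c.Per (fun p => a (p 2)))
    (hv : ∀ i, PlaneSmooth (fun x y => v x y i)) (i : Fin 3) : c.Smooth (fun p => horiz a v p i) := by
  fin_cases i
  · exact (horiz_apply_zero a v) ▸ smooth_scal ha hp (hv 0)
  · exact (horiz_apply_one a v) ▸ smooth_scal ha hp (hv 1)
  · exact (horiz_apply_two a v) ▸ c.smooth_zero

theorem Cylinder.smooth_vert {c : Cylinder} {a : ℝ → ℂ} {u : ℝ → ℝ → ℂ}
    (ha : ContDiff ℝ (⊤ : ℕ∞) a) (hp : c.Per (fun p => a (p 2)))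
    (hu : PlaneSmooth u) (i : Fin 3) : c.Smooth (fun p => vert a u p i) := by
  fin_cases i
  · exact (vert_apply_zero a u) ▸ c.smooth_zero
  · exact (vert_apply_one a u) ▸ c.smooth_zero
  · exact (vert_apply_two a u) ▸ smooth_scal ha hp hu

theorem planeSmooth_rotField {v : ℝ → ℝ → Fin 2 → ℂ} (hv : ∀ i, PlaneSmooth (fun x y => v x y i))
    (i : Fin 2) : PlaneSmooth (fun x y => rotField v x y i) := by
  fin_cases i
  · exact (hv 1).neg
  · exact hv 0

theorem wZernike_eq_zero (m : ℤ) (j : ℕ) {x y : ℝ} (h : x ^ 2 + y ^ 2 = 1) : wZernike m j x y = 0 := by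
  simp [wZernike, h]

/-- On the circle N is the orthogonal projection onto the radial direction. -/
theorem normalMat_normal (v : Fin 2 → ℂ) {x y : ℝ} (h : x ^ 2 + y ^ 2 = 1) :
    (normalMat x y).mulVec v 0 * y - (normalMat x y).mulVec v 1 * x = 0 := by
  have h' : (x : ℂ) ^ 2 + (y : ℂ) ^ 2 = 1 := by exact_mod_cast h
  rw [normalMat_mulVec]
  simp only [Matrix.cons_val_zero, Matrix.cons_val_one, Matrix.cons_val_fin_one]
  linear_combination (x * v 1 - y * v 0) * h'

theorem nPlus_normal (m : ℤ) (j : ℕ) {x y : ℝ} (h : x ^ 2 + y ^ 2 = 1) :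
    nPlus m j x y 0 * y - nPlus m j x y 1 * x = 0 := by
  have h1 := normalMat_normal (vN1 m j x y) h
  have h2 := normalMat_normal (vN2 m j x y) h
  unfold nPlus n1 n2
  split_ifs with hm
  · subst hm
    simp only [Pi.smul_apply, smul_eq_mul]
    linear_combination 2 * h1
  · simp only [Pi.add_apply]
    linear_combination h1 + h2

theorem nMinus_normal (m : ℤ) (j : ℕ) {x y : ℝ} (h : x ^ 2 + y ^ 2 = 1) :
    nMinus m j x y 0 * y - nMinus m j x y 1 * x = 0 := by
  have h1 := normalMat_normal (vN1 m j x y) h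
  have h2 := normalMat_normal (vN2 m j x y) h
  unfold nMinus n1 n2
  split_ifs with hm hj
  · subst hm
    simp only [Pi.smul_apply, smul_eq_mul]
    linear_combination 2 * h2
  · subst hj
    simp only [Pi.smul_apply, smul_eq_mul]
    linear_combination 2 * h1
  · simp only [Pi.sub_apply]
    linear_combination h1 - h2

section Membership

variable {c : Cylinder} {K : Type} {a b : K → ℝ → ℂ}

theorem scal_vanish (h : IsAxialPair c a b) (k : K) {u : ℝ → ℝ → ℂ}
    (hu : ∀ x y, x ^ 2 + y ^ 2 = 1 → u x y = 0) (p ν : Fin 3 → ℝ) (hν : c.IsNormal p ν) :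
    scal (a k) u p = 0 := by
  cases c
  · simp [scal, hu _ _ hν.1]
  · rcases hν with hν | ⟨-, ⟨hz, -⟩ | ⟨hz, -⟩⟩
    · simp [scal, hu _ _ hν.1]
    · simp [scal, hz, (h.vanish rfl k).1]
    · simp [scal, hz, (h.vanish rfl k).2]

theorem horiz_normal (h : IsAxialPair c a b) (k : K) {v : ℝ → ℝ → Fin 2 → ℂ}
    (hv : ∀ x y, x ^ 2 + y ^ 2 = 1 → v x y 0 * y - v x y 1 * x = 0) (p ν : Fin 3 → ℝ)
    (hν : c.IsNormal p ν) : crossProduct (horiz (a k) v p) (fun l => (ν l : ℂ)) = 0 := by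
  have lat : p 0 ^ 2 + p 1 ^ 2 = 1 → ν = ![p 0, p 1, 0] →
      crossProduct (horiz (a k) v p) (fun l => (ν l : ℂ)) = 0 := by
    rintro h1 rfl
    rw [cross_apply]
    ext i
    fin_cases i
    · simp [horiz]
    · simp [horiz]
    · simp [horiz]
      linear_combination a k (p 2) * hv _ _ h1
  cases c
  · exact lat hν.1 hν.2
  · rcases hν with hν | ⟨-, ⟨hz, -⟩ | ⟨hz, -⟩⟩
    · exact lat hν.1 hν.2.2.2
    · simp [horiz, hz, (h.vanish rfl k).1]
    · simp [horiz, hz, (h.vanish rfl k).2]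

theorem vert_normal (b : ℝ → ℂ) {u : ℝ → ℝ → ℂ} (hu : ∀ x y, x ^ 2 + y ^ 2 = 1 → u x y = 0)
    (p ν : Fin 3 → ℝ) (hν : c.IsNormal p ν) :
    crossProduct (vert b u p) (fun l => (ν l : ℂ)) = 0 := by
  cases c
  · simp [vert, hu _ _ hν.1, cross_apply]
  · rcases hν with hν | ⟨-, ⟨-, rfl⟩ | ⟨-, rfl⟩⟩
    · simp [vert, hu _ _ hν.1, cross_apply]
    · simp [vert, cross_apply]
    · simp [vert, cross_apply]

theorem horiz_tangential (b : ℝ → ℂ) {v : ℝ → ℝ → Fin 2 → ℂ}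
    (hv : ∀ x y, x ^ 2 + y ^ 2 = 1 → v x y 0 * y - v x y 1 * x = 0) (p ν : Fin 3 → ℝ)
    (hν : c.IsNormal p ν) : horiz b (rotField v) p ⬝ᵥ (fun l => (ν l : ℂ)) = 0 := by
  have lat : p 0 ^ 2 + p 1 ^ 2 = 1 → ν = ![p 0, p 1, 0] →
      horiz b (rotField v) p ⬝ᵥ (fun l => (ν l : ℂ)) = 0 := by
    rintro h1 rfl
    simp [horiz, rotField, dotProduct, Fin.sum_univ_three]
    linear_combination b (p 2) * hv _ _ h1
  cases c
  · exact lat hν.1 hν.2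
  · rcases hν with hν | ⟨-, ⟨-, rfl⟩ | ⟨-, rfl⟩⟩
    · exact lat hν.1 hν.2.2.2
    · simp [horiz, dotProduct, Fin.sum_univ_three]
    · simp [horiz, dotProduct, Fin.sum_univ_three]

theorem vert_tangential (h : IsAxialPair c a b) (k : K) (u : ℝ → ℝ → ℂ) (p ν : Fin 3 → ℝ)
    (hν : c.IsNormal p ν) : vert (a k) u p ⬝ᵥ (fun l => (ν l : ℂ)) = 0 := by
  cases c
  · obtain ⟨-, rfl⟩ := hν
    simp [vert, dotProduct, Fin.sum_univ_three]
  · rcases hν with ⟨-, -, -, rfl⟩ | ⟨-, ⟨hz, -⟩ | ⟨hz, -⟩⟩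
    · simp [vert, dotProduct, Fin.sum_univ_three]
    · simp [vert, hz, (h.vanish rfl k).1]
    · simp [vert, hz, (h.vanish rfl k).2]

theorem smooth_h1Fam (h : IsAxialPair c a b) (i : ℤ × K × ℕ) : c.Smooth (h1Fam a i) :=
  Cylinder.smooth_scal (h.smooth_left _) (h.per_left _) (isPlaneGrad_gradW _ _).smooth

theorem smooth_curlFam (h : IsAxialPair c a b) (i : VecIdx K) (l : Fin 3) :
    c.Smooth (fun p => curlFam a b i p l) := by
  cases i with
  | plus m k j hj =>
    exact Cylinder.smooth_horiz (h.smooth_left _) (h.per_left _) (isPlaneCurl_nPlus m j hj).smooth l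
  | minus m k j hj =>
    exact Cylinder.smooth_horiz (h.smooth_left _) (h.per_left _) (isPlaneCurl_nMinus m j hj).smooth l
  | axial m k j =>
    exact Cylinder.smooth_vert (h.smooth_right _) (h.per_right _) (isPlaneGrad_gradW m j).smooth l

theorem smooth_divFam (h : IsAxialPair c a b) (i : VecIdx K) (l : Fin 3) :
    c.Smooth (fun p => divFam a b i p l) := by
  cases i with
  | plus m k j hj =>
    simp only [divFam, tPlus_eq]
    exact Cylinder.smooth_horiz (h.smooth_right _) (h.per_right _)
      (planeSmooth_rotField (isPlaneCurl_nPlus m j hj).smooth) l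
  | minus m k j hj =>
    simp only [divFam, tMinus_eq]
    exact Cylinder.smooth_horiz (h.smooth_right _) (h.per_right _)
      (planeSmooth_rotField (isPlaneCurl_nMinus m j hj).smooth) l
  | axial m k j =>
    exact Cylinder.smooth_vert (h.smooth_left _) (h.per_left _) (planeSmooth_zernike m j) l

theorem smooth_l2Fam (h : IsAxialPair c a b) (i : ℤ × K × ℕ) : c.Smooth (l2Fam b i) :=
  Cylinder.smooth_scal (h.smooth_right _) (h.per_right _) (planeSmooth_zernike _ _)

theorem vanish_h1Fam (h : IsAxialPair c a b) (i : ℤ × K × ℕ) (p ν : Fin 3 → ℝ)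
    (hν : c.IsNormal p ν) : h1Fam a i p = 0 :=
  scal_vanish h _ (fun _ _ => wZernike_eq_zero _ _) p ν hν

theorem normal_curlFam (h : IsAxialPair c a b) (i : VecIdx K) (p ν : Fin 3 → ℝ)
    (hν : c.IsNormal p ν) : crossProduct (curlFam a b i p) (fun l => (ν l : ℂ)) = 0 := by
  cases i with
  | plus m k j hj => exact horiz_normal h k (fun _ _ => nPlus_normal m j) p ν hν
  | minus m k j hj => exact horiz_normal h k (fun _ _ => nMinus_normal m j) p ν hν
  | axial m k j => exact vert_normal _ (fun _ _ => wZernike_eq_zero m j) p ν hν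

theorem tangential_divFam (h : IsAxialPair c a b) (i : VecIdx K) (p ν : Fin 3 → ℝ)
    (hν : c.IsNormal p ν) : divFam a b i p ⬝ᵥ (fun l => (ν l : ℂ)) = 0 := by
  cases i with
  | plus m k j hj =>
    rw [divFam, tPlus_eq]
    exact horiz_tangential _ (fun _ _ => nPlus_normal m j) p ν hν
  | minus m k j hj =>
    rw [divFam, tMinus_eq]
    exact horiz_tangential _ (fun _ _ => nMinus_normal m j) p ν hν
  | axial m k j => exact vert_tangential h k _ p ν hν

end Membership

theorem contDiff_wUltra (k : ℕ) : ContDiff ℝ (⊤ : ℕ∞) (wUltra k) := (isAxialDeriv_wUltra k).smooth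

theorem expWave_add_period (k : ℤ) (z : ℝ) : expWave k (z + 2 * Real.pi) = expWave k z := by
  rw [expWave, expWave, Complex.exp_eq_exp_iff_exists_int]
  exact ⟨k, by push_cast; ring⟩

theorem isAxialPair_expWave : IsAxialPair .periodic expWave expWave := by
  have h : ∀ k : ℤ, Cylinder.periodic.Per (fun p => expWave k (p 2)) := by
    intro k p
    simpa using expWave_add_period k (p 2)
  exact ⟨fun k => (isAxialDeriv_expWave k).smooth, fun k => (isAxialDeriv_expWave k).smooth, h, h,
    fun h => by cases h⟩

theorem isAxialPair_wUltra : IsAxialPair .finite wUltra legendre :=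
  ⟨contDiff_wUltra, contDiff_legendre, fun _ => trivial, fun _ => trivial,
    fun _ k => by constructor <;> simp [wUltra]⟩

/-! ### Orthogonality on the periodic cylinder -/

theorem conj_expWave (k : ℤ) (z : ℝ) : (starRingEnd ℂ) (expWave k z) = expWave (-k) z := by
  rw [expWave, expWave, ← Complex.exp_conj]
  simp

theorem conj_zernike (m : ℤ) (j : ℕ) (x y : ℝ) :
    (starRingEnd ℂ) (zernike m j x y) = zernike (-m) j x y := by
  simp [zernike, zernikeGen, harmonic, signI]

theorem expWave_mul (k l : ℤ) (z : ℝ) : expWave k z * expWave l z = expWave (k + l) z := by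
  rw [expWave, expWave, expWave, ← Complex.exp_add]
  congr 1; push_cast; ring

theorem conj_mul_l2Fam (i j : ℤ × ℤ × ℕ) (p : Fin 3 → ℝ) :
    (starRingEnd ℂ) (l2Fam expWave i p) * l2Fam expWave j p = scal (expWave (j.2.1 - i.2.1))
      (fun x y => zernike (-i.1) i.2.2 x y * zernike j.1 j.2.2 x y) p := by
  simp only [l2Fam, scal, map_mul, conj_expWave, conj_zernike]
  rw [sub_eq_neg_add, ← expWave_mul]
  ring

/-- The integrand times ik is its own ∂_z, which integrates to zero over a period. -/
theorem integral_scal_expWave_eq_zero {k : ℤ} (hk : k ≠ 0) {u : ℝ → ℝ → ℂ} (hu : PlaneSmooth u) :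
    ∫ p, scal (expWave k) u p ∂Cylinder.periodic.vol = 0 := by
  have ha := isAxialDeriv_expWave k
  have h := Cylinder.periodic.integral_pd_eq_zero
    (contDiff_one_of_smooth (contDiff_scal ha.smooth hu)) 2
    (Cylinder.balanced_two (Cylinder.smooth_scal ha.smooth (isAxialPair_expWave.per_left k) hu).per
      (fun h => by cases h))
  have e : ∀ p, pd 2 (scal (expWave k) u) p = (I * k) * scal (expWave k) u p := by
    intro p
    rw [pd_two_scal ha hu]
    simp [scal, mul_assoc]
  simp only [e] at h
  rw [integral_const_mul] at h
  exact (mul_eq_zero.1 h).resolve_left (mul_ne_zero I_ne_zero (Int.cast_ne_zero.2 hk))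

theorem hasDerivAt_zernike_angle (m : ℤ) (j : ℕ) (x y : ℝ) :
    x * deriv (fun s => zernike m j x s) y - y * deriv (fun s => zernike m j s y) x
      = I * m * zernike m j x y := by
  rw [zernike_eq_mode, (hasDerivAt_mode_left _ _ _ x y).deriv,
    (hasDerivAt_mode_right _ _ _ x y).deriv]
  by_cases hm : m = 0
  · subst hm; simp [mode]; ring
  · have hs := signI_sq hm
    have hc : I * (m : ℂ) = m.natAbs * signI m := by
      rw [signI, ← mul_assoc, mul_comm I]
      congr 1
      have := Int.sign_mul_natAbs m
      rw [mul_comm] at this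
      have h2 : (((m.natAbs : ℤ) * m.sign : ℤ) : ℂ) = m := by rw [this]
      rw [← h2]
      push_cast
      simp
    rw [hc]
    obtain ⟨b, hb⟩ : ∃ b, m.natAbs = b + 1 := ⟨_, natAbs_eq_succ hm⟩
    rw [hb]
    simp only [mode, Nat.add_sub_cancel, pow_succ ((x : ℂ) + signI m * y)]
    push_cast
    linear_combination (-(b + 1 : ℂ) * ((x : ℂ) + signI m * y) ^ b *
      (jac j 0 (b + 1)).eval ((x : ℂ) ^ 2 + (y : ℂ) ^ 2) * y) * hs

/-- Rotating a field that is normal on the circle makes it tangential, and its divergence is minus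
the curl. Orthogonality is thus reduced to exhibiting the product as such a curl. -/
theorem rotField_tangential_integral {c : Cylinder} {a : ℝ → ℂ} (ha : ContDiff ℝ (⊤ : ℕ∞) a)
    (hp : c.Per (fun p => a (p 2))) {v : ℝ → ℝ → Fin 2 → ℂ} {h : ℝ → ℝ → ℂ} (hv : IsPlaneCurl v h)
    (hn : ∀ x y, x ^ 2 + y ^ 2 = 1 → v x y 0 * y - v x y 1 * x = 0) :
    ∫ p, scal a h p ∂c.vol = 0 := by
  have h1 := c.integral_div_eq_zero (X := horiz a (rotField v))
    (Cylinder.smooth_horiz ha hp (planeSmooth_rotField hv.smooth)) (horiz_tangential a hn)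
  rw [div_horiz_rotField ha hv] at h1
  have e : ∀ p, scal a (-h) p = -scal a h p := fun p => by simp [scal]
  simp only [e] at h1
  rwa [integral_neg, neg_eq_zero] at h1

/-- The product u has angular derivative i(m + m')u, and minus this derivative is the curl of u(x,
y), a radial and hence normal field. -/
theorem integral_scal_zernike_mul_zernike {m m' : ℤ} (hm : m + m' ≠ 0) (j j' : ℕ) (k : ℤ) :
    ∫ p, scal (expWave k) (fun x y => zernike m j x y * zernike m' j' x y) p
      ∂Cylinder.periodic.vol = 0 := by
  have hz := planeSmooth_zernike m j
  have hz' := planeSmooth_zernike m' j'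
  have hv : IsPlaneCurl (fun x y => (zernike m j x y * zernike m' j' x y) • ![(x : ℂ), (y : ℂ)])
      ((-(I * ((m + m' : ℤ) : ℂ))) • fun x y => zernike m j x y * zernike m' j' x y) := by
    refine ⟨fun i => ?_, fun x y => ?_⟩
    · fin_cases i
      · exact (hz.mul hz').mul planeSmooth_ofReal_fst
      · exact (hz.mul hz').mul planeSmooth_ofReal_snd
    · have h1 := hasDerivAt_zernike_angle m j x y
      have h2 := hasDerivAt_zernike_angle m' j' x y
      have d1 := (((hz.differentiable_left x y).hasDerivAt.fun_mul
        (hz'.differentiable_left x y).hasDerivAt).mul_const (y : ℂ)).deriv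
      have d2 := (((hz.differentiable_right x y).hasDerivAt.fun_mul
        (hz'.differentiable_right x y).hasDerivAt).mul_const (x : ℂ)).deriv
      simp only [Pi.smul_apply, smul_eq_mul, Matrix.cons_val_one, Matrix.cons_val_zero,
        Matrix.cons_val_fin_one]
      rw [d1, d2]
      push_cast
      linear_combination (-zernike m' j' x y) * h1 - zernike m j x y * h2
  have h := rotField_tangential_integral (isAxialPair_expWave.smooth_left k)
    (isAxialPair_expWave.per_left k) hv (fun x y _ => by simp; ring)
  rw [scal_smul_right] at h
  simp only [Pi.smul_apply, smul_eq_mul] at h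
  rw [integral_const_mul] at h
  refine (mul_eq_zero.1 h).resolve_left (neg_ne_zero.2 (mul_ne_zero I_ne_zero ?_))
  exact Int.cast_ne_zero.2 hm

open Polynomial in
/-- The Jacobi differential equation. -/
theorem jac_ode (j c : ℕ) : derivative (X ^ (c + 1) * ((1 - X) * derivative (jac j 0 c)))
    = C (-((j : ℂ) * (j + c + 1))) * (X ^ c * jac j 0 c) := by
  rcases j with _ | n
  · simp [jac_zero]
  · have h := mul_derivative_one_sub_mul_jac n c
    rw [derivative_jac]
    have e : X ^ (c + 1) * ((1 - X) * (C ((n : ℂ) + c + 2) * jac n 1 (c + 1)))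
      = C ((n : ℂ) + c + 2) * (X ^ (c + 1) * ((1 - X) * jac n 1 (c + 1))) := by ring
    rw [e, derivative_C_mul, derivative_mul, derivative_X_pow, Nat.add_sub_cancel]
    have e2 : (C ((c + 1 : ℕ) : ℂ) : ℂ[X]) = C ((c : ℂ) + 1) := by push_cast; rfl
    rw [e2]
    have e3 : (C (-(((n + 1 : ℕ) : ℂ) * (((n + 1 : ℕ) : ℂ) + c + 1))) : ℂ[X])
        = C ((n : ℂ) + c + 2) * C (-((n : ℂ) + 1)) := by
      rw [← C_mul]; congr 1; push_cast; ring
    rw [e3]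
    linear_combination (C ((n : ℂ) + c + 2) * X ^ c) * h

-- The Sturm–Liouville argument: XG is the Wronskian of two solutions of the Jacobi equation, so its
-- derivative is the difference of eigenvalues times the weighted product. The factor 1 - X makes G
-- vanish at r = 1.
open Polynomial in
theorem jac_wronskian (j j' c : ℕ) : let G : ℂ[X] := X ^ c * ((1 - X) *
      (derivative (jac j' 0 c) * jac j 0 c - derivative (jac j 0 c) * jac j' 0 c))
    G + X * derivative G = C ((j : ℂ) * (j + c + 1) - j' * (j' + c + 1)) *
      (X ^ c * jac j 0 c * jac j' 0 c) := by
  intro G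
  have h : G + X * derivative G = derivative (X * G) := by
    rw [derivative_mul (f := X), derivative_X]; ring
  have e : X * G = (X ^ (c + 1) * ((1 - X) * derivative (jac j' 0 c))) * jac j 0 c
      - (X ^ (c + 1) * ((1 - X) * derivative (jac j 0 c))) * jac j' 0 c := by
    simp only [G]; ring
  rw [h, e, derivative_sub, derivative_mul (g := jac j 0 c), derivative_mul (g := jac j' 0 c),
    jac_ode, jac_ode]
  simp only [C_neg, C_sub]
  ring

/-- The angular factors multiply to r^(2|m|), so the product is radial and is, up to a nonzero
factor, the curl of the angular field with the Wronskian coefficient. That field vanishes on the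
circle, and j(j+c+1) is strictly increasing in j. -/
theorem integral_scal_zernike_radial (m : ℤ) {j j' : ℕ} (hj : j ≠ j') :
    ∫ p, scal (expWave 0) (fun x y => zernike (-m) j x y * zernike m j' x y) p
      ∂Cylinder.periodic.vol = 0 := by
  set c := m.natAbs with hc
  have hU : (fun x y => zernike (-m) j x y * zernike m j' x y)
      = mode 0 0 (Polynomial.X ^ c * jac j 0 c * jac j' 0 c) := by
    ext x y
    rw [zernike_eq_mode, zernike_eq_mode, Int.natAbs_neg]
    have hs : signI (-m) = -signI m := by simp [signI]
    by_cases hm : m = 0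
    · subst hm
      simp [mode, hc]
    · have h2 := signI_sq hm
      have : ((x : ℂ) + -signI m * y) * ((x : ℂ) + signI m * y) = (x : ℂ) ^ 2 + (y : ℂ) ^ 2 := by
        linear_combination (-(y : ℂ) ^ 2) * h2
      simp only [mode, hs, Polynomial.eval_mul, Polynomial.eval_pow, Polynomial.eval_X, pow_zero,
        mul_one]
      rw [← this, mul_pow]
      ring
  have hw := jac_wronskian j j' c
  simp only at hw
  set G : Polynomial ℂ := Polynomial.X ^ c * ((1 - Polynomial.X) *
      (Polynomial.derivative (jac j' 0 c) * jac j 0 c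
        - Polynomial.derivative (jac j 0 c) * jac j' 0 c)) with hG
  have hv := isPlaneCurl_angularField G
  rw [hw, ← mul_assoc, ← Polynomial.C_mul, mode_C_mul, ← hU] at hv
  have h := rotField_tangential_integral (isAxialPair_expWave.smooth_left 0)
    (isAxialPair_expWave.per_left 0) hv (fun x y hxy => by
      have : (x : ℂ) ^ 2 + (y : ℂ) ^ 2 = 1 := by exact_mod_cast hxy
      simp [angularField, this, hG])
  rw [scal_smul_right] at h
  simp only [Pi.smul_apply, smul_eq_mul] at h
  rw [integral_const_mul] at h
  refine (mul_eq_zero.1 h).resolve_left (mul_ne_zero two_ne_zero (sub_ne_zero.2 fun h => hj ?_))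
  have h' : j * (j + c + 1) = j' * (j' + c + 1) := by exact_mod_cast h
  rcases lt_trichotomy j j' with hlt | heq | hlt
  · nlinarith
  · exact heq
  · nlinarith

theorem l2Fam_orthogonal (i j : ℤ × ℤ × ℕ) (hij : i ≠ j) :
    ∫ p, (starRingEnd ℂ) (l2Fam expWave i p) * l2Fam expWave j p ∂Cylinder.periodic.vol = 0 := by
  simp only [conj_mul_l2Fam]
  obtain ⟨m, k, n⟩ := i
  obtain ⟨m', k', n'⟩ := j
  by_cases hk : k' - k = 0
  · by_cases hm : -m + m' = 0
    · obtain rfl : m' = m := by omega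
      obtain rfl : k' = k := by omega
      have hn : n ≠ n' := fun h => hij (by rw [h])
      simpa only [sub_self] using integral_scal_zernike_radial m' hn
    · exact integral_scal_zernike_mul_zernike hm _ _ _
  · exact integral_scal_expWave_eq_zero hk ((planeSmooth_zernike _ _).mul (planeSmooth_zernike _ _))

/-! ### Spans of the plane families -/

/-- `mode` as a linear map. -/
noncomputable def modeL (σ : ℂ) (c : ℕ) : Polynomial ℂ →ₗ[ℂ] (ℝ → ℝ → ℂ) where
  toFun := mode σ c
  map_add' := mode_add σ c
  map_smul' a P := by rw [Polynomial.smul_eq_C_mul, mode_C_mul]; rfl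

/-- If `f` sends each Jacobi polynomial of given parameters into `V`, it sends all into `V`. -/
theorem linearMap_mem_of_jac {E : Type*} [AddCommGroup E] [Module ℂ E] (f : Polynomial ℂ →ₗ[ℂ] E)
    (V : Submodule ℂ E) (a b : ℕ) (h : ∀ n, f (jac n a b) ∈ V) (P : Polynomial ℂ) : f P ∈ V := by
  have h1 : Submodule.span ℂ (Set.range fun n => jac n a b) ≤ V.comap f :=
    Submodule.span_le.2 (Set.range_subset_iff.2 h)
  rw [span_jac] at h1
  exact h1 (Submodule.mem_top (x := P))

/-- The polynomials in the plane, spanned by the Zernike polynomials. -/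
def zernikeSpan : Submodule ℂ (ℝ → ℝ → ℂ) :=
  Submodule.span ℂ (Set.range fun i : ℤ × ℕ => zernike i.1 i.2)

/-- The span of the weighted Zernike polynomials. -/
def wZernikeSpan : Submodule ℂ (ℝ → ℝ → ℂ) :=
  Submodule.span ℂ (Set.range fun i : ℤ × ℕ => wZernike i.1 i.2)

theorem mode_mem_zernikeSpan (m : ℤ) (P : Polynomial ℂ) :
    mode (signI m) m.natAbs P ∈ zernikeSpan := by
  refine linearMap_mem_of_jac (modeL (signI m) m.natAbs) _ 0 m.natAbs (fun n => ?_) P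
  exact Submodule.subset_span ⟨(m, n), zernike_eq_mode m n⟩

theorem mode_mem_wZernikeSpan (m : ℤ) (P : Polynomial ℂ) :
    mode (signI m) m.natAbs ((1 - Polynomial.X) * P) ∈ wZernikeSpan := by
  refine linearMap_mem_of_jac (modeL (signI m) m.natAbs ∘ₗ
    LinearMap.mulLeft ℂ (1 - Polynomial.X)) _ 1 m.natAbs (fun n => ?_) P
  exact Submodule.subset_span ⟨(m, n), wZernike_eq_mode m n⟩

theorem mode_natCast (n : ℕ) (P : Polynomial ℂ) :
    mode (signI n) (n : ℤ).natAbs P = mode I n P := by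
  rcases n with _ | n
  · ext x y; simp [mode]
  · rw [Int.natAbs_natCast, signI, Int.sign_eq_one_of_pos (by positivity)]
    simp

theorem mode_neg_natCast (n : ℕ) (P : Polynomial ℂ) :
    mode (signI (-n)) (-(n : ℤ)).natAbs P = mode (-I) n P := by
  rcases n with _ | n
  · ext x y; simp [mode]
  · rw [Int.natAbs_neg, Int.natAbs_natCast, signI, Int.sign_neg,
      Int.sign_eq_one_of_pos (by positivity)]
    simp

theorem mode_I_mem (n : ℕ) (P : Polynomial ℂ) : mode I n P ∈ zernikeSpan :=
  mode_natCast n P ▸ mode_mem_zernikeSpan n P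

theorem mode_neg_I_mem (n : ℕ) (P : Polynomial ℂ) : mode (-I) n P ∈ zernikeSpan :=
  mode_neg_natCast n P ▸ mode_mem_zernikeSpan (-n) P

theorem zernikeSpan_induction {p : (ℝ → ℝ → ℂ) → Prop}
    (hI : ∀ n P, p (mode I n P)) (hI' : ∀ n P, p (mode (-I) n P)) (h0 : p 0)
    (hadd : ∀ u v, p u → p v → p (u + v)) (hsmul : ∀ (a : ℂ) u, p u → p (a • u))
    {u : ℝ → ℝ → ℂ} (hu : u ∈ zernikeSpan) : p u := by
  refine Submodule.span_induction ?_ h0 (fun u v _ _ => hadd u v) (fun a u _ => hsmul a u) hu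
  rintro _ ⟨⟨m, j⟩, rfl⟩
  simp only [zernike_eq_mode]
  obtain ⟨n, rfl | rfl⟩ := m.eq_nat_or_neg
  · rw [mode_natCast]; exact hI _ _
  · rw [mode_neg_natCast]; exact hI' _ _

theorem mul_conj_mode {σ : ℂ} (hσ : σ ^ 2 = -1) (n : ℕ) (P : Polynomial ℂ) :
    (fun x y : ℝ => ((x : ℂ) + -σ * y) * mode σ (n + 1) P x y) = mode σ n (Polynomial.X * P) := by
  ext x y
  simp [mode]
  linear_combination (-(y : ℂ) ^ 2 * P.eval ((x : ℂ) ^ 2 + y ^ 2) * ((x : ℂ) + σ * y) ^ n) * hσ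

theorem mul_mode (σ : ℂ) (n : ℕ) (P : Polynomial ℂ) :
    (fun x y : ℝ => ((x : ℂ) + σ * y) * mode σ n P x y) = mode σ (n + 1) P := by
  ext x y
  simp [mode]
  ring

/-- Multiplication by e raises the power of e by one; multiplication by ē lowers it by one and puts
eē = r² into the radial polynomial. Both keep the form of a mode. -/
theorem linear_mul_mem {σ : ℂ} (hσ : σ = I ∨ σ = -I) {u : ℝ → ℝ → ℂ} (hu : u ∈ zernikeSpan) :
    (fun x y : ℝ => ((x : ℂ) + σ * y) * u x y) ∈ zernikeSpan := by
  have hself : ∀ n P, (fun x y : ℝ => ((x : ℂ) + σ * y) * mode σ n P x y) ∈ zernikeSpan := by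
    intro n P
    rw [mul_mode]
    rcases hσ with rfl | rfl
    exacts [mode_I_mem _ _, mode_neg_I_mem _ _]
  have hother : ∀ n P, (fun x y : ℝ => ((x : ℂ) + σ * y) * mode (-σ) n P x y) ∈ zernikeSpan := by
    intro n P
    -- At exponent zero the sign of σ is irrelevant, so the first case applies.
    rcases n with _ | n
    · have : mode (-σ) 0 P = mode σ 0 P := by ext x y; simp [mode]
      rw [this]; exact hself 0 P
    · have h := mul_conj_mode (σ := -σ) (by rcases hσ with rfl | rfl <;> simp) n P
      rw [neg_neg] at h
      rw [h]
      rcases hσ with rfl | rfl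
      · exact mode_neg_I_mem _ _
      · rw [neg_neg]; exact mode_I_mem _ _
  refine zernikeSpan_induction (p := fun u => (fun x y : ℝ => ((x : ℂ) + σ * y) * u x y) ∈ zernikeSpan)
    ?_ ?_ ?_ (fun u v hu hv => ?_) (fun a u hu => ?_) hu
  · intro n P
    rcases hσ with rfl | rfl
    · exact hself n P
    · simpa using hother n P
  · intro n P
    rcases hσ with rfl | rfl
    · exact hother n P
    · exact hself n P
  · convert Submodule.zero_mem _ using 1
    ext; simp
  · convert Submodule.add_mem _ hu hv using 1
    ext; simp [mul_add]
  · convert Submodule.smul_mem _ a hu using 1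
    ext; simp [mul_left_comm]

/-- x and y are linear combinations of x + iy and x - iy, under whose multiplication the span is
stable. -/
theorem monomial_mem_zernikeSpan (p q : ℕ) :
    (fun x y : ℝ => (x : ℂ) ^ p * (y : ℂ) ^ q) ∈ zernikeSpan := by
  have hx : ∀ u ∈ zernikeSpan, (fun x y : ℝ => (x : ℂ) * u x y) ∈ zernikeSpan := by
    intro u hu
    convert Submodule.smul_mem _ (1 / 2 : ℂ) (Submodule.add_mem _ (linear_mul_mem (Or.inl rfl) hu)
      (linear_mul_mem (Or.inr rfl) hu)) using 1
    ext x y; simp; ring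
  have hy : ∀ u ∈ zernikeSpan, (fun x y : ℝ => (y : ℂ) * u x y) ∈ zernikeSpan := by
    intro u hu
    convert Submodule.smul_mem _ (-I / 2 : ℂ) (Submodule.sub_mem _ (linear_mul_mem (Or.inl rfl) hu)
      (linear_mul_mem (Or.inr rfl) hu)) using 1
    ext x y; simp
    linear_combination ((y : ℂ) * u x y) * I_mul_I
  induction p with
  | zero =>
    induction q with
    | zero =>
      convert mode_I_mem 0 1 using 1
      ext x y; simp [mode]
    | succ q ih =>
      convert hy _ ih using 1
      ext x y; ring
  | succ p ih =>
    convert hx _ ih using 1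
    ext x y; ring

theorem mul_mem_wZernikeSpan {u : ℝ → ℝ → ℂ} (hu : u ∈ zernikeSpan) :
    (fun x y : ℝ => (1 - ((x : ℂ) ^ 2 + (y : ℂ) ^ 2)) * u x y) ∈ wZernikeSpan := by
  have e : ∀ σ n P, (fun x y : ℝ => (1 - ((x : ℂ) ^ 2 + (y : ℂ) ^ 2)) * mode σ n P x y)
      = mode σ n ((1 - Polynomial.X) * P) := by
    intro σ n P; ext x y; simp [mode, mul_assoc]
  refine zernikeSpan_induction (p := fun u =>
    (fun x y : ℝ => (1 - ((x : ℂ) ^ 2 + (y : ℂ) ^ 2)) * u x y) ∈ wZernikeSpan)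
    (fun n P => ?_) (fun n P => ?_) ?_ (fun u v hu hv => ?_) (fun a u hu => ?_) hu
  · rw [e, ← mode_natCast]; exact mode_mem_wZernikeSpan _ _
  · rw [e, ← mode_neg_natCast]; exact mode_mem_wZernikeSpan _ _
  · convert Submodule.zero_mem _ using 1
    ext; simp
  · convert Submodule.add_mem _ hu hv using 1
    ext; simp [mul_add]
  · convert Submodule.smul_mem _ a hu using 1
    ext; simp [mul_left_comm]

theorem wZernikeSpan_le : wZernikeSpan ≤ zernikeSpan := by
  refine Submodule.span_le.2 ?_
  rintro _ ⟨⟨m, j⟩, rfl⟩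
  simp only [wZernike_eq_mode]
  exact mode_mem_zernikeSpan _ _

/-! ### Span of the plane vector fields -/

/-- Indices of the plane fields `n_{mj}^±`. -/
inductive PlaneIdx
  | plus (m : ℤ) (j : ℕ) (hj : 1 ≤ j)
  | minus (m : ℤ) (j : ℕ) (hj : 1 - |m| ≤ (j : ℤ))

/-- The plane fields `n_{mj}^±`. -/
noncomputable def planeFam : PlaneIdx → ℝ → ℝ → Fin 2 → ℂ
  | .plus m j _ => nPlus m j
  | .minus m j _ => nMinus m j

/-- The span of the plane fields `n_{mj}^±`. -/
noncomputable def planeSpan : Submodule ℂ (ℝ → ℝ → Fin 2 → ℂ) := Submodule.span ℂ (Set.range planeFam)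

theorem one_sub_abs_le {m : ℤ} (hm : m ≠ 0) (j : ℕ) : 1 - |m| ≤ (j : ℤ) := by
  have := Int.one_le_abs hm; omega

theorem gradW_mem (m : ℤ) (j : ℕ) : gradW m j ∈ planeSpan := by
  have h : (j : ℂ) + 1 ≠ 0 := by exact_mod_cast Nat.succ_ne_zero j
  have e : gradW m j = (-((j : ℂ) + 1)) • nPlus m (j + 1) := by
    rw [nPlus_succ, smul_smul, show (-((j : ℂ) + 1)) * (-(1 / ((j : ℂ) + 1))) = 1 by field_simp,
      one_smul]
  rw [e]
  exact Submodule.smul_mem _ _ (Submodule.subset_span ⟨.plus m (j + 1) (by omega), rfl⟩)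

theorem nMinus_mem {m : ℤ} (hm : m ≠ 0) (j : ℕ) : nMinus m j ∈ planeSpan :=
  Submodule.subset_span ⟨.minus m j (one_sub_abs_le hm j), rfl⟩

theorem two_n1_mem {m : ℤ} (hm : m ≠ 0) (j : ℕ) : (2 : ℂ) • n1 m j ∈ planeSpan := by
  rcases j with _ | j
  · rw [← nMinus_zero_right hm]
    exact nMinus_mem hm 0
  · have h := nMinus_succ hm j
    rw [← sub_eq_iff_eq_add] at h
    rw [← h]
    exact Submodule.sub_mem _ (nMinus_mem hm _) (Submodule.smul_mem _ _ (gradW_mem m j))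

/-- `n1_eq` is solved for `rotPart`. The coefficients are invertible because m ≠ 0 makes 2j + |m|
positive. -/
theorem rotPart_mem {m : ℤ} (hm : m ≠ 0) (j : ℕ) : rotPart m j ∈ planeSpan := by
  have h := two_n1_mem hm j
  have hpos := rConst_pos j (m.natAbs - 1)
  have hm' : (0 : ℝ) < m.natAbs := by exact_mod_cast Int.natAbs_pos.2 hm
  rw [n1_eq hm, smul_smul, Submodule.smul_mem_iff _ (mul_ne_zero two_ne_zero
    (ofReal_ne_zero.2 (by positivity)))] at h
  have h2 := Submodule.sub_mem _ h (Submodule.smul_mem _ (-((j + m.natAbs + 1 : ℝ) : ℂ))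
    (gradW_mem m j))
  rw [add_sub_cancel_right, Submodule.smul_mem_iff _ (ofReal_ne_zero.2 (by positivity))] at h2
  exact h2

/-- `modeField` as a linear map in one of its arguments, after linear maps on both. -/
noncomputable def modeFieldL (σ : ℂ) (b : ℕ) (f g : Polynomial ℂ →ₗ[ℂ] Polynomial ℂ) :
    Polynomial ℂ →ₗ[ℂ] (ℝ → ℝ → Fin 2 → ℂ) where
  toFun P := modeField σ b (f P) (g P)
  map_add' P Q := by rw [map_add, map_add, modeField_add]
  map_smul' a P := by
    rw [map_smul, map_smul, Polynomial.smul_eq_C_mul, Polynomial.smul_eq_C_mul, modeField_C_mul]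
    rfl

theorem exists_derivative_eq (P : Polynomial ℂ) : ∃ Q : Polynomial ℂ, Q.derivative = P := by
  induction P using Polynomial.induction_on' with
  | add p q hp hq =>
    obtain ⟨a, rfl⟩ := hp
    obtain ⟨b, rfl⟩ := hq
    exact ⟨a + b, Polynomial.derivative_add⟩
  | monomial n a =>
    refine ⟨Polynomial.monomial (n + 1) (a / (n + 1)), ?_⟩
    have h : (n : ℂ) + 1 ≠ 0 := by exact_mod_cast Nat.succ_ne_zero n
    rw [Polynomial.derivative_monomial]
    simp [h]

/-- The antiderivative is normalised to vanish at 1, hence is divisible by 1 - X. -/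
theorem exists_derivative_one_sub_mul_eq (P : Polynomial ℂ) :
    ∃ G : Polynomial ℂ, ((1 - Polynomial.X) * G).derivative = P := by
  obtain ⟨Q, hQ⟩ := exists_derivative_eq P
  obtain ⟨G, hG⟩ : (Polynomial.X - Polynomial.C 1) ∣ (Q - Polynomial.C (Q.eval 1)) :=
    Polynomial.X_sub_C_dvd_sub_C_eval
  refine ⟨-G, ?_⟩
  have : (1 - Polynomial.X) * -G = Q - Polynomial.C (Q.eval 1) := by
    rw [hG, Polynomial.C_1]; ring
  rw [this, Polynomial.derivative_sub, Polynomial.derivative_C, sub_zero, hQ]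

theorem modeField_left_mem {m : ℤ} (hm : m ≠ 0) (A : Polynomial ℂ) :
    modeField (signI m) (m.natAbs - 1) ((1 - Polynomial.X) * A) 0 ∈ planeSpan :=
  linearMap_mem_of_jac (modeFieldL (signI m) (m.natAbs - 1)
    (LinearMap.mulLeft ℂ (1 - Polynomial.X)) 0) _ 1 (m.natAbs - 1) (fun n => rotPart_mem hm n) A

theorem modeField_grad_mem {m : ℤ} (hm : m ≠ 0) (G : Polynomial ℂ) :
    modeField (signI m) (m.natAbs - 1)
      (Polynomial.C (((m.natAbs - 1 : ℕ) : ℂ) + 1) * ((1 - Polynomial.X) * G)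
        + Polynomial.X * ((1 - Polynomial.X) * G).derivative)
      ((1 - Polynomial.X) * G).derivative ∈ planeSpan := by
  have key : ∀ n : ℕ, modeFieldL (signI m) (m.natAbs - 1)
    ((LinearMap.mulLeft ℂ (Polynomial.C (((m.natAbs - 1 : ℕ) : ℂ) + 1)) +
      LinearMap.mulLeft ℂ Polynomial.X ∘ₗ Polynomial.derivative) ∘ₗ
      LinearMap.mulLeft ℂ (1 - Polynomial.X))
    (Polynomial.derivative ∘ₗ LinearMap.mulLeft ℂ (1 - Polynomial.X)) (jac n 1 m.natAbs) ∈
      planeSpan := by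
    intro n
    have h := gradW_mem m n
    rw [gradW, if_neg hm] at h
    simpa only [modeFieldL, LinearMap.coe_mk, AddHom.coe_mk, LinearMap.comp_apply,
      LinearMap.add_apply, LinearMap.mulLeft_apply] using h
  have h := linearMap_mem_of_jac _ _ _ _ key G
  simpa only [modeFieldL, LinearMap.coe_mk, AddHom.coe_mk, LinearMap.comp_apply,
      LinearMap.add_apply, LinearMap.mulLeft_apply] using h

/-- A gradient can have any prescribed (1, -σ) coefficient. If that coefficient is divisible by 1 -
X, so is the accompanying (1, σ) coefficient, which can be removed by `modeField_left_mem`. -/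
theorem modeField_right_mem {m : ℤ} (hm : m ≠ 0) (D : Polynomial ℂ) :
    modeField (signI m) (m.natAbs - 1) 0 ((1 - Polynomial.X) * D) ∈ planeSpan := by
  obtain ⟨G, hG⟩ := exists_derivative_one_sub_mul_eq ((1 - Polynomial.X) * D)
  have h1 := modeField_grad_mem hm G
  have h2 := modeField_left_mem hm (-(Polynomial.C (((m.natAbs - 1 : ℕ) : ℂ) + 1) * G
    + Polynomial.X * D))
  have h3 := Submodule.add_mem _ h1 h2
  rw [← modeField_add, hG] at h3
  convert h3 using 2
  · ring
  · ring

theorem radialField_mem (A : Polynomial ℂ) : radialField A ∈ planeSpan := by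
  refine linearMap_mem_of_jac (E := ℝ → ℝ → Fin 2 → ℂ) { toFun := radialField, map_add' := fun P Q => ?_, map_smul' := fun a P => ?_ }
    _ 0 1 (fun n => ?_) A
  · ext x y i; fin_cases i <;> simp [radialField, add_mul]
  · ext x y i; fin_cases i <;> simp [radialField, mul_assoc]
  · have h := gradW_mem 0 n
    have hn : (-2 * ((n : ℂ) + 1)) ≠ 0 :=
      mul_ne_zero (by norm_num) (by exact_mod_cast Nat.succ_ne_zero n)
    have e : gradW 0 n = (-2 * ((n : ℂ) + 1)) • radialField (jac n 0 1) := by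
      rw [gradW, if_pos rfl]
      ext x y i; fin_cases i <;> simp [radialField, mul_assoc]
    rw [e, Submodule.smul_mem_iff _ hn] at h
    exact h

theorem angularField_mem (B : Polynomial ℂ) :
    angularField ((1 - Polynomial.X) * B) ∈ planeSpan := by
  refine linearMap_mem_of_jac (E := ℝ → ℝ → Fin 2 → ℂ) { toFun := fun B => angularField ((1 - Polynomial.X) * B), map_add' := fun P Q => ?_, map_smul' := fun a P => ?_ }
    _ 1 1 (fun n => ?_) B
  · ext x y i; fin_cases i <;> simp [angularField] <;> ring
  · ext x y i; fin_cases i <;> simp [angularField] <;> ring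
  · have h : nMinus 0 (n + 1) ∈ planeSpan :=
      Submodule.subset_span ⟨.minus 0 (n + 1) (by simp), rfl⟩
    rw [nMinus_zero_left, Submodule.smul_mem_iff _ two_ne_zero] at h
    exact h

theorem modeField_I_mem (n : ℕ) (A D : Polynomial ℂ) :
    modeField I n ((1 - Polynomial.X) * A) ((1 - Polynomial.X) * D) ∈ planeSpan := by
  have hs : signI ((n : ℤ) + 1) = I := by
    rw [signI, Int.sign_eq_one_of_pos (by positivity)]; simp
  have hm : ((n : ℤ) + 1) ≠ 0 := by omega
  have h1 := modeField_left_mem hm A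
  have h2 := modeField_right_mem hm D
  have e : ((n : ℤ) + 1).natAbs - 1 = n := by omega
  rw [hs, e] at h1 h2
  have h := Submodule.add_mem _ h1 h2
  rwa [← modeField_add, add_zero, zero_add] at h

theorem modeField_neg_I_mem (n : ℕ) (A D : Polynomial ℂ) :
    modeField (-I) n ((1 - Polynomial.X) * A) ((1 - Polynomial.X) * D) ∈ planeSpan := by
  have hs : signI (-((n : ℤ) + 1)) = -I := by
    rw [signI, Int.sign_neg, Int.sign_eq_one_of_pos (by positivity)]; simp
  have hm : -((n : ℤ) + 1) ≠ 0 := by omega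
  have h1 := modeField_left_mem hm A
  have h2 := modeField_right_mem hm D
  have e : (-((n : ℤ) + 1)).natAbs - 1 = n := by omega
  rw [hs, e] at h1 h2
  have h := Submodule.add_mem _ h1 h2
  rwa [← modeField_add, add_zero, zero_add] at h

/-- The direction (1, σ) is the first slot of `modeField`. The direction (1, -σ) is the second slot,
but only for powers e^n with n ≥ 2. For n = 0 it is the first slot for -σ, and for n = 1 the
identity e(1, -σ) = (x, y) - σ(-y, x) leads to the fields with m = 0. -/
theorem mode_smul_mem_planeSpan {σ : ℂ} (hσ : σ = I ∨ σ = -I) (n : ℕ) (P : Polynomial ℂ) :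
    (fun x y : ℝ => mode σ n ((1 - Polynomial.X) * P) x y • ![1, σ]) ∈ planeSpan ∧
    (fun x y : ℝ => mode σ n ((1 - Polynomial.X) * P) x y • ![1, -σ]) ∈ planeSpan := by
  have hmem : ∀ τ : ℂ, τ = I ∨ τ = -I → ∀ n A D,
      modeField τ n ((1 - Polynomial.X) * A) ((1 - Polynomial.X) * D) ∈ planeSpan := by
    rintro τ (rfl | rfl)
    exacts [modeField_I_mem, modeField_neg_I_mem]
  constructor
  · convert hmem σ hσ n P 0 using 1
    ext x y i
    fin_cases i <;> simp [modeField, mode]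
    ring
  · rcases n with _ | _ | n
    · convert hmem (-σ) (by rcases hσ with rfl | rfl <;> simp) 0 P 0 using 1
      ext x y i
      fin_cases i <;> simp [modeField, mode]
      ring
    · convert Submodule.sub_mem _ (radialField_mem ((1 - Polynomial.X) * P))
        (Submodule.smul_mem _ σ (angularField_mem P)) using 1
      have h2 : σ ^ 2 = -1 := by rcases hσ with rfl | rfl <;> simp
      ext x y i
      fin_cases i
      · simp [mode, radialField, angularField]; ring
      · simp [mode, radialField, angularField]
        linear_combination (-(1 - ((x : ℂ) ^ 2 + y ^ 2)) * P.eval ((x : ℂ) ^ 2 + y ^ 2) * y) * h2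
    · convert hmem σ hσ n 0 P using 1
      ext x y i
      fin_cases i <;> simp [modeField, mode]
      ring

/-- The vectors (1, σ) and (1, -σ) form a basis of ℂ². This frees the approximation argument from
boundary conditions on components: any plane field whose components are polynomials divisible by 1 -
r² is available. -/
theorem smul_mem_planeSpan {u : ℝ → ℝ → ℂ} (hu : u ∈ wZernikeSpan) (v : Fin 2 → ℂ) :
    (fun x y : ℝ => u x y • v) ∈ planeSpan := by
  have hlin : ∀ (u : ℝ → ℝ → ℂ) (v₁ v₂ : Fin 2 → ℂ) (a b : ℂ), (fun x y : ℝ => (u x y : ℂ) • v₁) ∈ planeSpan →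
      (fun x y : ℝ => u x y • v₂) ∈ planeSpan →
      (fun x y : ℝ => u x y • (a • v₁ + b • v₂)) ∈ planeSpan := by
    intro u v₁ v₂ a b h1 h2
    convert Submodule.add_mem _ (Submodule.smul_mem _ a h1) (Submodule.smul_mem _ b h2) using 1
    ext x y i; simp; ring
  have hgen : ∀ σ : ℂ, (σ = I ∨ σ = -I) → ∀ n P,
      (fun x y : ℝ => mode σ n ((1 - Polynomial.X) * P) x y • v) ∈ planeSpan := by
    intro σ hσ n P
    obtain ⟨h1, h2⟩ := mode_smul_mem_planeSpan hσ n P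
    have h := hlin _ _ _ ((v 0 - σ * v 1) / 2) ((v 0 + σ * v 1) / 2) h1 h2
    have hs : σ ^ 2 = -1 := by rcases hσ with rfl | rfl <;> simp
    convert h using 4
    ext i
    fin_cases i
    · simp; ring
    · simp; linear_combination v 1 * hs
  refine Submodule.span_induction (p := fun u _ => (fun x y : ℝ => u x y • v) ∈ planeSpan)
    ?_ ?_ (fun u w _ _ hu hw => ?_) (fun a u _ hu => ?_) hu
  · rintro _ ⟨⟨m, j⟩, rfl⟩
    simp only [wZernike_eq_mode]
    obtain ⟨n, rfl | rfl⟩ := m.eq_nat_or_neg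
    · rw [mode_natCast]; exact hgen _ (Or.inl rfl) _ _
    · rw [mode_neg_natCast]; exact hgen _ (Or.inr rfl) _ _
  · convert Submodule.zero_mem _ using 1
    ext; simp
  · convert Submodule.add_mem _ hu hw using 1
    ext; simp [add_mul]
  · convert Submodule.smul_mem _ a hu using 1
    ext; simp [mul_assoc]

/-! ### Spans of the tensor families -/

noncomputable def scalL : (ℝ → ℂ) →ₗ[ℂ] (ℝ → ℝ → ℂ) →ₗ[ℂ] Scalar :=
  LinearMap.mk₂ ℂ scal (fun a a' u => by ext p; simp [scal, add_mul])
    (fun c a u => scal_smul_left c a u) (fun a u u' => by ext p; simp [scal, mul_add])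
    (fun c a u => scal_smul_right c a u)

noncomputable def horizL : (ℝ → ℂ) →ₗ[ℂ] (ℝ → ℝ → Fin 2 → ℂ) →ₗ[ℂ] Vector :=
  LinearMap.mk₂ ℂ horiz (fun a a' u => by ext p i; fin_cases i <;> simp [horiz, add_mul])
    (fun c a u => horiz_smul_left c a u)
    (fun a u u' => by ext p i; fin_cases i <;> simp [horiz, mul_add])
    (fun c a u => horiz_smul_right c a u)

noncomputable def vertL : (ℝ → ℂ) →ₗ[ℂ] (ℝ → ℝ → ℂ) →ₗ[ℂ] Vector :=
  LinearMap.mk₂ ℂ vert (fun a a' u => by ext p i; fin_cases i <;> simp [vert, add_mul])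
    (fun c a u => vert_smul_left c a u)
    (fun a u u' => by ext p i; fin_cases i <;> simp [vert, mul_add])
    (fun c a u => vert_smul_right c a u)

theorem bilinear_mem_of_span {E F G ι κ : Type*} [AddCommGroup E] [Module ℂ E] [AddCommGroup F]
    [Module ℂ F] [AddCommGroup G] [Module ℂ G] (f : E →ₗ[ℂ] F →ₗ[ℂ] G) {e : ι → E} {u : κ → F}
    {W : Submodule ℂ G} (h : ∀ i j, f (e i) (u j) ∈ W) {x : E} {y : F}
    (hx : x ∈ Submodule.span ℂ (Set.range e)) (hy : y ∈ Submodule.span ℂ (Set.range u)) :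
    f x y ∈ W := by
  have h1 : Submodule.map₂ f (Submodule.span ℂ (Set.range e)) (Submodule.span ℂ (Set.range u)) ≤
      W := by
    rw [Submodule.map₂_span_span, Submodule.span_le]
    rintro _ ⟨_, ⟨i, rfl⟩, _, ⟨j, rfl⟩, rfl⟩
    exact h i j
  exact h1 (Submodule.apply_mem_map₂ f hx hy)

section

variable {K : Type} {a b : K → ℝ → ℂ}

theorem scal_mem_span_h1Fam {A : ℝ → ℂ} {u : ℝ → ℝ → ℂ} (hA : A ∈ Submodule.span ℂ (Set.range a))
    (hu : u ∈ wZernikeSpan) : scal A u ∈ Submodule.span ℂ (Set.range (h1Fam a)) :=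
  bilinear_mem_of_span scalL
    (fun k i => Submodule.subset_span (Set.mem_range.2 ⟨(i.1, k, i.2), rfl⟩)) hA hu

theorem scal_mem_span_l2Fam {A : ℝ → ℂ} {u : ℝ → ℝ → ℂ} (hA : A ∈ Submodule.span ℂ (Set.range b))
    (hu : u ∈ zernikeSpan) : scal A u ∈ Submodule.span ℂ (Set.range (l2Fam b)) :=
  bilinear_mem_of_span scalL
    (fun k i => Submodule.subset_span (Set.mem_range.2 ⟨(i.1, k, i.2), rfl⟩)) hA hu

theorem horiz_mem_span_curlFam {A : ℝ → ℂ} {v : ℝ → ℝ → Fin 2 → ℂ}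
    (hA : A ∈ Submodule.span ℂ (Set.range a)) (hv : v ∈ planeSpan) :
    horiz A v ∈ Submodule.span ℂ (Set.range (curlFam a b)) := by
  refine bilinear_mem_of_span horizL (fun k i => ?_) hA hv
  rcases i with ⟨m, j, hj⟩ | ⟨m, j, hj⟩
  · exact Submodule.subset_span ⟨.plus m k j hj, rfl⟩
  · exact Submodule.subset_span ⟨.minus m k j hj, rfl⟩

theorem vert_mem_span_curlFam {B : ℝ → ℂ} {u : ℝ → ℝ → ℂ}
    (hB : B ∈ Submodule.span ℂ (Set.range b)) (hu : u ∈ wZernikeSpan) :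
    vert B u ∈ Submodule.span ℂ (Set.range (curlFam a b)) :=
  bilinear_mem_of_span vertL
    (fun k i => Submodule.subset_span (Set.mem_range.2 ⟨.axial i.1 k i.2, rfl⟩)) hB hu

/-- `rotField` as a linear map. -/
def rotFieldL : (ℝ → ℝ → Fin 2 → ℂ) →ₗ[ℂ] (ℝ → ℝ → Fin 2 → ℂ) where
  toFun := rotField
  map_add' u v := by
    ext x y i; fin_cases i <;> simp [rotField]; ring
  map_smul' := rotField_smul

theorem horiz_rotField_mem_span_divFam {B : ℝ → ℂ} {v : ℝ → ℝ → Fin 2 → ℂ}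
    (hB : B ∈ Submodule.span ℂ (Set.range b)) (hv : v ∈ planeSpan) :
    horiz B (rotField v) ∈ Submodule.span ℂ (Set.range (divFam a b)) := by
  refine bilinear_mem_of_span (horizL.compl₂ rotFieldL) (fun k i => ?_) hB hv
  rcases i with ⟨m, j, hj⟩ | ⟨m, j, hj⟩
  · exact Submodule.subset_span ⟨.plus m k j hj, by simp only [divFam, tPlus_eq]; rfl⟩
  · exact Submodule.subset_span ⟨.minus m k j hj, by simp only [divFam, tMinus_eq]; rfl⟩

theorem vert_mem_span_divFam {A : ℝ → ℂ} {u : ℝ → ℝ → ℂ}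
    (hA : A ∈ Submodule.span ℂ (Set.range a)) (hu : u ∈ zernikeSpan) :
    vert A u ∈ Submodule.span ℂ (Set.range (divFam a b)) :=
  bilinear_mem_of_span vertL
    (fun k i => Submodule.subset_span (Set.mem_range.2 ⟨.axial i.1 k i.2, rfl⟩)) hA hu

/-- A span of scalar fields times constant vectors. -/
theorem smul_vec_mem {W : Submodule ℂ Vector} (v : Fin 3 → ℂ)
    (h : ∀ m k j, (fun p => scal (a k) (wZernike m j) p • v) ∈ W) {q : Scalar}
    (hq : q ∈ Submodule.span ℂ (Set.range (h1Fam a))) : (fun p => q p • v) ∈ W := by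
  refine Submodule.span_induction (p := fun q _ => (fun p => q p • v) ∈ W)
    ?_ ?_ (fun u w _ _ hu hw => ?_) (fun a u _ hu => ?_) hq
  · rintro _ ⟨⟨m, k, j⟩, rfl⟩
    exact h m k j
  · convert Submodule.zero_mem _ using 1
    ext; simp
  · convert Submodule.add_mem _ hu hw using 1
    ext; simp [add_mul]
  · convert Submodule.smul_mem _ a hu using 1
    ext; simp [mul_assoc]

/-- The horizontal part already carries a_k; the vertical fields of the curl family carry b_k, hence
the hypothesis that each a_k lies in the span of b. -/
theorem smul_vec_mem_span_curlFam (hab : ∀ k, a k ∈ Submodule.span ℂ (Set.range b))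
    (v : Fin 3 → ℂ) {q : Scalar} (hq : q ∈ Submodule.span ℂ (Set.range (h1Fam a))) :
    (fun p => q p • v) ∈ Submodule.span ℂ (Set.range (curlFam a b)) := by
  refine smul_vec_mem v (fun m k j => ?_) hq
  have hw : wZernike m j ∈ wZernikeSpan := Submodule.subset_span ⟨(m, j), rfl⟩
  convert Submodule.add_mem _ (horiz_mem_span_curlFam (b := b) (Submodule.subset_span ⟨k, rfl⟩)
    (smul_mem_planeSpan hw ![v 0, v 1])) (Submodule.smul_mem _ (v 2)
    (vert_mem_span_curlFam (a := a) (hab k) hw)) using 1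
  ext p i
  fin_cases i <;> simp [horiz, vert, scal] <;> ring

/-- Here the roles are exchanged: the horizontal fields carry b_k, the vertical ones a_k. -/
theorem smul_vec_mem_span_divFam (hab : ∀ k, a k ∈ Submodule.span ℂ (Set.range b))
    (v : Fin 3 → ℂ) {q : Scalar} (hq : q ∈ Submodule.span ℂ (Set.range (h1Fam a))) :
    (fun p => q p • v) ∈ Submodule.span ℂ (Set.range (divFam a b)) := by
  refine smul_vec_mem v (fun m k j => ?_) hq
  have hw : wZernike m j ∈ wZernikeSpan := Submodule.subset_span ⟨(m, j), rfl⟩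
  -- The vector (v₁, -v₀) is the one that the rotation by π/2 takes to (v₀, v₁).
  convert Submodule.add_mem _ (horiz_rotField_mem_span_divFam (a := a) (hab k)
    (smul_mem_planeSpan hw ![v 1, -v 0])) (Submodule.smul_mem _ (v 2)
    (vert_mem_span_divFam (b := b) (Submodule.subset_span ⟨k, rfl⟩) (wZernikeSpan_le hw))) using 1
  ext p i
  fin_cases i <;> simp [horiz, vert, scal, rotField] <;> ring

theorem vec_eq_sum (q : Fin 3 → Scalar) : (fun p i => q i p) =
    ∑ i, (fun p => q i p • (Pi.single i 1 : Fin 3 → ℂ)) := by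
  ext p i
  simp [Finset.sum_apply, Pi.single_apply]

theorem vec_mem_span_curlFam (hab : ∀ k, a k ∈ Submodule.span ℂ (Set.range b))
    {q : Fin 3 → Scalar} (hq : ∀ i, q i ∈ Submodule.span ℂ (Set.range (h1Fam a))) :
    (fun p i => q i p) ∈ Submodule.span ℂ (Set.range (curlFam a b)) := by
  rw [vec_eq_sum]
  exact Submodule.sum_mem _ fun i _ => smul_vec_mem_span_curlFam hab _ (hq i)

theorem vec_mem_span_divFam (hab : ∀ k, a k ∈ Submodule.span ℂ (Set.range b))
    {q : Fin 3 → Scalar} (hq : ∀ i, q i ∈ Submodule.span ℂ (Set.range (h1Fam a))) :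
    (fun p i => q i p) ∈ Submodule.span ℂ (Set.range (divFam a b)) := by
  rw [vec_eq_sum]
  exact Submodule.sum_mem _ fun i _ => smul_vec_mem_span_divFam hab _ (hq i)

end

/-! ### Span of the axial functions -/

/-- A polynomial in `(z + 1) / 2` as a function of `z`. -/
noncomputable def evalHalf : Polynomial ℂ →ₗ[ℂ] (ℝ → ℂ) where
  toFun P z := P.eval (((z : ℂ) + 1) / 2)
  map_add' P Q := by ext; simp
  map_smul' c P := by ext; simp

theorem evalHalf_jac_zero (n : ℕ) : evalHalf (jac n 0 0) = legendre n := by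
  ext z; simp [evalHalf, legendre, jacobi_eq_eval]

theorem evalHalf_mem_span_legendre (P : Polynomial ℂ) :
    evalHalf P ∈ Submodule.span ℂ (Set.range legendre) :=
  linearMap_mem_of_jac evalHalf _ 0 0
    (fun n => Submodule.subset_span (Set.mem_range.2 ⟨n, (evalHalf_jac_zero n).symm⟩)) P

theorem wUltra_eq_evalHalf (k : ℕ) : wUltra k = (2 * ((k : ℂ) + 2)) •
    evalHalf (Polynomial.X * ((1 - Polynomial.X) * jac k 1 1)) := by
  rw [wUltra_eq_eval]
  ext z
  simp [evalHalf]

theorem evalHalf_mem_span_wUltra (P : Polynomial ℂ) :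
    evalHalf (Polynomial.X * ((1 - Polynomial.X) * P)) ∈ Submodule.span ℂ (Set.range wUltra) := by
  have key : ∀ k, (evalHalf ∘ₗ LinearMap.mulLeft ℂ Polynomial.X ∘ₗ
    LinearMap.mulLeft ℂ (1 - Polynomial.X)) (jac k 1 1) ∈
      Submodule.span ℂ (Set.range wUltra) := by
    intro k
    simp only [LinearMap.comp_apply, LinearMap.mulLeft_apply]
    have h : wUltra k ∈ Submodule.span ℂ (Set.range wUltra) := Submodule.subset_span ⟨k, rfl⟩
    have h0 : (2 * ((k : ℂ) + 2)) ≠ 0 :=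
      mul_ne_zero two_ne_zero (by exact_mod_cast (by omega : k + 2 ≠ 0))
    rw [wUltra_eq_evalHalf k] at h
    exact (Submodule.smul_mem_iff _ h0).1 h
  have h := linearMap_mem_of_jac _ _ _ _ key P
  simpa only [LinearMap.comp_apply, LinearMap.mulLeft_apply] using h

theorem wUltra_mem_span_legendre (k : ℕ) : wUltra k ∈ Submodule.span ℂ (Set.range legendre) := by
  rw [wUltra_eq_evalHalf]
  exact Submodule.smul_mem _ _ (evalHalf_mem_span_legendre _)

theorem pow_eq_evalHalf (l : ℕ) :
    (fun z : ℝ => (z : ℂ) ^ l) = evalHalf ((2 * Polynomial.X - 1) ^ l) := by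
  ext z
  simp [evalHalf]
  ring

theorem pow_mem_span_legendre (l : ℕ) :
    (fun z : ℝ => (z : ℂ) ^ l) ∈ Submodule.span ℂ (Set.range legendre) := by
  rw [pow_eq_evalHalf]; exact evalHalf_mem_span_legendre _

theorem one_sub_sq_mul_pow_mem_span_wUltra (l : ℕ) :
    (fun z : ℝ => (1 - (z : ℂ) ^ 2) * (z : ℂ) ^ l) ∈ Submodule.span ℂ (Set.range wUltra) := by
  -- With t = (z+1)/2, 1 - z² = 4t(1-t).
  convert Submodule.smul_mem _ (4 : ℂ)
    (evalHalf_mem_span_wUltra ((2 * Polynomial.X - 1) ^ l)) using 1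
  ext z
  simp [evalHalf]
  ring

/-! ### Linear independence -/

/-- Every linear functional on E turns the relation into a scalar one, and functionals separate
points. -/
theorem eq_zero_of_linearIndependent_fun {ι X E : Type*} [AddCommGroup E] [Module ℂ E]
    {α : ι → X → ℂ} (hα : LinearIndependent ℂ α) (s : Finset ι) (e : ι → E)
    (h : ∀ x, ∑ i ∈ s, α i x • e i = 0) : ∀ i ∈ s, e i = 0 := by
  intro i hi
  rw [← Module.forall_dual_apply_eq_zero_iff ℂ]
  intro φ
  refine linearIndependent_iff'.1 hα s (fun i => φ (e i)) ?_ i hi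
  ext x
  have := congrArg φ (h x)
  simpa [Finset.sum_apply, mul_comm] using this

/-- Products of independent functions in separate variables are independent. -/
theorem LinearIndependent.tensor {ι κ X Y E : Type*} [AddCommGroup E] [Module ℂ E]
    {α : ι → X → ℂ} {β : ι → κ → Y → E} (hα : LinearIndependent ℂ α)
    (hβ : ∀ i, LinearIndependent ℂ (β i)) :
    LinearIndependent ℂ (fun (i : ι × κ) (p : X × Y) => α i.1 p.1 • β i.1 i.2 p.2) := by
  classical
  rw [linearIndependent_iff']
  intro s g hg
  -- The coefficients are extended by zero to the product of the two projections of s, so that the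
  -- double sum can be taken one variable at a time.
  set g' : ι × κ → ℂ := fun i => if i ∈ s then g i else 0 with hg'
  have hsum : ∀ x y, ∑ i ∈ s.image Prod.fst, α i x •
      ∑ k ∈ s.image Prod.snd, g' (i, k) • β i k y = 0 := by
    intro x y
    have h1 := congrFun hg (x, y)
    simp only [Finset.sum_apply, Pi.smul_apply, Pi.zero_apply] at h1
    rw [← h1]
    simp only [Finset.smul_sum]
    rw [← Finset.sum_product', ← Finset.sum_subset (s₁ := s)]
    · refine Finset.sum_congr rfl fun i hi => ?_
      simp only [hg', if_pos hi]
      rw [smul_comm]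
    · intro i hi
      exact Finset.mem_product.2 ⟨Finset.mem_image_of_mem _ hi, Finset.mem_image_of_mem _ hi⟩
    · intro i _ hi
      simp [hg', hi]
  intro i hi
  have h2 : ∑ k ∈ s.image Prod.snd, g' (i.1, k) • β i.1 k = 0 := by
    ext y
    have := eq_zero_of_linearIndependent_fun hα _ _ (fun x => hsum x y) i.1
      (Finset.mem_image_of_mem _ hi)
    simpa [Finset.sum_apply] using this
  have h3 := linearIndependent_iff'.1 (hβ i.1) _ _ h2 i.2 (Finset.mem_image_of_mem _ hi)
  simpa [hg', hi] using h3

/-- Independence of restrictions along a map implies independence. -/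
theorem LinearIndependent.of_comap {ι X Y E : Type*} [AddCommGroup E] [Module ℂ E]
    {F : ι → Y → E} (φ : X → Y) (h : LinearIndependent ℂ (fun i x => F i (φ x))) :
    LinearIndependent ℂ F :=
  LinearIndependent.of_comp (LinearMap.funLeft ℂ E φ) h

theorem LinearIndependent.congr_apply {ι X E : Type*} [AddCommGroup E] [Module ℂ E]
    {F G : ι → X → E} (h : LinearIndependent ℂ F) (e : ∀ i x, F i x = G i x) :
    LinearIndependent ℂ G := by
  rwa [show G = F from funext₂ fun i x => (e i x).symm]

/-! ### Independence of the axial functions -/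

/-- The exponentials are distinct characters of the additive group ℝ, and distinct characters are
independent (Dedekind). The derivative at 0 recovers k. -/
theorem linearIndependent_expWave : LinearIndependent ℂ (fun k : ℤ => expWave k) := by
  let f : ℤ → Multiplicative ℝ →* ℂ := fun k =>
    { toFun := fun z => expWave k z.toAdd
      map_one' := by simp [expWave]
      map_mul' := fun x y => by
        simp only [expWave, toAdd_mul, ← Complex.exp_add]; push_cast; congr 1; ring }
  have hf : Function.Injective f := by
    intro k l hkl
    have h1 : ∀ z : ℝ, expWave k z = expWave l z := fun z => DFunLike.congr_fun hkl (.ofAdd z)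
    have h2 := (isAxialDeriv_expWave k).deriv 0
    have h3 := (isAxialDeriv_expWave l).deriv 0
    rw [show expWave k = expWave l from funext h1] at h2
    have h4 := h2.unique h3
    simpa [expWave, I_ne_zero] using h4
  have h := (linearIndependent_monoidHom (Multiplicative ℝ) ℂ).comp f hf
  exact LinearIndependent.of_comap (fun z : Multiplicative ℝ => z.toAdd) h

/-- The range of the axial coordinate. -/
def Cylinder.axis : Cylinder → Set ℝ
  | .periodic => Set.Ico 0 (2 * Real.pi)
  | .finite => Set.Icc (-1) 1

theorem linearIndependent_expWave_axis :
    LinearIndependent ℂ (fun (k : ℤ) (z : Cylinder.periodic.axis) => expWave k z) := by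
  rw [linearIndependent_iff']
  intro s g hg
  refine linearIndependent_iff'.1 linearIndependent_expWave s g ?_
  have hper : Function.Periodic (∑ i ∈ s, g i • expWave i) (2 * Real.pi) := by
    intro z
    simp only [Finset.sum_apply, Pi.smul_apply, expWave_add_period]
  ext z
  obtain ⟨y, hy, e⟩ := hper.exists_mem_Ico₀ Real.two_pi_pos z
  rw [e]
  simpa [Finset.sum_apply] using congrFun hg ⟨y, hy⟩

/-- A polynomial that vanishes on an interval has infinitely many roots. -/
theorem linearIndependent_evalHalf {P : ℕ → Polynomial ℂ} (hP : LinearIndependent ℂ P) :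
    LinearIndependent ℂ (fun (k : ℕ) (z : Cylinder.finite.axis) => evalHalf (P k) z) := by
  refine hP.map' ((LinearMap.funLeft ℂ ℂ (fun z : Cylinder.finite.axis => (z : ℝ))) ∘ₗ evalHalf)
    (LinearMap.ker_eq_bot'.2 fun Q hQ => Polynomial.eq_zero_of_infinite_isRoot Q ?_)
  refine Set.infinite_of_injOn_mapsTo (s := Set.Icc (-1 : ℝ) 1)
    (f := fun z : ℝ => ((z : ℂ) + 1) / 2) (fun x _ y _ h => ?_) (fun z hz => ?_)
    (Set.Icc_infinite (by norm_num))
  · simpa using h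
  · exact congrFun hQ ⟨z, hz⟩

theorem linearIndependent_legendre :
    LinearIndependent ℂ (fun (k : ℕ) (z : Cylinder.finite.axis) => legendre k z) := by
  simpa only [evalHalf_jac_zero] using linearIndependent_evalHalf (linearIndependent_jac 0 0)

theorem LinearIndependent.polynomial_mul {P : ℕ → Polynomial ℂ} (hP : LinearIndependent ℂ P)
    {Q : Polynomial ℂ} (hQ : Q ≠ 0) : LinearIndependent ℂ (fun k => Q * P k) :=
  hP.map' (LinearMap.mulLeft ℂ Q) (LinearMap.ker_eq_bot'.2 fun R hR => by
    simpa [hQ] using hR)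

theorem LinearIndependent.smul_of_ne_zero {ι E : Type*} [AddCommGroup E] [Module ℂ E] {F : ι → E}
    (hF : LinearIndependent ℂ F) {c : ι → ℂ} (hc : ∀ i, c i ≠ 0) :
    LinearIndependent ℂ (fun i => c i • F i) :=
  hF.units_smul (fun i => Units.mk0 (c i) (hc i))

theorem one_sub_X_ne_zero : (1 - Polynomial.X : Polynomial ℂ) ≠ 0 := by
  intro h
  have := congrArg (Polynomial.eval 0) h
  simp at this

theorem linearIndependent_wUltra :
    LinearIndependent ℂ (fun (k : ℕ) (z : Cylinder.finite.axis) => wUltra k z) := by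
  have h := linearIndependent_evalHalf (LinearIndependent.polynomial_mul
    (LinearIndependent.polynomial_mul (linearIndependent_jac 1 1) one_sub_X_ne_zero)
    Polynomial.X_ne_zero)
  have h2 := LinearIndependent.smul_of_ne_zero h (c := fun k => 2 * ((k : ℂ) + 2))
    (fun k => mul_ne_zero two_ne_zero (by exact_mod_cast (by omega : k + 2 ≠ 0)))
  simp only [wUltra_eq_evalHalf]
  exact h2

/-! ### Independence of the plane families -/

/-- The open unit disk. -/
abbrev disk : Set (ℝ × ℝ) := {q | q.1 ^ 2 + q.2 ^ 2 < 1}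

theorem mode_polar (m : ℤ) (P : Polynomial ℂ) (r θ : ℝ) :
    mode (signI m) m.natAbs P (r * Real.cos θ) (r * Real.sin θ) =
      expWave m θ * ((r : ℂ) ^ m.natAbs * P.eval ((r : ℂ) ^ 2)) := by
  have hcs : (Complex.sin θ) ^ 2 + (Complex.cos θ) ^ 2 = 1 := Complex.sin_sq_add_cos_sq _
  have hE : expWave m θ = (Complex.cos θ + signI m * Complex.sin θ) ^ m.natAbs := by
    obtain ⟨n, rfl | rfl⟩ := m.eq_nat_or_neg
    · rcases n with _ | n
      · simp [expWave]
      · rw [signI, Int.sign_eq_one_of_pos (by positivity)]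
        rw [Int.natAbs_natCast, Int.cast_one, one_mul, mul_comm I, ← Complex.exp_mul_I,
          ← Complex.exp_nat_mul, expWave]
        congr 1; push_cast; ring
    · rcases n with _ | n
      · simp [expWave]
      · rw [signI, Int.sign_neg, Int.sign_eq_one_of_pos (by positivity)]
        rw [Int.natAbs_neg, Int.natAbs_natCast, expWave]
        have : Complex.cos θ + ((-1 : ℤ) : ℂ) * I * Complex.sin θ = Complex.exp ((-θ : ℂ) * I) := by
          rw [Complex.exp_mul_I, Complex.cos_neg, Complex.sin_neg]; push_cast; ring
        rw [this, ← Complex.exp_nat_mul]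
        congr 1; push_cast; ring
  rw [hE, mode]
  push_cast
  rw [show ((r : ℂ) * Complex.cos θ) ^ 2 + (r * Complex.sin θ) ^ 2 = r ^ 2 by
    linear_combination (r : ℂ) ^ 2 * hcs]
  rw [show (r : ℂ) * Complex.cos θ + signI m * (r * Complex.sin θ) =
    r * (Complex.cos θ + signI m * Complex.sin θ) by ring, mul_pow]
  ring

/-- Polar coordinates give a tensor product: exponentials in θ are independent, and for each m the
radial factors r^|m| P(r²) are independent on 0 < r < 1. -/
theorem linearIndependent_mode {P : ℤ → ℕ → Polynomial ℂ} (hP : ∀ m, LinearIndependent ℂ (P m)) :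
    LinearIndependent ℂ (fun (i : ℤ × ℕ) (q : disk) =>
      mode (signI i.1) i.1.natAbs (P i.1 i.2) q.1.1 q.1.2) := by
  have hR : ∀ m : ℤ, LinearIndependent ℂ (fun (j : ℕ) (r : Set.Ioo (0 : ℝ) 1) =>
      ((r : ℝ) : ℂ) ^ m.natAbs * (P m j).eval (((r : ℝ) : ℂ) ^ 2)) := by
    intro m
    let L : Polynomial ℂ →ₗ[ℂ] (Set.Ioo (0 : ℝ) 1 → ℂ) :=
      { toFun := fun Q r => ((r : ℝ) : ℂ) ^ m.natAbs * Q.eval (((r : ℝ) : ℂ) ^ 2)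
        map_add' := fun Q R => by ext r; simp [mul_add]
        map_smul' := fun c Q => by ext r; simp [mul_left_comm] }
    refine (hP m).map' L (LinearMap.ker_eq_bot'.2 fun Q hQ =>
      Polynomial.eq_zero_of_infinite_isRoot Q ?_)
    refine Set.infinite_of_injOn_mapsTo (s := Set.Ioo (0 : ℝ) 1)
      (f := fun z : ℝ => (z : ℂ) ^ 2) (fun x hx y hy h => ?_) (fun r hr => ?_)
      (Set.Ioo_infinite (by norm_num))
    · have h' : x ^ 2 = y ^ 2 := by
        have h : (x : ℂ) ^ 2 = (y : ℂ) ^ 2 := h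
        exact_mod_cast h
      exact (pow_left_inj₀ hx.1.le hy.1.le two_ne_zero).1 h'
    · have h1 := congrFun hQ ⟨r, hr⟩
      have h2 : (r : ℂ) ≠ 0 := ofReal_ne_zero.2 hr.1.ne'
      simpa [L, h2] using h1
  have h := LinearIndependent.tensor linearIndependent_expWave hR
  refine LinearIndependent.of_comap (fun p : ℝ × Set.Ioo (0 : ℝ) 1 =>
    (⟨((p.2 : ℝ) * Real.cos p.1, (p.2 : ℝ) * Real.sin p.1), ?_⟩ : disk)) ?_
  · have h1 := p.2.2.1
    have h2 := p.2.2.2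
    have h3 := Real.sin_sq_add_cos_sq p.1
    change ((p.2 : ℝ) * Real.cos p.1) ^ 2 + ((p.2 : ℝ) * Real.sin p.1) ^ 2 < 1
    have h4 : ((p.2 : ℝ) * Real.cos p.1) ^ 2 + ((p.2 : ℝ) * Real.sin p.1) ^ 2 = (p.2 : ℝ) ^ 2 := by
      linear_combination (p.2 : ℝ) ^ 2 * h3
    rw [h4]; nlinarith
  · simp only [mode_polar]
    exact h

theorem linearIndependent_zernike :
    LinearIndependent ℂ (fun (i : ℤ × ℕ) (q : disk) => zernike i.1 i.2 q.1.1 q.1.2) := by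
  simp only [zernike_eq_mode]
  exact linearIndependent_mode (P := fun m j => jac j 0 m.natAbs)
    fun m => linearIndependent_jac 0 m.natAbs

theorem linearIndependent_wZernike :
    LinearIndependent ℂ (fun (i : ℤ × ℕ) (q : disk) => wZernike i.1 i.2 q.1.1 q.1.2) := by
  simp only [wZernike_eq_mode]
  exact linearIndependent_mode (P := fun m j => (1 - Polynomial.X) * jac j 1 m.natAbs) fun m =>
    LinearIndependent.polynomial_mul (linearIndependent_jac 1 m.natAbs) one_sub_X_ne_zero

theorem kappa_ne_zero {m : ℤ} {j : ℕ} (hj : 1 - |m| ≤ (j : ℤ)) : kappa m j ≠ 0 := by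
  by_cases hm : m = 0
  · subst hm
    have : j ≠ 0 := by rintro rfl; simp at hj
    simp [kappa, this]
  · rw [kappa, if_neg hm]
    have h1 := rConst_pos j (m.natAbs - 1)
    have h2 : (0 : ℝ) < m.natAbs := by exact_mod_cast Int.natAbs_pos.2 hm
    refine mul_ne_zero (ofReal_ne_zero.2 (by positivity)) fun h => ?_
    have := signI_sq hm
    simp [h] at this

/-- The scalar curl of the plane fields. -/
noncomputable def planeCurl : PlaneIdx → ℝ → ℝ → ℂ
  | .plus _ _ _ => 0
  | .minus m j _ => -kappa m j • zernike m j

theorem isPlaneCurl_planeFam : ∀ i, IsPlaneCurl (planeFam i) (planeCurl i)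
  | .plus m j hj => isPlaneCurl_nPlus m j hj
  | .minus m j hj => isPlaneCurl_nMinus m j hj

theorem IsPlaneCurl.sum {ι : Type*} (s : Finset ι) {v : ι → ℝ → ℝ → Fin 2 → ℂ}
    {h : ι → ℝ → ℝ → ℂ} (hv : ∀ i, IsPlaneCurl (v i) (h i)) :
    IsPlaneCurl (∑ i ∈ s, v i) (∑ i ∈ s, h i) := by
  classical
  induction s using Finset.induction_on with
  | empty => exact ⟨fun i => contDiff_const, fun x y => by simp⟩
  | insert i s hi ih => rw [Finset.sum_insert hi, Finset.sum_insert hi]; exact (hv i).add ih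

theorem IsPlaneGrad.sum {ι : Type*} (s : Finset ι) {u : ι → ℝ → ℝ → ℂ}
    {v : ι → ℝ → ℝ → Fin 2 → ℂ} (hv : ∀ i, IsPlaneGrad (u i) (v i)) :
    IsPlaneGrad (∑ i ∈ s, u i) (∑ i ∈ s, v i) := by
  classical
  induction s using Finset.induction_on with
  | empty => exact ⟨contDiff_const, fun x y => hasDerivAt_const _ _, fun x y => hasDerivAt_const _ _⟩
  | insert i s hi ih =>
    rw [Finset.sum_insert hi, Finset.sum_insert hi]
    exact ⟨(hv i).smooth.add ih.smooth, fun x y => ((hv i).left x y).add (ih.left x y),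
      fun x y => ((hv i).right x y).add (ih.right x y)⟩

theorem IsPlaneGrad.smul {u : ℝ → ℝ → ℂ} {v : ℝ → ℝ → Fin 2 → ℂ} (h : IsPlaneGrad u v) (a : ℂ) :
    IsPlaneGrad (a • u) (a • v) :=
  ⟨contDiff_const.mul h.smooth, fun x y => (h.left x y).const_mul a,
    fun x y => (h.right x y).const_mul a⟩

theorem IsPlaneCurl.eq_zero_of_disk {v : ℝ → ℝ → Fin 2 → ℂ} {h : ℝ → ℝ → ℂ} (hv : IsPlaneCurl v h)
    (h0 : ∀ q ∈ disk, v q.1 q.2 = 0) : ∀ q ∈ disk, h q.1 q.2 = 0 := by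
  intro q hq
  have hopen : IsOpen disk := isOpen_lt (by fun_prop) continuous_const
  rw [← hv.curl q.1 q.2]
  have h1 : ∀ᶠ s in nhds q.1, v s q.2 1 = 0 := by
    have : ∀ᶠ s in nhds q.1, (s, q.2) ∈ disk :=
      (Continuous.prodMk_left q.2).continuousAt.eventually (hopen.mem_nhds hq)
    filter_upwards [this] with s hs
    exact congrFun (h0 (s, q.2) hs) 1
  have h2 : ∀ᶠ s in nhds q.2, v q.1 s 0 = 0 := by
    have : ∀ᶠ s in nhds q.2, (q.1, s) ∈ disk :=
      (Continuous.prodMk_right q.1).continuousAt.eventually (hopen.mem_nhds hq)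
    filter_upwards [this] with s hs
    exact congrFun (h0 (q.1, s) hs) 0
  rw [Filter.EventuallyEq.deriv_eq (f := fun _ => (0 : ℂ)) h1,
    Filter.EventuallyEq.deriv_eq (f := fun _ => (0 : ℂ)) h2]
  simp

/-- Along the horizontal chord from (x, y) to the circle u is constant, and it ends with the value
zero. -/
theorem IsPlaneGrad.eq_zero_of_disk {u : ℝ → ℝ → ℂ} {v : ℝ → ℝ → Fin 2 → ℂ} (hu : IsPlaneGrad u v)
    (h0 : ∀ q ∈ disk, v q.1 q.2 = 0) (hb : ∀ x y : ℝ, x ^ 2 + y ^ 2 = 1 → u x y = 0) :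
    ∀ q ∈ disk, u q.1 q.2 = 0 := by
  rintro ⟨x, y⟩ hq
  change x ^ 2 + y ^ 2 < 1 at hq
  set R := Real.sqrt (1 - y ^ 2) with hR
  have hR2 : R ^ 2 = 1 - y ^ 2 := Real.sq_sqrt (by nlinarith [sq_nonneg x])
  have hx : x < R := by
    refine lt_of_le_of_lt (le_abs_self x) (abs_lt_of_sq_lt_sq (by linarith) (Real.sqrt_nonneg _))
  have hRx : -R < x := by
    have := abs_lt_of_sq_lt_sq (by linarith : x ^ 2 < R ^ 2) (Real.sqrt_nonneg _)
    exact (abs_lt.1 this).1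
  have hc := constant_of_has_deriv_right_zero (f := fun s => u s y) (a := x) (b := R)
    (fun s _ => (hu.left s y).continuousAt.continuousWithinAt) (fun s hs => by
      have : v s y = 0 := h0 (s, y) (by
        change s ^ 2 + y ^ 2 < 1
        have h1 := hs.1
        have h2 := hs.2
        nlinarith)
      have h3 := (hu.left s y).hasDerivWithinAt (s := Set.Ici s)
      rwa [this] at h3) R (Set.right_mem_Icc.2 hx.le)
  change u x y = 0
  rw [← hc]
  exact hb R y (by linarith)

/-- The plane fields are independent on the open disk. -/
theorem linearIndependent_planeFam :
    LinearIndependent ℂ (fun (i : PlaneIdx) (q : disk) => planeFam i q.1.1 q.1.2) := by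
  classical
  rw [linearIndependent_iff']
  intro s g hg
  have hv : ∀ q ∈ disk, (∑ i ∈ s, g i • planeFam i) q.1 q.2 = 0 := by
    intro q hq
    simpa [Finset.sum_apply] using congrFun hg ⟨q, hq⟩
  -- the curl kills the coefficients of the fields `n⁻`
  have hcurl := (IsPlaneCurl.sum s (fun i => (isPlaneCurl_planeFam i).smul (g i))).eq_zero_of_disk hv
  have hminus : ∀ m j hj, PlaneIdx.minus m j hj ∈ s → g (.minus m j hj) = 0 := by
    let e : {p : ℤ × ℕ // 1 - |p.1| ≤ (p.2 : ℤ)} → PlaneIdx := fun p => .minus p.1.1 p.1.2 p.2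
    have he : Function.Injective e := by
      rintro ⟨⟨m, j⟩, h⟩ ⟨⟨m', j'⟩, h'⟩ hh
      simp only [e, PlaneIdx.minus.injEq] at hh
      simp [hh.1, hh.2]
    have hli : LinearIndependent ℂ (fun (p : {p : ℤ × ℕ // 1 - |p.1| ≤ (p.2 : ℤ)}) (q : disk) =>
        planeCurl (e p) q.1.1 q.1.2) :=
      LinearIndependent.smul_of_ne_zero
        (linearIndependent_zernike.comp Subtype.val Subtype.val_injective)
        (c := fun p => -kappa p.1.1 p.1.2) (fun p => neg_ne_zero.2 (kappa_ne_zero p.2))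
    intro m j hj hs
    refine linearIndependent_iff'.1 hli (s.preimage e he.injOn) (fun p => g (e p)) ?_
      ⟨(m, j), hj⟩ (Finset.mem_preimage.2 hs)
    ext q
    have h1 := hcurl q.1 q.2
    simp only [Finset.sum_apply, Pi.smul_apply] at h1 ⊢
    rw [Finset.sum_preimage e s he.injOn (fun i => g i • planeCurl i q.1.1 q.1.2)]
    · exact h1
    · rintro (⟨m, j, hj⟩ | ⟨m, j, hj⟩) _ hx
      · simp [planeCurl]
      · exact absurd ⟨⟨(m, j), hj⟩, rfl⟩ hx
  -- What remains is a combination of gradients of w_{mj}. The corresponding combination of the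
  -- functions themselves vanishes on the circle, so it is zero, and the w_{mj} are independent.
  have hplus : ∀ m j hj, PlaneIdx.plus m j hj ∈ s → g (.plus m j hj) = 0 := by
    let e : ℤ × ℕ → PlaneIdx := fun p => .plus p.1 (p.2 + 1) (by omega)
    have he : Function.Injective e := by
      rintro ⟨m, j⟩ ⟨m', j'⟩ hh
      simp only [e, PlaneIdx.plus.injEq] at hh
      simp; omega
    have hc : ∀ j : ℕ, (-(1 / ((j : ℂ) + 1))) ≠ 0 := fun j =>
      neg_ne_zero.2 (one_div_ne_zero (by exact_mod_cast Nat.succ_ne_zero j))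
    have hli : LinearIndependent ℂ (fun (p : ℤ × ℕ) (q : disk) =>
        ((-(1 / ((p.2 : ℂ) + 1))) • wZernike p.1 p.2) q.1.1 q.1.2) :=
      LinearIndependent.smul_of_ne_zero linearIndependent_wZernike
        (c := fun p => -(1 / ((p.2 : ℂ) + 1))) (fun p => hc p.2)
    have hgrad := (IsPlaneGrad.sum (s.preimage e he.injOn) (fun p : ℤ × ℕ =>
      ((isPlaneGrad_gradW p.1 p.2).smul (-(1 / ((p.2 : ℂ) + 1)))).smul (g (e p)))).eq_zero_of_disk
      (fun q hq => by
        have h1 := hv q hq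
        simp only [Finset.sum_apply, Pi.smul_apply] at h1 ⊢
        rw [← h1, ← Finset.sum_preimage e s he.injOn (fun i => g i • planeFam i q.1 q.2)]
        · refine Finset.sum_congr rfl fun p _ => ?_
          simp only [e, planeFam, nPlus_succ, Pi.smul_apply]
        · rintro (⟨m, j, hj⟩ | ⟨m, j, hj⟩) hs hx
          · exact absurd ⟨(m, j - 1), by simp only [e]; congr; omega⟩ hx
          · simp [hminus m j hj hs])
      (fun x y hxy => by
        simp only [Finset.sum_apply, Pi.smul_apply]
        exact Finset.sum_eq_zero fun p _ => by simp [wZernike_eq_zero p.1 p.2 hxy])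
    intro m j hj hs
    obtain ⟨j, rfl⟩ : ∃ i, j = i + 1 := ⟨j - 1, by omega⟩
    refine linearIndependent_iff'.1 hli (s.preimage e he.injOn) (fun p => g (e p)) ?_
      (m, j) (Finset.mem_preimage.2 hs)
    ext q
    have h1 := hgrad q.1 q.2
    simpa [Finset.sum_apply] using h1
  rintro (⟨m, j, hj⟩ | ⟨m, j, hj⟩) hs
  exacts [hplus m j hj hs, hminus m j hj hs]

/-! ### Independence on the cylinder -/

/-- The point of the cylinder with given axial and plane coordinates. -/
def Cylinder.point (c : Cylinder) (p : c.axis × disk) : c.region :=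
  ⟨![p.2.1.1, p.2.1.2, p.1.1], by
    have h1 := p.2.2
    change p.2.1.1 ^ 2 + p.2.1.2 ^ 2 < 1 at h1
    have h2 := p.1.2
    cases c
    · exact ⟨h1.le, h2.1, h2.2⟩
    · exact ⟨h1.le, h2.1, h2.2⟩⟩

section

variable {c : Cylinder} {K : Type} {a b : K → ℝ → ℂ}

theorem indepOn_scal {ι : Type} {u : ι → ℝ → ℝ → ℂ}
    (ha : LinearIndependent ℂ (fun k (z : c.axis) => a k z))
    (hu : LinearIndependent ℂ (fun i (q : disk) => u i q.1.1 q.1.2)) :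
    IndepOn c (fun i : K × ι => scal (a i.1) (u i.2)) := by
  refine LinearIndependent.of_comap (c.point) ?_
  refine LinearIndependent.congr_apply
    (LinearIndependent.tensor (β := fun _ i (q : disk) => u i q.1.1 q.1.2) ha (fun _ => hu)) ?_
  intro i x
  simp [scal, Cylinder.point]

theorem indepOn_vert {ι : Type} {u : ι → ℝ → ℝ → ℂ}
    (ha : LinearIndependent ℂ (fun k (z : c.axis) => a k z))
    (hu : LinearIndependent ℂ (fun i (q : disk) => u i q.1.1 q.1.2)) :
    IndepOn c (fun i : K × ι => vert (a i.1) (u i.2)) := by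
  refine LinearIndependent.of_comp ((LinearMap.proj (2 : Fin 3)).compLeft c.region) ?_
  refine LinearIndependent.congr_apply (indepOn_scal ha hu) fun i p => ?_
  simp [vert, scal]

theorem indepOn_horiz {ι : Type} {v : ι → ℝ → ℝ → Fin 2 → ℂ}
    (ha : LinearIndependent ℂ (fun k (z : c.axis) => a k z))
    (hv : LinearIndependent ℂ (fun i (q : disk) => v i q.1.1 q.1.2)) :
    IndepOn c (fun i : K × ι => horiz (a i.1) (v i.2)) := by
  refine LinearIndependent.of_comap (c.point) ?_
  refine LinearIndependent.of_comp ((LinearMap.funLeft ℂ ℂ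
    (Fin.castSucc : Fin 2 → Fin 3)).compLeft (c.axis × disk)) ?_
  refine LinearIndependent.congr_apply
    (LinearIndependent.tensor (β := fun _ i (q : disk) => v i q.1.1 q.1.2) ha (fun _ => hv)) ?_
  intro i p
  ext l
  fin_cases l <;> simp [horiz, Cylinder.point, LinearMap.funLeft]

/-- The horizontal fields lie in the kernel of the third component, the vertical ones in the kernel
of the first two; these kernels meet in zero. -/
theorem indepOn_horiz_vert {ι κ : Type} {v : ι → ℝ → ℝ → Fin 2 → ℂ} {u : κ → ℝ → ℝ → ℂ}
    (ha : LinearIndependent ℂ (fun k (z : c.axis) => a k z))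
    (hb : LinearIndependent ℂ (fun k (z : c.axis) => b k z))
    (hv : LinearIndependent ℂ (fun i (q : disk) => v i q.1.1 q.1.2))
    (hu : LinearIndependent ℂ (fun i (q : disk) => u i q.1.1 q.1.2)) :
    IndepOn c (Sum.elim (fun i : K × ι => horiz (a i.1) (v i.2))
      (fun i : K × κ => vert (b i.1) (u i.2))) := by
  have h := LinearIndependent.sum_type (indepOn_horiz ha hv) (indepOn_vert hb hu) ?_
  · refine LinearIndependent.congr_apply h fun i p => ?_
    rcases i with i | i <;> rfl
  · have h1 : Submodule.span ℂ (Set.range fun (i : K × ι) (p : c.region) =>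
        horiz (a i.1) (v i.2) p) ≤
        LinearMap.ker ((LinearMap.proj (R := ℂ) (φ := fun _ : Fin 3 => ℂ) 2).compLeft c.region) := by
      rw [Submodule.span_le]
      rintro _ ⟨i, rfl⟩
      ext p; simp [horiz]
    have h2 : Submodule.span ℂ (Set.range fun (i : K × κ) (p : c.region) =>
        vert (b i.1) (u i.2) p) ≤ LinearMap.ker ((LinearMap.funLeft ℂ ℂ
          (Fin.castSucc : Fin 2 → Fin 3)).compLeft c.region) := by
      rw [Submodule.span_le]
      rintro _ ⟨i, rfl⟩
      ext p l; fin_cases l <;> simp [vert, LinearMap.funLeft]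
    refine Disjoint.mono h1 h2 (Submodule.disjoint_def.2 fun f hf hf' => ?_)
    ext p l
    have e2 := congrFun hf p
    have e0 := congrFun (congrFun hf' p) 0
    have e1 := congrFun (congrFun hf' p) 1
    fin_cases l
    exacts [e0, e1, e2]

/-- Vector indices as tensor indices. -/
def VecIdx.toSum : VecIdx K → (K × PlaneIdx) ⊕ (K × ℤ × ℕ)
  | .plus m k j hj => .inl (k, .plus m j hj)
  | .minus m k j hj => .inl (k, .minus m j hj)
  | .axial m k j => .inr (k, m, j)

theorem VecIdx.toSum_injective : Function.Injective (VecIdx.toSum (K := K)) := by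
  rintro (⟨m, k, j, hj⟩ | ⟨m, k, j, hj⟩ | ⟨m, k, j⟩) (⟨m', k', j', hj'⟩ | ⟨m', k', j', hj'⟩ | ⟨m', k', j'⟩) h <;>
    simp [VecIdx.toSum] at h ⊢ <;> tauto

theorem linearIndependent_rotField :
    LinearIndependent ℂ (fun (i : PlaneIdx) (q : disk) => rotField (planeFam i) q.1.1 q.1.2) := by
  -- This matrix is the rotation by -π/2, which undoes `rotField`.
  let L : (Fin 2 → ℂ) →ₗ[ℂ] (Fin 2 → ℂ) := Matrix.mulVecLin !![0, 1; -1, 0]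
  refine LinearIndependent.of_comp (L.compLeft disk) ?_
  refine LinearIndependent.congr_apply linearIndependent_planeFam fun i q => ?_
  ext l
  fin_cases l <;> simp [L, rotField]

theorem indepOn_curlFam (ha : LinearIndependent ℂ (fun k (z : c.axis) => a k z))
    (hb : LinearIndependent ℂ (fun k (z : c.axis) => b k z)) : IndepOn c (curlFam a b) := by
  have h := LinearIndependent.comp (indepOn_horiz_vert ha hb linearIndependent_planeFam
    linearIndependent_wZernike) _ VecIdx.toSum_injective
  refine LinearIndependent.congr_apply h fun i p => ?_
  rcases i with ⟨m, k, j, hj⟩ | ⟨m, k, j, hj⟩ | ⟨m, k, j⟩ <;> rfl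

theorem indepOn_divFam (ha : LinearIndependent ℂ (fun k (z : c.axis) => a k z))
    (hb : LinearIndependent ℂ (fun k (z : c.axis) => b k z)) : IndepOn c (divFam a b) := by
  have h := LinearIndependent.comp (indepOn_horiz_vert hb ha linearIndependent_rotField
    linearIndependent_zernike) _ VecIdx.toSum_injective
  refine LinearIndependent.congr_apply h fun i p => ?_
  rcases i with ⟨m, k, j, hj⟩ | ⟨m, k, j, hj⟩ | ⟨m, k, j⟩
  · simp [divFam, VecIdx.toSum, tPlus_eq, planeFam]
  · simp [divFam, VecIdx.toSum, tMinus_eq, planeFam]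
  · rfl

theorem indepOn_h1Fam (ha : LinearIndependent ℂ (fun k (z : c.axis) => a k z)) :
    IndepOn c (h1Fam a) :=
  LinearIndependent.comp (indepOn_scal ha linearIndependent_wZernike)
    (fun i : ℤ × K × ℕ => (i.2.1, i.1, i.2.2)) (by rintro ⟨m, k, j⟩ ⟨m', k', j'⟩ h; simp at h ⊢; tauto)

theorem indepOn_l2Fam (hb : LinearIndependent ℂ (fun k (z : c.axis) => b k z)) :
    IndepOn c (l2Fam b) :=
  LinearIndependent.comp (indepOn_scal hb linearIndependent_zernike)
    (fun i : ℤ × K × ℕ => (i.2.1, i.1, i.2.2)) (by rintro ⟨m, k, j⟩ ⟨m', k', j'⟩ h; simp at h ⊢; tauto)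

/-- Independence on the cylinder implies independence as functions on space. -/
theorem IndepOn.linearIndependent {ι V : Type} [AddCommGroup V] [Module ℂ V]
    {F : ι → (Fin 3 → ℝ) → V} (h : IndepOn c F) : LinearIndependent ℂ F :=
  LinearIndependent.of_comap (fun p : c.region => (p : Fin 3 → ℝ)) h

end

/-! ### Approximate identities in one variable -/

/-- The kernels `(x, y) ↦ ψ n (lam n * x - y)` are a smooth approximate identity on `Z`. -/
structure IsApproxKernel (Z : Set ℝ) (ψ : ℕ → ℝ → ℝ) (lam : ℕ → ℝ) : Prop where
  smooth : ∀ n, ContDiff ℝ (⊤ : ℕ∞) (ψ n)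
  nonneg : ∀ n, ∀ x ∈ Z, ∀ y ∈ Z, 0 ≤ ψ n (lam n * x - y)
  left : ∀ n, ∀ x ∈ Z, ∫ y in Z, ψ n (lam n * x - y) ≤ 1
  right : ∀ n, ∀ y ∈ Z, ∫ x in Z, ψ n (lam n * x - y) ≤ 1
  one_le : ∀ n, 1 ≤ lam n
  tendsto_lam : Filter.Tendsto lam Filter.atTop (nhds 1)
  tendsto : ∀ f : ℝ → ℝ, Continuous f → ∀ x ∈ interior Z,
    Filter.Tendsto (fun n => ∫ y in Z, ψ n (lam n * x - y) * f y) Filter.atTop (nhds (f x))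

/-- The Landau kernel. -/
noncomputable def landau (n : ℕ) (s : ℝ) : ℝ :=
  (∫ s in (-3 : ℝ)..3, (1 - s ^ 2 / 9) ^ n)⁻¹ * (1 - s ^ 2 / 9) ^ n

theorem one_sub_sq_nonneg {s : ℝ} (hs : s ∈ Set.Icc (-3 : ℝ) 3) : 0 ≤ 1 - s ^ 2 / 9 := by
  nlinarith [hs.1, hs.2]

theorem landau_integral_pos (n : ℕ) : 0 < ∫ s in (-3 : ℝ)..3, (1 - s ^ 2 / 9) ^ n := by
  refine intervalIntegral.intervalIntegral_pos_of_pos_on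
    (Continuous.intervalIntegrable (by fun_prop) _ _) (fun s hs => ?_) (by norm_num)
  exact pow_pos (by nlinarith [hs.1, hs.2]) n

theorem landau_nonneg (n : ℕ) {s : ℝ} (hs : s ∈ Set.Icc (-3 : ℝ) 3) : 0 ≤ landau n s :=
  mul_nonneg (inv_nonneg.2 (landau_integral_pos n).le) (pow_nonneg (one_sub_sq_nonneg hs) n)

theorem continuous_landau (n : ℕ) : Continuous (landau n) := by
  unfold landau; fun_prop

theorem integral_landau_le {n : ℕ} {a b : ℝ} (ha : -3 ≤ a) (hab : a ≤ b) (hb : b ≤ 3) :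
    ∫ s in a..b, landau n s ≤ 1 := by
  refine (intervalIntegral.integral_mono_interval ha hab hb ?_
    ((continuous_landau n).intervalIntegrable _ _)).trans_eq ?_
  · filter_upwards [ae_restrict_mem measurableSet_Ioc] with s hs
    exact landau_nonneg n ⟨hs.1.le, hs.2⟩
  · simp only [landau]
    rw [intervalIntegral.integral_const_mul, inv_mul_cancel₀ (landau_integral_pos n).ne']

/-- For x, y in [-1, 1] the difference stays in [-2, 2], inside the interval [-3, 3] on which 1 -
s²/9 is nonnegative with its only maximum at 0. Powers of such a function concentrate at the
maximum. -/
theorem isApproxKernel_landau :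
    IsApproxKernel (Set.Icc (-1) 1) landau (fun _ => 1) where
  smooth n := by unfold landau; fun_prop
  nonneg n x hx y hy := landau_nonneg n ⟨by linarith [hx.1, hy.2], by linarith [hx.2, hy.1]⟩
  left n x hx := by
    rw [integral_Icc_eq_integral_Ioc, ← intervalIntegral.integral_of_le (by norm_num),
      intervalIntegral.integral_comp_sub_left (fun s => landau n s)]
    exact integral_landau_le (by linarith [hx.1]) (by linarith) (by linarith [hx.2])
  right n y hy := by
    simp only [one_mul]
    rw [integral_Icc_eq_integral_Ioc, ← intervalIntegral.integral_of_le (by norm_num),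
      intervalIntegral.integral_comp_sub_right (fun s => landau n s)]
    exact integral_landau_le (by linarith [hy.2]) (by linarith) (by linarith [hy.1])
  one_le _ := le_rfl
  tendsto_lam := tendsto_const_nhds
  tendsto f hf x hx := by
    rw [interior_Icc] at hx
    -- The substitution s = x - y moves the integration window to (x-1, x+1]; the cut-off makes it
    -- part of the fixed interval [-3, 3], and it contains 0 in its interior when x is interior.
    set g : ℝ → ℝ := (Set.Ioc (x - 1) (x + 1)).indicator (fun s => f (x - s)) with hg
    have hfi : IntegrableOn (fun s => f (x - s)) (Set.Icc (-3 : ℝ) 3) :=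
      (Continuous.continuousOn (by fun_prop)).integrableOn_compact isCompact_Icc
    have hmem : Set.Ioc (x - 1) (x + 1) ∈ nhds (0 : ℝ) :=
      Ioc_mem_nhds (by linarith [hx.2]) (by linarith [hx.1])
    have hg0 : g 0 = f x := by
      rw [hg, Set.indicator_of_mem (mem_of_mem_nhds hmem), sub_zero]
    have h := tendsto_setIntegral_pow_smul_of_unique_maximum_of_isCompact_of_integrableOn
      (μ := volume) (s := Set.Icc (-3 : ℝ) 3) (x₀ := 0) (g := g) isCompact_Icc
      (c := fun s => 1 - s ^ 2 / 9) (Continuous.continuousOn (by fun_prop))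
      (fun y _ hy => by have := sq_pos_of_ne_zero hy; simp; linarith)
      (fun y hy => one_sub_sq_nonneg hy) (by norm_num)
      (subset_closure (by rw [interior_Icc]; norm_num))
      (hfi.indicator measurableSet_Ioc) (ContinuousAt.continuousWithinAt (by
        have : Continuous fun s => f (x - s) := by fun_prop
        refine this.continuousAt.congr ?_
        filter_upwards [hmem] with s hs
        rw [hg, Set.indicator_of_mem hs]))
    rw [hg0] at h
    refine h.congr fun n => ?_
    rw [integral_Icc_eq_integral_Ioc, integral_Icc_eq_integral_Ioc, integral_Icc_eq_integral_Ioc,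
      ← intervalIntegral.integral_of_le (by norm_num), ← intervalIntegral.integral_of_le
      (by norm_num : (-1 : ℝ) ≤ 1)]
    have e1 : ∀ y, landau n (1 * x - y) * f y = (fun s => landau n s * f (x - s)) (x - y) := by
      intro y; simp
    simp only [e1]
    rw [intervalIntegral.integral_comp_sub_left (fun s => landau n s * f (x - s)) x,
      show x - -1 = x + 1 by ring, intervalIntegral.integral_of_le (by linarith : x - 1 ≤ x + 1)]
    have e2 : ∀ s, (1 - s ^ 2 / 9) ^ n • g s = (Set.Ioc (x - 1) (x + 1)).indicator
        (fun s => (1 - s ^ 2 / 9) ^ n * f (x - s)) s := by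
      intro s
      by_cases hs : s ∈ Set.Ioc (x - 1) (x + 1) <;> simp [hg, hs]
    simp only [e2]
    rw [setIntegral_indicator measurableSet_Ioc, Set.inter_eq_right.2
      (Set.Ioc_subset_Ioc (by linarith [hx.1]) (by linarith [hx.2])), smul_eq_mul,
      ← integral_const_mul]
    simp only [landau, mul_assoc]

/-- The kernel `((1 + cos s) / 2) ^ n`, normalised. -/
noncomputable def fejer (n : ℕ) (s : ℝ) : ℝ :=
  (∫ s in (0 : ℝ)..2 * Real.pi, ((1 + Real.cos s) / 2) ^ n)⁻¹ * ((1 + Real.cos s) / 2) ^ n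

theorem one_add_cos_nonneg (s : ℝ) : 0 ≤ (1 + Real.cos s) / 2 := by
  linarith [Real.neg_one_le_cos s]

theorem periodic_fejer (n : ℕ) : Function.Periodic (fejer n) (2 * Real.pi) := by
  intro s; simp [fejer]

theorem fejer_integral_pos (n : ℕ) :
    0 < ∫ s in (0 : ℝ)..2 * Real.pi, ((1 + Real.cos s) / 2) ^ n := by
  refine intervalIntegral.integral_pos Real.two_pi_pos (Continuous.continuousOn (by fun_prop))
    (fun s _ => pow_nonneg (one_add_cos_nonneg s) n) ⟨0, ⟨le_rfl, Real.two_pi_pos.le⟩, ?_⟩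
  simp

theorem fejer_nonneg (n : ℕ) (s : ℝ) : 0 ≤ fejer n s :=
  mul_nonneg (inv_nonneg.2 (fejer_integral_pos n).le) (pow_nonneg (one_add_cos_nonneg s) n)

theorem integral_fejer (n : ℕ) {a b : ℝ} (h : b = a + 2 * Real.pi) :
    ∫ s in a..b, fejer n s = 1 := by
  rw [h, (periodic_fejer n).intervalIntegral_add_eq a 0, zero_add]
  simp only [fejer]
  rw [intervalIntegral.integral_const_mul, inv_mul_cancel₀ (fejer_integral_pos n).ne']

/-- Periodicity makes the mass over any period exactly 1. The base (1 + cos s)/2 attains its maximum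
once per period, so its powers concentrate there. -/
theorem isApproxKernel_fejer :
    IsApproxKernel (Set.Ico 0 (2 * Real.pi)) fejer (fun _ => 1) where
  smooth n := by
    unfold fejer
    exact contDiff_const.mul (((contDiff_const.add Real.contDiff_cos).div_const 2).pow n)
  nonneg n x _ y _ := fejer_nonneg n _
  left n x hx := by
    rw [integral_Ico_eq_integral_Ioc, ← intervalIntegral.integral_of_le Real.two_pi_pos.le,
      intervalIntegral.integral_comp_sub_left (fun s => fejer n s),
      integral_fejer n (by ring)]
  right n y hy := by
    simp only [one_mul]
    rw [integral_Ico_eq_integral_Ioc, ← intervalIntegral.integral_of_le Real.two_pi_pos.le,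
      intervalIntegral.integral_comp_sub_right (fun s => fejer n s),
      integral_fejer n (by ring)]
  one_le _ := le_rfl
  tendsto_lam := tendsto_const_nhds
  tendsto f hf x hx := by
    rw [interior_Ico] at hx
    -- For 0 < x < 2π the window [x - 2π, x] contains 0 in its interior and no other multiple of 2π.
    have h := tendsto_setIntegral_pow_smul_of_unique_maximum_of_isCompact_of_continuousOn
      (μ := volume) (s := Set.Icc (x - 2 * Real.pi) x) (x₀ := 0) (g := fun s => f (x - s))
      isCompact_Icc
      (c := fun s => (1 + Real.cos s) / 2) (Continuous.continuousOn (by fun_prop))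
      (fun y hy hy0 => by
        have h1 : Real.cos y ≠ 1 := fun h => hy0
          ((Real.cos_eq_one_iff_of_lt_of_lt (by linarith [hy.1, hx.1]) (by linarith [hy.2, hx.2])).1 h)
        have h2 := lt_of_le_of_ne (Real.cos_le_one y) h1
        simp; linarith)
      (fun y _ => one_add_cos_nonneg y) (by norm_num)
      (subset_closure (by rw [interior_Icc]; exact ⟨by linarith [hx.2], hx.1⟩))
      (Continuous.continuousOn (by fun_prop))
    simp only [sub_zero] at h
    refine h.congr fun n => ?_
    rw [integral_Icc_eq_integral_Ioc, integral_Icc_eq_integral_Ioc, integral_Ico_eq_integral_Ioc,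
      ← intervalIntegral.integral_of_le (by linarith [Real.two_pi_pos]),
      ← intervalIntegral.integral_of_le (by linarith [Real.two_pi_pos]),
      ← intervalIntegral.integral_of_le Real.two_pi_pos.le]
    have e1 : ∀ y, fejer n (1 * x - y) * f y = (fun s => fejer n s * f (x - s)) (x - y) := by
      intro y; simp
    simp only [e1]
    rw [intervalIntegral.integral_comp_sub_left (fun s => fejer n s * f (x - s)) x, sub_zero]
    have hper : Function.Periodic (fun s => ((1 + Real.cos s) / 2) ^ n) (2 * Real.pi) := by
      intro s; simp
    have e2 : ∫ s in (x - 2 * Real.pi)..x, ((1 + Real.cos s) / 2) ^ n =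
        ∫ s in (0 : ℝ)..2 * Real.pi, ((1 + Real.cos s) / 2) ^ n := by
      have := hper.intervalIntegral_add_eq (x - 2 * Real.pi) 0
      simpa using this
    rw [e2, smul_eq_mul, ← intervalIntegral.integral_const_mul]
    simp only [fejer, mul_assoc, smul_eq_mul]

/-- The bump of radius `1 / (n + 1)`. -/
noncomputable def bumpSeq (n : ℕ) : ContDiffBump (0 : ℝ) where
  rIn := 1 / (2 * ((n : ℝ) + 1))
  rOut := 1 / ((n : ℝ) + 1)
  rIn_pos := by positivity
  rIn_lt_rOut := by
    apply one_div_lt_one_div_of_lt <;> [positivity; linarith [n.cast_nonneg (α := ℝ)]]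

/-- The normalised bump of radius `1 / (n + 1)`. -/
noncomputable def bump (n : ℕ) : ℝ → ℝ := (bumpSeq n).normed volume

/-- The dilation factors for `bump`. -/
noncomputable def bumpScale (n : ℕ) : ℝ := 1 + 3 * (1 / ((n : ℝ) + 1))

theorem bump_eq_zero {n : ℕ} {s : ℝ} (hs : 1 / ((n : ℝ) + 1) ≤ |s|) : bump n s = 0 := by
  rw [← Function.notMem_support, bump, ContDiffBump.support_normed_eq]
  simpa [bumpSeq] using hs

theorem one_le_bumpScale (n : ℕ) : 1 ≤ bumpScale n := by
  have : (0 : ℝ) ≤ 1 / ((n : ℝ) + 1) := by positivity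
  unfold bumpScale; linarith

theorem tendsto_bumpScale : Filter.Tendsto bumpScale Filter.atTop (nhds 1) := by
  have h := ((tendsto_one_div_add_atTop_nhds_zero_nat (𝕜 := ℝ)).const_mul 3).const_add 1
  change Filter.Tendsto (fun n : ℕ => 1 + 3 * (1 / ((n : ℝ) + 1))) Filter.atTop (nhds 1)
  simpa using h

theorem bump_nonneg (n : ℕ) (s : ℝ) : 0 ≤ bump n s := (bumpSeq n).nonneg_normed s

theorem integrable_bump (n : ℕ) : Integrable (bump n) := (bumpSeq n).integrable_normed

/-- The mass in y is at most 1; in x the dilation divides it by its factor, which is at least 1. The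
factor 1 + 3/(n+1) exceeds the kernel radius 1/(n+1) enough to push supports off the boundary, as
used in `Cylinder.isCore_mollify`. -/
theorem isApproxKernel_bump : IsApproxKernel (Set.Icc (-1) 1) bump bumpScale where
  smooth n := (bumpSeq n).contDiff_normed
  nonneg n x _ y _ := bump_nonneg n _
  left n x hx := by
    refine (setIntegral_le_integral ((integrable_bump n).comp_sub_left _)
      (Filter.Eventually.of_forall fun y => bump_nonneg n _)).trans_eq ?_
    rw [integral_sub_left_eq_self (fun s => bump n s)]
    exact (bumpSeq n).integral_normed
  right n y hy := by
    have h0 : (0 : ℝ) < bumpScale n := zero_lt_one.trans_le (one_le_bumpScale n)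
    refine (setIntegral_le_integral (((integrable_bump n).comp_sub_right y).comp_mul_left' h0.ne')
      (Filter.Eventually.of_forall fun y => bump_nonneg n _)).trans ?_
    rw [Measure.integral_comp_mul_left (fun s => bump n (s - y)),
      integral_sub_right_eq_self (fun s => bump n s)]
    have : ∫ s, bump n s = 1 := (bumpSeq n).integral_normed
    rw [this, smul_eq_mul, mul_one, abs_of_pos (inv_pos.2 h0)]
    exact inv_le_one_of_one_le₀ (one_le_bumpScale n)
  one_le := one_le_bumpScale
  tendsto_lam := tendsto_bumpScale
  tendsto f hf x hx := by
    have hmem : Set.Icc (-1 : ℝ) 1 ∈ nhds x := mem_interior_iff_mem_nhds.1 hx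
    -- The integral is a convolution with f cut off to [-1, 1], evaluated at a moving point that
    -- tends to x; the cut-off function is continuous at the interior point x.
    have h := ContDiffBump.convolution_tendsto_right (μ := (volume : Measure ℝ)) (φ := bumpSeq)
      (g := fun _ => (Set.Icc (-1 : ℝ) 1).indicator f) (k := fun n => bumpScale n * x) (x₀ := x)
      (z₀ := f x) (l := Filter.atTop) (tendsto_one_div_add_atTop_nhds_zero_nat (𝕜 := ℝ))
      (Filter.Eventually.of_forall fun _ =>
        (hf.measurable.indicator measurableSet_Icc).aestronglyMeasurable) (by
        have h1 : Filter.Tendsto ((Set.Icc (-1 : ℝ) 1).indicator f) (nhds x) (nhds (f x)) := by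
          refine (hf.tendsto x).congr' ?_
          filter_upwards [hmem] with s hs
          rw [Set.indicator_of_mem hs]
        exact h1.comp Filter.tendsto_snd) (by simpa using tendsto_bumpScale.mul_const x)
    refine h.congr fun n => ?_
    rw [convolution_lsmul_swap, ← integral_indicator measurableSet_Icc]
    refine integral_congr_ae (Filter.Eventually.of_forall fun y => ?_)
    by_cases hy : y ∈ Set.Icc (-1 : ℝ) 1 <;> simp [hy, bump]

/-! ### Smoothing operators on the cylinders -/

/-- The sides of the smallest box that contains the cylinder. -/
def Cylinder.side (c : Cylinder) : Fin 3 → Set ℝ := ![Set.Icc (-1) 1, Set.Icc (-1) 1, c.axis]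

/-- The smallest box that contains the cylinder. -/
def Cylinder.box (c : Cylinder) : Set (Fin 3 → ℝ) := Set.univ.pi c.side

theorem Cylinder.region_subset_box (c : Cylinder) : c.region ⊆ c.box := by
  intro p hp i _
  have h : p 0 ^ 2 + p 1 ^ 2 ≤ 1 := by cases c <;> exact hp.1
  have h0 := abs_le.1 ((sq_le_one_iff_abs_le_one (p 0)).1 (by nlinarith [sq_nonneg (p 1)]))
  have h1 := abs_le.1 ((sq_le_one_iff_abs_le_one (p 1)).1 (by nlinarith [sq_nonneg (p 0)]))
  fin_cases i
  · exact h0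
  · exact h1
  · cases c <;> exact hp.2

theorem Cylinder.measurableSet_side (c : Cylinder) (i : Fin 3) : MeasurableSet (c.side i) := by
  fin_cases i
  · exact measurableSet_Icc
  · exact measurableSet_Icc
  · cases c
    exacts [measurableSet_Ico, measurableSet_Icc]

theorem Cylinder.measurableSet_box (c : Cylinder) : MeasurableSet c.box :=
  MeasurableSet.univ_pi c.measurableSet_side

theorem Cylinder.integrableOn_box (c : Cylinder) {E : Type*} [NormedAddCommGroup E]
    {f : (Fin 3 → ℝ) → E} (hf : Continuous f) : IntegrableOn f c.box := by
  have hc : IsCompact (Set.univ.pi fun _ : Fin 3 => Set.Icc (-7 : ℝ) 7) :=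
    isCompact_univ_pi fun _ => isCompact_Icc
  refine (hf.continuousOn.integrableOn_compact hc).mono_set ?_
  have h1 : Set.Icc (-1 : ℝ) 1 ⊆ Set.Icc (-7) 7 := Set.Icc_subset_Icc (by norm_num) (by norm_num)
  refine Set.pi_mono fun i _ => ?_
  fin_cases i
  · exact h1
  · exact h1
  · cases c
    · exact fun z hz => ⟨by linarith [hz.1], by linarith [hz.2, Real.pi_lt_d2]⟩
    · exact h1

theorem Cylinder.integral_box (c : Cylinder) (g : Fin 3 → ℝ → ℝ) :
    ∫ y in c.box, ∏ i, g i (y i) = ∏ i, ∫ s in c.side i, g i s := by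
  rw [Cylinder.box, volume_pi, Measure.restrict_pi_pi]
  exact integral_fintype_prod_eq_prod (fun i => g i)

theorem Cylinder.vol_le (c : Cylinder) : c.vol ≤ volume.restrict c.box :=
  Measure.restrict_mono c.region_subset_box le_rfl

theorem Cylinder.convex_region (c : Cylinder) : Convex ℝ c.region := by
  have h0 : Convex ℝ {p : Fin 3 → ℝ | p 0 ^ 2 + p 1 ^ 2 ≤ 1} := by
    intro p hp q hq a b ha hb hab
    change (a * p 0 + b * q 0) ^ 2 + (a * p 1 + b * q 1) ^ 2 ≤ 1
    change p 0 ^ 2 + p 1 ^ 2 ≤ 1 at hp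
    change q 0 ^ 2 + q 1 ^ 2 ≤ 1 at hq
    have hb' : b = 1 - a := by linarith
    have hab0 := mul_nonneg ha hb
    subst hb'
    nlinarith [mul_nonneg hab0 (add_nonneg (sq_nonneg (p 0 - q 0)) (sq_nonneg (p 1 - q 1))),
      mul_le_mul_of_nonneg_left hp ha, mul_le_mul_of_nonneg_left hq hb]
  have h2 : ∀ s : Set ℝ, Convex ℝ s → Convex ℝ {p : Fin 3 → ℝ | p 2 ∈ s} := fun s hs =>
    hs.linear_preimage (LinearMap.proj (R := ℝ) (φ := fun _ : Fin 3 => ℝ) 2)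
  cases c
  · exact h0.inter (h2 _ (convex_Ico 0 (2 * Real.pi)))
  · exact h0.inter (h2 _ (convex_Icc (-1) 1))

/-- The frontier of a convex set is a null set. -/
theorem Cylinder.ae_mem_interior (c : Cylinder) : ∀ᵐ p ∂c.vol, p ∈ interior c.region := by
  have h : ∀ᵐ p ∂c.vol, p ∉ frontier c.region :=
    ae_restrict_of_ae (measure_eq_zero_iff_ae_notMem.1 (c.convex_region.addHaar_frontier volume))
  filter_upwards [h, c.ae_mem_region] with p hp hp'
  by_contra h
  exact hp ⟨subset_closure hp', h⟩

theorem Cylinder.mem_interior_side {c : Cylinder} {p : Fin 3 → ℝ} (hp : p ∈ interior c.region)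
    (i : Fin 3) : p i ∈ interior (c.side i) := by
  have h := interior_mono c.region_subset_box hp
  rw [Cylinder.box, interior_pi_set Set.finite_univ] at h
  exact h i (Set.mem_univ i)

/-- A product kernel at step `n`. -/
noncomputable def prodKer (ψ : Fin 3 → ℕ → ℝ → ℝ) (n : ℕ) (s : Fin 3 → ℝ) : ℝ := ∏ i, ψ i n (s i)

/-- The argument `lam x - y`. -/
def dilSub (lam : Fin 3 → ℕ → ℝ) (n : ℕ) (x y : Fin 3 → ℝ) : Fin 3 → ℝ :=
  fun i => lam i n * x i - y i

/-- The smoothing operator with the kernel `∏ ψ_i (lam_i x_i - y_i)`. -/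
noncomputable def smoothOp (c : Cylinder) (ψ : Fin 3 → ℕ → ℝ → ℝ) (lam : Fin 3 → ℕ → ℝ) (n : ℕ)
    (u : Scalar) : Scalar :=
  fun x => ∫ y, (prodKer ψ n (dilSub lam n x y) : ℂ) * u y ∂c.vol

/-- A smooth approximate identity on a cylinder. -/
structure Cylinder.IsApprox (c : Cylinder) (ψ : Fin 3 → ℕ → ℝ → ℝ) (lam : Fin 3 → ℕ → ℝ) :
    Prop where
  kernel : ∀ i, IsApproxKernel (c.side i) (ψ i) (lam i)
  periodic : c = .periodic → ∀ n, Function.Periodic (ψ 2 n) (2 * Real.pi) ∧ lam 2 n = 1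

/-- Differentiation under the integral sign. -/
theorem contDiff_integral_kernel {c : Cylinder} {K : (Fin 3 → ℝ) × (Fin 3 → ℝ) → ℂ}
    (hK : ContDiff ℝ (⊤ : ℕ∞) K) {u : Scalar} (hu : Integrable u c.vol) :
    ContDiff ℝ 1 (fun x => ∫ y, K (x, y) * u y ∂c.vol) ∧
    ∀ i x, pd i (fun x => ∫ y, K (x, y) * u y ∂c.vol) x =
      ∫ y, pd i (fun x => K (x, y)) x * u y ∂c.vol := by
  set D : (Fin 3 → ℝ) × (Fin 3 → ℝ) → ((Fin 3 → ℝ) →L[ℝ] ℂ) := fun q =>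
    (fderiv ℝ K q).comp (ContinuousLinearMap.inl ℝ _ _) with hD
  have hDc : Continuous D :=
    (hK.continuous_fderiv (by simp)).clm_comp continuous_const
  have hKD : ∀ x y, HasFDerivAt (fun x => K (x, y)) (D (x, y)) x := fun x y =>
    ((hK.differentiable (by simp)) (x, y)).hasFDerivAt.comp x (hasFDerivAt_prodMk_left x y)
  -- Continuous kernels are bounded on a unit ball times the compact hull, so a multiple of ‖u‖
  -- dominates the integrands.
  have hbound : ∀ {E : Type} [NormedAddCommGroup E] (G : (Fin 3 → ℝ) × (Fin 3 → ℝ) → E),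
      Continuous G → ∀ x₀, ∃ C, ∀ᵐ y ∂c.vol, ∀ x ∈ Metric.closedBall x₀ 1, ‖G (x, y)‖ ≤ C := by
    intro E _ G hG x₀
    obtain ⟨C, hC⟩ := ((isCompact_closedBall x₀ 1).prod c.isCompact_hull).exists_bound_of_continuousOn
      hG.continuousOn
    refine ⟨C, ?_⟩
    filter_upwards [c.ae_mem_region] with y hy x hx
    exact hC (x, y) ⟨hx, c.region_subset_hull hy⟩
  have hnhds : ∀ x₀ : Fin 3 → ℝ, Metric.closedBall x₀ 1 ∈ nhds x₀ := fun x₀ =>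
    Metric.closedBall_mem_nhds x₀ one_pos
  have hmeas : ∀ x, AEStronglyMeasurable (fun y => u y • D (x, y)) c.vol := fun x =>
    hu.aestronglyMeasurable.smul (hDc.comp (Continuous.prodMk_right x)).aestronglyMeasurable
  have hint : ∀ x, Integrable (fun y => u y • D (x, y)) c.vol := by
    intro x
    obtain ⟨C, hC⟩ := hbound D hDc x
    refine (hu.norm.const_mul C).mono' (hmeas x) ?_
    filter_upwards [hC] with y hy
    rw [norm_smul, mul_comm]
    exact mul_le_mul_of_nonneg_right (hy x (Metric.mem_closedBall_self zero_le_one)) (norm_nonneg _)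
  have hmeas0 : ∀ x, AEStronglyMeasurable (fun y => K (x, y) * u y) c.vol := fun x =>
    (hK.continuous.comp (Continuous.prodMk_right x)).aestronglyMeasurable.mul
      hu.aestronglyMeasurable
  have hder : ∀ x₀, HasFDerivAt (fun x => ∫ y, K (x, y) * u y ∂c.vol)
      (∫ y, u y • D (x₀, y) ∂c.vol) x₀ := by
    intro x₀
    obtain ⟨C, hC⟩ := hbound D hDc x₀
    obtain ⟨C', hC'⟩ := hbound K hK.continuous x₀
    refine hasFDerivAt_integral_of_dominated_of_fderiv_le (hnhds x₀)
      (bound := fun y => C * ‖u y‖) (F' := fun x y => u y • D (x, y))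
      (Filter.Eventually.of_forall hmeas0) ?_ (hmeas x₀) ?_ (hu.norm.const_mul C) ?_
    · refine (hu.norm.const_mul C').mono' (hmeas0 x₀) ?_
      filter_upwards [hC'] with y hy
      rw [norm_mul]
      exact mul_le_mul_of_nonneg_right (hy x₀ (Metric.mem_closedBall_self zero_le_one))
        (norm_nonneg _)
    · filter_upwards [hC] with y hy x hx
      rw [norm_smul, mul_comm]
      exact mul_le_mul_of_nonneg_right (hy x hx) (norm_nonneg _)
    · exact Filter.Eventually.of_forall fun y x _ => (hKD x y).mul_const (u y)
  refine ⟨contDiff_one_iff_hasFDerivAt.2 ⟨_, ?_, hder⟩, fun i x => ?_⟩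
  · refine continuous_iff_continuousAt.2 fun x₀ => ?_
    obtain ⟨C, hC⟩ := hbound D hDc x₀
    refine continuousAt_of_dominated (bound := fun y => C * ‖u y‖)
      (Filter.Eventually.of_forall hmeas) ?_ (hu.norm.const_mul C)
      (Filter.Eventually.of_forall fun y =>
        (hDc.comp (Continuous.prodMk_left y)).continuousAt.const_smul (u y))
    filter_upwards [hnhds x₀] with x hx
    filter_upwards [hC] with y hy
    rw [norm_smul, mul_comm]
    exact mul_le_mul_of_nonneg_right (hy x hx) (norm_nonneg _)
  · rw [pd, (hder x).fderiv, ContinuousLinearMap.integral_apply (hint x)]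
    refine integral_congr_ae (Filter.Eventually.of_forall fun y => ?_)
    simp only [pd, (hKD x y).fderiv, smul_apply, smul_eq_mul]
    ring

section

variable {c : Cylinder} {ψ : Fin 3 → ℕ → ℝ → ℝ} {lam : Fin 3 → ℕ → ℝ}

theorem contDiff_prodKer (hψ : ∀ i n, ContDiff ℝ (⊤ : ℕ∞) (ψ i n)) (n : ℕ) :
    ContDiff ℝ (⊤ : ℕ∞) (fun s => (prodKer ψ n s : ℂ)) := by
  have h : ContDiff ℝ (⊤ : ℕ∞) (prodKer ψ n) :=
    contDiff_prod (f := fun i (s : Fin 3 → ℝ) => ψ i n (s i))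
      fun i _ => (hψ i n).comp (contDiff_apply ℝ ℝ i)
  exact ofRealCLM.contDiff.comp h

theorem contDiff_dilSub (lam : Fin 3 → ℕ → ℝ) (n : ℕ) :
    ContDiff ℝ (⊤ : ℕ∞) (fun q : (Fin 3 → ℝ) × (Fin 3 → ℝ) => dilSub lam n q.1 q.2) := by
  unfold dilSub; fun_prop

theorem contDiff_kernel (hψ : ∀ i n, ContDiff ℝ (⊤ : ℕ∞) (ψ i n)) (n : ℕ) :
    ContDiff ℝ (⊤ : ℕ∞) (fun q : (Fin 3 → ℝ) × (Fin 3 → ℝ) =>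
      (prodKer ψ n (dilSub lam n q.1 q.2) : ℂ)) :=
  (contDiff_prodKer hψ n).comp (contDiff_dilSub lam n)

theorem pd_kernel_left (hψ : ∀ i n, ContDiff ℝ (⊤ : ℕ∞) (ψ i n)) (n : ℕ) (i : Fin 3)
    (x y : Fin 3 → ℝ) : pd i (fun x => (prodKer ψ n (dilSub lam n x y) : ℂ)) x =
      lam i n * pd i (fun s => (prodKer ψ n s : ℂ)) (dilSub lam n x y) := by
  have hk := (contDiff_prodKer hψ n).differentiable (by simp)
  refine pd_eq_of_hasDerivAt (DifferentiableAt.comp x (hk _) (by unfold dilSub; fun_prop)) ?_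
  have e : ∀ s, dilSub lam n (Function.update x i s) y =
      Function.update (dilSub lam n x y) i (lam i n * s - y i) := by
    intro s; ext j
    by_cases h : j = i
    · subst h; simp [dilSub]
    · simp [dilSub, h]
  simp only [e]
  have h1 := hasDerivAt_update_pd hk i (dilSub lam n x y) (lam i n * x i - y i)
  have h2 : HasDerivAt (fun s => lam i n * s - y i) (lam i n) (x i) := by
    simpa using ((hasDerivAt_id (x i)).const_mul (lam i n)).sub_const (y i)
  have h3 := h1.scomp (x i) h2
  have e2 : Function.update (dilSub lam n x y) i (lam i n * x i - y i) = dilSub lam n x y :=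
    Function.update_eq_self i _
  rw [e2] at h3
  simpa [Function.comp_def] using h3

theorem pd_kernel_right (hψ : ∀ i n, ContDiff ℝ (⊤ : ℕ∞) (ψ i n)) (n : ℕ) (i : Fin 3)
    (x y : Fin 3 → ℝ) : pd i (fun y => (prodKer ψ n (dilSub lam n x y) : ℂ)) y =
      -pd i (fun s => (prodKer ψ n s : ℂ)) (dilSub lam n x y) := by
  have hk := (contDiff_prodKer hψ n).differentiable (by simp)
  refine pd_eq_of_hasDerivAt (DifferentiableAt.comp y (hk _) (by unfold dilSub; fun_prop)) ?_
  have e : ∀ s, dilSub lam n x (Function.update y i s) =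
      Function.update (dilSub lam n x y) i (lam i n * x i - s) := by
    intro s; ext j
    by_cases h : j = i
    · subst h; simp [dilSub]
    · simp [dilSub, h]
  simp only [e]
  have h1 := hasDerivAt_update_pd hk i (dilSub lam n x y) (lam i n * x i - y i)
  have h2 : HasDerivAt (fun s => lam i n * x i - s) (-1) (y i) := by
    simpa using (hasDerivAt_id (y i)).const_sub (lam i n * x i)
  have h3 := h1.scomp (y i) h2
  have e2 : Function.update (dilSub lam n x y) i (lam i n * x i - y i) = dilSub lam n x y :=
    Function.update_eq_self i _
  rw [e2] at h3
  simpa [Function.comp_def] using h3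

theorem Cylinder.IsApprox.contDiff_smoothOp (h : c.IsApprox ψ lam) (n : ℕ) {u : Scalar}
    (hu : Integrable u c.vol) : ContDiff ℝ 1 (smoothOp c ψ lam n u) :=
  (contDiff_integral_kernel (contDiff_kernel (lam := lam) (fun i => (h.kernel i).smooth) n) hu).1

/-- A derivative in x of the kernel is -lam times the derivative in y. After this exchange the
kernel, as a function of y, can be used as a test function. -/
theorem Cylinder.IsApprox.pd_smoothOp (h : c.IsApprox ψ lam) (n : ℕ) {u : Scalar}
    (hu : Integrable u c.vol) (i : Fin 3) (x : Fin 3 → ℝ) :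
    pd i (smoothOp c ψ lam n u) x =
      -(lam i n) * ∫ y, pd i (fun y => (prodKer ψ n (dilSub lam n x y) : ℂ)) y * u y ∂c.vol := by
  have hψ := fun i => (h.kernel i).smooth
  have h1 := (contDiff_integral_kernel (contDiff_kernel (lam := lam) hψ n) hu).2 i x
  unfold smoothOp
  rw [h1, ← integral_const_mul]
  refine integral_congr_ae (Filter.Eventually.of_forall fun y => ?_)
  simp only [pd_kernel_left hψ, pd_kernel_right hψ]
  ring

/-- The kernel is an admissible test function. -/
theorem Cylinder.IsApprox.smooth_kernel (h : c.IsApprox ψ lam) (n : ℕ) (x : Fin 3 → ℝ) :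
    c.Smooth (fun y => (prodKer ψ n (dilSub lam n x y) : ℂ)) := by
  refine Cylinder.smooth_iff.2 ⟨(contDiff_kernel (lam := lam) (fun i => (h.kernel i).smooth) n).comp
    (contDiff_prodMk_right x), ?_⟩
  cases c
  · intro p
    have h2 := ((h.periodic rfl n).1).sub_eq (lam 2 n * x 2 - p 2)
    simp only [prodKer, Fin.prod_univ_three, dilSub]
    simp [← sub_sub, h2]
  · trivial

end

/-! ### Convergence of the smoothing operators -/

/-- Cauchy–Schwarz for the factors k^(1/2) and k^(1/2) f. -/
theorem lintegral_mul_sq_le {α : Type*} [MeasurableSpace α] {μ : Measure α} {k f : α → ENNReal}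
    (hk : AEMeasurable k μ) (hf : AEMeasurable f μ) :
    (∫⁻ y, k y * f y ∂μ) ^ 2 ≤ (∫⁻ y, k y ∂μ) * ∫⁻ y, k y * f y ^ 2 ∂μ := by
  have h := ENNReal.lintegral_mul_le_Lp_mul_Lq μ Real.HolderConjugate.two_two
    (f := fun y => k y ^ (1 / 2 : ℝ)) (g := fun y => k y ^ (1 / 2 : ℝ) * f y)
    (hk.pow_const _) ((hk.pow_const _).mul hf)
  have e1 : ∀ a : ENNReal, (a ^ (1 / 2 : ℝ)) ^ (2 : ℝ) = a := fun a => by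
    rw [← ENNReal.rpow_mul]; norm_num
  have e2 : ∀ a : ENNReal, a ^ (1 / 2 : ℝ) * a ^ (1 / 2 : ℝ) = a := fun a => by
    rw [← ENNReal.rpow_add_of_nonneg _ _ (by norm_num) (by norm_num)]; norm_num
  simp only [Pi.mul_apply, ENNReal.mul_rpow_of_nonneg _ _ zero_le_two, e1, ← mul_assoc, e2] at h
  calc (∫⁻ y, k y * f y ∂μ) ^ 2 ≤ ((∫⁻ y, k y ∂μ) ^ (1 / 2 : ℝ) *
        (∫⁻ y, k y * f y ^ (2 : ℝ) ∂μ) ^ (1 / 2 : ℝ)) ^ 2 := by gcongr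
    _ = _ := by
      rw [← ENNReal.rpow_two, ENNReal.mul_rpow_of_nonneg _ _ zero_le_two, e1, e1]
      simp only [ENNReal.rpow_two]

/-- Schur's test for the square norm. -/
theorem lintegral_schur {α : Type*} [MeasurableSpace α] {μ : Measure α} [SFinite μ]
    {k : α → α → ENNReal} (hk : Measurable (Function.uncurry k)) {f : α → ENNReal}
    (hf : AEMeasurable f μ) (h1 : ∀ᵐ x ∂μ, ∫⁻ y, k x y ∂μ ≤ 1) (h2 : ∀ᵐ y ∂μ, ∫⁻ x, k x y ∂μ ≤ 1) :
    ∫⁻ x, (∫⁻ y, k x y * f y ∂μ) ^ 2 ∂μ ≤ ∫⁻ y, f y ^ 2 ∂μ := by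
  have hm : AEMeasurable (Function.uncurry fun x y => k x y * f y ^ 2) (μ.prod μ) :=
    AEMeasurable.mul (f := Function.uncurry k) (g := fun z : α × α => f z.2 ^ 2) hk.aemeasurable
      ((hf.pow_const 2).comp_snd)
  calc ∫⁻ x, (∫⁻ y, k x y * f y ∂μ) ^ 2 ∂μ ≤ ∫⁻ x, ∫⁻ y, k x y * f y ^ 2 ∂μ ∂μ := by
        refine lintegral_mono_ae ?_
        filter_upwards [h1] with x hx
        refine (lintegral_mul_sq_le hk.of_uncurry_left.aemeasurable hf).trans ?_
        calc _ ≤ 1 * ∫⁻ y, k x y * f y ^ 2 ∂μ := by gcongr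
          _ = _ := one_mul _
    _ = ∫⁻ y, ∫⁻ x, k x y * f y ^ 2 ∂μ ∂μ :=
        lintegral_lintegral_swap hm
    _ ≤ ∫⁻ y, f y ^ 2 ∂μ := by
        refine lintegral_mono_ae ?_
        filter_upwards [h2] with y hy
        rw [lintegral_mul_const _ hk.of_uncurry_right]
        calc _ ≤ 1 * f y ^ 2 := by gcongr
          _ = _ := one_mul _

theorem eLpNorm_two_eq {α E : Type*} [MeasurableSpace α] {μ : Measure α} [NormedAddCommGroup E]
    (f : α → E) : eLpNorm f 2 μ = (∫⁻ x, ‖f x‖ₑ ^ 2 ∂μ) ^ (1 / 2 : ℝ) := by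
  rw [eLpNorm_eq_lintegral_rpow_enorm_toReal two_ne_zero ENNReal.ofNat_ne_top]
  simp

theorem integrable_of_memLp_two (c : Cylinder) {E : Type*} [NormedAddCommGroup E]
    {u : (Fin 3 → ℝ) → E} (hu : MemLp u 2 c.vol) : Integrable u c.vol :=
  hu.integrable (by norm_num)

section

variable {c : Cylinder} {ψ : Fin 3 → ℕ → ℝ → ℝ} {lam : Fin 3 → ℕ → ℝ}

theorem Cylinder.IsApprox.nonneg (h : c.IsApprox ψ lam) (n : ℕ) {x y : Fin 3 → ℝ}
    (hx : x ∈ c.box) (hy : y ∈ c.box) : 0 ≤ prodKer ψ n (dilSub lam n x y) :=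
  Finset.prod_nonneg fun i _ => (h.kernel i).nonneg n _ (hx i trivial) _ (hy i trivial)

theorem Cylinder.IsApprox.continuous_kernel (h : c.IsApprox ψ lam) (n : ℕ) :
    Continuous (fun q : (Fin 3 → ℝ) × (Fin 3 → ℝ) => prodKer ψ n (dilSub lam n q.1 q.2)) := by
  unfold prodKer dilSub
  refine continuous_finsetProd _ fun i _ => ((h.kernel i).smooth n).continuous.comp ?_
  fun_prop

/-- On the enclosing box the integral of the product factorises; nonnegativity allows the passage
from the cylinder to the box. -/
theorem Cylinder.lintegral_le_one {c : Cylinder} {g : Fin 3 → ℝ → ℝ} (hg : ∀ i, Continuous (g i))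
    (h0 : ∀ i, ∀ s ∈ c.side i, 0 ≤ g i s) (h1 : ∀ i, ∫ s in c.side i, g i s ≤ 1) :
    ∫⁻ y, ENNReal.ofReal (∏ i, g i (y i)) ∂c.vol ≤ 1 := by
  have hc : Continuous fun y : Fin 3 → ℝ => ∏ i, g i (y i) :=
    continuous_finsetProd _ fun i _ => (hg i).comp (continuous_apply i)
  refine (lintegral_mono' c.vol_le le_rfl).trans ?_
  rw [← ofReal_integral_eq_lintegral_ofReal (c.integrableOn_box hc) ?_, c.integral_box g,
    ENNReal.ofReal_le_one]
  · exact Finset.prod_le_one (fun i _ => setIntegral_nonneg (c.measurableSet_side i) (h0 i))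
      fun i _ => h1 i
  · filter_upwards [ae_restrict_mem c.measurableSet_box] with y hy
    exact Finset.prod_nonneg fun i _ => h0 i _ (hy i trivial)

theorem Cylinder.IsApprox.lintegral_left (h : c.IsApprox ψ lam) (n : ℕ) {x : Fin 3 → ℝ}
    (hx : x ∈ c.region) :
    ∫⁻ y, ENNReal.ofReal (prodKer ψ n (dilSub lam n x y)) ∂c.vol ≤ 1 :=
  Cylinder.lintegral_le_one (g := fun i s => ψ i n (lam i n * x i - s))
    (fun i => ((h.kernel i).smooth n).continuous.comp (by fun_prop))
    (fun i s hs => (h.kernel i).nonneg n _ (c.region_subset_box hx i trivial) s hs)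
    (fun i => (h.kernel i).left n _ (c.region_subset_box hx i trivial))

theorem Cylinder.IsApprox.lintegral_right (h : c.IsApprox ψ lam) (n : ℕ) {y : Fin 3 → ℝ}
    (hy : y ∈ c.region) :
    ∫⁻ x, ENNReal.ofReal (prodKer ψ n (dilSub lam n x y)) ∂c.vol ≤ 1 :=
  Cylinder.lintegral_le_one (g := fun i s => ψ i n (lam i n * s - y i))
    (fun i => ((h.kernel i).smooth n).continuous.comp (by fun_prop))
    (fun i s hs => (h.kernel i).nonneg n s hs _ (c.region_subset_box hy i trivial))
    (fun i => (h.kernel i).right n _ (c.region_subset_box hy i trivial))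

theorem Cylinder.IsApprox.enorm_smoothOp_le (h : c.IsApprox ψ lam) (n : ℕ) {x : Fin 3 → ℝ}
    (hx : x ∈ c.region) (u : Scalar) : ‖smoothOp c ψ lam n u x‖ₑ ≤
      ∫⁻ y, ENNReal.ofReal (prodKer ψ n (dilSub lam n x y)) * ‖u y‖ₑ ∂c.vol := by
  refine (enorm_integral_le_lintegral_enorm _).trans (lintegral_mono_ae ?_)
  filter_upwards [c.ae_mem_region] with y hy
  rw [enorm_mul]
  have : ‖(prodKer ψ n (dilSub lam n x y) : ℂ)‖ₑ = ENNReal.ofReal (prodKer ψ n (dilSub lam n x y)) := by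
    rw [← ofReal_norm, Complex.norm_real, Real.norm_of_nonneg
      (h.nonneg n (c.region_subset_box hx) (c.region_subset_box hy))]
  rw [this]

/-- Schur's test with both masses of the kernel at most 1. The uniform bound lets strong convergence
be checked on a dense class. -/
theorem Cylinder.IsApprox.eLpNorm_smoothOp_le (h : c.IsApprox ψ lam) (n : ℕ) {u : Scalar}
    (hu : AEStronglyMeasurable u c.vol) :
    eLpNorm (smoothOp c ψ lam n u) 2 c.vol ≤ eLpNorm u 2 c.vol := by
  rw [eLpNorm_two_eq, eLpNorm_two_eq]
  refine ENNReal.rpow_le_rpow ?_ (by norm_num)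
  refine (lintegral_mono_ae ?_).trans (lintegral_schur
    (k := fun x y => ENNReal.ofReal (prodKer ψ n (dilSub lam n x y))) (f := fun y => ‖u y‖ₑ)
    (ENNReal.continuous_ofReal.comp (h.continuous_kernel n)).measurable hu.enorm ?_ ?_)
  · filter_upwards [c.ae_mem_region] with x hx
    exact pow_le_pow_left' (h.enorm_smoothOp_le n hx u) 2
  · filter_upwards [c.ae_mem_region] with x hx using h.lintegral_left n hx
  · filter_upwards [c.ae_mem_region] with x hx using h.lintegral_right n hx

theorem Cylinder.IsApprox.norm_smoothOp_le (h : c.IsApprox ψ lam) (n : ℕ) {x : Fin 3 → ℝ}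
    (hx : x ∈ c.region) {u : Scalar} {M : NNReal} (hM : ∀ y, ‖u y‖ₑ ≤ M) :
    ‖smoothOp c ψ lam n u x‖ₑ ≤ M := by
  refine (h.enorm_smoothOp_le n hx u).trans ?_
  calc _ ≤ ∫⁻ y, ENNReal.ofReal (prodKer ψ n (dilSub lam n x y)) * M ∂c.vol := by
        gcongr with y; exact hM y
    _ = (∫⁻ y, ENNReal.ofReal (prodKer ψ n (dilSub lam n x y)) ∂c.vol) * M := by
        refine lintegral_mul_const' _ _ ENNReal.coe_ne_top
    _ ≤ 1 * M := by gcongr; exact h.lintegral_left n hx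
    _ = M := one_mul _

/-- First moments of the kernels tend to zero. -/
theorem Cylinder.IsApprox.tendsto_moment (h : c.IsApprox ψ lam) {x : Fin 3 → ℝ}
    (hx : x ∈ interior c.region) {g : Fin 3 → ℝ → ℝ} (hg : ∀ i, Continuous (g i)) :
    Filter.Tendsto (fun n => ∫ y in c.box, prodKer ψ n (dilSub lam n x y) * ∏ i, g i (y i))
      Filter.atTop (nhds (∏ i, g i (x i))) := by
  have h1 : ∀ n, ∫ y in c.box, prodKer ψ n (dilSub lam n x y) * ∏ i, g i (y i) =
      ∏ i, ∫ s in c.side i, ψ i n (lam i n * x i - s) * g i s := by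
    intro n
    rw [← c.integral_box (fun i s => ψ i n (lam i n * x i - s) * g i s)]
    simp only [prodKer, dilSub, Finset.prod_mul_distrib]
  simp only [h1]
  exact tendsto_finsetProd _ fun i _ => (h.kernel i).tendsto (g i) (hg i) _ (c.mem_interior_side hx i)

/-- The function is extended by zero to the box, where the kernel is a product. The error against
φ(x) times the mass is controlled by the first absolute moments, which tend to zero, while the mass
tends to 1. -/
theorem Cylinder.IsApprox.tendsto_pointwise (h : c.IsApprox ψ lam) {x : Fin 3 → ℝ}
    (hx : x ∈ interior c.region) {φ : Scalar} (hφ : Continuous φ) {L M : ℝ}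
    (hM : ∀ y, ‖φ y‖ ≤ M) (hL : ∀ y z, ‖φ y - φ z‖ ≤ L * dist y z) (hL0 : 0 ≤ L) :
    Filter.Tendsto (fun n => smoothOp c ψ lam n φ x) Filter.atTop (nhds (φ x)) := by
  have hxr : x ∈ c.region := interior_subset hx
  have hM0 : 0 ≤ M := (norm_nonneg _).trans (hM 0)
  obtain ⟨r, hr, hball⟩ := Metric.isOpen_iff.1 isOpen_interior x hx
  set S : (Fin 3 → ℝ) → ℝ := fun y => ∑ i, |y i - x i| with hS
  have hdist : ∀ y, dist y x ≤ S y := by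
    intro y
    refine (dist_pi_le_iff (Finset.sum_nonneg fun i _ => abs_nonneg _)).2 fun i => ?_
    exact Finset.single_le_sum (f := fun i => |y i - x i|) (fun i _ => abs_nonneg _)
      (Finset.mem_univ i)
  have hScont : Continuous S :=
    continuous_finsetSum _ fun i _ => ((continuous_apply i).sub continuous_const).abs
  -- Within the cylinder the Lipschitz constant L suffices; outside it the distance to x is at least
  -- r, so the bound M is at most M/r times the distance.
  set A := L + M / r with hA
  have hbound : ∀ y, ‖c.region.indicator φ y - φ x‖ ≤ A * S y := by
    intro y
    have hS0 : 0 ≤ S y := dist_nonneg.trans (hdist y)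
    have hAS : A * S y = L * S y + M / r * S y := by rw [hA]; ring
    have hMr : 0 ≤ M / r := by positivity
    by_cases hy : y ∈ c.region
    · rw [Set.indicator_of_mem hy, hAS]
      have := (hL y x).trans (mul_le_mul_of_nonneg_left (hdist y) hL0)
      nlinarith [mul_nonneg hMr hS0]
    · rw [Set.indicator_of_notMem hy, zero_sub, norm_neg, hAS]
      have h1 : r ≤ S y := by
        refine le_trans ?_ (hdist y)
        by_contra hlt
        exact hy (interior_subset (hball (Metric.mem_ball.2 (not_le.1 hlt))))
      have h2 : M ≤ M / r * S y := by
        rw [div_mul_eq_mul_div, le_div_iff₀ hr]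
        exact mul_le_mul_of_nonneg_left h1 hM0
      have := hM x
      nlinarith [mul_nonneg hL0 hS0]
  have hK : ∀ n, Continuous fun y => prodKer ψ n (dilSub lam n x y) := fun n =>
    (h.continuous_kernel n).comp (Continuous.prodMk_right x)
  have hKc : ∀ n, Continuous fun y => (prodKer ψ n (dilSub lam n x y) : ℂ) := fun n =>
    continuous_ofReal.comp (hK n)
  -- mass and first moments
  have hmass : Filter.Tendsto (fun n => ∫ y in c.box, prodKer ψ n (dilSub lam n x y))
      Filter.atTop (nhds 1) := by
    simpa using h.tendsto_moment hx (g := fun _ _ => 1) (fun _ => continuous_const)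
  have hmom : Filter.Tendsto (fun n => ∫ y in c.box, prodKer ψ n (dilSub lam n x y) * S y)
      Filter.atTop (nhds 0) := by
    have h1 : ∀ i : Fin 3, Filter.Tendsto (fun n => ∫ y in c.box,
        prodKer ψ n (dilSub lam n x y) * |y i - x i|) Filter.atTop (nhds 0) := by
      intro i
      have h2 := h.tendsto_moment hx (g := fun j s => if j = i then |s - x j| else 1) (fun j => by
        by_cases hj : j = i
        · simp only [hj, if_true]; fun_prop
        · simp only [hj, if_false]; fun_prop)
      simpa using h2
    have h2 := tendsto_finsetSum Finset.univ fun i _ => h1 i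
    simp only [Finset.sum_const_zero] at h2
    refine h2.congr fun n => ?_
    rw [← integral_finsetSum]
    · simp only [hS, Finset.mul_sum]
    · exact fun i _ => c.integrableOn_box ((hK n).mul (by fun_prop))
  have hind : ∀ n, IntegrableOn (fun y => (prodKer ψ n (dilSub lam n x y) : ℂ) *
      c.region.indicator φ y) c.box := by
    intro n
    have := (c.integrableOn_box ((hKc n).mul hφ)).indicator c.measurableSet_region
    refine this.congr (Filter.Eventually.of_forall fun y => ?_)
    by_cases hy : y ∈ c.region <;> simp [hy]
  have hrep : ∀ n, smoothOp c ψ lam n φ x = ∫ y in c.box, (prodKer ψ n (dilSub lam n x y) : ℂ) *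
      c.region.indicator φ y := by
    intro n
    have e : ∀ y, (prodKer ψ n (dilSub lam n x y) : ℂ) * c.region.indicator φ y =
        c.region.indicator (fun y => (prodKer ψ n (dilSub lam n x y) : ℂ) * φ y) y := by
      intro y
      by_cases hy : y ∈ c.region <;> simp [hy]
    simp only [e]
    rw [setIntegral_indicator c.measurableSet_region, Set.inter_eq_right.2 c.region_subset_box]
    rfl
  have hdiff : ∀ n, ‖smoothOp c ψ lam n φ x -
      ((∫ y in c.box, prodKer ψ n (dilSub lam n x y) : ℝ) : ℂ) * φ x‖ ≤
      A * ∫ y in c.box, prodKer ψ n (dilSub lam n x y) * S y := by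
    intro n
    rw [hrep, ← integral_complex_ofReal, ← integral_mul_const, ← integral_sub (hind n)
      (c.integrableOn_box ((hKc n).fun_mul continuous_const)), ← integral_const_mul]
    refine norm_integral_le_of_norm_le ((c.integrableOn_box ((hK n).mul hScont)).const_mul A) ?_
    filter_upwards [ae_restrict_mem c.measurableSet_box] with y hy
    have hk := h.nonneg n (c.region_subset_box hxr) hy
    have e : (prodKer ψ n (dilSub lam n x y) : ℂ) * c.region.indicator φ y -
        (prodKer ψ n (dilSub lam n x y) : ℂ) * φ x =
        (prodKer ψ n (dilSub lam n x y) : ℂ) * (c.region.indicator φ y - φ x) := by ring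
    rw [e, norm_mul, Complex.norm_real, Real.norm_of_nonneg hk]
    calc _ ≤ prodKer ψ n (dilSub lam n x y) * (A * S y) :=
          mul_le_mul_of_nonneg_left (hbound y) hk
      _ = _ := by ring
  have h0 := squeeze_zero_norm hdiff (by simpa using hmom.const_mul A)
  have h1 : Filter.Tendsto (fun n => ((∫ y in c.box, prodKer ψ n (dilSub lam n x y) : ℝ) : ℂ) * φ x)
      Filter.atTop (nhds (φ x)) := by
    have := ((continuous_ofReal.tendsto 1).comp hmass).mul_const (φ x)
    simpa using this
  simpa using h0.add h1

/-- The smoothing operators converge strongly to the identity of `L²`. -/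
theorem Cylinder.IsApprox.tendsto_smoothOp (h : c.IsApprox ψ lam) {u : Scalar}
    (hu : MemLp u 2 c.vol) : Filter.Tendsto
      (fun n => eLpNorm (smoothOp c ψ lam n u - u) 2 c.vol) Filter.atTop (nhds 0) := by
  have hmeas : ∀ n {v : Scalar}, Integrable v c.vol →
      AEStronglyMeasurable (smoothOp c ψ lam n v) c.vol := fun n v hv =>
    (h.contDiff_smoothOp n hv).continuous.aestronglyMeasurable
  -- For smooth φ of compact support, pointwise convergence in the interior and the uniform bound
  -- allow dominated convergence. General u follows by approximation, with three errors of size δ.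
  have hsmooth : ∀ φ : Scalar, HasCompactSupport φ → ContDiff ℝ (⊤ : ℕ∞) φ → Filter.Tendsto
      (fun n => eLpNorm (smoothOp c ψ lam n φ - φ) 2 c.vol) Filter.atTop (nhds 0) := by
    intro φ hc hφ
    obtain ⟨M, hM⟩ := hc.exists_bound_of_continuous hφ.continuous
    obtain ⟨L, hL⟩ := ContDiff.lipschitzWith_of_hasCompactSupport hc hφ (by simp)
    have hM0 : 0 ≤ M := (norm_nonneg _).trans (hM 0)
    have hMe : ∀ y, ‖φ y‖ₑ ≤ (M.toNNReal : ENNReal) := by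
      intro y
      rw [← ofReal_norm]
      exact ENNReal.ofReal_le_ofReal (hM y)
    have hφi : Integrable φ c.vol := integrable_of_continuous c hφ.continuous
    simp only [eLpNorm_two_eq]
    have h0 : (0 : ENNReal) = 0 ^ (1 / 2 : ℝ) := by rw [ENNReal.zero_rpow_of_pos (by norm_num)]
    rw [h0]
    refine (ENNReal.continuous_rpow_const.tendsto _).comp ?_
    have h1 : (0 : ENNReal) = ∫⁻ _, 0 ∂c.vol := by simp
    rw [h1]
    refine tendsto_lintegral_of_dominated_convergence'
      (fun _ => ((M.toNNReal : ENNReal) + M.toNNReal) ^ 2)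
      (fun n => ((hmeas n hφi).sub hφi.aestronglyMeasurable).enorm.pow_const 2) (fun n => ?_) ?_ ?_
    · filter_upwards [c.ae_mem_region] with x hx
      refine pow_le_pow_left' (enorm_sub_le.trans ?_) 2
      exact add_le_add (h.norm_smoothOp_le n hx hMe) (hMe x)
    · simp [lintegral_const, ENNReal.mul_eq_top]
    · filter_upwards [c.ae_mem_interior] with x hx
      have h2 := h.tendsto_pointwise hx hφ.continuous hM
        (fun y z => by rw [← dist_eq_norm]; exact hL.dist_le_mul y z) L.2
      have h3 := (h2.sub_const (φ x)).enorm
      rw [sub_self, enorm_zero] at h3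
      simpa using ENNReal.Tendsto.pow (n := 2) h3
  rw [ENNReal.tendsto_nhds_zero]
  intro ε hε
  obtain ⟨δ, hδ, hδε⟩ : ∃ δ : ℝ, 0 < δ ∧ 3 * ENNReal.ofReal δ ≤ ε := by
    rcases eq_or_ne ε ⊤ with rfl | hεt
    · exact ⟨1, one_pos, le_top⟩
    · refine ⟨ε.toReal / 3, by have := ENNReal.toReal_pos hε.ne' hεt; positivity, ?_⟩
      rw [show (3 : ENNReal) = ENNReal.ofReal 3 by simp, ← ENNReal.ofReal_mul (by norm_num),
        show 3 * (ε.toReal / 3) = ε.toReal by ring, ENNReal.ofReal_toReal hεt]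
  obtain ⟨φ, hc, hφ, hclose⟩ := hu.exist_eLpNorm_sub_le (by norm_num) (by norm_num) hδ
  have hδ' : 0 < ENNReal.ofReal δ := ENNReal.ofReal_pos.2 hδ
  filter_upwards [(ENNReal.tendsto_nhds_zero.1 (hsmooth φ hc hφ)) _ hδ'] with n hn
  have hui := integrable_of_memLp_two c hu
  have hφi : Integrable φ c.vol := integrable_of_continuous c hφ.continuous
  have hK : ∀ x, Continuous fun y => (prodKer ψ n (dilSub lam n x y) : ℂ) := fun x =>
    continuous_ofReal.comp ((h.continuous_kernel n).comp (Continuous.prodMk_right x))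
  have hKi : ∀ x {v : Scalar}, Integrable v c.vol →
      Integrable (fun y => (prodKer ψ n (dilSub lam n x y) : ℂ) * v y) c.vol := by
    intro x v hv
    obtain ⟨C, hC⟩ := c.isCompact_hull.exists_bound_of_continuousOn (hK x).continuousOn
    refine hv.bdd_mul (c := C) (hK x).aestronglyMeasurable ?_
    filter_upwards [c.ae_mem_region] with y hy using hC y (c.region_subset_hull hy)
  have hlin : smoothOp c ψ lam n (u - φ) = smoothOp c ψ lam n u - smoothOp c ψ lam n φ := by
    ext x
    simp only [smoothOp, Pi.sub_apply, mul_sub]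
    exact integral_sub (hKi x hui) (hKi x hφi)
  have e : smoothOp c ψ lam n u - u = smoothOp c ψ lam n (u - φ) +
      ((smoothOp c ψ lam n φ - φ) - (u - φ)) := by rw [hlin]; abel
  have m1 := hmeas n (hui.sub hφi)
  have m2 := (hmeas n hφi).sub hφi.aestronglyMeasurable
  have m3 := (hui.sub hφi).aestronglyMeasurable
  calc eLpNorm (smoothOp c ψ lam n u - u) 2 c.vol
      ≤ eLpNorm (smoothOp c ψ lam n (u - φ)) 2 c.vol +
        (eLpNorm (smoothOp c ψ lam n φ - φ) 2 c.vol + eLpNorm (u - φ) 2 c.vol) := by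
        rw [e]
        refine (eLpNorm_add_le m1 (m2.sub m3) (by norm_num)).trans ?_
        gcongr
        exact eLpNorm_sub_le m2 m3 (by norm_num)
    _ ≤ ENNReal.ofReal δ + (ENNReal.ofReal δ + ENNReal.ofReal δ) := by
        gcongr
        exact (h.eLpNorm_smoothOp_le n m3).trans hclose
    _ = 3 * ENNReal.ofReal δ := by ring
    _ ≤ ε := hδε

end

/-! ### Smoothing of weak derivatives -/

/-- Functions of class `C¹` on the cylinder that vanish near its boundary. -/
structure Cylinder.IsCore (c : Cylinder) (s : Scalar) : Prop where
  contDiff : ContDiff ℝ 1 s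
  per : c.Per s
  zero : ∃ ρ < (1 : ℝ), ∀ p, (ρ ≤ p 0 ^ 2 + p 1 ^ 2 ∨ (c = .finite ∧ ρ ≤ p 2 ^ 2)) → s p = 0

/-- The mollifier kernels: bumps, except in periodic directions. -/
noncomputable def Cylinder.mollKer : Cylinder → Fin 3 → ℕ → ℝ → ℝ
  | .periodic => ![bump, bump, fejer]
  | .finite => ![bump, bump, bump]

/-- The dilation factors of the mollifiers. -/
noncomputable def Cylinder.mollScale : Cylinder → Fin 3 → ℕ → ℝ
  | .periodic => ![bumpScale, bumpScale, fun _ => 1]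
  | .finite => ![bumpScale, bumpScale, bumpScale]

/-- The polynomial kernels. -/
noncomputable def Cylinder.polyKer : Cylinder → Fin 3 → ℕ → ℝ → ℝ
  | .periodic => ![landau, landau, fejer]
  | .finite => ![landau, landau, landau]

theorem Cylinder.isApprox_moll (c : Cylinder) : c.IsApprox c.mollKer c.mollScale := by
  cases c
  · refine ⟨fun i => ?_, fun _ n => ⟨periodic_fejer n, rfl⟩⟩
    fin_cases i
    exacts [isApproxKernel_bump, isApproxKernel_bump, isApproxKernel_fejer]
  · refine ⟨fun i => ?_, fun h => nomatch h⟩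
    fin_cases i
    exacts [isApproxKernel_bump, isApproxKernel_bump, isApproxKernel_bump]

theorem Cylinder.isApprox_poly (c : Cylinder) : c.IsApprox c.polyKer (fun _ _ => 1) := by
  cases c
  · refine ⟨fun i => ?_, fun _ n => ⟨periodic_fejer n, rfl⟩⟩
    fin_cases i
    exacts [isApproxKernel_landau, isApproxKernel_landau, isApproxKernel_fejer]
  · refine ⟨fun i => ?_, fun h => nomatch h⟩
    fin_cases i
    exacts [isApproxKernel_landau, isApproxKernel_landau, isApproxKernel_landau]

section

variable {c : Cylinder} {ψ : Fin 3 → ℕ → ℝ → ℝ} {lam : Fin 3 → ℕ → ℝ}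

theorem Cylinder.IsApprox.per_smoothOp (h : c.IsApprox ψ lam) (n : ℕ) (u : Scalar) :
    c.Per (smoothOp c ψ lam n u) := by
  cases c
  · intro p
    unfold smoothOp
    congr 1 with y
    congr 2
    obtain ⟨h1, h2⟩ := h.periodic rfl n
    simp only [prodKer, Fin.prod_univ_three, dilSub]
    have h3 : ψ 2 n (lam 2 n * (p 2 + 2 * Real.pi) - y 2) = ψ 2 n (lam 2 n * p 2 - y 2) := by
      rw [h2, one_mul, one_mul, add_sub_right_comm]
      exact h1 _
    simp [h3]
  · trivial

/-- Smoothing and weak gradients. -/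
theorem Cylinder.IsApprox.pd_smoothOp_of_hasGrad₀ (h : c.IsApprox ψ lam) (n : ℕ) {u : Scalar}
    {g : Vector} (hu : HasGrad₀ c u g) (i : Fin 3) (x : Fin 3 → ℝ) :
    pd i (smoothOp c ψ lam n u) x = lam i n * smoothOp c ψ lam n (fun y => g y i) x := by
  rw [h.pd_smoothOp n (integrable_of_memLp_two c hu.1)]
  set K : Scalar := fun y => (prodKer ψ n (dilSub lam n x y) : ℂ) with hK
  have hKs : c.Smooth K := h.smooth_kernel n x
  -- The test field is the kernel in direction i. It need not vanish on the boundary, which is where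
  -- the zero trace of u enters.
  have h1 := hu.2.2 (fun y => Pi.single i (K y)) (fun j => by
    by_cases hj : j = i
    · subst hj; simpa using hKs
    · simpa [hj] using c.smooth_zero)
  have e1 : ∀ y, div (fun y => Pi.single i (K y)) y = pd i K y := by
    intro y
    fin_cases i <;> simp [div, pd_zero_fun]
  simp only [dotProduct_single, e1] at h1
  unfold smoothOp
  have e2 : ∫ y, pd i K y * u y ∂c.vol = ∫ y, u y * pd i K y ∂c.vol := by
    simp only [mul_comm]
  rw [e2, ← neg_eq_iff_eq_neg.2 h1]
  simp only [mul_comm, hK]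
  ring

/-- Smoothing and weak divergence. -/
theorem Cylinder.IsApprox.smoothOp_of_hasDiv₀ (h : c.IsApprox ψ lam) (n : ℕ) {f : Vector}
    {w : Scalar} (hf : HasDiv₀ c f w) (x : Fin 3 → ℝ) :
    smoothOp c ψ lam n w x = ∑ i, (lam i n : ℂ)⁻¹ * pd i (smoothOp c ψ lam n (fun y => f y i)) x := by
  have hfi := integrable_of_memLp_two c hf.1
  have hfi' : ∀ i, Integrable (fun y => f y i) c.vol := fun i => hfi.eval i
  set K : Scalar := fun y => (prodKer ψ n (dilSub lam n x y) : ℂ) with hK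
  have hKs : c.Smooth K := h.smooth_kernel n x
  have h1 := hf.2.2 K hKs
  have e : ∀ i, (lam i n : ℂ)⁻¹ * pd i (smoothOp c ψ lam n (fun y => f y i)) x =
      -∫ y, f y i * pd i K y ∂c.vol := by
    intro i
    have h0 : (lam i n : ℂ) ≠ 0 := ofReal_ne_zero.2
      (zero_lt_one.trans_le ((h.kernel i).one_le n)).ne'
    rw [h.pd_smoothOp n (hfi' i), ← mul_assoc, mul_neg, inv_mul_cancel₀ h0, neg_one_mul]
    simp only [mul_comm, hK]
  have hint : ∀ i, Integrable (fun y => f y i * pd i K y) c.vol := by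
    intro i
    have hc : Continuous (pd i K) := (contDiff_top_pd hKs.contDiff i).continuous
    obtain ⟨C, hC⟩ := c.isCompact_hull.exists_bound_of_continuousOn hc.continuousOn
    refine (hfi' i).mul_bdd (c := C) hc.aestronglyMeasurable ?_
    filter_upwards [c.ae_mem_region] with y hy using hC y (c.region_subset_hull hy)
  simp only [e, Finset.sum_neg_distrib]
  rw [← integral_finsetSum _ (fun i _ => hint i)]
  unfold smoothOp
  have e2 : ∀ y, f y ⬝ᵥ grad K y = ∑ i, f y i * pd i K y := by
    intro y; simp [dotProduct, grad, Fin.sum_univ_three]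
  simp only [e2] at h1
  rw [← h1]
  simp only [mul_comm, hK]

/-- Smoothing and weak curl, one component. -/
theorem Cylinder.IsApprox.smoothOp_of_hasCurl₀ (h : c.IsApprox ψ lam) (n : ℕ) {f g : Vector}
    (hf : HasCurl₀ c f g) {i j k : Fin 3} (hijk : ∀ K : Scalar, ∀ y,
      f y ⬝ᵥ curl (fun y => Pi.single i (K y)) y = f y j * pd k K y - f y k * pd j K y)
    (x : Fin 3 → ℝ) :
    lam k n * pd j (smoothOp c ψ lam n (fun y => f y k)) x -
      lam j n * pd k (smoothOp c ψ lam n (fun y => f y j)) x =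
      lam j n * lam k n * smoothOp c ψ lam n (fun y => g y i) x := by
  have hfi := integrable_of_memLp_two c hf.1
  have hfi' : ∀ i, Integrable (fun y => f y i) c.vol := fun i => hfi.eval i
  set K : Scalar := fun y => (prodKer ψ n (dilSub lam n x y) : ℂ) with hK
  have hKs : c.Smooth K := h.smooth_kernel n x
  have h1 := hf.2.2 (fun y => Pi.single i (K y)) (fun j => by
    by_cases hj : j = i
    · subst hj; simpa using hKs
    · simpa [hj] using c.smooth_zero)
  have hint : ∀ i l, Integrable (fun y => f y i * pd l K y) c.vol := by
    intro i l
    have hc : Continuous (pd l K) := (contDiff_top_pd hKs.contDiff l).continuous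
    obtain ⟨C, hC⟩ := c.isCompact_hull.exists_bound_of_continuousOn hc.continuousOn
    refine (hfi' i).mul_bdd (c := C) hc.aestronglyMeasurable ?_
    filter_upwards [c.ae_mem_region] with y hy using hC y (c.region_subset_hull hy)
  simp only [dotProduct_single, hijk] at h1
  rw [integral_sub (hint j k) (hint k j)] at h1
  rw [h.pd_smoothOp n (hfi' k), h.pd_smoothOp n (hfi' j)]
  have e : ∀ i l, ∫ y, pd l K y * f y i ∂c.vol = ∫ y, f y i * pd l K y ∂c.vol := by
    intro i l; simp only [mul_comm]
  have e2 : smoothOp c ψ lam n (fun y => g y i) x = ∫ y, g y i * K y ∂c.vol := by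
    unfold smoothOp; simp only [mul_comm, hK]
  rw [e2, h1, ← hK, e, e]
  ring

/-- This and the next two identities provide the cyclic triples needed in
`Cylinder.IsApprox.smoothOp_of_hasCurl₀`. -/
theorem dotProduct_curl_single_zero (f : Vector) (K : Scalar) (y : Fin 3 → ℝ) :
    f y ⬝ᵥ curl (fun y => Pi.single 0 (K y)) y = f y 1 * pd 2 K y - f y 2 * pd 1 K y := by
  simp [curl, dotProduct, Fin.sum_univ_three, pd_zero_fun]; ring

theorem dotProduct_curl_single_one (f : Vector) (K : Scalar) (y : Fin 3 → ℝ) :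
    f y ⬝ᵥ curl (fun y => Pi.single 1 (K y)) y = f y 2 * pd 0 K y - f y 0 * pd 2 K y := by
  simp [curl, dotProduct, Fin.sum_univ_three, pd_zero_fun]; ring

theorem dotProduct_curl_single_two (f : Vector) (K : Scalar) (y : Fin 3 → ℝ) :
    f y ⬝ᵥ curl (fun y => Pi.single 2 (K y)) y = f y 0 * pd 1 K y - f y 1 * pd 0 K y := by
  simp [curl, dotProduct, Fin.sum_univ_three, pd_zero_fun]; ring

theorem abs_lt_of_bump_ne_zero {n : ℕ} {x y : ℝ} (h : bump n (bumpScale n * x - y) ≠ 0) :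
    |bumpScale n * x - y| < 1 / ((n : ℝ) + 1) := by
  by_contra hlt
  exact h (bump_eq_zero (not_lt.1 hlt))

/-- Mollified functions vanish near the boundary. -/
theorem Cylinder.isCore_mollify (c : Cylinder) (n : ℕ) {u : Scalar} (hu : Integrable u c.vol) :
    c.IsCore (smoothOp c c.mollKer c.mollScale n u) := by
  refine ⟨c.isApprox_moll.contDiff_smoothOp n hu, c.isApprox_moll.per_smoothOp n u, ?_⟩
  set δ : ℝ := 1 / ((n : ℝ) + 1) with hδ
  have hδ0 : 0 < δ := by positivity
  have hl : bumpScale n = 1 + 3 * δ := rfl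
  -- If the kernel is nonzero at some y of the cylinder, each relevant coordinate of the dilated
  -- point is within δ of that of y. Its squared horizontal norm is then at most 1 + 4δ + 2δ², less
  -- than (1+2δ)², and in the finite case its axial coordinate is less than 1 + 2δ in modulus.
  -- Division by the dilation 1 + 3δ gives the radius.
  refine ⟨((1 + 2 * δ) / (1 + 3 * δ)) ^ 2, ?_, fun p hp => ?_⟩
  · rw [sq_lt_one_iff₀ (by positivity), div_lt_one (by positivity)]
    linarith
  have hker : ∀ y ∈ c.region, prodKer c.mollKer n (dilSub c.mollScale n p y) = 0 := by
    intro y hy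
    by_contra hne
    have hy' : y 0 ^ 2 + y 1 ^ 2 ≤ 1 := by cases c <;> exact hy.1
    have hfac : ∀ i, c.mollKer i n (c.mollScale i n * p i - y i) ≠ 0 := fun i =>
      Finset.prod_ne_zero_iff.1 hne i (Finset.mem_univ i)
    have b0 := abs_lt.1 (abs_lt_of_bump_ne_zero (n := n) (x := p 0) (y := y 0)
      (by cases c <;> exact hfac 0))
    have b1 := abs_lt.1 (abs_lt_of_bump_ne_zero (n := n) (x := p 1) (y := y 1)
      (by cases c <;> exact hfac 1))
    have y0 := abs_le.1 ((sq_le_one_iff_abs_le_one (y 0)).1 (by nlinarith [sq_nonneg (y 1)]))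
    have y1 := abs_le.1 ((sq_le_one_iff_abs_le_one (y 1)).1 (by nlinarith [sq_nonneg (y 0)]))
    rw [← hδ, hl] at b0 b1
    rw [div_pow] at hp
    rcases hp with hp | ⟨rfl, hp⟩
    · rw [div_le_iff₀ (by positivity)] at hp
      obtain ⟨e0, he0⟩ : ∃ e, (1 + 3 * δ) * p 0 - y 0 = e := ⟨_, rfl⟩
      obtain ⟨e1, he1⟩ : ∃ e, (1 + 3 * δ) * p 1 - y 1 = e := ⟨_, rfl⟩
      rw [he0] at b0
      rw [he1] at b1
      have h0 : e0 ^ 2 < δ ^ 2 := sq_lt_sq' b0.1 b0.2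
      have h1 : e1 ^ 2 < δ ^ 2 := sq_lt_sq' b1.1 b1.2
      have h2 : y 0 * e0 ≤ δ := by nlinarith
      have h3 : y 1 * e1 ≤ δ := by nlinarith
      have h4 : (p 0 ^ 2 + p 1 ^ 2) * (1 + 3 * δ) ^ 2 = (y 0 + e0) ^ 2 + (y 1 + e1) ^ 2 := by
        rw [← he0, ← he1]; ring
      nlinarith
    · rw [div_le_iff₀ (by positivity)] at hp
      have b2 := abs_lt.1 (abs_lt_of_bump_ne_zero (n := n) (x := p 2) (y := y 2) (hfac 2))
      rw [← hδ, hl] at b2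
      have hy2 := hy.2
      have h5 : ((1 + 3 * δ) * p 2) ^ 2 < (1 + 2 * δ) ^ 2 :=
        sq_lt_sq' (by linarith [hy2.1, b2.1]) (by linarith [hy2.2, b2.2])
      nlinarith
  unfold smoothOp
  refine integral_eq_zero_of_ae ?_
  filter_upwards [c.ae_mem_region] with y hy
  simp [hker y hy]

theorem Cylinder.balanced_of_core {c : Cylinder} {F : Scalar} (hF : c.IsCore F) (i : Fin 3) :
    c.Balanced i F := by
  obtain ⟨ρ, hρ, h0⟩ := hF.zero
  by_cases hi : i = 2
  · subst hi
    refine Cylinder.balanced_two hF.per fun hc p _ hz => h0 p (Or.inr ⟨hc, ?_⟩)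
    rcases hz with hz | hz <;> rw [hz] <;> linarith
  · exact Cylinder.balanced_of_ne hi fun p hp _ => h0 p (Or.inl (by linarith))

theorem Cylinder.IsCore.mul {s v : Scalar} (hs : c.IsCore s) (hv : ContDiff ℝ 1 v) (hp : c.Per v) :
    c.IsCore (fun p => v p * s p) := by
  obtain ⟨ρ, hρ, h0⟩ := hs.zero
  exact ⟨hv.mul hs.contDiff, hp.op₂ hs.per (· * ·), ρ, hρ, fun p h => by rw [h0 p h, mul_zero]⟩

/-- Smoothing commutes with the derivatives of functions that vanish near the boundary. -/
theorem Cylinder.IsApprox.pd_smoothOp_of_core (h : c.IsApprox ψ lam) (n : ℕ) {s : Scalar}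
    (hs : c.IsCore s) (i : Fin 3) (x : Fin 3 → ℝ) :
    pd i (smoothOp c ψ lam n s) x = lam i n * smoothOp c ψ lam n (pd i s) x := by
  rw [h.pd_smoothOp n (integrable_of_continuous c hs.contDiff.continuous)]
  set K : Scalar := fun y => (prodKer ψ n (dilSub lam n x y) : ℂ) with hK
  have hKs : c.Smooth K := h.smooth_kernel n x
  have hK1 := contDiff_one_of_smooth hKs.contDiff
  have h1 := c.integral_pd_eq_zero (hK1.mul hs.contDiff) i
    (Cylinder.balanced_of_core (hs.mul hK1 hKs.per) i)
  have e := pd_mul (hK1.differentiable (by simp)) (hs.contDiff.differentiable (by simp)) i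
  have e' : (pd i fun x => K x * s x) = fun p => K p * pd i s p + pd i K p * s p := e
  rw [e'] at h1
  have h2 : ∫ y, K y * pd i s y ∂c.vol + ∫ y, pd i K y * s y ∂c.vol = 0 :=
    (integral_add (integrable_of_continuous c (hK1.continuous.fun_mul (continuous_pd hs.contDiff i)))
      (integrable_of_continuous c ((continuous_pd hK1 i).fun_mul hs.contDiff.continuous))).symm.trans
        h1
  change -(lam i n : ℂ) * ∫ y, pd i K y * s y ∂c.vol = lam i n * ∫ y, K y * pd i s y ∂c.vol
  linear_combination (-(lam i n : ℂ)) * h2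

end

/-! ### Separable kernels -/

/-- Products of an axial function in `Ax`, powers of the plane variables, and a continuous function
of the second argument. -/
def separable (Ax : Submonoid (ℝ → ℂ)) : Submonoid ((Fin 3 → ℝ) → (Fin 3 → ℝ) → ℂ) where
  carrier := {k | ∃ A ∈ Ax, ∃ (p q : ℕ) (g : Scalar), Continuous g ∧
    k = fun x y => scal A (fun s t => (s : ℂ) ^ p * (t : ℂ) ^ q) x * g y}
  one_mem' := ⟨1, Ax.one_mem, 0, 0, fun _ => 1, continuous_const, by ext; simp [scal]⟩
  mul_mem' := by
    rintro _ _ ⟨A, hA, p, q, g, hg, rfl⟩ ⟨A', hA', p', q', g', hg', rfl⟩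
    refine ⟨A * A', Ax.mul_mem hA hA', p + p', q + q', fun y => g y * g' y, hg.mul hg', ?_⟩
    ext x y
    simp [scal, pow_add]
    ring

/-- Finite sums of separable kernels. -/
noncomputable def separableAlg (Ax : Submonoid (ℝ → ℂ)) :
    Subalgebra ℂ ((Fin 3 → ℝ) → (Fin 3 → ℝ) → ℂ) :=
  Algebra.adjoin ℂ (separable Ax : Set ((Fin 3 → ℝ) → (Fin 3 → ℝ) → ℂ))

theorem mem_separableAlg {Ax : Submonoid (ℝ → ℂ)} {A : ℝ → ℂ} (hA : A ∈ Ax) (p q : ℕ) {g : Scalar}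
    (hg : Continuous g) :
    (fun x y => scal A (fun s t => (s : ℂ) ^ p * (t : ℂ) ^ q) x * g y) ∈ separableAlg Ax :=
  Algebra.subset_adjoin ⟨A, hA, p, q, g, hg, rfl⟩

theorem integrable_mul_of_continuous {c : Cylinder} {u g : Scalar} (hu : Integrable u c.vol)
    (hg : Continuous g) : Integrable (fun y => g y * u y) c.vol := by
  obtain ⟨C, hC⟩ := c.isCompact_hull.exists_bound_of_continuousOn hg.continuousOn
  refine hu.bdd_mul (c := C) hg.aestronglyMeasurable ?_
  filter_upwards [c.ae_mem_region] with y hy using hC y (c.region_subset_hull hy)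

/-- Integration against a separable kernel has finite rank. -/
theorem integral_separable_mem {c : Cylinder} {Ax : Submonoid (ℝ → ℂ)}
    {k : (Fin 3 → ℝ) → (Fin 3 → ℝ) → ℂ} (hk : k ∈ separableAlg Ax) {u : Scalar}
    (hu : Integrable u c.vol) {N : Submodule ℂ Scalar}
    (hN : ∀ A ∈ Ax, ∀ p q : ℕ, scal A (fun s t => (s : ℂ) ^ p * (t : ℂ) ^ q) ∈ N) :
    (∀ x, Integrable (fun y => k x y * u y) c.vol) ∧ (fun x => ∫ y, k x y * u y ∂c.vol) ∈ N := by
  rw [separableAlg, ← Subalgebra.mem_toSubmodule, Algebra.adjoin_eq_span, Submonoid.closure_eq] at hk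
  refine Submodule.span_induction (p := fun k _ => (∀ x, Integrable (fun y => k x y * u y) c.vol) ∧
    (fun x => ∫ y, k x y * u y ∂c.vol) ∈ N) ?_ ?_ (fun k l _ _ hk hl => ?_) (fun a k _ hk => ?_) hk
  · rintro _ ⟨A, hA, p, q, g, hg, rfl⟩
    have hi := integrable_mul_of_continuous hu hg
    constructor
    · intro x
      simpa only [mul_assoc] using hi.const_mul (scal A (fun s t => (s : ℂ) ^ p * (t : ℂ) ^ q) x)
    · convert N.smul_mem (∫ y, g y * u y ∂c.vol) (hN A hA p q) using 1
      ext x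
      simp only [mul_assoc, Pi.smul_apply, smul_eq_mul]
      rw [integral_const_mul, mul_comm]
  · constructor
    · intro x; simp
    · convert N.zero_mem using 1
      ext; simp
  · constructor
    · intro x
      simpa only [Pi.add_apply, add_mul] using (hk.1 x).fun_add (hl.1 x)
    · convert N.add_mem hk.2 hl.2 using 1
      ext x
      simp only [Pi.add_apply, add_mul]
      exact integral_add (hk.1 x) (hl.1 x)
  · constructor
    · intro x
      simpa only [Pi.smul_apply, smul_eq_mul, mul_assoc] using (hk.1 x).const_mul a
    · convert N.smul_mem a hk.2 using 1
      ext x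
      simp only [Pi.smul_apply, smul_eq_mul, mul_assoc]
      exact integral_const_mul _ _

/-- The kernel is a polynomial in x_i - y_i, and both coordinates are in the algebra. -/
theorem landau_mem_separableAlg {Ax : Submonoid (ℝ → ℂ)} {i : Fin 3}
    (hX : (fun x _ => (x i : ℂ)) ∈ separableAlg Ax) (n : ℕ) :
    (fun x y => (landau n (x i - y i) : ℂ)) ∈ separableAlg Ax := by
  have hY : (fun _ y => (y i : ℂ)) ∈ separableAlg Ax := by
    convert mem_separableAlg Ax.one_mem 0 0 (contDiff_coord i (n := 0)).continuous using 1
    ext; simp [scal]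
  have h1 := pow_mem (sub_mem hX hY) 2
  have h2 := pow_mem (sub_mem (one_mem _) (Subalgebra.smul_mem _ h1 (1 / 9))) n
  generalize hC : (∫ s in (-3 : ℝ)..3, (1 - s ^ 2 / 9) ^ n)⁻¹ = C
  have h3 := Subalgebra.smul_mem _ h2 (C : ℂ)
  have e : (fun x y : Fin 3 → ℝ => (landau n (x i - y i) : ℂ)) = (C : ℂ) • (1 - (1 / 9 : ℂ) •
      ((fun x _ => (x i : ℂ)) - (fun _ y => (y i : ℂ)) :
        (Fin 3 → ℝ) → (Fin 3 → ℝ) → ℂ) ^ 2) ^ n := by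
    ext x y
    rw [landau, hC]
    simp only [Pi.smul_apply, Pi.pow_apply, Pi.sub_apply, Pi.one_apply, smul_eq_mul]
    push_cast
    ring
  rw [e]
  exact h3

/-- By Euler's formula cos(x - y) is half of e^{ix}e^{-iy} + e^{-ix}e^{iy}. -/
theorem fejer_mem_separableAlg {Ax : Submonoid (ℝ → ℂ)} (hA : ∀ k, expWave k ∈ Ax) (n : ℕ) :
    (fun x y => (fejer n (x 2 - y 2) : ℂ)) ∈ separableAlg Ax := by
  have hE : ∀ k : ℤ, (fun x y : Fin 3 → ℝ => expWave k (x 2) * expWave (-k) (y 2)) ∈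
      separableAlg Ax := by
    intro k
    convert mem_separableAlg (hA k) 0 0 (g := fun y => expWave (-k) (y 2))
      ((isAxialDeriv_expWave (-k)).smooth.continuous.comp (continuous_apply 2)) using 1
    ext; simp [scal]
  have h : ((((∫ s in (0 : ℝ)..2 * Real.pi, ((1 + Real.cos s) / 2) ^ n)⁻¹ : ℝ) : ℂ) •
      ((1 / 2 : ℂ) • 1 + (1 / 4 : ℂ) • ((fun x y : Fin 3 → ℝ => expWave 1 (x 2) * expWave (-1) (y 2)) +
        (fun x y : Fin 3 → ℝ => expWave (-1) (x 2) * expWave (- -1) (y 2)))) ^ n) ∈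
      separableAlg Ax :=
    Subalgebra.smul_mem _ (pow_mem (add_mem (Subalgebra.smul_mem _ (one_mem _) _)
      (Subalgebra.smul_mem _ (add_mem (hE 1) (hE (-1))) _)) n) _
  convert h using 1
  ext x y
  have hc : (Real.cos (x 2 - y 2) : ℂ) = (expWave 1 (x 2) * expWave (-1) (y 2) +
      expWave (-1) (x 2) * expWave (- -1) (y 2)) / 2 := by
    simp only [expWave, ← Complex.exp_add, Complex.ofReal_cos, Complex.cos]
    congr 1
    congr 1 <;> (congr 1; push_cast; ring)
  simp [fejer, -Complex.ofReal_cos, hc]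
  left
  congr 1
  ring

/-- The axial functions out of which the polynomial kernels are made. -/
def Cylinder.axialMonoid : Cylinder → Submonoid (ℝ → ℂ)
  | .periodic =>
    { carrier := Set.range expWave
      one_mem' := ⟨0, by ext; simp [expWave]⟩
      mul_mem' := by
        rintro _ _ ⟨k, rfl⟩ ⟨l, rfl⟩
        exact ⟨k + l, by ext z; exact (expWave_mul k l z).symm⟩ }
  | .finite => Submonoid.powers (fun z : ℝ => (z : ℂ))

theorem Cylinder.coord_mem_separableAlg (c : Cylinder) (i : Fin 3) (hi : i ≠ 2 ∨ c = .finite) :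
    (fun x _ => (x i : ℂ)) ∈ separableAlg c.axialMonoid := by
  have h : ∀ A ∈ c.axialMonoid, ∀ p q : ℕ,
      (fun x (_ : Fin 3 → ℝ) => A (x 2) * ((x 0 : ℂ) ^ p * (x 1 : ℂ) ^ q)) ∈
        separableAlg c.axialMonoid := by
    intro A hA p q
    convert mem_separableAlg hA p q (g := fun _ => 1) continuous_const using 1
    ext; simp [scal]
  fin_cases i
  · simpa using h 1 (one_mem _) 1 0
  · simpa using h 1 (one_mem _) 0 1
  · obtain rfl : c = .finite := by simpa using hi
    simpa using h _ (Submonoid.mem_powers _) 0 0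

theorem Cylinder.polyKer_mem_separableAlg (c : Cylinder) (n : ℕ) :
    (fun x y => (prodKer c.polyKer n (dilSub (fun _ _ => 1) n x y) : ℂ)) ∈
      separableAlg c.axialMonoid := by
  have h : ∀ i, (fun x y => (c.polyKer i n (x i - y i) : ℂ)) ∈ separableAlg c.axialMonoid := by
    have hl : ∀ i, i ≠ 2 ∨ c = .finite → (fun x y => (landau n (x i - y i) : ℂ)) ∈
        separableAlg c.axialMonoid := fun i hi =>
      landau_mem_separableAlg (c.coord_mem_separableAlg i hi) n
    intro i
    fin_cases i
    · cases c <;> exact hl 0 (Or.inl (by decide))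
    · cases c <;> exact hl 1 (Or.inl (by decide))
    · cases c
      · exact fejer_mem_separableAlg (Ax := Cylinder.periodic.axialMonoid) (fun k => ⟨k, rfl⟩) n
      · exact hl 2 (Or.inr rfl)
  convert mul_mem (mul_mem (h 0) (h 1)) (h 2) using 1
  ext x y
  simp [prodKer, dilSub, Fin.prod_univ_three]

/-! ### Density -/

/-- The axial weight: `1` in the periodic case, `1 - z²` in the finite case. -/
def Cylinder.axialWeight : Cylinder → ℝ → ℂ
  | .periodic => fun _ => 1
  | .finite => fun z => 1 - (z : ℂ) ^ 2

/-- A polynomial that vanishes exactly on the boundary. -/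
def Cylinder.weight (c : Cylinder) : Scalar :=
  scal c.axialWeight (fun x y => 1 - ((x : ℂ) ^ 2 + (y : ℂ) ^ 2))

/-- The axial functions `a` and `b` span enough for the approximation on the cylinder. -/
structure IsAxialSpanning (c : Cylinder) {K : Type} (a b : K → ℝ → ℂ) : Prop where
  left : ∀ A ∈ c.axialMonoid, c.axialWeight * A ∈ Submodule.span ℂ (Set.range a)
  right : ∀ A ∈ c.axialMonoid, A ∈ Submodule.span ℂ (Set.range b)
  mem : ∀ k, a k ∈ Submodule.span ℂ (Set.range b)

theorem isAxialSpanning_expWave : IsAxialSpanning .periodic expWave expWave where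
  left := by
    rintro _ ⟨k, rfl⟩
    exact Submodule.subset_span ⟨k, by ext; simp [Cylinder.axialWeight]⟩
  right := by
    rintro _ ⟨k, rfl⟩
    exact Submodule.subset_span ⟨k, rfl⟩
  mem k := Submodule.subset_span ⟨k, rfl⟩

theorem isAxialSpanning_wUltra : IsAxialSpanning .finite wUltra legendre where
  left := by
    rintro _ ⟨l, rfl⟩
    exact one_sub_sq_mul_pow_mem_span_wUltra l
  right := by
    rintro _ ⟨l, rfl⟩
    exact pow_mem_span_legendre l
  mem := wUltra_mem_span_legendre

theorem Cylinder.contDiff_weight (c : Cylinder) : ContDiff ℝ (⊤ : ℕ∞) c.weight := by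
  refine contDiff_scal ?_ ?_
  · cases c
    · exact contDiff_const
    · exact contDiff_const.sub (ofRealCLM.contDiff.pow 2)
  · exact contDiff_const.sub ((planeSmooth_ofReal_fst.pow 2).add (planeSmooth_ofReal_snd.pow 2))

theorem Cylinder.per_weight (c : Cylinder) : c.Per c.weight := by
  cases c
  · intro p; simp [weight, scal, axialWeight]
  · trivial

theorem Cylinder.weight_eq_zero {c : Cylinder} {p : Fin 3 → ℝ} (h : c.weight p = 0) :
    p 0 ^ 2 + p 1 ^ 2 = 1 ∨ (c = .finite ∧ p 2 ^ 2 = 1) := by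
  rcases mul_eq_zero.1 h with h | h
  · cases c
    · exact absurd h one_ne_zero
    · right
      refine ⟨rfl, ?_⟩
      have h1 : ((p 2 : ℂ)) ^ 2 = 1 := (sub_eq_zero.1 h).symm
      exact_mod_cast h1
  · left
    have h1 : ((p 0 : ℂ)) ^ 2 + (p 1 : ℂ) ^ 2 = 1 := (sub_eq_zero.1 h).symm
    exact_mod_cast h1

theorem Cylinder.IsCore.weight_ne_zero {c : Cylinder} {s : Scalar} (hs : c.IsCore s)
    {p : Fin 3 → ℝ} (hp : c.weight p = 0) : ∀ᶠ q in nhds p, s q = 0 := by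
  obtain ⟨ρ, hρ, h0⟩ := hs.zero
  rcases Cylinder.weight_eq_zero hp with h | ⟨hc, h⟩
  · have : ∀ᶠ q : Fin 3 → ℝ in nhds p, ρ < q 0 ^ 2 + q 1 ^ 2 :=
      (Continuous.continuousAt (by fun_prop)).eventually (lt_mem_nhds (by rw [h]; exact hρ))
    filter_upwards [this] with q hq using h0 q (Or.inl hq.le)
  · have : ∀ᶠ q : Fin 3 → ℝ in nhds p, ρ < q 2 ^ 2 :=
      (Continuous.continuousAt (by fun_prop)).eventually (lt_mem_nhds (by rw [h]; exact hρ))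
    filter_upwards [this] with q hq using h0 q (Or.inr ⟨hc, hq.le⟩)

/-- Near each zero of the weight the numerator vanishes identically, so the quotient is locally zero
there; elsewhere the division is regular. -/
theorem Cylinder.IsCore.div_weight {c : Cylinder} {s : Scalar} (hs : c.IsCore s) :
    c.IsCore (fun p => s p / c.weight p) := by
  refine ⟨contDiff_iff_contDiffAt.2 fun p => ?_, hs.per.op₂ c.per_weight (· / ·), ?_⟩
  · by_cases hp : c.weight p = 0
    · refine (contDiffAt_const (c := (0 : ℂ))).congr_of_eventuallyEq ?_
      filter_upwards [hs.weight_ne_zero hp] with q hq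
      rw [hq, zero_div]
    · simp only [div_eq_mul_inv]
      exact hs.contDiff.contDiffAt.mul
        ((contDiff_one_of_smooth c.contDiff_weight).contDiffAt.inv hp)
  · obtain ⟨ρ, hρ, h0⟩ := hs.zero
    exact ⟨ρ, hρ, fun p hp => by rw [h0 p hp, zero_div]⟩

theorem Cylinder.IsCore.weight_mul_div {c : Cylinder} {s : Scalar} (hs : c.IsCore s) :
    (fun p => c.weight p * (s p / c.weight p)) = s := by
  ext p
  by_cases hp : c.weight p = 0
  · rw [(hs.weight_ne_zero hp).self_of_nhds]; simp
  · field_simp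

theorem memLp_pd {c : Cylinder} {s : Scalar} (hs : ContDiff ℝ 1 s) (i : Fin 3) :
    MemLp (pd i s) 2 c.vol := memLp_of_continuous c (continuous_pd hs i) 2

theorem tendsto_eLpNorm_mul {c : Cylinder} {W : Scalar} (hW : Continuous W) {f : ℕ → Scalar}
    (hf : Filter.Tendsto (fun n => eLpNorm (f n) 2 c.vol) Filter.atTop (nhds 0)) :
    Filter.Tendsto (fun n => eLpNorm (fun p => W p * f n p) 2 c.vol) Filter.atTop (nhds 0) := by
  obtain ⟨C, hC⟩ := c.isCompact_hull.exists_bound_of_continuousOn hW.continuousOn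
  have h := ENNReal.Tendsto.const_mul (a := ENNReal.ofReal C) hf (Or.inr ENNReal.ofReal_ne_top)
  rw [mul_zero] at h
  refine tendsto_of_tendsto_of_tendsto_of_le_of_le tendsto_const_nhds h (fun _ => bot_le)
    fun n => ?_
  refine eLpNorm_le_mul_eLpNorm_of_ae_le_mul ?_ 2
  filter_upwards [c.ae_mem_region] with p hp
  rw [norm_mul]
  exact mul_le_mul_of_nonneg_right (hC p (c.region_subset_hull hp)) (norm_nonneg _)

theorem tendsto_eLpNorm_add {c : Cylinder} {f g : ℕ → Scalar}
    (hfm : ∀ n, AEStronglyMeasurable (f n) c.vol) (hgm : ∀ n, AEStronglyMeasurable (g n) c.vol)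
    (hf : Filter.Tendsto (fun n => eLpNorm (f n) 2 c.vol) Filter.atTop (nhds 0))
    (hg : Filter.Tendsto (fun n => eLpNorm (g n) 2 c.vol) Filter.atTop (nhds 0)) :
    Filter.Tendsto (fun n => eLpNorm (fun p => f n p + g n p) 2 c.vol) Filter.atTop (nhds 0) := by
  have h := hf.add hg
  rw [add_zero] at h
  exact tendsto_of_tendsto_of_tendsto_of_le_of_le tendsto_const_nhds h (fun _ => bot_le)
    fun n => eLpNorm_add_le (hfm n) (hgm n) (by norm_num)

section

variable {c : Cylinder} {K : Type} {a b : K → ℝ → ℂ}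

theorem Cylinder.smoothOp_mem_l2Fam (h : IsAxialSpanning c a b) (n : ℕ) {u : Scalar}
    (hu : Integrable u c.vol) : smoothOp c c.polyKer (fun _ _ => 1) n u ∈
      Submodule.span ℂ (Set.range (l2Fam b)) :=
  (integral_separable_mem (c.polyKer_mem_separableAlg n) hu fun A hA p q =>
    scal_mem_span_l2Fam (h.right A hA) (monomial_mem_zernikeSpan p q)).2

theorem Cylinder.weight_smoothOp_mem_h1Fam (h : IsAxialSpanning c a b) (n : ℕ) {u : Scalar}
    (hu : Integrable u c.vol) :
    (fun p => c.weight p * smoothOp c c.polyKer (fun _ _ => 1) n u p) ∈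
      Submodule.span ℂ (Set.range (h1Fam a)) := by
  have h1 := (integral_separable_mem (c.polyKer_mem_separableAlg n) hu
    -- Finite rank is used with the preimage of the span under multiplication by the weight: weight
    -- times a separable monomial splits into an axial factor with the axial weight and a plane
    -- polynomial divisible by 1 - r².
    (N := (Submodule.span ℂ (Set.range (h1Fam a))).comap (LinearMap.mulLeft ℂ c.weight))
    fun A hA p q => by
      rw [Submodule.mem_comap]
      convert scal_mem_span_h1Fam (h.left A hA)
        (mul_mem_wZernikeSpan (monomial_mem_zernikeSpan p q)) using 1
      ext x
      simp [Cylinder.weight, scal]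
      ring).2
  exact h1

/-- Functions that vanish near the boundary are limits of elements of the span in `H¹`. -/
theorem Cylinder.IsCore.approx (h : IsAxialSpanning c a b) {s : Scalar} (hs : c.IsCore s)
    {δ : ENNReal} (hδ : 0 < δ) : ∃ q ∈ Submodule.span ℂ (Set.range (h1Fam a)), ContDiff ℝ 1 q ∧
      eLpNorm (s - q) 2 c.vol ≤ δ ∧ ∀ i, eLpNorm (pd i s - pd i q) 2 c.vol ≤ δ := by
  -- The quotient is smoothed instead of s, because multiplying by the weight afterwards restores
  -- the boundary condition.
  set w : Scalar := fun p => s p / c.weight p with hw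
  have hwc : c.IsCore w := hs.div_weight
  have hsw : (fun p => c.weight p * w p) = s := hs.weight_mul_div
  set T : ℕ → Scalar → Scalar := smoothOp c c.polyKer (fun _ _ => 1) with hT
  have happ := c.isApprox_poly
  have hwi : Integrable w c.vol := integrable_of_continuous c hwc.contDiff.continuous
  have hpi : ∀ i, Integrable (pd i w) c.vol := fun i =>
    integrable_of_continuous c (continuous_pd hwc.contDiff i)
  have hTw : ∀ n, ContDiff ℝ 1 (T n w) := fun n => happ.contDiff_smoothOp n hwi
  have hTp : ∀ n i, ContDiff ℝ 1 (T n (pd i w)) := fun n i => happ.contDiff_smoothOp n (hpi i)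
  have hWs := contDiff_one_of_smooth c.contDiff_weight
  -- w vanishes near the boundary and the polynomial kernels have no dilation, so smoothing commutes
  -- exactly with derivatives.
  have hpd : ∀ n i, pd i (T n w) = T n (pd i w) := fun n i => by
    ext x
    have := happ.pd_smoothOp_of_core n hwc i x
    simpa using this
  have t0 := happ.tendsto_smoothOp (memLp_of_continuous c hwc.contDiff.continuous 2)
  have t1 := fun i => happ.tendsto_smoothOp (memLp_pd (c := c) hwc.contDiff i)
  have r0 : Filter.Tendsto (fun n => eLpNorm ((fun p => c.weight p * T n w p) - s) 2 c.vol)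
      Filter.atTop (nhds 0) := by
    refine (tendsto_eLpNorm_mul hWs.continuous t0).congr fun n => ?_
    congr 1
    rw [← hsw]
    ext p
    simp only [Pi.sub_apply]
    ring
  have r1 : ∀ i, Filter.Tendsto (fun n => eLpNorm (pd i (fun p => c.weight p * T n w p) - pd i s)
      2 c.vol) Filter.atTop (nhds 0) := by
    intro i
    have hWp := continuous_pd hWs i
    refine (tendsto_eLpNorm_add (fun n => ?_) (fun n => ?_)
      (tendsto_eLpNorm_mul hWs.continuous (t1 i)) (tendsto_eLpNorm_mul hWp t0)).congr fun n => ?_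
    · exact (hWs.continuous.mul ((hTp n i).continuous.sub
        (continuous_pd hwc.contDiff i))).aestronglyMeasurable
    · exact (hWp.mul ((hTw n).continuous.sub hwc.contDiff.continuous)).aestronglyMeasurable
    · congr 1
      rw [← hsw, pd_mul (hWs.differentiable (by simp)) (hwc.contDiff.differentiable (by simp)),
        pd_mul (hWs.differentiable (by simp)) ((hTw n).differentiable (by simp)), hpd]
      ext p
      simp only [Pi.sub_apply, hT]
      ring
  obtain ⟨n, hn0, hn1⟩ := (((ENNReal.tendsto_nhds_zero.1 r0) δ hδ).and
    (Filter.eventually_all.2 fun i => (ENNReal.tendsto_nhds_zero.1 (r1 i)) δ hδ)).exists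
  refine ⟨_, Cylinder.weight_smoothOp_mem_h1Fam h n hwi, hWs.mul (hTw n), ?_, fun i => ?_⟩
  · rw [eLpNorm_sub_comm]; exact hn0
  · rw [eLpNorm_sub_comm]; exact hn1 i

theorem eLpNorm_vec_le {f : Vector} (hf : ∀ i, AEStronglyMeasurable (fun p => f p i) c.vol)
    {δ : ENNReal} (h : ∀ i, eLpNorm (fun p => f p i) 2 c.vol ≤ δ) : eLpNorm f 2 c.vol ≤ 3 * δ := by
  have e : f = ∑ i, fun p => Pi.single i (f p i) := by
    ext p i
    simp [Finset.sum_apply, Pi.single_apply]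
  have hm : ∀ i, AEStronglyMeasurable (fun p => (Pi.single i (f p i) : Fin 3 → ℂ)) c.vol :=
    fun i => (continuous_single (A := fun _ : Fin 3 => ℂ) i).comp_aestronglyMeasurable (hf i)
  have hn : ∀ i, eLpNorm (fun p => (Pi.single i (f p i) : Fin 3 → ℂ)) 2 c.vol ≤ δ := by
    intro i
    refine (eLpNorm_congr_norm_ae (g := fun p => f p i) ?_).trans_le (h i)
    exact Filter.Eventually.of_forall fun p => by rw [Pi.norm_single]
  rw [e]
  refine (eLpNorm_sum_le (fun i _ => hm i) (by norm_num)).trans ?_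
  refine (Finset.sum_le_sum fun i _ => hn i).trans ?_
  simp

theorem eLpNorm_sub_le_of_le {f g s : Scalar} (hf : AEStronglyMeasurable f c.vol)
    (hg : AEStronglyMeasurable g c.vol) (hs : AEStronglyMeasurable s c.vol) {δ δ' : ENNReal}
    (h : eLpNorm (f - g) 2 c.vol ≤ δ) (h' : eLpNorm (g - s) 2 c.vol ≤ δ') :
    eLpNorm (f - s) 2 c.vol ≤ δ + δ' := by
  rw [← sub_add_sub_cancel f g s]
  exact (eLpNorm_add_le (hf.sub hg) (hg.sub hs) (by norm_num)).trans (add_le_add h h')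

/-- The constant 30 is generous: three components with at most four errors δ each need 12. -/
theorem exists_pos_mul_lt_ennreal {ε : ENNReal} (hε : 0 < ε) :
    ∃ δ : ENNReal, 0 < δ ∧ 30 * δ < ε := by
  obtain ⟨r, hr, h⟩ := ENNReal.exists_nnreal_pos_mul_lt (a := 30) (b := ε) (by norm_num) hε.ne'
  exact ⟨r, by exact_mod_cast hr, by rwa [mul_comm]⟩

/-- tf - g = t(f - g) + (t - 1)g. It absorbs the dilation factors of the mollifiers. -/
theorem tendsto_scaled {f : ℕ → Scalar} {g : Scalar} {t : ℕ → ℂ} (hg : MemLp g 2 c.vol)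
    (hfm : ∀ n, AEStronglyMeasurable (f n) c.vol)
    (hf : Filter.Tendsto (fun n => eLpNorm (f n - g) 2 c.vol) Filter.atTop (nhds 0))
    (ht : Filter.Tendsto t Filter.atTop (nhds 1)) :
    Filter.Tendsto (fun n => eLpNorm (fun p => t n * f n p - g p) 2 c.vol) Filter.atTop
      (nhds 0) := by
  have h1 : Filter.Tendsto (fun n => ‖t n‖ₑ * eLpNorm (f n - g) 2 c.vol) Filter.atTop (nhds 0) := by
    have := ENNReal.Tendsto.mul ht.enorm (Or.inr ENNReal.zero_ne_top) hf (Or.inr enorm_ne_top)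
    simpa using this
  have h2 : Filter.Tendsto (fun n => ‖t n - 1‖ₑ * eLpNorm g 2 c.vol) Filter.atTop (nhds 0) := by
    have h3 := (ht.sub_const 1).enorm
    rw [sub_self, enorm_zero] at h3
    have := ENNReal.Tendsto.mul_const (b := eLpNorm g 2 c.vol) h3 (Or.inr hg.2.ne)
    simpa using this
  have h := h1.add h2
  rw [add_zero] at h
  refine tendsto_of_tendsto_of_tendsto_of_le_of_le tendsto_const_nhds h (fun _ => bot_le)
    fun n => ?_
  have e : (fun p => t n * f n p - g p) = t n • (f n - g) + (t n - 1) • g := by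
    ext p; simp; ring
  rw [e]
  refine (eLpNorm_add_le (((hfm n).sub hg.1).const_smul _) (hg.1.const_smul _) (by norm_num)).trans ?_
  exact add_le_add (eLpNorm_const_smul_le) (eLpNorm_const_smul_le)

theorem dense_l2Fam (h : IsAxialSpanning c a b) (u : Scalar) (hu : MemLp u 2 c.vol) (ε : ENNReal)
    (hε : 0 < ε) : ∃ s ∈ Submodule.span ℂ (Set.range (l2Fam b)), eLpNorm (u - s) 2 c.vol < ε := by
  obtain ⟨δ, hδ, hδε⟩ := exists_pos_mul_lt_ennreal hε
  obtain ⟨n, hn⟩ := ((ENNReal.tendsto_nhds_zero.1 (c.isApprox_poly.tendsto_smoothOp hu)) δ hδ).exists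
  refine ⟨_, Cylinder.smoothOp_mem_l2Fam h n (integrable_of_memLp_two c hu), ?_⟩
  rw [eLpNorm_sub_comm]
  refine lt_of_le_of_lt (hn.trans ?_) hδε
  calc δ = 1 * δ := (one_mul _).symm
    _ ≤ 30 * δ := by gcongr; norm_num

end

/-! ### Density in the graph norms -/

theorem pd_const_mul (t : ℂ) {v : Scalar} (hv : Differentiable ℝ v) (i : Fin 3) :
    pd i (fun p => t * v p) = fun p => t * pd i v p := by
  ext p; simp [pd, fderiv_const_mul (hv p)]

theorem Cylinder.IsCore.const_mul {c : Cylinder} {s : Scalar} (hs : c.IsCore s) (t : ℂ) :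
    c.IsCore (fun p => t * s p) :=
  hs.mul (v := fun _ => t) contDiff_const (by cases c <;> simp [Cylinder.Per])

theorem Cylinder.tendsto_mollScale (c : Cylinder) (i : Fin 3) :
    Filter.Tendsto (fun n => (c.mollScale i n : ℂ)) Filter.atTop (nhds 1) := by
  have h := (Complex.continuous_ofReal.tendsto 1).comp (c.isApprox_moll.kernel i).tendsto_lam
  rwa [Complex.ofReal_one] at h

theorem eLpNorm_lt_of_le {c : Cylinder} {f : Vector} {δ ε : ENNReal}
    (hf : ∀ i, AEStronglyMeasurable (fun p => f p i) c.vol) (hε : 30 * δ < ε)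
    (h : ∀ i, eLpNorm (fun p => f p i) 2 c.vol ≤ 4 * δ) : eLpNorm f 2 c.vol < ε := by
  refine lt_of_le_of_lt ((eLpNorm_vec_le hf h).trans ?_) hε
  rw [← mul_assoc]
  gcongr
  norm_num

section

variable {c : Cylinder} {K : Type} {a b : K → ℝ → ℂ}

/-- Scaled mollifications converge. -/
theorem tendsto_mollify {f : Scalar} (hf : MemLp f 2 c.vol) {t : ℕ → ℂ}
    (ht : Filter.Tendsto t Filter.atTop (nhds 1)) {δ : ENNReal} (hδ : 0 < δ) :
    ∀ᶠ n in Filter.atTop,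
      eLpNorm (fun p => t n * smoothOp c c.mollKer c.mollScale n f p - f p) 2 c.vol ≤ δ :=
  (ENNReal.tendsto_nhds_zero.1 (tendsto_scaled hf
    (fun n => (c.isCore_mollify n (integrable_of_memLp_two c hf)).contDiff.continuous.aestronglyMeasurable)
    (c.isApprox_moll.tendsto_smoothOp hf) ht)) δ hδ

/-- Mollification gives a function that vanishes near the boundary and whose derivatives are scaled
mollifications of g; such a function is approximated in the span by `Cylinder.IsCore.approx`. -/
theorem dense_h1Fam (h : IsAxialSpanning c a b) (u : Scalar) (g : Vector) (hu : HasGrad₀ c u g)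
    (ε : ENNReal) (hε : 0 < ε) : ∃ s ∈ Submodule.span ℂ (Set.range (h1Fam a)),
      eLpNorm (u - s) 2 c.vol < ε ∧ eLpNorm (g - grad s) 2 c.vol < ε := by
  obtain ⟨δ, hδ, hδε⟩ := exists_pos_mul_lt_ennreal hε
  have hg : ∀ i, MemLp (fun p => g p i) 2 c.vol := fun i => hu.2.1.eval i
  obtain ⟨n, h0, h1⟩ := ((tendsto_mollify hu.1 tendsto_const_nhds hδ).and
    (Filter.eventually_all.2 fun i => tendsto_mollify (hg i) (c.tendsto_mollScale i) hδ)).exists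
  have hs := c.isCore_mollify n (integrable_of_memLp_two c hu.1)
  set s := smoothOp c c.mollKer c.mollScale n u with hs'
  obtain ⟨q, hq, hq1, hqs, hqd⟩ := hs.approx h hδ
  have m : ∀ {f : Scalar}, Continuous f → AEStronglyMeasurable f c.vol :=
    fun hf => hf.aestronglyMeasurable
  have hpd : ∀ i, pd i s = fun p => c.mollScale i n *
      smoothOp c c.mollKer c.mollScale n (fun y => g y i) p := fun i => by
    ext p; exact c.isApprox_moll.pd_smoothOp_of_hasGrad₀ n hu i p
  have comp : ∀ (f : Vector) i, (fun p => (f - grad q) p i) = (fun p => f p i) - pd i q := by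
    intro f i; ext p; fin_cases i <;> simp [grad]
  refine ⟨q, hq, ?_, eLpNorm_lt_of_le (δ := δ) (fun i => ?_) hδε fun i => ?_⟩
  · refine lt_of_le_of_lt ((eLpNorm_sub_le_of_le hu.1.1 (m hs.contDiff.continuous)
      (m hq1.continuous) (δ := δ) ?_ hqs).trans ?_) hδε
    · rw [eLpNorm_sub_comm]
      simp only [one_mul] at h0
      exact h0
    · rw [← two_mul]; gcongr; norm_num
  · rw [comp]
    exact (hg i).1.sub (m (continuous_pd hq1 i))
  · rw [comp]
    refine (eLpNorm_sub_le_of_le (hg i).1 (m (continuous_pd hs.contDiff i))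
      (m (continuous_pd hq1 i)) (δ := δ) ?_ (hqd i)).trans ?_
    · rw [eLpNorm_sub_comm, hpd]
      exact h1 i
    · rw [← two_mul]; gcongr; norm_num

theorem dense_curlFam (h : IsAxialSpanning c a b)
    (f g : Vector)
    (hf : HasCurl₀ c f g) (ε : ENNReal) (hε : 0 < ε) :
    ∃ s ∈ Submodule.span ℂ (Set.range (curlFam a b)),
      eLpNorm (f - s) 2 c.vol < ε ∧ eLpNorm (g - curl s) 2 c.vol < ε := by
  obtain ⟨δ, hδ, hδε⟩ := exists_pos_mul_lt_ennreal hε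
  have hfi : ∀ i, MemLp (fun p => f p i) 2 c.vol := fun i => hf.1.eval i
  have hg : ∀ i, MemLp (fun p => g p i) 2 c.vol := fun i => hf.2.1.eval i
  have ht := c.tendsto_mollScale
  have ht2 : ∀ i j, Filter.Tendsto (fun n => (c.mollScale i n : ℂ) * c.mollScale j n)
      Filter.atTop (nhds 1) := fun i j => by simpa using (ht i).mul (ht j)
  obtain ⟨n, h0, h1⟩ := ((Filter.eventually_all.2 fun i => tendsto_mollify (hfi i) (ht i) hδ).and
    (Filter.eventually_all.2 fun i =>
      tendsto_mollify (hg i) (ht2 (i + 1) (i + 2)) hδ)).exists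
  have hT : ∀ i, c.IsCore (smoothOp c c.mollKer c.mollScale n (fun p => f p i)) := fun i =>
    c.isCore_mollify n (integrable_of_memLp_two c (hfi i))
  -- Component i is multiplied by its dilation factor, the transformation rule of a covector field.
  -- Then curl F is the mollification of g with the product of the two complementary factors.
  -- Indices i + 1, i + 2 are cyclic in `Fin 3`.
  set F : Fin 3 → Scalar := fun i p => c.mollScale i n *
    smoothOp c c.mollKer c.mollScale n (fun p => f p i) p with hF
  have hs : ∀ i, c.IsCore (F i) := fun i => (hT i).const_mul _
  choose q hq hq1 hqs hqd using fun i => (hs i).approx h hδ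
  have m : ∀ {f : Scalar}, Continuous f → AEStronglyMeasurable f c.vol :=
    fun hf => hf.aestronglyMeasurable
  have hpd : ∀ i j, pd j (F i) = fun p => c.mollScale i n *
      pd j (smoothOp c c.mollKer c.mollScale n (fun p => f p i)) p := fun i j =>
    pd_const_mul _ ((hT i).contDiff.differentiable (by simp)) j
  have hcurl : ∀ i, pd (i + 1) (F (i + 2)) - pd (i + 2) (F (i + 1)) =
      fun p => c.mollScale (i + 1) n * c.mollScale (i + 2) n *
        smoothOp c c.mollKer c.mollScale n (fun p => g p i) p := by
    intro i
    rw [hpd, hpd]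
    ext p
    fin_cases i
    · exact c.isApprox_moll.smoothOp_of_hasCurl₀ n hf
        (fun K y => dotProduct_curl_single_zero f K y) p
    · exact c.isApprox_moll.smoothOp_of_hasCurl₀ n hf
        (fun K y => dotProduct_curl_single_one f K y) p
    · exact c.isApprox_moll.smoothOp_of_hasCurl₀ n hf
        (fun K y => dotProduct_curl_single_two f K y) p
  have comp : ∀ i, (fun p => (g - curl (fun p i => q i p)) p i) =
      (fun p => g p i) - (pd (i + 1) (q (i + 2)) - pd (i + 2) (q (i + 1))) := by
    intro i; ext p; fin_cases i <;> rfl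
  have hdm : ∀ i j, AEStronglyMeasurable (pd j (q i)) c.vol := fun i j =>
    m (continuous_pd (hq1 i) j)
  have hFm : ∀ i j, AEStronglyMeasurable (pd j (F i)) c.vol := fun i j =>
    m (continuous_pd (hs i).contDiff j)
  refine ⟨_, vec_mem_span_curlFam h.mem hq, eLpNorm_lt_of_le (δ := δ) (fun i => ?_) hδε fun i => ?_,
    eLpNorm_lt_of_le (δ := δ) (fun i => ?_) hδε fun i => ?_⟩
  · exact (hfi i).1.sub (m (hq1 i).continuous)
  · refine (eLpNorm_sub_le_of_le (hfi i).1 (m (hs i).contDiff.continuous)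
      (m (hq1 i).continuous) (δ := δ) ?_ (hqs i)).trans ?_
    · rw [eLpNorm_sub_comm]
      exact h0 i
    · rw [← two_mul]; gcongr; norm_num
  · rw [comp]
    exact (hg i).1.sub ((hdm _ _).sub (hdm _ _))
  · rw [comp]
    refine (eLpNorm_sub_le_of_le (hg i).1 ((hFm (i + 2) (i + 1)).sub (hFm (i + 1) (i + 2)))
      ((hdm _ _).sub (hdm _ _)) (δ := δ) (δ' := δ + δ) ?_ ?_).trans ?_
    · rw [eLpNorm_sub_comm, hcurl]
      exact h1 i
    · rw [sub_sub_sub_comm]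
      refine (eLpNorm_sub_le ((hFm _ _).sub (hdm _ _)) ((hFm _ _).sub (hdm _ _))
        (by norm_num)).trans (add_le_add (hqd _ _) (hqd _ _))
    · calc δ + (δ + δ) = 3 * δ := by ring
        _ ≤ 4 * δ := by gcongr; norm_num

theorem dense_divFam (h : IsAxialSpanning c a b)
    (f : Vector) (w : Scalar)
    (hf : HasDiv₀ c f w) (ε : ENNReal) (hε : 0 < ε) :
    ∃ s ∈ Submodule.span ℂ (Set.range (divFam a b)),
      eLpNorm (f - s) 2 c.vol < ε ∧ eLpNorm (w - div s) 2 c.vol < ε := by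
  obtain ⟨δ, hδ, hδε⟩ := exists_pos_mul_lt_ennreal hε
  have hfi : ∀ i, MemLp (fun p => f p i) 2 c.vol := fun i => hf.1.eval i
  have ht : ∀ i, Filter.Tendsto (fun n => (c.mollScale i n : ℂ)⁻¹) Filter.atTop (nhds 1) :=
    fun i => by simpa using (c.tendsto_mollScale i).inv₀ one_ne_zero
  obtain ⟨n, h0, h1⟩ := ((Filter.eventually_all.2 fun i => tendsto_mollify (hfi i) (ht i) hδ).and
    (tendsto_mollify hf.2.1 tendsto_const_nhds hδ)).exists
  have hT : ∀ i, c.IsCore (smoothOp c c.mollKer c.mollScale n (fun p => f p i)) := fun i =>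
    c.isCore_mollify n (integrable_of_memLp_two c (hfi i))
  -- For the divergence the components are divided by the dilation factors, and div F is exactly the
  -- mollification of w.
  set F : Fin 3 → Scalar := fun i p => (c.mollScale i n : ℂ)⁻¹ *
    smoothOp c c.mollKer c.mollScale n (fun p => f p i) p with hF
  have hs : ∀ i, c.IsCore (F i) := fun i => (hT i).const_mul _
  choose q hq hq1 hqs hqd using fun i => (hs i).approx h hδ
  have m : ∀ {f : Scalar}, Continuous f → AEStronglyMeasurable f c.vol :=
    fun hf => hf.aestronglyMeasurable
  have hdiv : pd 0 (F 0) + pd 1 (F 1) + pd 2 (F 2) =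
      smoothOp c c.mollKer c.mollScale n w := by
    ext p
    rw [c.isApprox_moll.smoothOp_of_hasDiv₀ n hf p, Fin.sum_univ_three]
    simp only [hF, Pi.add_apply]
    rw [pd_const_mul _ ((hT 0).contDiff.differentiable (by simp)),
      pd_const_mul _ ((hT 1).contDiff.differentiable (by simp)),
      pd_const_mul _ ((hT 2).contDiff.differentiable (by simp))]
  have hdm : ∀ i, AEStronglyMeasurable (pd i (q i)) c.vol := fun i => m (continuous_pd (hq1 i) i)
  have hFm : ∀ i, AEStronglyMeasurable (pd i (F i)) c.vol := fun i =>
    m (continuous_pd (hs i).contDiff i)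
  have hd : ∀ i, AEStronglyMeasurable (pd i (F i) - pd i (q i)) c.vol := fun i =>
    (hFm i).sub (hdm i)
  have comp : w - div (fun p i => q i p) =
      w - (pd 0 (q 0) + pd 1 (q 1) + pd 2 (q 2)) := rfl
  refine ⟨_, vec_mem_span_divFam h.mem hq, eLpNorm_lt_of_le (δ := δ) (fun i => ?_) hδε fun i => ?_,
    lt_of_le_of_lt ?_ hδε⟩
  · exact (hfi i).1.sub (m (hq1 i).continuous)
  · refine (eLpNorm_sub_le_of_le (hfi i).1 (m (hs i).contDiff.continuous)
      (m (hq1 i).continuous) (δ := δ) ?_ (hqs i)).trans ?_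
    · rw [eLpNorm_sub_comm]
      exact h0 i
    · rw [← two_mul]; gcongr; norm_num
  · rw [comp]
    refine (eLpNorm_sub_le_of_le hf.2.1.1 (((hFm 0).add (hFm 1)).add (hFm 2))
      (((hdm 0).add (hdm 1)).add (hdm 2)) (δ := δ) (δ' := δ + δ + δ) ?_ ?_).trans ?_
    · rw [eLpNorm_sub_comm, hdiv]
      simp only [one_mul] at h1
      exact h1
    · rw [add_sub_add_comm, add_sub_add_comm]
      refine (eLpNorm_add_le ((hd 0).add (hd 1)) (hd 2) (by norm_num)).trans
        (add_le_add ((eLpNorm_add_le (hd 0) (hd 1) (by norm_num)).trans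
          (add_le_add (hqd _ _) (hqd _ _))) (hqd _ _))
    · calc δ + (δ + δ + δ) = 4 * δ := by ring
        _ ≤ 30 * δ := by gcongr; norm_num

theorem isDeRhamBasis (hp : IsAxialPair c a b) (h : IsAxialSpanning c a b)
    (ha : LinearIndependent ℂ fun k => fun z : c.axis => a k z)
    (hb : LinearIndependent ℂ fun k => fun z : c.axis => b k z) :
    IsDeRhamBasis c (h1Fam a) (curlFam a b) (divFam a b) (l2Fam b) where
  mem₀ i := hasGrad₀_of_smooth (smooth_h1Fam hp i) (vanish_h1Fam hp i)
  mem₁ i := hasCurl₀_of_smooth (smooth_curlFam hp i) (normal_curlFam hp i)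
  mem₂ i := hasDiv₀_of_smooth (smooth_divFam hp i) (tangential_divFam hp i)
  mem₃ i := memLp_of_continuous c (smooth_l2Fam hp i).contDiff.continuous 2
  vanish := vanish_h1Fam hp
  normal := normal_curlFam hp
  tangential := tangential_divFam hp
  indep₀ := indepOn_h1Fam ha
  indep₁ := indepOn_curlFam ha hb
  indep₂ := indepOn_divFam ha hb
  indep₃ := indepOn_l2Fam hb
  dense₀ := dense_h1Fam h
  dense₁ := dense_curlFam h
  dense₂ := dense_divFam h
  dense₃ := dense_l2Fam h

end

theorem isDeRhamBasis_periodic : IsDeRhamBasis .periodic (h1Fam expWave) (curlFam expWave expWave)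
    (divFam expWave expWave) (l2Fam expWave) :=
  isDeRhamBasis isAxialPair_expWave isAxialSpanning_expWave
    linearIndependent_expWave_axis linearIndependent_expWave_axis

theorem isDeRhamBasis_finite : IsDeRhamBasis .finite (h1Fam wUltra) (curlFam wUltra legendre)
    (divFam wUltra legendre) (l2Fam legendre) :=
  isDeRhamBasis isAxialPair_wUltra isAxialSpanning_wUltra
    linearIndependent_wUltra linearIndependent_legendre

/-! ### Linearity of the differential operators and exactness of the sub-complexes -/

theorem grad_smul (x : ℂ) {u : Scalar} (hu : Differentiable ℝ u) :
    grad (x • u) = x • grad u := by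
  have h := fun i => pd_const_mul x hu i
  ext p i
  fin_cases i <;> exact congrFun (h _) p

theorem curl_add {f g : Vector} (hf : ∀ i, Differentiable ℝ fun p => f p i)
    (hg : ∀ i, Differentiable ℝ fun p => g p i) : curl (f + g) = curl f + curl g := by
  have h := fun i j => pd_add (hf i) (hg i) j
  ext p i
  fin_cases i <;> simp [curl, h] <;> ring

theorem curl_smul (x : ℂ) {f : Vector} (hf : ∀ i, Differentiable ℝ fun p => f p i) :
    curl (x • f) = x • curl f := by
  have h := fun i j => pd_const_mul x (hf i) j
  ext p i
  fin_cases i <;> simp [curl, h] <;> ring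

theorem div_add {f g : Vector} (hf : ∀ i, Differentiable ℝ fun p => f p i)
    (hg : ∀ i, Differentiable ℝ fun p => g p i) : div (f + g) = div f + div g := by
  have h := fun i j => pd_add (hf i) (hg i) j
  ext p
  simp [div, h]; ring

theorem div_smul (x : ℂ) {f : Vector} (hf : ∀ i, Differentiable ℝ fun p => f p i) :
    div (x • f) = x • div f := by
  have h := fun i j => pd_const_mul x (hf i) j
  ext p
  simp [div, h]; ring

theorem grad_zero : grad 0 = 0 := by simpa using grad_smul 0 (differentiable_const (0 : ℂ))

theorem curl_zero : curl 0 = 0 := by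
  simpa using curl_smul 0 (f := 0) fun _ => differentiable_const (0 : ℂ)

theorem div_zero : div 0 = 0 := by
  simpa using div_smul 0 (f := 0) fun _ => differentiable_const (0 : ℂ)

theorem differentiable_smul (x : ℂ) {f : Vector} (hf : ∀ i, Differentiable ℝ fun p => f p i) :
    ∀ i, Differentiable ℝ fun p => (x • f) p i := fun i => (hf i).const_mul x

theorem differentiable_add {f g : Vector} (hf : ∀ i, Differentiable ℝ fun p => f p i)
    (hg : ∀ i, Differentiable ℝ fun p => g p i) :
    ∀ i, Differentiable ℝ fun p => (f + g) p i := fun i => (hf i).add (hg i)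

theorem LinearIndependent.eq_zero_of_pair {ι M : Type*} [AddCommGroup M] [Module ℂ M] {v : ι → M}
    (hv : LinearIndependent ℂ v) {i j : ι} (hij : i ≠ j) {x y : ℂ}
    (h : x • v i + y • v j = 0) : x = 0 ∧ y = 0 := by
  classical
  have h0 := linearIndependent_iff.1 hv (Finsupp.single i x + Finsupp.single j y) (by
    simpa [Finsupp.linearCombination_single] using h)
  have hi := DFunLike.congr_fun h0 i
  have hj := DFunLike.congr_fun h0 j
  simp [hij, hij.symm] at hi hj
  exact ⟨hi, hj⟩

theorem LinearIndependent.eq_zero_of_triple {ι M : Type*} [AddCommGroup M] [Module ℂ M]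
    {v : ι → M} (hv : LinearIndependent ℂ v) {i j k : ι} (hij : i ≠ j) (hik : i ≠ k) (hjk : j ≠ k)
    {x y z : ℂ} (h : x • v i + y • v j + z • v k = 0) : x = 0 ∧ y = 0 ∧ z = 0 := by
  classical
  have h0 := linearIndependent_iff.1 hv
    (Finsupp.single i x + Finsupp.single j y + Finsupp.single k z) (by
    simpa [Finsupp.linearCombination_single] using h)
  have hi := DFunLike.congr_fun h0 i
  have hj := DFunLike.congr_fun h0 j
  have hk := DFunLike.congr_fun h0 k
  simp [hij, hij.symm, hik, hik.symm, hjk, hjk.symm] at hi hj hk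
  exact ⟨hi, hj, hk⟩

section

variable {c : Cylinder} {K : Type} {a b : K → ℝ → ℂ} {k k' : K} {l : ℂ}

theorem differentiable_curlFam (hp : IsAxialPair c a b) (i : VecIdx K) (n : Fin 3) :
    Differentiable ℝ fun p => curlFam a b i p n :=
  (smooth_curlFam hp i n).contDiff.differentiable (by simp)

theorem differentiable_divFam (hp : IsAxialPair c a b) (i : VecIdx K) (n : Fin 3) :
    Differentiable ℝ fun p => divFam a b i p n :=
  (smooth_divFam hp i n).contDiff.differentiable (by simp)

/-- The common setting of the sub-complexes: a pair of axial families, each of them independent on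
the axis. -/
structure IsAxialBasis (c : Cylinder) {K : Type} (a b : K → ℝ → ℂ) : Prop extends
    IsAxialPair c a b where
  left : LinearIndependent ℂ fun k => fun z : c.axis => a k z
  right : LinearIndependent ℂ fun k => fun z : c.axis => b k z

theorem IsAxialBasis.h1Fam (h : IsAxialBasis c a b) : LinearIndependent ℂ (h1Fam a) :=
  IndepOn.linearIndependent (indepOn_h1Fam h.left)

theorem IsAxialBasis.curlFam (h : IsAxialBasis c a b) : LinearIndependent ℂ (curlFam a b) :=
  IndepOn.linearIndependent (indepOn_curlFam h.left h.right)

theorem IsAxialBasis.divFam (h : IsAxialBasis c a b) : LinearIndependent ℂ (divFam a b) :=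
  IndepOn.linearIndependent (indepOn_divFam h.left h.right)

theorem IsAxialBasis.l2Fam (h : IsAxialBasis c a b) : LinearIndependent ℂ (l2Fam b) :=
  IndepOn.linearIndependent (indepOn_l2Fam h.right)

/-- With α = j + 1, the maps are x ↦ (-αx, 0, lx), (x, y, t) ↦ (lx + αt, ly, -κy) and (x, y, t) ↦ κy
+ lt. Exactness needs only α ≠ 0 and κ ≠ 0, so l = 0 is allowed. -/
theorem isExact_main (h : IsAxialBasis c a b) (hk : IsAxialDeriv (a k) (l • b k')) (m : ℤ) (j : ℕ) :
    FourTerm.IsExact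
      { V₀ := Submodule.span ℂ {scal (a k) (wZernike m j)}
        V₁ := Submodule.span ℂ {horiz (a k) (nPlus m (j + 1)),
          horiz (a k) (nMinus m (j + 1)), vert (b k') (wZernike m j)}
        V₂ := Submodule.span ℂ {horiz (b k') (tPlus m (j + 1)),
          horiz (b k') (tMinus m (j + 1)), vert (a k) (zernike m (j + 1))}
        V₃ := Submodule.span ℂ {scal (b k') (zernike m (j + 1))} } := by
  have hp : 1 ≤ j + 1 := by omega
  have hm : 1 - |m| ≤ ((j + 1 : ℕ) : ℤ) := by have := abs_nonneg m; omega
  have hj : (j : ℂ) + 1 ≠ 0 := by exact_mod_cast j.succ_ne_zero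
  have hκ : kappa m (j + 1) ≠ 0 := kappa_ne_zero hm
  have e1 := grad_scal_wZernike (m := m) (j := j) hk
  have e2 := curl_horiz_nPlus m _ hk hp
  have e3 := curl_horiz_nMinus m _ hk hm
  have e4 := curl_vert_wZernike (m := m) (j := j) (h.smooth_right k')
  have e5 := div_horiz_tPlus m _ (h.smooth_right k') hp
  have e6 := div_horiz_tMinus m _ (h.smooth_right k') hm
  have e7 := div_vert_zernike (m := m) (j := j + 1) hk
  have d0 : Differentiable ℝ (scal (a k) (wZernike m j)) :=
    (smooth_h1Fam h.toIsAxialPair (m, k, j)).contDiff.differentiable (by simp)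
  have d1 := differentiable_curlFam h.toIsAxialPair (.plus m k (j + 1) hp)
  have d2 := differentiable_curlFam h.toIsAxialPair (.minus m k (j + 1) hm)
  have d3 := differentiable_curlFam h.toIsAxialPair (.axial m k' j)
  have d4 := differentiable_divFam h.toIsAxialPair (.plus m k' (j + 1) hp)
  have d5 := differentiable_divFam h.toIsAxialPair (.minus m k' (j + 1) hm)
  have d6 := differentiable_divFam h.toIsAxialPair (.axial m k (j + 1))
  have i1 := fun x y => LinearIndependent.eq_zero_of_pair (x := x) (y := y) h.curlFam
    (i := .plus m k (j + 1) hp) (j := .axial m k' j) (by simp)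
  have i2 := fun x y z => LinearIndependent.eq_zero_of_triple (x := x) (y := y) (z := z) h.divFam
    (i := .plus m k' (j + 1) hp) (j := .minus m k' (j + 1) hm) (k := .axial m k (j + 1))
    (by simp) (by simp) (by simp)
  have i3 := h.l2Fam.ne_zero (m, k', j + 1)
  simp only [curlFam, divFam, l2Fam] at d1 d2 d3 d4 d5 d6 i1 i2 i3
  generalize scal (a k) (wZernike m j) = w at *
  generalize horiz (a k) (nPlus m (j + 1)) = np at *
  generalize horiz (a k) (nMinus m (j + 1)) = nm at *
  generalize vert (b k') (wZernike m j) = v at *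
  generalize horiz (b k') (tPlus m (j + 1)) = tp at *
  generalize horiz (b k') (tMinus m (j + 1)) = tm at *
  generalize vert (a k) (zernike m (j + 1)) = z at *
  generalize scal (b k') (zernike m (j + 1)) = s at *
  generalize kappa m (j + 1) = κ at *
  generalize (j : ℂ) + 1 = α at *
  have g0 : ∀ x : ℂ, grad (x • w) = (-(x * α)) • np + (x * l) • v := fun x => by
    rw [grad_smul x d0, e1]; module
  have g1 : ∀ x y t : ℂ, curl (x • np + y • nm + t • v) =
      (x * l + t * α) • tp + (y * l) • tm + (-(y * κ)) • z := fun x y t => by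
    rw [curl_add (differentiable_add (differentiable_smul x d1) (differentiable_smul y d2))
      (differentiable_smul t d3), curl_add (differentiable_smul x d1) (differentiable_smul y d2),
      curl_smul x d1, curl_smul y d2, curl_smul t d3, e2, e3, e4]
    module
  have g2 : ∀ x y t : ℂ, div (x • tp + y • tm + t • z) = (y * κ + t * l) • s := fun x y t => by
    rw [div_add (differentiable_add (differentiable_smul x d4) (differentiable_smul y d5))
      (differentiable_smul t d6), div_add (differentiable_smul x d4) (differentiable_smul y d5),
      div_smul x d4, div_smul y d5, div_smul t d6, e5, e6, e7]
    module
  simp only [FourTerm.IsExact, FourTerm.IsSubcomplex, Submodule.mem_span_singleton,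
    Submodule.mem_span_triple]
  refine ⟨⟨?_, ?_, ?_⟩, ?_, ?_, ?_, ?_⟩
  · rintro _ ⟨x, rfl⟩
    exact ⟨-(x * α), 0, x * l, by rw [g0]; module⟩
  · rintro _ ⟨x, y, t, rfl⟩
    exact ⟨_, _, _, (g1 x y t).symm⟩
  · rintro _ ⟨x, y, t, rfl⟩
    exact ⟨_, (g2 x y t).symm⟩
  · rintro _ ⟨x, rfl⟩ h0
    rw [g0] at h0
    have := (i1 _ _ h0).1
    rw [(mul_eq_zero.1 (neg_eq_zero.1 this)).resolve_right hj, zero_smul]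
  · rintro _ ⟨x, y, t, rfl⟩
    constructor
    · intro h0
      rw [g1] at h0
      obtain ⟨h1, -, h2⟩ := i2 _ _ _ h0
      have hy : y = 0 := (mul_eq_zero.1 (neg_eq_zero.1 h2)).resolve_right hκ
      -- The potential is read off the n⁺ coefficient; the relation lx + αt = 0 takes care of the
      -- vertical one.
      refine ⟨_, ⟨-(x / α), rfl⟩, ?_⟩
      rw [g0, hy, show -(-(x / α) * α) = x by field_simp,
        show -(x / α) * l = t by field_simp; linear_combination -h1, zero_smul, add_zero]
    · rintro ⟨_, ⟨r, rfl⟩, hr⟩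
      rw [← hr, g0, show (-(r * α)) • np + (r * l) • v = (-(r * α)) • np + (0 : ℂ) • nm + (r * l) • v
        by module, g1]
      module
  · rintro _ ⟨x, y, t, rfl⟩
    constructor
    · intro h0
      rw [g2] at h0
      have h1 := (smul_eq_zero.1 h0).resolve_right i3
      -- The vertical coefficient determines the amount of n⁻, and the t⁺ coefficient is supplied by
      -- the vertical field alone.
      refine ⟨_, ⟨0, -(t / κ), x / α, rfl⟩, ?_⟩
      rw [g1, show 0 * l + x / α * α = x by field_simp; ring,
        show -(t / κ) * l = y by field_simp; linear_combination -h1,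
        show -(-(t / κ) * κ) = t by field_simp]
    · rintro ⟨_, ⟨p, q, r, rfl⟩, hr⟩
      rw [← hr, g1, g2]
      module
  · rintro _ ⟨x, rfl⟩
    refine ⟨_, ⟨0, x / κ, 0, rfl⟩, ?_⟩
    rw [g2, show x / κ * κ + 0 * l = x by field_simp; ring]

/-- Without the gradient part only κ ≠ 0 is needed, again for any l. -/
theorem isExact_edge (h : IsAxialBasis c a b) (hk : IsAxialDeriv (a k) (l • b k')) {m : ℤ}
    (hm : m ≠ 0) :
    FourTerm.IsExact
      { V₀ := ⊥
        V₁ := Submodule.span ℂ {horiz (a k) (nMinus m 0)}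
        V₂ := Submodule.span ℂ {horiz (b k') (tMinus m 0), vert (a k) (zernike m 0)}
        V₃ := Submodule.span ℂ {scal (b k') (zernike m 0)} } := by
  have hm : 1 - |m| ≤ ((0 : ℕ) : ℤ) := by have := abs_pos.2 hm; omega
  have hκ : kappa m 0 ≠ 0 := kappa_ne_zero hm
  have e3 := curl_horiz_nMinus m _ hk hm
  have e6 := div_horiz_tMinus m _ (h.smooth_right k') hm
  have e7 := div_vert_zernike (m := m) (j := 0) hk
  have d2 := differentiable_curlFam h.toIsAxialPair (.minus m k 0 hm)
  have d5 := differentiable_divFam h.toIsAxialPair (.minus m k' 0 hm)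
  have d6 := differentiable_divFam h.toIsAxialPair (.axial m k 0)
  have i2 := fun x y => LinearIndependent.eq_zero_of_pair (x := x) (y := y) h.divFam
    (i := .minus m k' 0 hm) (j := .axial m k 0) (by simp)
  have i3 := h.l2Fam.ne_zero (m, k', 0)
  simp only [curlFam, divFam, l2Fam] at d2 d5 d6 i2 i3
  generalize horiz (a k) (nMinus m 0) = nm at *
  generalize horiz (b k') (tMinus m 0) = tm at *
  generalize vert (a k) (zernike m 0) = z at *
  generalize scal (b k') (zernike m 0) = s at *
  generalize kappa m 0 = κ at *
  have g1 : ∀ y : ℂ, curl (y • nm) = (y * l) • tm + (-(y * κ)) • z := fun y => by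
    rw [curl_smul y d2, e3]
    module
  have g2 : ∀ y t : ℂ, div (y • tm + t • z) = (y * κ + t * l) • s := fun y t => by
    rw [div_add (differentiable_smul y d5) (differentiable_smul t d6), div_smul y d5,
      div_smul t d6, e6, e7]
    module
  simp only [FourTerm.IsExact, FourTerm.IsSubcomplex, Submodule.mem_span_singleton,
    Submodule.mem_span_pair, Submodule.mem_bot, forall_eq, exists_eq_left, grad_zero]
  refine ⟨⟨⟨0, zero_smul _ _⟩, ?_, ?_⟩, fun _ => trivial, ?_, ?_, ?_⟩
  · rintro _ ⟨y, rfl⟩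
    exact ⟨_, _, (g1 y).symm⟩
  · rintro _ ⟨y, t, rfl⟩
    exact ⟨_, (g2 y t).symm⟩
  · rintro _ ⟨y, rfl⟩
    constructor
    · intro h0
      rw [g1] at h0
      have h2 := (i2 _ _ h0).2
      rw [(mul_eq_zero.1 (neg_eq_zero.1 h2)).resolve_right hκ, zero_smul]
    · intro hr
      rw [← hr, curl_zero]
  · rintro _ ⟨y, t, rfl⟩
    constructor
    · intro h0
      rw [g2] at h0
      have h1 := (smul_eq_zero.1 h0).resolve_right i3
      refine ⟨_, ⟨-(t / κ), rfl⟩, ?_⟩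
      rw [g1, show -(t / κ) * l = y by field_simp; linear_combination -h1,
        show -(-(t / κ) * κ) = t by field_simp]
    · rintro ⟨_, ⟨q, rfl⟩, hr⟩
      rw [← hr, g1, g2]
      module
  · rintro _ ⟨x, rfl⟩
    refine ⟨_, ⟨x / κ, 0, rfl⟩, ?_⟩
    rw [g2, show x / κ * κ + 0 * l = x by field_simp; ring]

/-- The block of an axial function b that is not paired with a derivative of any a, as P₀ on the
finite cylinder. The terms with l are absent, and α and κ act separately on t⁺ and t⁻. -/
theorem isExact_low (h : IsAxialBasis c a b) (k' : K) (m : ℤ) (j : ℕ) :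
    FourTerm.IsExact
      { V₀ := ⊥
        V₁ := Submodule.span ℂ {vert (b k') (wZernike m j)}
        V₂ := Submodule.span ℂ {horiz (b k') (tPlus m (j + 1)), horiz (b k') (tMinus m (j + 1))}
        V₃ := Submodule.span ℂ {scal (b k') (zernike m (j + 1))} } := by
  have hp : 1 ≤ j + 1 := by omega
  have hm : 1 - |m| ≤ ((j + 1 : ℕ) : ℤ) := by have := abs_nonneg m; omega
  have hj : (j : ℂ) + 1 ≠ 0 := by exact_mod_cast j.succ_ne_zero
  have hκ : kappa m (j + 1) ≠ 0 := kappa_ne_zero hm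
  have e4 := curl_vert_wZernike (m := m) (j := j) (h.smooth_right k')
  have e5 := div_horiz_tPlus m _ (h.smooth_right k') hp
  have e6 := div_horiz_tMinus m _ (h.smooth_right k') hm
  have d3 := differentiable_curlFam h.toIsAxialPair (.axial m k' j)
  have d4 := differentiable_divFam h.toIsAxialPair (.plus m k' (j + 1) hp)
  have d5 := differentiable_divFam h.toIsAxialPair (.minus m k' (j + 1) hm)
  have i2 := h.divFam.ne_zero (.plus m k' (j + 1) hp)
  have i3 := h.l2Fam.ne_zero (m, k', j + 1)
  simp only [curlFam, divFam, l2Fam] at d3 d4 d5 i2 i3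
  generalize vert (b k') (wZernike m j) = v at *
  generalize horiz (b k') (tPlus m (j + 1)) = tp at *
  generalize horiz (b k') (tMinus m (j + 1)) = tm at *
  generalize scal (b k') (zernike m (j + 1)) = s at *
  generalize kappa m (j + 1) = κ at *
  generalize (j : ℂ) + 1 = α at *
  have g1 : ∀ t : ℂ, curl (t • v) = (t * α) • tp := fun t => by
    rw [curl_smul t d3, e4]
    module
  have g2 : ∀ x y : ℂ, div (x • tp + y • tm) = (y * κ) • s := fun x y => by
    rw [div_add (differentiable_smul x d4) (differentiable_smul y d5), div_smul x d4,
      div_smul y d5, e5, e6]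
    module
  simp only [FourTerm.IsExact, FourTerm.IsSubcomplex, Submodule.mem_span_singleton,
    Submodule.mem_span_pair, Submodule.mem_bot, forall_eq, exists_eq_left, grad_zero]
  refine ⟨⟨⟨0, zero_smul _ _⟩, ?_, ?_⟩, fun _ => trivial, ?_, ?_, ?_⟩
  · rintro _ ⟨t, rfl⟩
    exact ⟨t * α, 0, by rw [g1]; module⟩
  · rintro _ ⟨x, y, rfl⟩
    exact ⟨_, (g2 x y).symm⟩
  · rintro _ ⟨t, rfl⟩
    constructor
    · intro h0
      rw [g1] at h0
      rw [(mul_eq_zero.1 ((smul_eq_zero.1 h0).resolve_right i2)).resolve_right hj, zero_smul]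
    · intro hr
      rw [← hr, curl_zero]
  · rintro _ ⟨x, y, rfl⟩
    constructor
    · intro h0
      rw [g2] at h0
      have hy := (mul_eq_zero.1 ((smul_eq_zero.1 h0).resolve_right i3)).resolve_right hκ
      refine ⟨_, ⟨x / α, rfl⟩, ?_⟩
      rw [g1, hy, show x / α * α = x by field_simp]
      module
    · rintro ⟨_, ⟨t, rfl⟩, hr⟩
      have := g2 (t * α) 0
      rw [← hr, g1]
      simpa using this
  · rintro _ ⟨x, rfl⟩
    refine ⟨_, ⟨0, x / κ, rfl⟩, ?_⟩
    rw [g2, show x / κ * κ = x by field_simp]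

/-- The complex `0 → 0 → 0 → ⟨f⟩ → ⟨s⟩ → 0` with `div f = κ s`. -/
theorem isSubcomplex_tail {f : Vector} {s : Scalar} {κ : ℂ}
    (hf : ∀ i, Differentiable ℝ fun p => f p i) (h : div f = κ • s) :
    FourTerm.IsSubcomplex
      { V₀ := ⊥, V₁ := ⊥, V₂ := Submodule.span ℂ {f}, V₃ := Submodule.span ℂ {s} } := by
  simp only [FourTerm.IsSubcomplex, Submodule.mem_span_singleton, Submodule.mem_bot, forall_eq,
    grad_zero, curl_zero, true_and]
  refine ⟨⟨0, zero_smul _ _⟩, ?_⟩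
  rintro _ ⟨x, rfl⟩
  exact ⟨x * κ, by rw [div_smul x hf, h, smul_smul]⟩

theorem isExact_tail {f : Vector} {s : Scalar} {κ : ℂ}
    (hf : ∀ i, Differentiable ℝ fun p => f p i) (h : div f = κ • s) (hκ : κ ≠ 0) (hs : s ≠ 0) :
    FourTerm.IsExact
      { V₀ := ⊥, V₁ := ⊥, V₂ := Submodule.span ℂ {f}, V₃ := Submodule.span ℂ {s} } := by
  have g : ∀ x : ℂ, div (x • f) = (x * κ) • s := fun x => by rw [div_smul x hf, h, smul_smul]
  refine ⟨isSubcomplex_tail hf h, ?_⟩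
  simp only [Submodule.mem_span_singleton, Submodule.mem_bot, forall_eq, exists_eq_left, grad_zero,
    curl_zero, true_and, forall_true_left]
  refine ⟨?_, ?_⟩
  · rintro _ ⟨x, rfl⟩
    constructor
    · intro h0
      rw [g] at h0
      rw [(mul_eq_zero.1 ((smul_eq_zero.1 h0).resolve_right hs)).resolve_right hκ, zero_smul]
    · intro hr
      rw [← hr, div_zero]
  · rintro _ ⟨x, rfl⟩
    refine ⟨_, ⟨x / κ, rfl⟩, ?_⟩
    rw [g, show x / κ * κ = x by field_simp]

end

/-! ### Decomposition into sub-complexes -/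

theorem isAxialBasis_expWave : IsAxialBasis .periodic expWave expWave :=
  ⟨isAxialPair_expWave, linearIndependent_expWave_axis, linearIndependent_expWave_axis⟩

theorem isAxialBasis_wUltra : IsAxialBasis .finite wUltra legendre :=
  ⟨isAxialPair_wUltra, linearIndependent_wUltra, linearIndependent_legendre⟩

/-- The spans of the fibres of a map on the index set of an independent family. -/
theorem LinearIndependent.iSupIndep_of_fibres {ι κ M : Type*} [AddCommGroup M] [Module ℂ M]
    {v : ι → M} (hv : LinearIndependent ℂ v) (f : ι → κ) {V : κ → Submodule ℂ M}
    (h1 : ∀ i, v i ∈ V (f i)) (h2 : ∀ k, ∃ S : Set M, V k = Submodule.span ℂ S ∧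
      ∀ x ∈ S, ∃ i, f i = k ∧ v i = x) :
    iSupIndep V ∧ ⨆ k, V k = Submodule.span ℂ (Set.range v) := by
  have hV : ∀ k, V k = Submodule.span ℂ (v '' (f ⁻¹' {k})) := by
    intro k
    obtain ⟨S, hS, hx⟩ := h2 k
    refine le_antisymm ?_ (Submodule.span_le.2 ?_)
    · rw [hS]
      refine Submodule.span_mono fun x hxS => ?_
      obtain ⟨i, hi, rfl⟩ := hx x hxS
      exact ⟨i, hi, rfl⟩
    · rintro _ ⟨i, rfl, rfl⟩
      exact h1 i
  -- Any union of blocks spans what the corresponding indices span; both independence and the total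
  -- span are instances.
  have hsup : ∀ p : κ → Prop, ⨆ k, ⨆ _ : p k, V k = Submodule.span ℂ (v '' {i | p (f i)}) := by
    intro p
    simp only [hV, ← Submodule.span_iUnion, ← Set.image_iUnion]
    congr 2
    ext i
    simp
  refine ⟨fun k => ?_, ?_⟩
  · rw [hsup, hV]
    refine LinearIndependent.disjoint_span_image hv (Set.disjoint_left.2 ?_)
    rintro i rfl hi
    exact hi rfl
  · have := hsup fun _ => True
    simpa using this

/-- The sub-complex that contains a given element of the bases; indices that do not occur go to an
arbitrary one. -/
def perBlock₁ : VecIdx ℤ → PerBlock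
  | .plus m k j _ => .main m k (j - 1)
  | .minus m k 0 _ => if hm : m = 0 then .const k else .edge m k hm
  | .minus m k (j + 1) _ => .main m k j
  | .axial m k j => .main m k j

def perBlock₃ : ℤ × ℤ × ℕ → PerBlock
  | (m, k, 0) => if hm : m = 0 then .const k else .edge m k hm
  | (m, k, j + 1) => .main m k j

def perBlock₂ : VecIdx ℤ → PerBlock
  | .plus m k j _ => .main m k (j - 1)
  | .minus m k 0 _ => if hm : m = 0 then .const k else .edge m k hm
  | .minus m k (j + 1) _ => .main m k j
  | .axial m k j => perBlock₃ (m, k, j)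

/-- Since W_k differentiates to P_{k+1}, elements carrying P_{k+1} join the blocks of W_k, and those
carrying P₀ go to the low blocks. The same shift governs `finBlock₂` and `finBlock₃`. The value
`const` for `minus` at j = 0 and m = 0 is a placeholder, as no such index exists. -/
def finBlock₁ : VecIdx ℕ → FinBlock
  | .plus m k j _ => .main m k (j - 1)
  | .minus m k 0 _ => if hm : m = 0 then .const else .edge m k hm
  | .minus m k (j + 1) _ => .main m k j
  | .axial m 0 j => .low m j
  | .axial m (k + 1) j => .main m k j

def finBlock₂ : VecIdx ℕ → FinBlock
  | .plus m 0 j _ => .low m (j - 1)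
  | .plus m (k + 1) j _ => .main m k (j - 1)
  | .minus m 0 0 _ => if hm : m = 0 then .const else .lowEdge m hm
  | .minus m 0 (j + 1) _ => .low m j
  | .minus m (k + 1) 0 _ => if hm : m = 0 then .const else .edge m k hm
  | .minus m (k + 1) (j + 1) _ => .main m k j
  | .axial m k 0 => if hm : m = 0 then .axial k else .edge m k hm
  | .axial m k (j + 1) => .main m k j

def finBlock₃ : ℤ × ℕ × ℕ → FinBlock
  | (m, 0, 0) => if hm : m = 0 then .const else .lowEdge m hm
  | (m, 0, j + 1) => .low m j
  | (m, k + 1, 0) => if hm : m = 0 then .axial k else .edge m k hm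
  | (m, k + 1, j + 1) => .main m k j

theorem one_sub_abs_succ_le (m : ℤ) (j : ℕ) : 1 - |m| ≤ ((j + 1 : ℕ) : ℤ) := by
  have := abs_nonneg m
  omega

theorem one_sub_abs_zero_le {m : ℤ} (hm : m ≠ 0) : 1 - |m| ≤ ((0 : ℕ) : ℤ) := by
  have := abs_pos.2 hm
  omega

theorem ne_zero_of_one_sub_abs_zero_le {m : ℤ} (h : 1 - |m| ≤ ((0 : ℕ) : ℤ)) : m ≠ 0 := by
  rintro rfl
  simp at h

theorem decomposesInto_periodic : DecomposesInto PerBlock.terms (h1Fam expWave)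
    (curlFam expWave expWave) (divFam expWave expWave) (l2Fam expWave) := by
  have h := isAxialBasis_expWave
  refine ⟨LinearIndependent.iSupIndep_of_fibres h.h1Fam
      (fun i => PerBlock.main i.1 i.2.1 i.2.2) (V := fun i => (PerBlock.terms i).V₀) ?_ ?_,
    LinearIndependent.iSupIndep_of_fibres h.curlFam perBlock₁
      (V := fun i => (PerBlock.terms i).V₁) ?_ ?_,
    LinearIndependent.iSupIndep_of_fibres h.divFam perBlock₂
      (V := fun i => (PerBlock.terms i).V₂) ?_ ?_,
    LinearIndependent.iSupIndep_of_fibres h.l2Fam perBlock₃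
      (V := fun i => (PerBlock.terms i).V₃) ?_ ?_⟩
  · rintro ⟨m, k, j⟩
    exact Submodule.subset_span rfl
  · rintro (⟨m, k, j⟩ | ⟨m, k, hm⟩ | ⟨k⟩)
    · exact ⟨_, rfl, by rintro _ rfl; exact ⟨(m, k, j), rfl, rfl⟩⟩
    · exact ⟨∅, Submodule.span_empty.symm, by simp⟩
    · exact ⟨∅, Submodule.span_empty.symm, by simp⟩
  · rintro (⟨m, k, j, hj⟩ | ⟨m, k, j, hj⟩ | ⟨m, k, j⟩)
    · obtain ⟨j, rfl⟩ : ∃ i, j = i + 1 := ⟨j - 1, by omega⟩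
      exact Submodule.subset_span (by simp [curlFam])
    · rcases j with _ | j
      · rw [perBlock₁, dif_neg (ne_zero_of_one_sub_abs_zero_le hj)]
        exact Submodule.subset_span (by simp [curlFam])
      · exact Submodule.subset_span (by simp [curlFam])
    · exact Submodule.subset_span (by simp [curlFam])
  · rintro (⟨m, k, j⟩ | ⟨m, k, hm⟩ | ⟨k⟩)
    · refine ⟨_, rfl, ?_⟩
      rintro _ (rfl | rfl | rfl)
      · exact ⟨.plus m k (j + 1) (by omega), rfl, rfl⟩
      · exact ⟨.minus m k (j + 1) (one_sub_abs_succ_le m j), rfl, rfl⟩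
      · exact ⟨.axial m k j, rfl, rfl⟩
    · refine ⟨_, rfl, ?_⟩
      rintro _ rfl
      exact ⟨.minus m k 0 (one_sub_abs_zero_le hm), by simp [perBlock₁, hm], rfl⟩
    · exact ⟨∅, Submodule.span_empty.symm, by simp⟩
  · rintro (⟨m, k, j, hj⟩ | ⟨m, k, j, hj⟩ | ⟨m, k, j⟩)
    · obtain ⟨j, rfl⟩ : ∃ i, j = i + 1 := ⟨j - 1, by omega⟩
      exact Submodule.subset_span (by simp [divFam])
    · rcases j with _ | j
      · rw [perBlock₂, dif_neg (ne_zero_of_one_sub_abs_zero_le hj)]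
        exact Submodule.subset_span (by simp [divFam])
      · exact Submodule.subset_span (by simp [divFam])
    · rcases j with _ | j
      · by_cases hm : m = 0
        · subst hm
          exact Submodule.subset_span (by simp [divFam])
        · rw [perBlock₂, perBlock₃, dif_neg hm]
          exact Submodule.subset_span (by simp [divFam])
      · exact Submodule.subset_span (by simp [divFam])
  · rintro (⟨m, k, j⟩ | ⟨m, k, hm⟩ | ⟨k⟩)
    · refine ⟨_, rfl, ?_⟩
      rintro _ (rfl | rfl | rfl)
      · exact ⟨.plus m k (j + 1) (by omega), rfl, rfl⟩
      · exact ⟨.minus m k (j + 1) (one_sub_abs_succ_le m j), rfl, rfl⟩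
      · exact ⟨.axial m k (j + 1), rfl, rfl⟩
    · refine ⟨_, rfl, ?_⟩
      rintro _ (rfl | rfl)
      · exact ⟨.minus m k 0 (one_sub_abs_zero_le hm), by simp [perBlock₂, hm], rfl⟩
      · exact ⟨.axial m k 0, by simp [perBlock₂, perBlock₃, hm], rfl⟩
    · refine ⟨_, rfl, ?_⟩
      rintro _ rfl
      exact ⟨.axial 0 k 0, rfl, rfl⟩
  · rintro ⟨m, k, j⟩
    rcases j with _ | j
    · by_cases hm : m = 0
      · subst hm
        exact Submodule.subset_span (by simp [l2Fam])
      · rw [perBlock₃, dif_neg hm]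
        exact Submodule.subset_span (by simp [l2Fam])
    · exact Submodule.subset_span (by simp [l2Fam])
  · rintro (⟨m, k, j⟩ | ⟨m, k, hm⟩ | ⟨k⟩)
    · exact ⟨_, rfl, by rintro _ rfl; exact ⟨(m, k, j + 1), rfl, rfl⟩⟩
    · exact ⟨_, rfl, by rintro _ rfl; exact ⟨(m, k, 0), by simp [perBlock₃, hm], rfl⟩⟩
    · exact ⟨_, rfl, by rintro _ rfl; exact ⟨(0, k, 0), rfl, rfl⟩⟩

theorem decomposesInto_finite : DecomposesInto FinBlock.terms (h1Fam wUltra)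
    (curlFam wUltra legendre) (divFam wUltra legendre) (l2Fam legendre) := by
  have h := isAxialBasis_wUltra
  refine ⟨LinearIndependent.iSupIndep_of_fibres h.h1Fam
      (fun i => FinBlock.main i.1 i.2.1 i.2.2) (V := fun i => (FinBlock.terms i).V₀) ?_ ?_,
    LinearIndependent.iSupIndep_of_fibres h.curlFam finBlock₁
      (V := fun i => (FinBlock.terms i).V₁) ?_ ?_,
    LinearIndependent.iSupIndep_of_fibres h.divFam finBlock₂
      (V := fun i => (FinBlock.terms i).V₂) ?_ ?_,
    LinearIndependent.iSupIndep_of_fibres h.l2Fam finBlock₃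
      (V := fun i => (FinBlock.terms i).V₃) ?_ ?_⟩
  · rintro ⟨m, k, j⟩
    exact Submodule.subset_span rfl
  · rintro (⟨m, k, j⟩ | ⟨m, k, hm⟩ | ⟨m, j⟩ | ⟨m, hm⟩ | ⟨k⟩ | _)
    · exact ⟨_, rfl, by rintro _ rfl; exact ⟨(m, k, j), rfl, rfl⟩⟩
    all_goals exact ⟨∅, Submodule.span_empty.symm, by simp⟩
  · rintro (⟨m, k, j, hj⟩ | ⟨m, k, j, hj⟩ | ⟨m, k, j⟩)
    · obtain ⟨j, rfl⟩ : ∃ i, j = i + 1 := ⟨j - 1, by omega⟩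
      exact Submodule.subset_span (by simp [curlFam])
    · rcases j with _ | j
      · rw [finBlock₁, dif_neg (ne_zero_of_one_sub_abs_zero_le hj)]
        exact Submodule.subset_span (by simp [curlFam])
      · exact Submodule.subset_span (by simp [curlFam])
    · rcases k with _ | k <;> exact Submodule.subset_span (by simp [curlFam])
  · rintro (⟨m, k, j⟩ | ⟨m, k, hm⟩ | ⟨m, j⟩ | ⟨m, hm⟩ | ⟨k⟩ | _)
    · refine ⟨_, rfl, ?_⟩
      rintro _ (rfl | rfl | rfl)
      · exact ⟨.plus m k (j + 1) (by omega), rfl, rfl⟩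
      · exact ⟨.minus m k (j + 1) (one_sub_abs_succ_le m j), rfl, rfl⟩
      · exact ⟨.axial m (k + 1) j, rfl, rfl⟩
    · refine ⟨_, rfl, ?_⟩
      rintro _ rfl
      exact ⟨.minus m k 0 (one_sub_abs_zero_le hm), by simp [finBlock₁, hm], rfl⟩
    · exact ⟨_, rfl, by rintro _ rfl; exact ⟨.axial m 0 j, rfl, rfl⟩⟩
    all_goals exact ⟨∅, Submodule.span_empty.symm, by simp⟩
  · rintro (⟨m, k, j, hj⟩ | ⟨m, k, j, hj⟩ | ⟨m, k, j⟩)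
    · obtain ⟨j, rfl⟩ : ∃ i, j = i + 1 := ⟨j - 1, by omega⟩
      rcases k with _ | k <;> exact Submodule.subset_span (by simp [divFam])
    · rcases j with _ | j
      · have hm := ne_zero_of_one_sub_abs_zero_le hj
        rcases k with _ | k <;> rw [finBlock₂, dif_neg hm] <;>
          exact Submodule.subset_span (by simp [divFam])
      · rcases k with _ | k <;> exact Submodule.subset_span (by simp [divFam])
    · rcases j with _ | j
      · by_cases hm : m = 0
        · subst hm
          exact Submodule.subset_span (by simp [divFam])
        · rw [finBlock₂, dif_neg hm]
          exact Submodule.subset_span (by simp [divFam])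
      · exact Submodule.subset_span (by simp [divFam])
  · rintro (⟨m, k, j⟩ | ⟨m, k, hm⟩ | ⟨m, j⟩ | ⟨m, hm⟩ | ⟨k⟩ | _)
    · refine ⟨_, rfl, ?_⟩
      rintro _ (rfl | rfl | rfl)
      · exact ⟨.plus m (k + 1) (j + 1) (by omega), rfl, rfl⟩
      · exact ⟨.minus m (k + 1) (j + 1) (one_sub_abs_succ_le m j), rfl, rfl⟩
      · exact ⟨.axial m k (j + 1), rfl, rfl⟩
    · refine ⟨_, rfl, ?_⟩
      rintro _ (rfl | rfl)
      · exact ⟨.minus m (k + 1) 0 (one_sub_abs_zero_le hm), by simp [finBlock₂, hm], rfl⟩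
      · exact ⟨.axial m k 0, by simp [finBlock₂, hm], rfl⟩
    · refine ⟨_, rfl, ?_⟩
      rintro _ (rfl | rfl)
      · exact ⟨.plus m 0 (j + 1) (by omega), rfl, rfl⟩
      · exact ⟨.minus m 0 (j + 1) (one_sub_abs_succ_le m j), rfl, rfl⟩
    · refine ⟨_, rfl, ?_⟩
      rintro _ rfl
      exact ⟨.minus m 0 0 (one_sub_abs_zero_le hm), by simp [finBlock₂, hm], rfl⟩
    · exact ⟨_, rfl, by rintro _ rfl; exact ⟨.axial 0 k 0, rfl, rfl⟩⟩
    · exact ⟨∅, Submodule.span_empty.symm, by simp⟩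
  · rintro ⟨m, k, j⟩
    rcases j with _ | j
    · by_cases hm : m = 0
      · subst hm
        rcases k with _ | k <;> exact Submodule.subset_span (by simp [l2Fam])
      · rcases k with _ | k <;> rw [finBlock₃, dif_neg hm] <;>
          exact Submodule.subset_span (by simp [l2Fam])
    · rcases k with _ | k <;> exact Submodule.subset_span (by simp [l2Fam])
  · rintro (⟨m, k, j⟩ | ⟨m, k, hm⟩ | ⟨m, j⟩ | ⟨m, hm⟩ | ⟨k⟩ | _)
    · exact ⟨_, rfl, by rintro _ rfl; exact ⟨(m, k + 1, j + 1), rfl, rfl⟩⟩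
    · exact ⟨_, rfl, by rintro _ rfl; exact ⟨(m, k + 1, 0), by simp [finBlock₃, hm], rfl⟩⟩
    · exact ⟨_, rfl, by rintro _ rfl; exact ⟨(m, 0, j + 1), rfl, rfl⟩⟩
    · exact ⟨_, rfl, by rintro _ rfl; exact ⟨(m, 0, 0), by simp [finBlock₃, hm], rfl⟩⟩
    · exact ⟨_, rfl, by rintro _ rfl; exact ⟨(0, k + 1, 0), rfl, rfl⟩⟩
    · exact ⟨_, rfl, by rintro _ rfl; exact ⟨(0, 0, 0), rfl, rfl⟩⟩

/-! ### Exactness of the sub-complexes of the two cylinders -/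

theorem FourTerm.not_isExact_of_div_eq_zero {S : FourTerm} (h : ∀ f ∈ S.V₂, div f = 0) {s : Scalar}
    (hs : s ∈ S.V₃) (h0 : s ≠ 0) : ¬ S.IsExact := by
  intro he
  obtain ⟨f, hf, hd⟩ := he.2.2.2.2 s hs
  exact h0 (hd ▸ h f hf)

theorem scal_expWave_zero : scal (expWave 0) (zernike 0 0) = fun _ => 1 := by
  ext p
  simp [scal, expWave, zernike, zernikeGen, jacobi, harmonic]

theorem vert_expWave_zero : vert (expWave 0) (zernike 0 0) = fun _ => ![0, 0, 1] := by
  ext p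
  simp [vert, expWave, zernike, zernikeGen, jacobi, harmonic]

theorem scal_legendre_zero : scal (legendre 0) (zernike 0 0) = fun _ => 1 := by
  ext p
  simp [scal, legendre, zernike, zernikeGen, jacobi, harmonic]

theorem div_vert_expWave_zero : div (vert (expWave 0) (zernike 0 0)) = 0 := by
  rw [div_vert_zernike _ _ (isAxialDeriv_expWave 0)]
  simp

/-- In the constant blocks the divergence is multiplication by ik, which is invertible unless k = 0;
the other blocks are exact even then. -/
theorem PerBlock.isExact_iff (b : PerBlock) : b.terms.IsExact ↔ b ≠ PerBlock.const 0 := by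
  rcases b with ⟨m, k, j⟩ | ⟨m, k, hm⟩ | ⟨k⟩
  · exact iff_of_true (isExact_main isAxialBasis_expWave (isAxialDeriv_expWave k) m j) (by simp)
  · exact iff_of_true (isExact_edge isAxialBasis_expWave (isAxialDeriv_expWave k) hm) (by simp)
  · have hd := differentiable_divFam isAxialPair_expWave (.axial 0 k 0)
    have hs := isAxialBasis_expWave.l2Fam.ne_zero (0, k, 0)
    by_cases hk : k = 0
    · subst hk
      refine iff_of_false (FourTerm.not_isExact_of_div_eq_zero ?_
        (Submodule.mem_span_singleton_self _) hs) (by simp)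
      intro f hf
      obtain ⟨x, rfl⟩ := Submodule.mem_span_singleton.1 hf
      exact (div_smul x hd).trans ((congrArg (x • ·) div_vert_expWave_zero).trans (smul_zero x))
    · exact iff_of_true (isExact_tail hd (div_vert_zernike 0 0 (isAxialDeriv_expWave k))
        (by simp [hk]) hs) (by simp [hk])

theorem PerBlock.isSubcomplex (b : PerBlock) : b.terms.IsSubcomplex := by
  by_cases hb : b = PerBlock.const 0
  · subst hb
    exact isSubcomplex_tail (differentiable_divFam isAxialPair_expWave (.axial 0 0 0))
      (div_vert_zernike 0 0 (isAxialDeriv_expWave 0))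
  · exact (b.isExact_iff.2 hb).1

theorem isExact_axialTerms (k j : ℕ) : (axialTerms k j).IsExact := by
  refine isExact_tail (differentiable_divFam isAxialPair_wUltra (.axial 0 k j))
    (div_vert_zernike 0 j (isAxialDeriv_wUltra k)) ?_
    (isAxialBasis_wUltra.l2Fam.ne_zero (0, k + 1, j))
  have h1 : (k : ℂ) + 1 ≠ 0 := by exact_mod_cast k.succ_ne_zero
  have h2 : (k : ℂ) + 2 ≠ 0 := by exact_mod_cast (k + 1).succ_ne_zero
  exact neg_ne_zero.2 (mul_ne_zero h1 h2)

theorem FinBlock.isExact_iff (b : FinBlock) : b.terms.IsExact ↔ b ≠ FinBlock.const := by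
  rcases b with ⟨m, k, j⟩ | ⟨m, k, hm⟩ | ⟨m, j⟩ | ⟨m, hm⟩ | ⟨k⟩ | _
  · exact iff_of_true (isExact_main isAxialBasis_wUltra (isAxialDeriv_wUltra k) m j) (by simp)
  · exact iff_of_true (isExact_edge isAxialBasis_wUltra (isAxialDeriv_wUltra k) hm) (by simp)
  · exact iff_of_true (isExact_low isAxialBasis_wUltra 0 m j) (by simp)
  · have h := one_sub_abs_zero_le hm
    exact iff_of_true (isExact_tail (differentiable_divFam isAxialPair_wUltra (.minus m 0 0 h))
      (div_horiz_tMinus m 0 (contDiff_legendre 0) h) (kappa_ne_zero h)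
      (isAxialBasis_wUltra.l2Fam.ne_zero (m, 0, 0))) (by simp)
  · exact iff_of_true (isExact_axialTerms k 0) (by simp)
  · refine iff_of_false (FourTerm.not_isExact_of_div_eq_zero ?_
      (Submodule.mem_span_singleton_self _)
      (isAxialBasis_wUltra.l2Fam.ne_zero (0, 0, 0))) (by simp)
    rintro f (rfl : f = 0)
    exact div_zero

theorem FinBlock.isSubcomplex (b : FinBlock) : b.terms.IsSubcomplex := by
  by_cases hb : b = FinBlock.const
  · subst hb
    refine ⟨?_, ?_, ?_⟩
    · rintro f (rfl : f = 0)
      exact grad_zero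
    · rintro f (rfl : f = 0)
      exact curl_zero
    · rintro f (rfl : f = 0)
      rw [div_zero]
      exact Submodule.zero_mem _
  · exact (b.isExact_iff.2 hb).1

/-! ### The exceptional spaces -/

/-- Both cylinders contain the open cube (0, 1/2)³ and have finite volume. -/
theorem Cylinder.integral_const_ne_zero (c : Cylinder) {r : ℂ} (hr : r ≠ 0) :
    ∫ _, r ∂c.vol ≠ 0 := by
  rw [integral_const]
  refine smul_ne_zero ?_ hr
  have hfin : c.vol Set.univ ≠ ⊤ := measure_ne_top _ _
  have hpos : c.vol Set.univ ≠ 0 := by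
    rw [Cylinder.vol, Measure.restrict_apply_univ]
    have ho : IsOpen (Set.univ.pi fun _ : Fin 3 => Set.Ioo (0 : ℝ) (1 / 2)) :=
      isOpen_set_pi Set.finite_univ fun _ _ => isOpen_Ioo
    have hn : (Set.univ.pi fun _ : Fin 3 => Set.Ioo (0 : ℝ) (1 / 2)).Nonempty :=
      ⟨fun _ => 1 / 4, fun _ _ => by norm_num⟩
    refine ((ho.measure_pos volume hn).trans_le (measure_mono fun p hp => ?_)).ne'
    have h0 := hp 0 trivial
    have h1 := hp 1 trivial
    have h2 := hp 2 trivial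
    have hr : p 0 ^ 2 + p 1 ^ 2 ≤ 1 := by nlinarith [h0.1, h0.2, h1.1, h1.2]
    cases c with
    | periodic => exact ⟨hr, h2.1.le, by linarith [h2.2, Real.pi_gt_three]⟩
    | finite => exact ⟨hr, by linarith [h2.1], by linarith [h2.2]⟩
  simp [Measure.real, ENNReal.toReal_eq_zero_iff, hfin, hpos]

theorem Cylinder.smooth_const (c : Cylinder) (r : ℂ) : c.Smooth (fun _ => r) := by
  cases c
  · exact ⟨contDiff_const, fun _ => rfl⟩
  · exact (contDiff_const : ContDiff ℝ (⊤ : ℕ∞) fun _ : Fin 3 → ℝ => r)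

/-- The constant 1 is an admissible test function with zero gradient, so a divergence has mean zero.
-/
theorem not_hasDiv₀_const (c : Cylinder) {r : ℂ} (hr : r ≠ 0) :
    ¬ ∃ f, HasDiv₀ c f (fun _ => r) := by
  rintro ⟨f, hf⟩
  have h := hf.2.2 (fun _ => 1) (c.smooth_const 1)
  refine c.integral_const_ne_zero hr ?_
  simpa [grad, pd] using h

/-- The constant field (0, 0, 1) is an admissible test field with zero curl, so the axial component
of a weak curl has mean zero. -/
theorem not_hasCurl₀_const (c : Cylinder) {r : ℂ} (hr : r ≠ 0) :
    ¬ ∃ f, HasCurl₀ c f (fun _ => ![0, 0, r]) := by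
  rintro ⟨f, hf⟩
  have h := hf.2.2 (fun _ => ![0, 0, 1]) (fun i => c.smooth_const _)
  refine c.integral_const_ne_zero hr ?_
  simpa [curl, pd] using h

theorem hasDiv₀_axis : HasDiv₀ Cylinder.periodic (fun _ => ![0, 0, 1]) 0 := by
  have h := isDeRhamBasis_periodic.mem₂ (.axial 0 0 0)
  simp only [divFam] at h
  rwa [div_vert_expWave_zero, vert_expWave_zero] at h

end CylDeRham

/-! ### Assembly of the theorem -/

theorem mainTheorem10 :
    -- the periodic cylinder: bases
    IsDeRhamBasis Cylinder.periodic (h1Fam expWave) (curlFam expWave expWave)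
      (divFam expWave expWave) (l2Fam expWave) ∧
    (∀ i j : ℤ × ℤ × ℕ, i ≠ j →
      ∫ p, (starRingEnd ℂ) (l2Fam expWave i p) * l2Fam expWave j p ∂Cylinder.periodic.vol = 0) ∧
    -- the periodic cylinder: gradient, curl and divergence of the basis elements
    (∀ (m k : ℤ) (j : ℕ), grad (scal (expWave k) (wZernike m j)) =
      (-((j : ℂ) + 1)) • horiz (expWave k) (nPlus m (j + 1))
        + (I * (k : ℂ)) • vert (expWave k) (wZernike m j)) ∧
    (∀ (m k : ℤ) (j : ℕ), 1 ≤ j → curl (horiz (expWave k) (nPlus m j)) =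
      (I * (k : ℂ)) • horiz (expWave k) (tPlus m j)) ∧
    (∀ (m k : ℤ) (j : ℕ), 1 - |m| ≤ (j : ℤ) → curl (horiz (expWave k) (nMinus m j)) =
      (I * (k : ℂ)) • horiz (expWave k) (tMinus m j)
        - kappa m j • vert (expWave k) (zernike m j)) ∧
    (∀ (m k : ℤ) (j : ℕ), 1 ≤ j → curl (vert (expWave k) (wZernike m (j - 1))) =
      (j : ℂ) • horiz (expWave k) (tPlus m j)) ∧
    (∀ (m k : ℤ) (j : ℕ), 1 ≤ j → div (horiz (expWave k) (tPlus m j)) = 0) ∧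
    (∀ (m k : ℤ) (j : ℕ), 1 - |m| ≤ (j : ℤ) → div (horiz (expWave k) (tMinus m j)) =
      kappa m j • scal (expWave k) (zernike m j)) ∧
    (∀ (m k : ℤ) (j : ℕ), div (vert (expWave k) (zernike m j)) =
      (I * (k : ℂ)) • scal (expWave k) (zernike m j)) ∧
    -- the periodic cylinder: decomposition into sub-complexes and the two exceptional spaces
    DecomposesInto PerBlock.terms (h1Fam expWave) (curlFam expWave expWave)
      (divFam expWave expWave) (l2Fam expWave) ∧
    (∀ b : PerBlock, b.terms.IsSubcomplex) ∧
    (∀ b : PerBlock, b.terms.IsExact ↔ b ≠ PerBlock.const 0) ∧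
    vert (expWave 0) (zernike 0 0) = (fun _ => ![0, 0, 1]) ∧
    HasDiv₀ Cylinder.periodic (fun _ => ![0, 0, 1]) 0 ∧
    (∀ c : ℂ, c ≠ 0 → ¬ ∃ f, HasCurl₀ Cylinder.periodic f (fun _ => ![0, 0, c])) ∧
    scal (expWave 0) (zernike 0 0) = (fun _ => 1) ∧
    (∀ c : ℂ, c ≠ 0 → ¬ ∃ f, HasDiv₀ Cylinder.periodic f (fun _ => c)) ∧
    -- the finite cylinder: bases
    IsDeRhamBasis Cylinder.finite (h1Fam wUltra) (curlFam wUltra legendre)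
      (divFam wUltra legendre) (l2Fam legendre) ∧
    -- the finite cylinder: gradient, curl and divergence of the basis elements
    (∀ (m : ℤ) (k j : ℕ), grad (scal (wUltra k) (wZernike m j)) =
      (-((j : ℂ) + 1)) • horiz (wUltra k) (nPlus m (j + 1))
        - (((k : ℂ) + 1) * ((k : ℂ) + 2)) • vert (legendre (k + 1)) (wZernike m j)) ∧
    (∀ (m : ℤ) (k j : ℕ), 1 ≤ j → curl (horiz (wUltra k) (nPlus m j)) =
      (-(((k : ℂ) + 1) * ((k : ℂ) + 2))) • horiz (legendre (k + 1)) (tPlus m j)) ∧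
    (∀ (m : ℤ) (k j : ℕ), 1 - |m| ≤ (j : ℤ) → curl (horiz (wUltra k) (nMinus m j)) =
      (-(((k : ℂ) + 1) * ((k : ℂ) + 2))) • horiz (legendre (k + 1)) (tMinus m j)
        - kappa m j • vert (wUltra k) (zernike m j)) ∧
    (∀ (m : ℤ) (k j : ℕ), 1 ≤ j → curl (vert (legendre k) (wZernike m (j - 1))) =
      (j : ℂ) • horiz (legendre k) (tPlus m j)) ∧
    (∀ (m : ℤ) (k j : ℕ), 1 ≤ j → div (horiz (legendre k) (tPlus m j)) = 0) ∧
    (∀ (m : ℤ) (k j : ℕ), 1 - |m| ≤ (j : ℤ) → div (horiz (legendre k) (tMinus m j)) =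
      kappa m j • scal (legendre k) (zernike m j)) ∧
    (∀ (m : ℤ) (k j : ℕ), div (vert (wUltra k) (zernike m j)) =
      (-(((k : ℂ) + 1) * ((k : ℂ) + 2))) • scal (legendre (k + 1)) (zernike m j)) ∧
    -- the finite cylinder: decomposition into sub-complexes and the exceptional space
    DecomposesInto FinBlock.terms (h1Fam wUltra) (curlFam wUltra legendre)
      (divFam wUltra legendre) (l2Fam legendre) ∧
    (∀ b : FinBlock, b.terms.IsSubcomplex) ∧
    (∀ b : FinBlock, b.terms.IsExact ↔ b ≠ FinBlock.const) ∧
    (∀ k j : ℕ, (axialTerms k j).IsExact) ∧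
    scal (legendre 0) (zernike 0 0) = (fun _ => 1) ∧
    (∀ c : ℂ, c ≠ 0 → ¬ ∃ f, HasDiv₀ Cylinder.finite f (fun _ => c)) := by
  refine ⟨isDeRhamBasis_periodic, fun i j h => l2Fam_orthogonal i j h,
    fun m k j => grad_scal_wZernike m j (isAxialDeriv_expWave k),
    fun m k j hj => curl_horiz_nPlus m j (isAxialDeriv_expWave k) hj,
    fun m k j hj => curl_horiz_nMinus m j (isAxialDeriv_expWave k) hj,
    fun m k j hj => ?_,
    fun m k j hj => div_horiz_tPlus m j (isAxialDeriv_expWave k).smooth hj,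
    fun m k j hj => div_horiz_tMinus m j (isAxialDeriv_expWave k).smooth hj,
    fun m k j => div_vert_zernike m j (isAxialDeriv_expWave k),
    decomposesInto_periodic, PerBlock.isSubcomplex, PerBlock.isExact_iff, vert_expWave_zero,
    hasDiv₀_axis, fun c hc => not_hasCurl₀_const _ hc, scal_expWave_zero,
    fun c hc => not_hasDiv₀_const _ hc, isDeRhamBasis_finite, fun m k j => ?_,
    fun m k j hj => curl_horiz_nPlus m j (isAxialDeriv_wUltra k) hj,
    fun m k j hj => curl_horiz_nMinus m j (isAxialDeriv_wUltra k) hj,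
    fun m k j hj => ?_,
    fun m k j hj => div_horiz_tPlus m j (contDiff_legendre k) hj,
    fun m k j hj => div_horiz_tMinus m j (contDiff_legendre k) hj,
    fun m k j => div_vert_zernike m j (isAxialDeriv_wUltra k),
    decomposesInto_finite, FinBlock.isSubcomplex, FinBlock.isExact_iff, isExact_axialTerms,
    scal_legendre_zero, fun c hc => not_hasDiv₀_const _ hc⟩
  · obtain ⟨j, rfl⟩ : ∃ i, j = i + 1 := ⟨j - 1, by omega⟩
    rw [Nat.add_sub_cancel, curl_vert_wZernike m j (isAxialDeriv_expWave k).smooth]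
    push_cast
    rfl
  · rw [grad_scal_wZernike m j (isAxialDeriv_wUltra k), neg_smul _ (vert _ _), ← sub_eq_add_neg]
  · obtain ⟨j, rfl⟩ : ∃ i, j = i + 1 := ⟨j - 1, by omega⟩
    rw [Nat.add_sub_cancel, curl_vert_wZernike m j (contDiff_legendre k)]
    push_cast
    rfl
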